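/- Let $(W,\{s,t\})$ be a finite dihedral Coxeter group, $3\le m_{st}<\infty$, with length $\ell$, neutral element $e$, longest element $w_I$, and let $L:W\to\mathbb Z$ be a positive weight function: $L(xy)=L(x)+L(y)$ whenever $\ell(xy)=\ell(x)+\ell(y)$, and $L(s),L(t)>0$. Notation. Let $\mathcal A=\mathbb Z[q,q^{-1}]$ and let $\mathcal H$ be the Hecke algebra over $\mathcal A$ with basis $(T_w)_{w\in W}$, where $T_{xy}=T_xT_y$ if $\ell(xy)=\ell(x)+\ell(y)$ and $T_r^2=1+(q^{L(r)}-q^{-L(r)})T_r$ for $r\in\{s,t\}$. Let $\overline{\,\cdot\,}$ be the bar involution ($\bar q=q^{-1}$, $\overline{T_w}=T_{w^{-1}}^{-1}$), and let $C_w=\sum_y p_{y,w}T_y$ be the Kazhdan–Lusztig basis: $C_w$ is the unique bar-invariant element of $T_w+\bigoplus_y q^{-1}\mathbb Z[q^{-1}]T_y$. Write $C_xC_y=\sum_z h_{x,y,z}C_z$ and $\mathbf a(z)=\max_{x,y}\deg h_{x,y,z}$; let $\gamma_{x,y,z^{-1}}$ be the coefficient of $q^{\mathbf a(z)}$ in $h_{x,y,z}$,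 and write $p_{e,w}=n_wq^{-\Delta(w)}+(\text{lower degree})$ with $n_w\ne0$. Put $\mathcal D=\{z:\mathbf a(z)=\Delta(z)\}$. The preorder $\prec_L$ (resp. $\prec_R$) is generated by: $C_{w'}$ occurs in $C_rC_w$ (resp. in $C_wC_r$) for some $r\in\{s,t\}$; $\prec_{LR}$ is generated by both kinds of relations; $\sim_L,\sim_R,\sim_{LR}$ are the associated equivalence relations, and their classes are the left, right and two-sided cells. For $N\in\mathbb N$ put $W_{\ge N}=\{w:\mathbf a(w)\ge N\}$ and $W_N=W_{\ge N}\setminus W_{\ge N+1}$. If $L(s)<L(t)$ and $m_{st}=2m$, put $d_I=ts\cdots t$ ($2m-1$ factors) and $L'(d_I)=mL(t)-(m-1)L(s)$. Call $e,s,t,w_I$, and also $d_I$ if $L(s)<L(t)$ (and likewise with $s$ and $t$ exchanged if $L(t)<L(s)$), the distinguished elements, with $\mathbf a'(d)=L(d)$ for $d\in\{e,s,t,w_I\}$ and $\mathbf a'(d_I)=L'(d_I)$. Let $\Omega_{\ge N}$ be the set of all $xdy$ with $d$ distinguished, $\mathbf a'(d)\ge N$ and $\ell(xdy)=\ell(x)+\ell(d)+\ell(y)$,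 and put $\Omega_N=\Omega_{\ge N}\setminus\Omega_{\ge N+1}$. Theorem. (A) Lusztig's conjectures P1–P15 hold for $(W,\{s,t\},L)$; equivalently, for every $N\in\mathbb N$ the following statements $(\mathrm{P1}\text{–}\mathrm{P15})_{\ge N}$ hold. - P1: $\mathbf a(w)\le\Delta(w)$ for $w\in W_{\ge N}$. - P2: if $z\in\mathcal D\cap W_{\ge N}$ and $\gamma_{x,y,z}\ne0$, then $x=y^{-1}$. - P3: for $y\in W_{\ge N}$ there is a unique $z\in\mathcal D$ with $\gamma_{y^{-1},y,z}\neq0$. - P4: if $w'\prec_{LR}w$ and $w\in W_{\ge N}$, then $\mathbf a(w')\ge\mathbf a(w)$. - P5: if $z\in\mathcal D\cap W_{\ge N}$ and $\gamma_{y^{-1},y,z}\ne0$, then $\gamma_{y^{-1},y,z}=n_z=\pm1$. - P6: $z^2=e$ for $z\in\mathcal D\cap W_{\ge N}$. - P7: $\gamma_{x,y,z}=\gamma_{y,z,x}=\gamma_{z,x,y}$ if one of $x,y,z$ lies in $W_{\ge N}$. - P8: if one of $x,y,z$ lies in $W_{\ge N}$ and $\gamma_{x,y,z}\ne0$, then $x\sim_Ly^{-1}$,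 $y\sim_Lz^{-1}$, $z\sim_Lx^{-1}$. - P9, P10, P11: for $\bullet=L,R,LR$ respectively, if $w'\prec_\bullet w$, $w\in W_{\ge N}$ and $\mathbf a(w')=\mathbf a(w)$, then $w'\sim_\bullet w$. - P12: for $J\subseteq\{s,t\}$ and $y\in W_J\cap W_{\ge N}$, the value of the $\mathbf a$-function of $(W_J,J,L|_{W_J})$ at $y$ is $\mathbf a(y)$. - P13: each left cell $\Gamma\subseteq W_{\ge N}$ contains a unique $z\in\mathcal D$, and $\gamma_{y^{-1},y,z}\ne0$ for all $y\in\Gamma$. - P14: $w\sim_{LR}w^{-1}$ for $w\in W_{\ge N}$. - P15: for $w,w'\in W$ and $x,y\in W_{\ge N}$ with $\mathbf a(x)=\mathbf a(y)$, $\sum_zh_{w,x,z}\otimes h_{z,w',y}=\sum_zh_{w,z,y}\otimes h_{x,w',z}$ in $\mathcal A\otimes_{\mathbb Z}\mathcal A$. (B) $W_N=\Omega_N$ for every $N\in\mathbb N$. (C) Suppose $L(s)=L(t)=a$. Then the two-sided cells of $W$ are $\{e\}$, $W\setminus\{e,w_I\}$ and $\{w_I\}$, and $\mathbf a$ takes on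 them the constant values $0$, $a$ and $L(w_I)$, respectively. In particular $W_N=\emptyset$ for $a<N<L(w_I)$, and $W_a=W\setminus\{e,w_I\}$. (D) Suppose $L(s)=a<b=L(t)$. Then $m_{st}=2m$ is even, the two-sided cells of $W$ are $\{e\}$, $\{s\}$, $W\setminus\{e,s,d_I,w_I\}$, $\{d_I\}$ and $\{w_I\}$, and $\mathbf a$ takes on them the constant values $0$, $a$, $b$, $L'(d_I)$ and $L(w_I)$, respectively. In particular $W_N=\emptyset$ for $a<N<b$, for $b<N<L'(d_I)$ and for $L'(d_I)<N<L(w_I)$, and $W_a=\{s\}$, $W_b=W\setminus\{e,s,d_I,w_I\}$, $W_{L'(d_I)}=\{d_I\}$. -/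

import Mathlib

open scoped LaurentPolynomial TensorProduct

noncomputable section

namespace HeckeKL

/-! A pair `(W, S)` consists of a group `W` and a set `S` of generators (a Coxeter system in
the theorem, and a standard parabolic subgroup `W_I` with its generators `I` in P12). -/

/-- The ring `ℤ[q, q⁻¹]`; the power `q ^ n` is `LaurentPolynomial.T n`. -/
abbrev A : Type := ℤ[T;T⁻¹]

section Group

variable {W : Type*} [Group W]

/-- `l` is a word in the generators `S` with product `w`. -/
def IsWord (S : Set W) (w : W) (l : List W) : Prop := (∀ x ∈ l, x ∈ S) ∧ l.prod = w

/-- The length `ℓ(w)`: the least number of factors of a word for `w` in the generators `S`. -/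
def len (S : Set W) (w : W) : ℕ := sInf {n | ∃ l : List W, IsWord S w l ∧ l.length = n}

/-- On a Coxeter system this is Mathlib's length function. -/
theorem len_range_simple {B : Type*} {M : CoxeterMatrix B} (cs : CoxeterSystem M W) (w : W) :
    len (Set.range cs.simple) w = cs.length w := by
  apply le_antisymm
  · obtain ⟨ω, hω, rfl⟩ := cs.exists_isReduced w
    apply Nat.sInf_le
    refine ⟨ω.map cs.simple, ⟨?_, rfl⟩, ?_⟩
    · intro x hx
      obtain ⟨i, -, rfl⟩ := List.mem_map.1 hx
      exact ⟨i, rfl⟩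
    · rw [List.length_map, hω.eq]
  · obtain ⟨ω, -, hω⟩ := cs.exists_isReduced w
    refine le_csInf ⟨ω.length, ω.map cs.simple, ⟨?_, hω.symm⟩, List.length_map _⟩ ?_
    · intro x hx
      obtain ⟨i, -, rfl⟩ := List.mem_map.1 hx
      exact ⟨i, rfl⟩
    · rintro n ⟨l, ⟨hl, rfl⟩, rfl⟩
      obtain ⟨ω, rfl⟩ : ∃ ω : List B, ω.map cs.simple = l := by
        have : l ∈ Set.range (List.map cs.simple) := by
          rw [Set.range_list_map]
          exact hl
        exact this
      rw [List.length_map]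
      exact cs.length_wordProd_le ω

open Classical in
/-- A chosen word for `w` in the generators `S`, of minimal length. -/
def redWord (S : Set W) (w : W) : List W :=
  if h : ∃ l : List W, IsWord S w l ∧ l.length = len S w then h.choose else []

/-- A weight function: an integer-valued function that is additive on length-additive products. -/
def IsWeight (S : Set W) (L : W → ℤ) : Prop :=
  ∀ x y : W, len S (x * y) = len S x + len S y → L (x * y) = L x + L y

/-! ### The Hecke algebra -/

/-- The underlying `ℤ[q, q⁻¹]`-module of the Hecke algebra, free on the elements `T_w`. -/
abbrev H (W : Type*) : Type _ := W →₀ A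

/-- The standard basis element `T_w`. -/
def stdT (w : W) : H W := Finsupp.single w 1

/-- `ξ_s = q ^ L(s) - q ^ (-L(s))`. -/
def xi (L : W → ℤ) (s : W) : A := LaurentPolynomial.T (L s) - LaurentPolynomial.T (-(L s))

open Classical in
/-- Left multiplication by `T_s`, for `s ∈ S`: one has `T_s T_w = T_{sw}` if `ℓ(sw) > ℓ(w)` and
`T_s T_w = T_{sw} + ξ_s T_w` otherwise. -/
def genOp (S : Set W) (L : W → ℤ) (s : W) : Module.End A (H W) :=
  Finsupp.linearCombination A fun w : W =>
    if len S w < len S (s * w) then stdT (s * w) else stdT (s * w) + xi L s • stdT w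

/-- Left multiplication by `T_w`: the composite of the operators of a reduced word of `w`. -/
def stdOp (S : Set W) (L : W → ℤ) (w : W) : Module.End A (H W) :=
  ((redWord S w).map (genOp S L)).prod

/-- The product of the Hecke algebra. -/
def mul (S : Set W) (L : W → ℤ) (u v : H W) : H W :=
  Finsupp.linearCombination A (stdOp S L) u v

/-- The bar involution: `q ↦ q⁻¹` on scalars and `T_w ↦ (T_{w⁻¹})⁻¹`. -/
def bar (S : Set W) (L : W → ℤ) (u : H W) : H W :=
  u.sum fun w p => LaurentPolynomial.invert p • (Ring.inverse (stdOp S L w⁻¹)) (stdT 1)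

/-! ### The Kazhdan-Lusztig basis -/

/-- `p ∈ q⁻¹ ℤ[q⁻¹]`. -/
def IsNeg (p : A) : Prop := ∀ n : ℤ, 0 ≤ n → p.coeff n = 0

/-- `c` is bar invariant and congruent to `T_w` modulo `⨁ q⁻¹ ℤ[q⁻¹] T_y`. -/
def IsKL (S : Set W) (L : W → ℤ) (w : W) (c : H W) : Prop :=
  bar S L c = c ∧ ∀ y : W, IsNeg ((c - stdT w) y)

open Classical in
/-- The Kazhdan-Lusztig basis element `C_w`. -/
def klC (S : Set W) (L : W → ℤ) (w : W) : H W :=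
  if h : ∃ c : H W, IsKL S L w c then h.choose else 0

/-- The coefficients of an element of the Hecke algebra in the Kazhdan-Lusztig basis. -/
def klCoord (S : Set W) (L : W → ℤ) (u : H W) : W →₀ A :=
  Function.invFun (fun g : W →₀ A => Finsupp.linearCombination A (klC S L) g) u

/-- The Kazhdan-Lusztig polynomial `p_{y,w}`, given by `C_w = ∑ p_{y,w} T_y`. -/
def klP (S : Set W) (L : W → ℤ) (y w : W) : A := klC S L w y

/-- `h x y z` is the structure constant `h_{x,y,z}`, given by `C_x C_y = ∑ h_{x,y,z} C_z`. -/
def h (S : Set W) (L : W → ℤ) (x y : W) : W →₀ A :=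
  klCoord S L (mul S L (klC S L x) (klC S L y))

/-! ### Preorders and cells -/

/-- `w' ≺_L w`: the preorder generated by the relations `C_{w'}` occurs in `C_s C_w`, `s ∈ S`. -/
def preL (S : Set W) (L : W → ℤ) : W → W → Prop :=
  Relation.ReflTransGen fun w' w => ∃ s ∈ S, h S L s w w' ≠ 0

/-- `w' ≺_R w`: the preorder generated by the relations `C_{w'}` occurs in `C_w C_s`, `s ∈ S`. -/
def preR (S : Set W) (L : W → ℤ) : W → W → Prop :=
  Relation.ReflTransGen fun w' w => ∃ s ∈ S, h S L w s w' ≠ 0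

/-- `w' ≺_LR w`: the preorder generated by both kinds of relations. -/
def preLR (S : Set W) (L : W → ℤ) : W → W → Prop :=
  Relation.ReflTransGen fun w' w => ∃ s ∈ S, h S L s w w' ≠ 0 ∨ h S L w s w' ≠ 0

def simL (S : Set W) (L : W → ℤ) (x y : W) : Prop := preL S L x y ∧ preL S L y x
def simR (S : Set W) (L : W → ℤ) (x y : W) : Prop := preR S L x y ∧ preR S L y x
def simLR (S : Set W) (L : W → ℤ) (x y : W) : Prop := preLR S L x y ∧ preLR S L y x

def IsLeftCell (S : Set W) (L : W → ℤ) (Γ : Set W) : Prop := ∃ w, Γ = {x | simL S L x w}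
def IsTwoSidedCell (S : Set W) (L : W → ℤ) (Γ : Set W) : Prop := ∃ w, Γ = {x | simLR S L x w}

/-! ### The a-function and the related invariants -/

/-- Lusztig's a-function with values in `ℕ ∪ {∞}`: the supremum of the degrees of `h_{x,y,w}`.
Only exponents `n ≥ 0` need be listed, as `h_{e,w,w} = 1`. -/
def aFun (S : Set W) (L : W → ℤ) (w : W) : ℕ∞ :=
  ⨆ (x : W) (y : W) (n : ℕ) (_ : (h S L x y w).coeff (n : ℤ) ≠ 0), (n : ℕ∞)

/-- `a(w) = n`, for an integer `n`. -/
def HasA (S : Set W) (L : W → ℤ) (w : W) (n : ℤ) : Prop :=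
  ∃ k : ℕ, aFun S L w = k ∧ (k : ℤ) = n

/-- `γ_{x,y,z}`, the coefficient of `q ^ a(z⁻¹)` in `h_{x,y,z⁻¹}`. -/
def gam (S : Set W) (L : W → ℤ) (x y z : W) : ℤ :=
  (h S L x y z⁻¹).coeff ((aFun S L z⁻¹).toNat : ℤ)

/-- `Δ(w) = - deg p_{e,w}`. -/
def Del (S : Set W) (L : W → ℤ) (w : W) : ℤ :=
  -((LaurentPolynomial.degree (klP S L 1 w)).unbotD 0)

/-- `n_w`, the leading coefficient of `p_{e,w}`. -/
def lead (S : Set W) (L : W → ℤ) (w : W) : ℤ := (klP S L 1 w).coeff (-(Del S L w))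

/-- `𝒟 = {z | a(z) = Δ(z)}`. -/
def setD (S : Set W) (L : W → ℤ) : Set W := {z | HasA S L z (Del S L z)}

/-- `W_{≥N} = {w | a(w) ≥ N}`. -/
def WGe (S : Set W) (L : W → ℤ) (N : ℕ) : Set W := {w | (N : ℕ∞) ≤ aFun S L w}

/-- `W_N = W_{≥N} ∖ W_{≥N+1}`. -/
def WEq (S : Set W) (L : W → ℤ) (N : ℕ) : Set W := WGe S L N \ WGe S L (N + 1)

/-! ### The sets `Ω_N` -/

/-- The alternating product `x y x ⋯` with `n` factors. -/
def alt (x y : W) : ℕ → W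
  | 0 => 1
  | n + 1 => x * alt y x n

/-- `w` is the longest element of the parabolic subgroup `W_J`. -/
def IsLongestIn (S J : Set W) (w : W) : Prop :=
  w ∈ Subgroup.closure J ∧ ∀ x ∈ Subgroup.closure J, x ≠ w → len S x < len S w

/-- `d` is one of the distinguished elements, with `a'(d) = n`: either `d = w_J` for some `J ⊆ S`,
with `a'(d) = L(d)`; or `d = t s t ⋯ t` with `m_{st} - 1` factors where `s, t ∈ S`,
`L(s) < L(t)` and `m_{st} = 2k` is finite, with `a'(d) = L'(d) = k L(t) - (k - 1) L(s)`. -/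
def IsDist (S : Set W) (L : W → ℤ) (d : W) (n : ℤ) : Prop :=
  (∃ J ⊆ S, IsLongestIn S J d ∧ n = L d) ∨
  (∃ s ∈ S, ∃ t ∈ S, L s < L t ∧ ∃ k : ℕ, 0 < k ∧ orderOf (s * t) = 2 * k ∧
    d = alt t s (2 * k - 1) ∧ n = k * L t - (k - 1) * L s)

/-- `Ω_{≥N}`: the elements `x d y`, `ℓ(x d y) = ℓ(x) + ℓ(d) + ℓ(y)`, with `d` distinguished and
`a'(d) ≥ N`. -/
def OmGe (S : Set W) (L : W → ℤ) (N : ℕ) : Set W :=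
  {w | ∃ d n, IsDist S L d n ∧ (N : ℤ) ≤ n ∧
    ∃ x y, w = x * d * y ∧ len S w = len S x + len S d + len S y}

/-- `Ω_N = Ω_{≥N} ∖ Ω_{≥N+1}`. -/
def OmEq (S : Set W) (L : W → ℤ) (N : ℕ) : Set W := OmGe S L N \ OmGe S L (N + 1)

/-! ### Lusztig's conjectures -/

/-- The statements (P1-P15)_{≥N}. For `N = 0` they are Lusztig's conjectures P1-P15. -/
structure PConj (S : Set W) (L : W → ℤ) (N : ℕ) : Prop where
  P1 : ∀ w ∈ WGe S L N, ∃ k : ℕ, aFun S L w = k ∧ (k : ℤ) ≤ Del S L w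
  P2 : ∀ z ∈ setD S L ∩ WGe S L N, ∀ x y : W, gam S L x y z ≠ 0 → x = y⁻¹
  P3 : ∀ y ∈ WGe S L N, ∃! z, z ∈ setD S L ∧ gam S L y⁻¹ y z ≠ 0
  P4 : ∀ w ∈ WGe S L N, ∀ w', preLR S L w' w → aFun S L w ≤ aFun S L w'
  P5 : ∀ z ∈ setD S L ∩ WGe S L N, ∀ y : W, gam S L y⁻¹ y z ≠ 0 →
    gam S L y⁻¹ y z = lead S L z ∧ (lead S L z = 1 ∨ lead S L z = -1)
  P6 : ∀ z ∈ setD S L ∩ WGe S L N, z * z = 1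
  P7 : ∀ x y z : W, (x ∈ WGe S L N ∨ y ∈ WGe S L N ∨ z ∈ WGe S L N) →
    gam S L x y z = gam S L y z x ∧ gam S L y z x = gam S L z x y
  P8 : ∀ x y z : W, (x ∈ WGe S L N ∨ y ∈ WGe S L N ∨ z ∈ WGe S L N) →
    gam S L x y z ≠ 0 → simL S L x y⁻¹ ∧ simL S L y z⁻¹ ∧ simL S L z x⁻¹
  P9 : ∀ w ∈ WGe S L N, ∀ w', preL S L w' w → aFun S L w' = aFun S L w → simL S L w' w
  P10 : ∀ w ∈ WGe S L N, ∀ w', preR S L w' w → aFun S L w' = aFun S L w → simR S L w' w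
  P11 : ∀ w ∈ WGe S L N, ∀ w', preLR S L w' w → aFun S L w' = aFun S L w → simLR S L w' w
  P12 : ∀ I ⊆ S, ∀ y : Subgroup.closure I, (y : W) ∈ WGe S L N →
    aFun (W := Subgroup.closure I) {x | (x : W) ∈ I} (fun x => L (x : W)) y = aFun S L (y : W)
  P13 : ∀ Γ ⊆ WGe S L N, IsLeftCell S L Γ →
    (∃! z, z ∈ Γ ∧ z ∈ setD S L) ∧
    ∀ z ∈ Γ, z ∈ setD S L → ∀ y ∈ Γ, gam S L y⁻¹ y z ≠ 0
  P14 : ∀ w ∈ WGe S L N, simLR S L w w⁻¹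
  P15 : ∀ w w' : W, ∀ x ∈ WGe S L N, ∀ y ∈ WGe S L N, aFun S L x = aFun S L y →
    ((h S L w x).sum fun z p => p ⊗ₜ[ℤ] h S L z w' y : A ⊗[ℤ] A) =
      (h S L x w').sum fun z p => h S L w z y ⊗ₜ[ℤ] p

/-! ### Background facts under which the notions above have their intended meaning -/

/-- The module `H W` with `mul` is the Hecke algebra of `(W, S, L)`, `bar` is its bar involution,
the `C_w` exist, are unique and form a basis, and `p_{e,w} ≠ 0`. -/
structure WellDefined (S : Set W) (L : W → ℤ) : Prop where
  mul_assoc : ∀ u v w : H W, mul S L (mul S L u v) w = mul S L u (mul S L v w)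
  one_mul : ∀ u : H W, mul S L (stdT 1) u = u
  mul_one : ∀ u : H W, mul S L u (stdT 1) = u
  stdT_mul : ∀ x y : W, len S (x * y) = len S x + len S y →
    mul S L (stdT x) (stdT y) = stdT (x * y)
  stdT_sq : ∀ s ∈ S, mul S L (stdT s) (stdT s) = stdT 1 + xi L s • stdT s
  bar_mul : ∀ u v : H W, bar S L (mul S L u v) = mul S L (bar S L u) (bar S L v)
  bar_stdT : ∀ w : W, mul S L (bar S L (stdT w)) (stdT w⁻¹) = stdT 1 ∧
    mul S L (stdT w⁻¹) (bar S L (stdT w)) = stdT 1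
  existsUnique_isKL : ∀ w : W, ∃! c : H W, IsKL S L w c
  linearIndependent : LinearIndependent A (klC S L)
  span_eq_top : Submodule.span A (Set.range (klC S L)) = ⊤
  klP_one_ne_zero : ∀ w : W, klP S L 1 w ≠ 0

end Group

end HeckeKL

end

/-! The Hecke algebra is realised by operators on the free module on `W`. Left and right
multiplications by generators commute (`commute_genOp`), and `T_1` generates the module under right
multiplications, so an operator commuting with these is determined by its value at `T_1`.
Associativity, the anti-involution `flip` and the bar involution follow. Triangularity of the bar
involution makes Kazhdan–Lusztig elements unique, so any explicit triangular family with the right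
properties is the basis `C_w` (`IsKLFamily.klC_eq`).

In a finite dihedral group the raw material is the interval sum `Γ_w = ∑_{y ≤ w} q^(L(y)-L(w)) T_y`.
Writing `c` and `!c` for the two generators and `Γ_{c,k}` for the sum attached to the word with `k`
letters that starts with `c`, one has `C_c Γ_{!c,k+1} = Γ_{c,k+2} + q^(L(c)-L(!c)) Γ_{c,k}`
(`klOp_Gam_not`). For equal parameters the coefficient is `1`, and `Γ_w = C_w` for `w ≠ e`. For `a =
L(s) < b = L(t)` suitable corrections of the `Γ_w` are bar invariant. If `E_i` denotes the `C_w` for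
words starting with `t`, with fixed last letter, they satisfy `C_t C_s E_i = E_{i+1} + ζ E_i +
E_{i-1}` with `ζ = q^(b-a) + q^(a-b)` (`klOp_true_neE_false`).

In both cases one two-sided cell is indexed by a first letter, a vertex of a path with `n` vertices
and a last letter, where `n` is `m_st - 1` or `m_st / 2 - 1`. The path ends because the next term of
the recursion lies in the left ideal spanned by the higher cells. Modulo that ideal `C_w` acts,
block by block, by `U_l(X) (p + r X)`, where `X` is the adjacency matrix of the path, `U_l` a
Chebyshev polynomial and `l` the vertex of `w` (`rep_op_Gam`, `rep_op_neE`). The coefficient `p`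
reaches the top degree, with leading coefficient `1`, exactly when the last letter of `w` is the
first letter of the other factor; `r` has smaller degree. So the numbers `γ` on this cell are the
entries `(U_i)_{jk}`. Row `0` of `U_i` is the `i`-th unit vector and all `U_i` are symmetric and
commute. Hence `(U_i)_{jk}` is symmetric in its three indices, which gives P7, and index `0` acts as
a unit, which gives P2, P3, P5 and P13. Every matrix commuting with `X` is a combination of the
`U_l`, which gives P15 (`sum_tmul_of_commute`).

The remaining two-sided cells are singletons. At `w_I`, the coefficient of `C_{w_I}` is that of
`T_{w_I}`, and degrees can be estimated in the standard basis (`h_top`). At `d_I` one has `C_s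
C_{d_I} = C_{w_I}`, so modulo `C_{w_I}` the eigenvalues of the `C_{ts⋯t}` on `C_{d_I}` satisfy the
recursion without its term `C_t C_s`. This gives the degree `L'(d_I)` and the sign `(-1)^n`
(`op_neE_pal`, `neChain_deg`), while `neDeg_op` bounds the other products.

`CellDatum` collects these facts. All of P1–P15 except P12, and the description of two-sided cells
as fibres of the a-function, are consequences of it. P12 follows by computing the a-function of the
parabolic subgroups, and (B) by comparing the explicit a-function with length-additive
factorisations. -/

noncomputable section

namespace HeckeKL

variable {W : Type*} [Group W] {S : Set W} {L : W → ℤ}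

/-! ### Hecke systems -/

/-- The properties of a pair `(W, S)` and of a weight function `L` from which the Hecke algebra is
constructed: `S` consists of involutions that generate `W` and satisfy a weak exchange
condition. -/
structure IsHeckeSystem (S : Set W) (L : W → ℤ) : Prop where
  mul_self : ∀ s ∈ S, s * s = 1
  exists_word : ∀ w : W, ∃ l : List W, IsWord S w l
  len_mul_ne : ∀ s ∈ S, ∀ w : W, len S (s * w) ≠ len S w
  exchange : ∀ s ∈ S, ∀ r ∈ S, ∀ w : W, len S w < len S (s * w) → len S w < len S (w * r) →
    len S (s * w * r) < len S (s * w) → s * w = w * r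
  isWeight : IsWeight S L

namespace IsHeckeSystem

variable (hS : IsHeckeSystem S L)
include hS

theorem inv_mem {s : W} (hs : s ∈ S) : s⁻¹ = s :=
  inv_eq_of_mul_eq_one_right (hS.mul_self s hs)

theorem mul_cancel {s : W} (hs : s ∈ S) (w : W) : s * (s * w) = w := by
  rw [← mul_assoc, hS.mul_self s hs, one_mul]

theorem mul_cancel_right {s : W} (hs : s ∈ S) (w : W) : w * s * s = w := by
  rw [mul_assoc, hS.mul_self s hs, mul_one]

theorem exists_reduced (w : W) : ∃ l : List W, IsWord S w l ∧ l.length = len S w := by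
  obtain ⟨l, hl⟩ := hS.exists_word w
  have : len S w ∈ {n | ∃ l : List W, IsWord S w l ∧ l.length = n} :=
    Nat.sInf_mem ⟨l.length, l, hl, rfl⟩
  exact this

omit hS in
theorem len_le {w : W} {l : List W} (hl : IsWord S w l) : len S w ≤ l.length :=
  Nat.sInf_le ⟨l, hl, rfl⟩

omit hS in
theorem len_one : len S (1 : W) = 0 :=
  Nat.le_zero.1 (len_le (l := []) ⟨by simp, rfl⟩)

theorem len_eq_zero {w : W} (h : len S w = 0) : w = 1 := by
  obtain ⟨l, hl, h'⟩ := hS.exists_reduced w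
  rw [h, List.length_eq_zero_iff] at h'
  subst h'
  exact hl.2.symm

theorem len_mul_le (s : W) (hs : s ∈ S) (w : W) : len S (s * w) ≤ len S w + 1 := by
  obtain ⟨l, hl, h⟩ := hS.exists_reduced w
  have : IsWord S (s * w) (s :: l) :=
    ⟨by simpa [hs] using hl.1, by rw [List.prod_cons, hl.2]⟩
  simpa [h] using len_le this

theorem len_inv_le (w : W) : len S w⁻¹ ≤ len S w := by
  obtain ⟨l, hl, h⟩ := hS.exists_reduced w
  have : IsWord S w⁻¹ l.reverse := by
    refine ⟨fun x hx => hl.1 x (List.mem_reverse.1 hx), ?_⟩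
    rw [← hl.2, List.prod_inv_reverse]
    congr 2
    nth_rw 1 [← List.map_id l]
    refine List.map_congr_left fun x hx => ?_
    rw [hS.inv_mem (hl.1 x hx), id]
  simpa [h] using len_le this

theorem len_inv (w : W) : len S w⁻¹ = len S w :=
  le_antisymm (hS.len_inv_le w) (by simpa using hS.len_inv_le w⁻¹)

theorem len_mul_le_add (x y : W) : len S (x * y) ≤ len S x + len S y := by
  obtain ⟨l, hl, h⟩ := hS.exists_reduced x
  obtain ⟨l', hl', h'⟩ := hS.exists_reduced y
  have : IsWord S (x * y) (l ++ l') := by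
    refine ⟨fun z hz => ?_, by rw [List.prod_append, hl.2, hl'.2]⟩
    rcases List.mem_append.1 hz with hz | hz
    exacts [hl.1 z hz, hl'.1 z hz]
  simpa [h, h'] using len_le this

theorem len_gen {s : W} (hs : s ∈ S) : len S s = 1 := by
  have h1 := hS.len_mul_ne s hs 1
  have h2 := hS.len_mul_le s hs 1
  rw [mul_one, len_one] at h1 h2
  omega

theorem len_mul_gen {s : W} (hs : s ∈ S) (w : W) :
    len S (s * w) = len S w + 1 ∨ len S w = len S (s * w) + 1 := by
  have h1 := hS.len_mul_le s hs w
  have h2 := hS.len_mul_le s hs (s * w)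
  rw [hS.mul_cancel hs] at h2
  have h3 := hS.len_mul_ne s hs w
  omega

theorem len_mul_gen_right {s : W} (hs : s ∈ S) (w : W) :
    len S (w * s) = len S w + 1 ∨ len S w = len S (w * s) + 1 := by
  have h := hS.len_mul_gen hs w⁻¹
  rw [← hS.len_inv (s * w⁻¹), hS.len_inv w] at h
  simpa [hS.inv_mem hs] using h

theorem weight_one : L 1 = 0 := by
  have := hS.isWeight 1 1 (by simp [len_one])
  simpa using this

theorem weight_gen_mul {s : W} (hs : s ∈ S) {w : W} (h : len S w < len S (s * w)) :
    L (s * w) = L s + L w := by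
  apply hS.isWeight
  rw [hS.len_gen hs]
  have := hS.len_mul_gen hs w
  omega

theorem weight_mul_gen {s : W} (hs : s ∈ S) {w : W} (h : len S w < len S (w * s)) :
    L (w * s) = L w + L s := by
  apply hS.isWeight
  rw [hS.len_gen hs]
  have := hS.len_mul_gen_right hs w
  omega

/-- An element other than `1` can be shortened by a generator from the left. -/
theorem exists_gen_mul {w : W} (hw : w ≠ 1) :
    ∃ s ∈ S, ∃ v, w = s * v ∧ len S w = len S v + 1 := by
  obtain ⟨l, hl, h⟩ := hS.exists_reduced w
  cases l with
  | nil => exact absurd hl.2.symm hw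
  | cons s l =>
    have hs : s ∈ S := hl.1 s (by simp)
    have hw' : w = s * l.prod := by rw [← hl.2, List.prod_cons]
    refine ⟨s, hs, l.prod, hw', ?_⟩
    have h1 : len S l.prod ≤ l.length :=
      len_le ⟨fun x hx => hl.1 x (List.mem_cons_of_mem _ hx), rfl⟩
    have h2 := hS.len_mul_le s hs l.prod
    rw [← hw'] at h2
    simp only [List.length_cons] at h
    omega

/-- Induction along left multiplication by generators that increases the length. -/
theorem induction_left {p : W → Prop} (one : p 1)
    (step : ∀ s ∈ S, ∀ w, len S w < len S (s * w) → p w → p (s * w)) (w : W) : p w := by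
  induction hn : len S w generalizing w with
  | zero => rw [hS.len_eq_zero hn]; exact one
  | succ n ih =>
    obtain ⟨s, hs, v, rfl, h⟩ := hS.exists_gen_mul (w := w)
      (by rintro rfl; rw [len_one] at hn; omega)
    exact step s hs v (by omega) (ih v (by omega))

end IsHeckeSystem

/-! ### The regular representation -/

theorem genOp_stdT (s w : W) : genOp S L s (stdT w) =
    stdT (s * w) + (if len S w < len S (s * w) then 0 else xi L s) • stdT w := by
  unfold genOp stdT
  rw [Finsupp.linearCombination_single, one_smul]
  split_ifs <;> simp

/-- The linear map `T_w ↦ T_{w⁻¹}`. -/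
def flip (W : Type*) [Group W] : H W →ₗ[A] H W := Finsupp.lmapDomain A A (fun w : W => w⁻¹)

@[simp] theorem flip_stdT (w : W) : flip W (stdT w) = stdT w⁻¹ := by
  simp [flip, stdT]

@[simp] theorem flip_flip (u : H W) : flip W (flip W u) = u := by
  have : (flip W).comp (flip W) = LinearMap.id := by
    ext w
    simp [flip]
  exact LinearMap.congr_fun this u

theorem flip_apply (u : H W) (w : W) : flip W u w = u w⁻¹ := by
  have h : (fun w : W => w⁻¹) (w⁻¹) = w := inv_inv w
  rw [flip, Finsupp.lmapDomain_apply, ← h, Finsupp.mapDomain_apply inv_injective]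
  simp

/-- Right multiplication by `T_s`. -/
def genOpRight (S : Set W) (L : W → ℤ) (s : W) : Module.End A (H W) :=
  flip W * genOp S L s * flip W

omit [Group W] in
theorem H_ext {f g : Module.End A (H W)} (h : ∀ w, f (stdT w) = g (stdT w)) : f = g :=
  Finsupp.lhom_ext' fun w => LinearMap.ext_ring (h w)

/-- Multiplication by `u` as an operator. -/
def op (S : Set W) (L : W → ℤ) : H W →ₗ[A] Module.End A (H W) :=
  Finsupp.linearCombination A (stdOp S L)

theorem mul_eq_op (u v : H W) : mul S L u v = op S L u v := rfl

@[simp] theorem op_stdT (w : W) : op S L (stdT w) = stdOp S L w := by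
  simp [op, stdT]

namespace IsHeckeSystem

variable (hS : IsHeckeSystem S L)
include hS

theorem genOpRight_stdT {s : W} (hs : s ∈ S) (w : W) : genOpRight S L s (stdT w) =
    stdT (w * s) + (if len S w < len S (w * s) then 0 else xi L s) • stdT w := by
  have h1 : len S (s * w⁻¹) = len S (w * s) := by
    rw [← hS.len_inv]; simp [hS.inv_mem hs]
  simp only [genOpRight, Module.End.mul_apply, flip_stdT, genOp_stdT, map_add, map_smul, h1,
    hS.len_inv, mul_inv_rev, inv_inv, hS.inv_mem hs]

/-- If `s` raises `w` but not `w * r`, the exchange condition gives `s * w = w * r`, and comparing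
weights gives `L s = L r`. The opposite failure is the same situation at `s * w`. -/
theorem gen_eq_of_exchange {s r : W} (hs : s ∈ S) (hr : r ∈ S) {w : W}
    (h : ¬ (len S (w * r) < len S (s * w * r) ↔ len S w < len S (s * w))) :
    s * w = w * r ∧ xi L s = xi L r := by
  have key : ∀ w : W, len S w < len S (s * w) → ¬ len S (w * r) < len S (s * w * r) →
      s * w = w * r ∧ xi L s = xi L r := by
    intro w h1 h2
    have h3 := hS.len_mul_gen hs w
    have h4 := hS.len_mul_gen hs (w * r)
    have h5 := hS.len_mul_gen_right hr w
    have h6 := hS.len_mul_gen_right hr (s * w)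
    rw [← mul_assoc] at h4
    have e := hS.exchange s hs r hr w h1 (by omega) (by omega)
    refine ⟨e, ?_⟩
    have h7 := hS.weight_gen_mul hs h1
    have h8 := hS.weight_mul_gen hr (w := w) (by omega)
    have : L s = L r := by rw [e] at h7; linarith
    simp [xi, this]
  by_cases h1 : len S w < len S (s * w)
  · exact key w h1 (by tauto)
  · have h3 := hS.len_mul_gen hs w
    have h4 := hS.len_mul_gen hs (w * r)
    rw [← mul_assoc] at h4
    have := key (s * w) (by rw [hS.mul_cancel hs]; omega)
      (by rw [hS.mul_cancel hs]; have : len S (w * r) < len S (s * w * r) := by tauto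
          omega)
    rw [hS.mul_cancel hs] at this
    refine ⟨?_, this.2⟩
    rw [eq_comm, this.1, hS.mul_cancel_right hr, ← this.1]

/-- This commutation is the source of associativity. On `T_w` both composites have the same
expansion as long as `s` behaves alike at `w` and `w * r`, and `r` alike at `w` and `s * w`. If one
of these fails, `s * w = w * r` and `ξ_s = ξ_r`, and the expansions agree again. -/
theorem commute_genOp {s r : W} (hs : s ∈ S) (hr : r ∈ S) :
    Commute (genOp S L s) (genOpRight S L r) := by
  refine H_ext fun w => ?_
  rw [Module.End.mul_apply, Module.End.mul_apply, hS.genOpRight_stdT hr, genOp_stdT, map_add,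
    map_add, map_smul, map_smul, genOp_stdT, genOp_stdT, hS.genOpRight_stdT hr,
    hS.genOpRight_stdT hr]
  rw [← mul_assoc]
  by_cases h : (len S (w * r) < len S (s * w * r) ↔ len S w < len S (s * w))
  · by_cases h' : (len S (s * w) < len S (s * w * r) ↔ len S w < len S (w * r))
    · simp only [h, h']
      module
    · have hrs : s * w = w * r ∧ xi L s = xi L r := by
        -- A failure on the right becomes a failure on the left after inverting all elements.
        have h1 := hS.gen_eq_of_exchange hr hs (w := w⁻¹) (by
          rw [← hS.len_inv (w⁻¹ * s), ← hS.len_inv (r * w⁻¹ * s), ← hS.len_inv (r * w⁻¹),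
            ← hS.len_inv w⁻¹]
          simp only [mul_inv_rev, inv_inv, hS.inv_mem hs, hS.inv_mem hr]
          simpa [mul_assoc] using h')
        refine ⟨?_, h1.2.symm⟩
        have := congrArg (·⁻¹) h1.1
        simpa [hS.inv_mem hs, hS.inv_mem hr, eq_comm] using this
      rw [hrs.1, hrs.2]
  · obtain ⟨h1, h2⟩ := hS.gen_eq_of_exchange hs hr h
    rw [h1, h2]

end IsHeckeSystem

/-! ### The Hecke algebra as an algebra of operators -/

theorem genOp_stdT_of_lt {s w : W} (h : len S w < len S (s * w)) :
    genOp S L s (stdT w) = stdT (s * w) := by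
  rw [genOp_stdT, if_pos h, zero_smul, add_zero]

theorem genOp_stdT_of_not_lt {s w : W} (h : ¬ len S w < len S (s * w)) :
    genOp S L s (stdT w) = stdT (s * w) + xi L s • stdT w := by
  rw [genOp_stdT, if_neg h]

/-- An operator that commutes with the right multiplications by the generators. -/
def CommutesRight (S : Set W) (L : W → ℤ) (f : Module.End A (H W)) : Prop :=
  ∀ r ∈ S, Commute f (genOpRight S L r)

omit [Group W] in
@[elab_as_elim]
theorem H_induction {p : H W → Prop} (u : H W) (zero : p 0) (add : ∀ u v, p u → p v → p (u + v))
    (smul : ∀ (a : A) w, p (a • stdT w)) : p u := by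
  induction u using Finsupp.induction_linear with
  | zero => exact zero
  | add u v hu hv => exact add u v hu hv
  | single w a => simpa [stdT] using smul a w

namespace IsHeckeSystem

variable (hS : IsHeckeSystem S L)
include hS

theorem induction_right {p : W → Prop} (one : p 1)
    (step : ∀ s ∈ S, ∀ w, len S w < len S (w * s) → p w → p (w * s)) (w : W) : p w := by
  rw [← inv_inv w]
  induction w⁻¹ using hS.induction_left with
  | one => simpa using one
  | step s hs v h ih =>
    rw [mul_inv_rev, hS.inv_mem hs]
    refine step s hs _ ?_ ih
    rw [hS.len_inv, ← hS.len_inv (v⁻¹ * s), mul_inv_rev, inv_inv, hS.inv_mem hs]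
    exact h

/-- `stdT 1` generates the module under right multiplications, so the commutant of these embeds into
the module by evaluation at `stdT 1`. -/
theorem commutesRight_ext {f g : Module.End A (H W)} (hf : CommutesRight S L f)
    (hg : CommutesRight S L g) (h : f (stdT 1) = g (stdT 1)) : f = g := by
  refine H_ext fun w => ?_
  induction w using hS.induction_right with
  | one => exact h
  | step s hs w hw ih =>
    have e : stdT (w * s) = genOpRight S L s (stdT w) := by
      rw [hS.genOpRight_stdT hs, if_pos hw, zero_smul, add_zero]
    rw [e]
    have h1 := LinearMap.congr_fun (hf s hs) (stdT w)
    have h2 := LinearMap.congr_fun (hg s hs) (stdT w)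
    simp only [Module.End.mul_apply] at h1 h2
    rw [h1, h2, ih]

theorem commutesRight_genOp {s : W} (hs : s ∈ S) : CommutesRight S L (genOp S L s) :=
  fun _ hr => hS.commute_genOp hs hr

omit hS in
theorem commutesRight_mul {f g : Module.End A (H W)} (hf : CommutesRight S L f)
    (hg : CommutesRight S L g) : CommutesRight S L (f * g) :=
  fun r hr => (hf r hr).mul_left (hg r hr)

omit hS in
theorem commutesRight_one : CommutesRight S L (1 : Module.End A (H W)) :=
  fun _ _ => Commute.one_left _

theorem redWord_spec (w : W) : IsWord S w (redWord S w) ∧ (redWord S w).length = len S w := by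
  have h := hS.exists_reduced w
  rw [redWord, dif_pos h]
  exact h.choose_spec

theorem commutesRight_stdOp (w : W) : CommutesRight S L (stdOp S L w) := by
  have := (hS.redWord_spec w).1.1
  rw [stdOp]
  generalize redWord S w = l at this ⊢
  induction l with
  | nil => exact commutesRight_one
  | cons s l ih =>
    rw [List.map_cons, List.prod_cons]
    exact commutesRight_mul (hS.commutesRight_genOp (this s (by simp)))
      (ih fun x hx => this x (List.mem_cons_of_mem _ hx))

theorem genOp_list_stdT_one {l : List W} (h1 : ∀ x ∈ l, x ∈ S) (h3 : l.length = len S l.prod) :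
    (l.map (genOp S L)).prod (stdT 1) = stdT l.prod := by
  induction l with
  | nil => rfl
  | cons s l ih =>
    have hs : s ∈ S := h1 s (by simp)
    have h4 : len S l.prod ≤ l.length := len_le ⟨fun x hx => h1 x (List.mem_cons_of_mem _ hx), rfl⟩
    have h5 := hS.len_mul_le s hs l.prod
    rw [List.prod_cons, List.length_cons] at h3
    rw [List.map_cons, List.prod_cons, Module.End.mul_apply, List.prod_cons,
      ih (fun x hx => h1 x (List.mem_cons_of_mem _ hx)) (by omega), genOp_stdT_of_lt (by omega)]

theorem stdOp_stdT_one (w : W) : stdOp S L w (stdT 1) = stdT w := by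
  obtain ⟨⟨h1, h2⟩, h3⟩ := hS.redWord_spec w
  rw [stdOp, hS.genOp_list_stdT_one h1 (by rw [h2, h3]), h2]

theorem stdOp_one : stdOp S L 1 = 1 :=
  hS.commutesRight_ext (hS.commutesRight_stdOp 1) commutesRight_one (hS.stdOp_stdT_one 1)

theorem stdOp_gen {s : W} (hs : s ∈ S) : stdOp S L s = genOp S L s := by
  refine hS.commutesRight_ext (hS.commutesRight_stdOp s) (hS.commutesRight_genOp hs) ?_
  rw [hS.stdOp_stdT_one, genOp_stdT_of_lt, mul_one]
  rw [mul_one, hS.len_gen hs, len_one]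
  exact one_pos

theorem commutesRight_op (u : H W) : CommutesRight S L (op S L u) := by
  intro r hr
  refine H_induction u ?_ ?_ ?_
  · rw [map_zero]; exact Commute.zero_left _
  · intro u v hu hv
    rw [map_add]
    exact hu.add_left hv
  · intro a w
    rw [map_smul, op_stdT]
    exact (hS.commutesRight_stdOp w r hr).smul_left a

theorem op_stdT_one (u : H W) : op S L u (stdT 1) = u := by
  refine H_induction u (by rw [map_zero]; rfl) ?_ ?_
  · intro u v hu hv
    rw [map_add, LinearMap.add_apply, hu, hv]
  · intro a w
    rw [map_smul, op_stdT, LinearMap.smul_apply, hS.stdOp_stdT_one]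

theorem op_of_commutesRight {f : Module.End A (H W)} (hf : CommutesRight S L f) :
    op S L (f (stdT 1)) = f :=
  hS.commutesRight_ext (hS.commutesRight_op _) hf (hS.op_stdT_one _)

/-- This is associativity: both sides lie in the commutant of the right multiplications and take the
same value at `stdT 1`. -/
theorem op_mul (u v : H W) : op S L (op S L u v) = op S L u * op S L v := by
  have := hS.op_of_commutesRight (commutesRight_mul (hS.commutesRight_op u) (hS.commutesRight_op v))
  rwa [Module.End.mul_apply, hS.op_stdT_one] at this

theorem op_genOp {s : W} (hs : s ∈ S) (v : H W) :
    op S L (genOp S L s v) = genOp S L s * op S L v := by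
  rw [← hS.stdOp_gen hs, ← op_stdT, hS.op_mul]

theorem op_one : op S L (stdT 1) = 1 := by
  rw [op_stdT, hS.stdOp_one]

theorem stdOp_mul {x y : W} (h : len S (x * y) = len S x + len S y) :
    stdOp S L (x * y) = stdOp S L x * stdOp S L y := by
  induction x using hS.induction_left with
  | one => rw [one_mul, hS.stdOp_one, one_mul]
  | step s hs w hw ih =>
    rw [mul_assoc] at h ⊢
    have h1 := hS.len_mul_gen hs w
    have h2 := hS.len_mul_gen hs (w * y)
    have h3 := hS.len_mul_le_add w y
    have key : ∀ v, len S v < len S (s * v) → stdOp S L (s * v) = genOp S L s * stdOp S L v := by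
      intro v hv
      refine hS.commutesRight_ext (hS.commutesRight_stdOp _)
        (commutesRight_mul (hS.commutesRight_genOp hs) (hS.commutesRight_stdOp _)) ?_
      rw [hS.stdOp_stdT_one, Module.End.mul_apply, hS.stdOp_stdT_one, genOp_stdT_of_lt hv]
    rw [key _ (by omega), key _ hw, ih (by omega), mul_assoc]

theorem stdOp_gen_mul {s : W} (hs : s ∈ S) {v : W} (hv : len S v < len S (s * v)) :
    stdOp S L (s * v) = genOp S L s * stdOp S L v := by
  rw [← hS.stdOp_gen hs]
  apply hS.stdOp_mul
  have := hS.len_mul_gen hs v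
  rw [hS.len_gen hs]
  omega

theorem genOp_mul_self {s : W} (hs : s ∈ S) :
    genOp S L s * genOp S L s = 1 + xi L s • genOp S L s := by
  refine H_ext fun w => ?_
  rw [Module.End.mul_apply, LinearMap.add_apply, LinearMap.smul_apply, Module.End.one_apply]
  have h := hS.len_mul_gen hs w
  by_cases hw : len S w < len S (s * w)
  · rw [genOp_stdT_of_lt hw, genOp_stdT_of_not_lt (by rw [hS.mul_cancel hs]; omega),
      hS.mul_cancel hs]
  · rw [genOp_stdT_of_not_lt hw, map_add, map_smul, genOp_stdT_of_lt (by
      rw [hS.mul_cancel hs]; omega), genOp_stdT_of_not_lt hw, hS.mul_cancel hs]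

theorem mul_assoc' (u v w : H W) : mul S L (mul S L u v) w = mul S L u (mul S L v w) := by
  simp only [mul_eq_op, hS.op_mul, Module.End.mul_apply]

theorem one_mul' (u : H W) : mul S L (stdT 1) u = u := by
  rw [mul_eq_op, hS.op_one, Module.End.one_apply]

theorem mul_one' (u : H W) : mul S L u (stdT 1) = u := by
  rw [mul_eq_op, hS.op_stdT_one]

theorem stdT_mul' {x y : W} (h : len S (x * y) = len S x + len S y) :
    mul S L (stdT x) (stdT y) = stdT (x * y) := by
  rw [mul_eq_op, op_stdT, ← hS.stdOp_stdT_one (x * y), hS.stdOp_mul h, Module.End.mul_apply,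
    hS.stdOp_stdT_one y]

theorem stdT_sq' {s : W} (hs : s ∈ S) :
    mul S L (stdT s) (stdT s) = stdT 1 + xi L s • stdT s := by
  have h := LinearMap.congr_fun (hS.genOp_mul_self hs) (stdT 1)
  have h1 : genOp S L s (stdT 1) = stdT s := by rw [← hS.stdOp_gen hs, hS.stdOp_stdT_one]
  rw [mul_eq_op, op_stdT, hS.stdOp_gen hs]
  rw [Module.End.mul_apply, LinearMap.add_apply, LinearMap.smul_apply, Module.End.one_apply, h1] at h
  exact h

/-! ### The anti-involution -/

/-- Conjugating a left multiplication by `flip` gives a composite of right multiplications by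
generators. Evaluated at `stdT 1`, the commutation says that `flip` is an anti-automorphism. -/
theorem commute_op_flip (u v : H W) : Commute (op S L u) (flip W * op S L v * flip W) := by
  have hff : flip W * flip W = (1 : Module.End A (H W)) := LinearMap.ext fun u => flip_flip u
  refine H_induction v (by rw [map_zero, mul_zero, zero_mul]; exact Commute.zero_right _) ?_ ?_
  · intro v w hv hw
    rw [map_add, mul_add, add_mul]
    exact hv.add_right hw
  · intro a w
    rw [map_smul, op_stdT, mul_smul_comm, smul_mul_assoc]
    refine Commute.smul_right ?_ a
    induction w using hS.induction_left with
    | one => rw [hS.stdOp_one, mul_one, hff]; exact Commute.one_right _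
    | step s hs w hw ih =>
      have : flip W * stdOp S L (s * w) * flip W
          = genOpRight S L s * (flip W * stdOp S L w * flip W) := by
        rw [hS.stdOp_gen_mul hs hw, genOpRight]
        simp only [mul_assoc]
        rw [← mul_assoc (flip W) (flip W), hff, one_mul]
      rw [this]
      exact (hS.commutesRight_op u s hs).mul_right ih

theorem flip_mul (u v : H W) : flip W (mul S L u v) = mul S L (flip W v) (flip W u) := by
  have h := LinearMap.congr_fun (hS.commute_op_flip (flip W v) u) (stdT 1)
  simp only [Module.End.mul_apply, flip_stdT, inv_one, hS.op_stdT_one, flip_flip] at h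
  exact h.symm

/-! ### The bar involution -/

theorem genOp_mul_inverse {s : W} (hs : s ∈ S) :
    genOp S L s * (genOp S L s + (-xi L s) • 1) = 1 ∧
      (genOp S L s + (-xi L s) • 1) * genOp S L s = 1 := by
  have h := hS.genOp_mul_self hs
  constructor
  · rw [mul_add, h, mul_smul_comm, mul_one, add_assoc, ← add_smul, add_neg_cancel, zero_smul,
      add_zero]
  · rw [add_mul, h, smul_mul_assoc, one_mul, add_assoc, ← add_smul, add_neg_cancel, zero_smul,
      add_zero]

theorem isUnit_genOp {s : W} (hs : s ∈ S) : IsUnit (genOp S L s) :=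
  ⟨⟨_, _, (hS.genOp_mul_inverse hs).1, (hS.genOp_mul_inverse hs).2⟩, rfl⟩

theorem inverse_genOp {s : W} (hs : s ∈ S) :
    Ring.inverse (genOp S L s) = genOp S L s + (-xi L s) • 1 :=
  Ring.inverse_unit (⟨_, _, (hS.genOp_mul_inverse hs).1, (hS.genOp_mul_inverse hs).2⟩ : Units _)

theorem isUnit_stdOp (w : W) : IsUnit (stdOp S L w) := by
  induction w using hS.induction_left with
  | one => rw [hS.stdOp_one]; exact isUnit_one
  | step s hs w hw ih => rw [hS.stdOp_gen_mul hs hw]; exact (hS.isUnit_genOp hs).mul ih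

end IsHeckeSystem

/-! ### Properties of the bar involution -/

theorem bar_zero : bar S L (0 : H W) = 0 := Finsupp.sum_zero_index

theorem bar_add (u v : H W) : bar S L (u + v) = bar S L u + bar S L v := by
  unfold bar
  refine Finsupp.sum_add_index' (fun w => by simp) fun w p q => ?_
  rw [map_add, add_smul]

theorem bar_smul (a : A) (u : H W) :
    bar S L (a • u) = LaurentPolynomial.invert a • bar S L u := by
  unfold bar
  rw [Finsupp.sum_smul_index fun w => by simp, Finsupp.smul_sum]
  simp [mul_smul]

theorem bar_stdT (w : W) :
    bar S L (stdT w) = (Ring.inverse (stdOp S L w⁻¹)) (stdT 1) := by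
  unfold bar stdT
  rw [Finsupp.sum_single_index (by simp), map_one, one_smul]

/-- The bar involution as an additive map. -/
def barHom (S : Set W) (L : W → ℤ) : H W →+ H W where
  toFun := bar S L
  map_zero' := bar_zero
  map_add' := bar_add

theorem bar_sub (u v : H W) : bar S L (u - v) = bar S L u - bar S L v :=
  map_sub (barHom S L) u v

omit [Group W] in
theorem invert_xi (s : W) : LaurentPolynomial.invert (xi L s) = -xi L s := by
  simp [xi]

/-- The operator of left multiplication by `C_s = T_s + q ^ (-L(s))`. -/
def klOp (S : Set W) (L : W → ℤ) (s : W) : Module.End A (H W) :=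
  genOp S L s + (LaurentPolynomial.T (-(L s)) : A) • 1

theorem klOp_apply (s : W) (u : H W) :
    klOp S L s u = genOp S L s u + (LaurentPolynomial.T (-(L s)) : A) • u := rfl

/-- The submodule spanned by the `T_y` with `ℓ(y) < n`. -/
def lower (S : Set W) (n : ℕ) : Submodule A (H W) := Finsupp.supported A A {y | len S y < n}

theorem mem_lower {n : ℕ} {u : H W} : u ∈ lower S n ↔ ∀ y, n ≤ len S y → u y = 0 := by
  rw [lower, Finsupp.mem_supported']
  simp

theorem lower_mono {m n : ℕ} (h : m ≤ n) : lower S m ≤ lower S n := fun _ hu =>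
  mem_lower.2 fun y hy => mem_lower.1 hu y (h.trans hy)

theorem stdT_mem_lower {w : W} {n : ℕ} (h : len S w < n) : stdT w ∈ lower S n :=
  Finsupp.single_mem_supported A _ h

omit [Group W] in
theorem stdT_apply_self (w : W) : stdT w w = 1 := Finsupp.single_eq_same

omit [Group W] in
theorem stdT_apply_of_ne {w y : W} (h : y ≠ w) : stdT w y = 0 := Finsupp.single_eq_of_ne h

theorem eq_zero_of_isNeg_of_invert {p : A} (h : IsNeg p) (h' : LaurentPolynomial.invert p = p) :
    p = 0 := by
  ext n
  rcases le_total 0 n with hn | hn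
  · simpa using h n hn
  · have := h (-n) (by omega)
    rw [← h', LaurentPolynomial.invert_apply, this]
    rfl

namespace IsHeckeSystem

variable (hS : IsHeckeSystem S L)
include hS

theorem commutesRight_inverse (w : W) : CommutesRight S L (Ring.inverse (stdOp S L w)) := by
  intro r hr
  obtain ⟨u, hu⟩ := hS.isUnit_stdOp w
  have h := hS.commutesRight_stdOp w r hr
  rw [← hu] at h ⊢
  rw [Ring.inverse_unit]
  exact h.units_inv_left

theorem op_bar_stdT (w : W) : op S L (bar S L (stdT w)) = Ring.inverse (stdOp S L w⁻¹) := by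
  rw [bar_stdT]
  exact hS.op_of_commutesRight (hS.commutesRight_inverse _)

theorem bar_stdT_gen_mul {s : W} (hs : s ∈ S) {w : W} (hw : len S w < len S (s * w)) :
    bar S L (stdT (s * w)) = (genOp S L s + (-xi L s) • 1) (bar S L (stdT w)) := by
  have e : stdOp S L (s * w)⁻¹ = stdOp S L w⁻¹ * genOp S L s := by
    rw [mul_inv_rev, hS.inv_mem hs, ← hS.stdOp_gen hs]
    apply hS.stdOp_mul
    have h1 := hS.len_inv (s * w)
    rw [mul_inv_rev, hS.inv_mem hs] at h1
    rw [h1, hS.len_inv, hS.len_gen hs]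
    have := hS.len_mul_gen hs w
    omega
  rw [bar_stdT, bar_stdT, e, Ring.inverse_mul (Or.inl (hS.isUnit_stdOp _)), hS.inverse_genOp hs]
  rfl

theorem bar_genOp {s : W} (hs : s ∈ S) (u : H W) :
    bar S L (genOp S L s u) = (genOp S L s + (-xi L s) • 1) (bar S L u) := by
  induction u using H_induction with
  | zero => rw [map_zero, bar_zero, map_zero]
  | add u v hu hv => rw [map_add, bar_add, bar_add, map_add, hu, hv]
  | smul a w =>
    rw [map_smul, bar_smul, bar_smul, map_smul]
    congr 1
    by_cases hw : len S w < len S (s * w)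
    · rw [genOp_stdT_of_lt hw, hS.bar_stdT_gen_mul hs hw]
    · have h := hS.len_mul_gen hs w
      -- In the descending case the formula for ascents is applied at `s * w` and solved for the
      -- other term by multiplying with `T_s`.
      have h2 := hS.bar_stdT_gen_mul hs (w := s * w) (by rw [hS.mul_cancel hs]; omega)
      rw [hS.mul_cancel hs] at h2
      have h3 : bar S L (stdT (s * w)) = genOp S L s (bar S L (stdT w)) := by
        rw [h2, ← Module.End.mul_apply, (hS.genOp_mul_inverse hs).1, Module.End.one_apply]
      rw [genOp_stdT_of_not_lt hw, bar_add, bar_smul, invert_xi, h3]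
      rfl

/-- `T_s⁻¹ = T_s - ξ_s`, so `T_s + q^(-L(s))` is its own bar conjugate. Bar invariance of every
explicit Kazhdan–Lusztig element is later derived from this single fact. -/
theorem bar_klOp {s : W} (hs : s ∈ S) (u : H W) :
    bar S L (klOp S L s u) = klOp S L s (bar S L u) := by
  rw [klOp_apply, bar_add, hS.bar_genOp hs, bar_smul, klOp_apply, LinearMap.add_apply,
    LinearMap.smul_apply, Module.End.one_apply, LaurentPolynomial.invert_T, neg_neg, add_assoc,
    ← add_smul, xi]
  congr 2
  ring

theorem bar_stdT_one : bar S L (stdT 1) = stdT 1 := by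
  rw [bar_stdT, inv_one, hS.stdOp_one, Ring.inverse_one, Module.End.one_apply]

theorem bar_mul' (u v : H W) : bar S L (mul S L u v) = mul S L (bar S L u) (bar S L v) := by
  rw [mul_eq_op, mul_eq_op]
  induction u using H_induction with
  | zero => simp [bar_zero]
  | add u u' hu hu' =>
    rw [map_add, LinearMap.add_apply, bar_add, hu, hu', bar_add, map_add, LinearMap.add_apply]
  | smul a w =>
    rw [map_smul, LinearMap.smul_apply, bar_smul, bar_smul, map_smul, LinearMap.smul_apply]
    congr 1
    rw [op_stdT]
    induction w using hS.induction_left with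
    | one => rw [hS.stdOp_one, hS.bar_stdT_one, hS.op_one]; rfl
    | step s hs w hw ih =>
      have h : op S L (bar S L (stdT (s * w)))
          = (genOp S L s + (-xi L s) • 1) * op S L (bar S L (stdT w)) := by
        rw [hS.bar_stdT_gen_mul hs hw, LinearMap.add_apply, LinearMap.smul_apply, map_add,
          map_smul, hS.op_genOp hs, add_mul, smul_mul_assoc, one_mul, Module.End.one_apply]
      rw [hS.stdOp_gen_mul hs hw, Module.End.mul_apply, hS.bar_genOp hs, ih, h]
      rfl

theorem bar_stdT_mul (w : W) : mul S L (bar S L (stdT w)) (stdT w⁻¹) = stdT 1 ∧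
    mul S L (stdT w⁻¹) (bar S L (stdT w)) = stdT 1 := by
  constructor
  · rw [mul_eq_op, hS.op_bar_stdT, ← hS.stdOp_stdT_one, ← Module.End.mul_apply,
      Ring.inverse_mul_cancel _ (hS.isUnit_stdOp _)]
    rfl
  · rw [mul_eq_op, op_stdT, bar_stdT, ← Module.End.mul_apply,
      Ring.mul_inverse_cancel _ (hS.isUnit_stdOp _)]
    rfl

theorem flip_bar (u : H W) : flip W (bar S L u) = bar S L (flip W u) := by
  induction u using H_induction with
  | zero => rw [map_zero, bar_zero, map_zero]
  | add u v hu hv => rw [map_add, bar_add, bar_add, map_add, hu, hv]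
  | smul a w =>
    rw [bar_smul, map_smul, map_smul, bar_smul, flip_stdT]
    congr 1
    have h1 := congrArg (flip W) (hS.bar_stdT_mul w).2
    rw [hS.flip_mul, flip_stdT, flip_stdT, inv_one, inv_inv] at h1
    have h2 := (hS.bar_stdT_mul w⁻¹).2
    rw [inv_inv] at h2
    rw [← hS.mul_one' (flip W _), ← h2, ← hS.mul_assoc', h1, hS.one_mul']

theorem genOp_mem_lower {s : W} (hs : s ∈ S) {n : ℕ} {u : H W} (hu : u ∈ lower S n) :
    genOp S L s u ∈ lower S (n + 1) := by
  rw [lower, Finsupp.mem_supported] at hu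
  have e : u = u.sum fun w p => p • stdT w := by
    conv_lhs => rw [← Finsupp.sum_single u]
    simp [stdT]
  rw [e, Finsupp.sum, map_sum]
  refine Submodule.sum_mem _ fun w hw => ?_
  have h1 : len S w < n := hu hw
  have h2 := hS.len_mul_le s hs w
  rw [map_smul, genOp_stdT]
  exact Submodule.smul_mem _ _ (Submodule.add_mem _ (stdT_mem_lower (by omega))
    (Submodule.smul_mem _ _ (stdT_mem_lower (by omega))))

theorem bar_stdT_sub_mem (w : W) : bar S L (stdT w) - stdT w ∈ lower S (len S w) := by
  induction w using hS.induction_left with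
  | one => rw [hS.bar_stdT_one, sub_self]; exact Submodule.zero_mem _
  | step s hs w hw ih =>
    have h1 := hS.len_mul_gen hs w
    have e : bar S L (stdT (s * w)) - stdT (s * w) = genOp S L s (bar S L (stdT w) - stdT w)
        + (-xi L s) • (bar S L (stdT w) - stdT w) + (-xi L s) • stdT w := by
      rw [hS.bar_stdT_gen_mul hs hw, ← genOp_stdT_of_lt hw, LinearMap.add_apply,
        LinearMap.smul_apply, Module.End.one_apply, map_sub, smul_sub]
      abel
    rw [e, show len S (s * w) = len S w + 1 by omega]
    refine Submodule.add_mem _ (Submodule.add_mem _ (hS.genOp_mem_lower hs ih)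
      (Submodule.smul_mem _ _ (lower_mono (by omega) ih)))
      (Submodule.smul_mem _ _ (stdT_mem_lower (by omega)))

/-- At an element of maximal length in the support, triangularity of the bar involution shows that
the coefficient is itself fixed by `q ↦ q⁻¹`. A fixed element of `q⁻¹ℤ[q⁻¹]` vanishes. -/
theorem eq_zero_of_bar_eq {c : H W} (hc : bar S L c = c) (hneg : ∀ y, IsNeg (c y)) : c = 0 := by
  by_contra hne
  obtain ⟨y, hy, hmax⟩ := Finset.exists_max_image c.support (len S)
    (Finsupp.support_nonempty_iff.2 hne)
  have h1 : bar S L c y = LaurentPolynomial.invert (c y) := by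
    have : bar S L c - c.sum (fun w p => LaurentPolynomial.invert p • stdT w) ∈
        lower S (len S y) := by
      rw [bar, Finsupp.sum, Finsupp.sum, ← Finset.sum_sub_distrib]
      refine Submodule.sum_mem _ fun w hw => ?_
      rw [← smul_sub, ← bar_stdT]
      exact Submodule.smul_mem _ _ (lower_mono (hmax w hw) (hS.bar_stdT_sub_mem w))
    have h2 := mem_lower.1 this y le_rfl
    rw [Finsupp.sub_apply, sub_eq_zero] at h2
    rw [h2, Finsupp.sum, Finsupp.finsetSum_apply, Finset.sum_eq_single y]
    · simp [stdT_apply_self]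
    · intro w _ hwy
      simp [stdT_apply_of_ne hwy.symm]
    · intro h
      exact absurd hy h
  rw [hc] at h1
  exact Finsupp.mem_support_iff.1 hy (eq_zero_of_isNeg_of_invert (hneg y) h1.symm)

end IsHeckeSystem

theorem IsNeg.sub {p q : A} (hp : IsNeg p) (hq : IsNeg q) : IsNeg (p - q) := fun n hn => by
  rw [AddMonoidAlgebra.coeff_sub, Finsupp.sub_apply, hp n hn, hq n hn, sub_zero]

theorem IsHeckeSystem.isKL_unique (hS : IsHeckeSystem S L) {w : W} {c d : H W}
    (hc : IsKL S L w c) (hd : IsKL S L w d) : c = d := by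
  rw [← sub_eq_zero]
  refine hS.eq_zero_of_bar_eq (by rw [bar_sub, hc.1, hd.1]) fun y => ?_
  have := (hc.2 y).sub (hd.2 y)
  rwa [← Finsupp.sub_apply, sub_sub_sub_cancel_right] at this

/-- A family of Kazhdan-Lusztig elements that is triangular with respect to the length. -/
structure IsKLFamily (S : Set W) (L : W → ℤ) (c : W → H W) : Prop where
  isKL : ∀ w, IsKL S L w (c w)
  sub_mem_lower : ∀ w, c w - stdT w ∈ lower S (len S w)

/-! ### The Kazhdan-Lusztig basis -/

namespace IsKLFamily

variable {c : W → H W} (hS : IsHeckeSystem S L) (hc : IsKLFamily S L c)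
include hS hc

theorem existsUnique (w : W) : ∃! c : H W, IsKL S L w c :=
  ⟨c w, hc.isKL w, fun _ hd => hS.isKL_unique hd (hc.isKL w)⟩

/-- Uniqueness replaces the chosen elements in `klC` by the explicit family, so that all later
computations can be made with `c`. -/
theorem klC_eq : klC S L = c := by
  funext w
  have h : ∃ c : H W, IsKL S L w c := ⟨c w, hc.isKL w⟩
  rw [klC, dif_pos h]
  exact hS.isKL_unique h.choose_spec (hc.isKL w)

theorem span_eq_top' : Submodule.span A (Set.range (klC S L)) = ⊤ := by
  rw [hc.klC_eq hS]
  have key : ∀ n, ∀ w, len S w < n → stdT w ∈ Submodule.span A (Set.range c) := by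
    intro n
    induction n with
    | zero => intro w hw; exact absurd hw (Nat.not_lt_zero _)
    | succ n ih =>
      intro w hw
      have h1 : lower S (len S w) ≤ Submodule.span A (Set.range c) := by
        rw [lower, Finsupp.supported_eq_span_single, Submodule.span_le]
        rintro _ ⟨y, hy, rfl⟩
        exact ih y (lt_of_lt_of_le hy (by omega))
      have h2 : c w ∈ Submodule.span A (Set.range c) := Submodule.subset_span ⟨w, rfl⟩
      have := Submodule.sub_mem _ h2 (h1 (hc.sub_mem_lower w))
      rwa [sub_sub_cancel] at this
  rw [eq_top_iff]
  intro u _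
  induction u using H_induction with
  | zero => exact Submodule.zero_mem _
  | add u v hu hv => exact Submodule.add_mem _ (hu trivial) (hv trivial)
  | smul a w => exact Submodule.smul_mem _ _ (key _ w (Nat.lt_succ_self _))

variable [Finite W]

theorem linearIndependent' : LinearIndependent A (klC S L) := by
  have := Fintype.ofFinite W
  refine linearIndependent_of_top_le_span_of_card_eq_finrank (hc.span_eq_top' hS).ge ?_
  simp [H]

theorem wellDefined (h1 : ∀ w : W, klP S L 1 w ≠ 0) : WellDefined S L where
  mul_assoc := hS.mul_assoc'
  one_mul := hS.one_mul'
  mul_one := hS.mul_one'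
  stdT_mul _ _ := hS.stdT_mul'
  stdT_sq _ := hS.stdT_sq'
  bar_mul := hS.bar_mul'
  bar_stdT := hS.bar_stdT_mul
  existsUnique_isKL := hc.existsUnique hS
  linearIndependent := hc.linearIndependent' hS
  span_eq_top := hc.span_eq_top' hS
  klP_one_ne_zero := h1

/-- The Kazhdan-Lusztig basis. -/
def basis : Module.Basis W A (H W) :=
  Module.Basis.mk (hc.linearIndependent' hS) (hc.span_eq_top' hS).ge

theorem basis_apply (w : W) : hc.basis hS w = c w := by
  rw [basis, Module.Basis.mk_apply, hc.klC_eq hS]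

theorem klCoord_eq (u : H W) : klCoord S L u = (hc.basis hS).repr u := by
  have h : (fun g : W →₀ A => Finsupp.linearCombination A (klC S L) g)
      = (hc.basis hS).repr.symm := by
    funext g
    rw [Module.Basis.repr_symm_apply]
    congr 2
    funext w
    rw [hc.basis_apply hS, hc.klC_eq hS]
  rw [klCoord, h]
  have := Function.leftInverse_invFun (hc.basis hS).repr.symm.injective ((hc.basis hS).repr u)
  rwa [LinearEquiv.symm_apply_apply] at this

theorem h_eq (x y : W) : h S L x y = (hc.basis hS).repr (op S L (c x) (c y)) := by
  rw [h, hc.klCoord_eq hS, hc.klC_eq hS, mul_eq_op]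

theorem op_eq_sum (x y : W) : op S L (c x) (c y) = (h S L x y).sum fun z p => p • c z := by
  rw [hc.h_eq hS]
  conv_lhs => rw [← (hc.basis hS).linearCombination_repr (op S L (c x) (c y))]
  rw [Finsupp.linearCombination_apply]
  simp only [hc.basis_apply hS]

theorem repr_self (w : W) : (hc.basis hS).repr (c w) = Finsupp.single w 1 := by
  rw [← hc.basis_apply hS, Module.Basis.repr_self]

omit [Finite W] in
theorem flip_klC (w : W) : flip W (c w) = c w⁻¹ := by
  refine hS.isKL_unique (w := w⁻¹) ⟨?_, fun y => ?_⟩ (hc.isKL w⁻¹)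
  · rw [← hS.flip_bar, (hc.isKL w).1]
  · rw [← flip_stdT, ← map_sub, flip_apply]
    exact (hc.isKL w).2 _

/-- The anti-involution `T_w ↦ T_{w⁻¹}` permutes the Kazhdan–Lusztig basis by inversion. Every
statement about right multiplication is reduced to one about left multiplication in this way. -/
theorem h_flip (x y z : W) : h S L x y z = h S L y⁻¹ x⁻¹ z⁻¹ := by
  have e : ∀ u z, (hc.basis hS).repr (flip W u) z = (hc.basis hS).repr u z⁻¹ := by
    intro u z
    have : (Finsupp.lmapDomain A A (fun w : W => w⁻¹)).comp (hc.basis hS).repr.toLinearMap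
        = (hc.basis hS).repr.toLinearMap.comp (flip W) := by
      refine (hc.basis hS).ext fun w => ?_
      simp only [LinearMap.comp_apply, LinearEquiv.coe_coe, hc.basis_apply hS, hc.flip_klC hS,
        hc.repr_self hS]
      simp
    have := LinearMap.congr_fun this u
    simp only [LinearMap.comp_apply, LinearEquiv.coe_coe] at this
    rw [← this]
    exact flip_apply _ _
  rw [hc.h_eq hS, hc.h_eq hS, ← hc.flip_klC hS, ← hc.flip_klC hS,
    ← mul_eq_op (flip W _), ← hS.flip_mul, e, inv_inv, mul_eq_op]

omit hc [Finite W] in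
theorem isKL_klOp_one {s : W} (hs : s ∈ S) (hpos : 0 < L s) :
    IsKL S L s (klOp S L s (stdT 1)) := by
  have e : genOp S L s (stdT 1) = stdT s := by
    rw [← hS.stdOp_gen hs, hS.stdOp_stdT_one]
  refine ⟨?_, fun y => ?_⟩
  · rw [hS.bar_klOp hs, hS.bar_stdT_one]
  · rw [klOp_apply, e, add_sub_cancel_left]
    intro n hn
    by_cases hy : y = 1
    · subst hy
      rw [Finsupp.smul_apply, stdT_apply_self, smul_eq_mul, mul_one, LaurentPolynomial.T_apply,
        if_neg (by omega)]
    · rw [Finsupp.smul_apply, stdT_apply_of_ne hy, smul_zero]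
      rfl

omit hc [Finite W] in
theorem isKL_stdT_one : IsKL S L 1 (stdT 1) := by
  refine ⟨hS.bar_stdT_one, fun y n hn => ?_⟩
  rw [sub_self]
  rfl

omit [Finite W] in
theorem klC_gen {s : W} (hs : s ∈ S) (hpos : 0 < L s) : c s = klOp S L s (stdT 1) :=
  hS.isKL_unique (hc.isKL s) (isKL_klOp_one hS hs hpos)

omit [Finite W] in
theorem klC_one : c 1 = stdT 1 := hS.isKL_unique (hc.isKL 1) (isKL_stdT_one hS)

omit hc [Finite W] in
theorem op_klOp {s : W} (hs : s ∈ S) (v : H W) :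
    op S L (klOp S L s v) = klOp S L s * op S L v := by
  rw [klOp, LinearMap.add_apply, LinearMap.smul_apply, map_add, map_smul, hS.op_genOp hs, add_mul,
    smul_mul_assoc, one_mul, Module.End.one_apply]

omit [Finite W] in
theorem op_klC_gen {s : W} (hs : s ∈ S) (hpos : 0 < L s) : op S L (c s) = klOp S L s := by
  rw [hc.klC_gen hS hs hpos, op_klOp hS hs, hS.op_one, mul_one]

theorem h_gen {s : W} (hs : s ∈ S) (hpos : 0 < L s) (x : W) :
    h S L s x = (hc.basis hS).repr (klOp S L s (c x)) := by
  rw [hc.h_eq hS, hc.op_klC_gen hS hs hpos]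

theorem h_one_left (x : W) : h S L 1 x = Finsupp.single x 1 := by
  rw [hc.h_eq hS, hc.klC_one hS, hS.op_one, Module.End.one_apply, hc.repr_self hS]

variable (hpos : ∀ s ∈ S, 0 < L s)
include hpos

omit hc [Finite W] hpos in
/-- A submodule that is stable under the operators of the generators is a left ideal. -/
theorem op_mem_of_klOp_mem {N : Submodule A (H W)}
    (hN : ∀ s ∈ S, ∀ u ∈ N, klOp S L s u ∈ N) (u v : H W) (hv : v ∈ N) : op S L u v ∈ N := by
  have hgen : ∀ s ∈ S, ∀ u ∈ N, genOp S L s u ∈ N := by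
    intro s hs u hu
    have := N.sub_mem (hN s hs u hu) (N.smul_mem (LaurentPolynomial.T (-(L s))) hu)
    rwa [klOp_apply, add_sub_cancel_right] at this
  induction u using H_induction with
  | zero => rw [map_zero]; exact N.zero_mem
  | add u u' hu hu' => rw [map_add]; exact N.add_mem hu hu'
  | smul a w =>
    rw [map_smul]
    refine N.smul_mem _ ?_
    rw [op_stdT]
    induction w using hS.induction_left with
    | one => rw [hS.stdOp_one]; exact hv
    | step s hs w hw ih =>
      rw [hS.stdOp_gen_mul hs hw]
      exact hgen s hs _ ih

/-- The span of the `C_z` with `z ≺_L y` is stable under the `C_s` by definition of the preorder. It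
is therefore a left ideal, and it contains every product `C_w C_y`. -/
theorem preL_of_h_ne_zero {w y z : W} (hz : h S L w y z ≠ 0) : preL S L z y := by
  let N : Submodule A (H W) :=
    (Finsupp.supported A A {z | preL S L z y}).comap (hc.basis hS).repr.toLinearMap
  have hmem : ∀ u, u ∈ N ↔ ∀ z, ¬ preL S L z y → (hc.basis hS).repr u z = 0 := by
    intro u
    rw [Submodule.mem_comap, Finsupp.mem_supported']
    rfl
  have hbase : ∀ z, preL S L z y → c z ∈ N := by
    intro z hz
    rw [hmem]
    intro z' hz'
    rw [hc.repr_self hS, Finsupp.single_eq_of_ne]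
    rintro rfl
    exact hz' hz
  have hN : ∀ s ∈ S, ∀ u ∈ N, klOp S L s u ∈ N := by
    intro s hs u hu
    rw [← (hc.basis hS).linearCombination_repr u, Finsupp.linearCombination_apply, Finsupp.sum,
      map_sum]
    refine N.sum_mem fun z hz => ?_
    rw [map_smul, hc.basis_apply hS]
    refine N.smul_mem _ ?_
    rw [← hc.op_klC_gen hS hs (hpos s hs), hc.op_eq_sum hS]
    refine N.sum_mem fun z' hz' => N.smul_mem _ (hbase z' ?_)
    refine Relation.ReflTransGen.head ⟨s, hs, Finsupp.mem_support_iff.1 hz'⟩ ?_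
    by_contra hzy
    exact Finsupp.mem_support_iff.1 hz ((hmem u).1 hu z hzy)
  have h1 := op_mem_of_klOp_mem hS hN (c w) (c y) (hbase y Relation.ReflTransGen.refl)
  by_contra hzy
  refine hz ?_
  rw [hc.h_eq hS]
  exact (hmem _).1 h1 z hzy

end IsKLFamily

end HeckeKL

end

noncomputable section

namespace HeckeKL

/-! ### Fusion matrices -/

/-- The adjacency matrix of the path with `n` vertices. -/
def pathX (R : Type*) [CommRing R] (n : ℕ) : Matrix (Fin n) (Fin n) R :=
  fun j k => if (j : ℕ) + 1 = k ∨ (k : ℕ) + 1 = j then 1 else 0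

/-- The Chebyshev polynomials in the adjacency matrix of a path. -/
def pathU (R : Type*) [CommRing R] (n : ℕ) : ℕ → Matrix (Fin n) (Fin n) R
  | 0 => 1
  | 1 => pathX R n
  | i + 2 => pathX R n * pathU R n (i + 1) - pathU R n i

section Fusion

variable {R : Type*} [CommRing R] {n : ℕ}

theorem pathX_symm (j k : Fin n) : pathX R n j k = pathX R n k j := by
  unfold pathX
  simp only [or_comm]

theorem pathU_commute_of_commute {P : Matrix (Fin n) (Fin n) R} (hP : Commute P (pathX R n)) :
    ∀ i, Commute P (pathU R n i)
  | 0 => Commute.one_right _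
  | 1 => hP
  | i + 2 => (hP.mul_right (pathU_commute_of_commute hP (i + 1))).sub_right
      (pathU_commute_of_commute hP i)

theorem pathU_commute_pathX (i : ℕ) : Commute (pathU R n i) (pathX R n) :=
  (pathU_commute_of_commute (Commute.refl _) i).symm

theorem pathU_commute (i j : ℕ) : Commute (pathU R n i) (pathU R n j) :=
  pathU_commute_of_commute (pathU_commute_pathX i) j

theorem pathU_transpose : ∀ i, (pathU R n i).transpose = pathU R n i
  | 0 => Matrix.transpose_one
  | 1 => by ext j k; exact pathX_symm k j
  | i + 2 => by
    rw [pathU, Matrix.transpose_sub, Matrix.transpose_mul, pathU_transpose i,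
      pathU_transpose (i + 1)]
    have : (pathX R n).transpose = pathX R n := by ext j k; exact pathX_symm k j
    rw [this, (pathU_commute_pathX (i + 1)).eq]

theorem pathU_symm (i : ℕ) (j k : Fin n) : pathU R n i j k = pathU R n i k j := by
  conv_lhs => rw [← pathU_transpose i]
  rfl

theorem pathX_map {R' : Type*} [CommRing R'] (f : R →+* R') :
    (pathX R n).map f = pathX R' n := by
  ext j k
  simp only [Matrix.map_apply, pathX]
  split_ifs <;> simp

theorem pathU_map {R' : Type*} [CommRing R'] (f : R →+* R') :
    ∀ i, (pathU R n i).map f = pathU R' n i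
  | 0 => by simp [pathU]
  | 1 => pathX_map f
  | i + 2 => by
    rw [pathU, pathU, Matrix.map_sub f (map_sub f), Matrix.map_mul, pathX_map, pathU_map f i,
      pathU_map f (i + 1)]

/-- The path is bipartite, and `U_i` is an even or odd polynomial in `X` according to the parity of
`i`. -/
theorem pathU_parity : ∀ (i : ℕ) (j k : Fin n), pathU R n i j k ≠ 0 → (i + j + k) % 2 = 0
  | 0, j, k => fun h => by
    have : j = k := by
      by_contra hne
      exact h (Matrix.one_apply_ne hne)
    subst this
    omega
  | 1, j, k => fun h => by
    unfold pathU pathX at h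
    split_ifs at h with h'
    · omega
    · exact absurd rfl h
  | i + 2, j, k => fun h => by
    by_contra hne
    refine h ?_
    rw [pathU, Matrix.sub_apply, Matrix.mul_apply, Finset.sum_eq_zero, zero_sub, neg_eq_zero]
    · by_contra h'
      have := pathU_parity i j k h'
      omega
    · intro l _
      by_contra h'
      have h1 := pathU_parity (i + 1) l k (right_ne_zero_of_mul h')
      have h2 := pathU_parity 1 j l (left_ne_zero_of_mul h')
      omega

variable [NeZero n]

/-- Starting at the end vertex `0`, the recursion moves along the path one vertex at a time and does
not meet the other end as long as `i < n`. All symmetries of the fusion matrices come from this. -/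
theorem pathU_zero_row : ∀ (i : ℕ), i < n → ∀ k : Fin n,
    pathU R n i 0 k = if i = (k : ℕ) then 1 else 0
  | 0 => fun _ k => by
    rw [pathU, Matrix.one_apply]
    congr 1
    simp only [Fin.ext_iff, Fin.val_zero]
  | 1 => fun _ k => by
    rw [pathU, pathX]
    congr 1
    simp only [Fin.val_zero, eq_iff_iff]
    omega
  | i + 2 => fun hi k => by
    rw [pathU, ← (pathU_commute_pathX (i + 1)).eq, Matrix.sub_apply, Matrix.mul_apply,
      pathU_zero_row i (by omega)]
    simp only [pathU_zero_row (i + 1) (by omega)]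
    rw [Finset.sum_eq_single (⟨i + 1, by omega⟩ : Fin n)]
    · simp only [if_true, one_mul, pathX]
      split_ifs <;> simp <;> omega
    · intro l _ hl
      rw [if_neg, zero_mul]
      intro h
      exact hl (Fin.ext h.symm)
    · intro h
      exact absurd (Finset.mem_univ _) h

theorem pathU_mul_zero_row (i : Fin n) (P : Matrix (Fin n) (Fin n) R) (k : Fin n) :
    (pathU R n i * P) 0 k = P i k := by
  rw [Matrix.mul_apply, Finset.sum_eq_single i]
  · rw [pathU_zero_row i i.2, if_pos rfl, one_mul]
  · intro l _ hl
    rw [pathU_zero_row i i.2, if_neg, zero_mul]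
    intro h
    exact hl (Fin.ext h.symm)
  · intro h
    exact absurd (Finset.mem_univ _) h

/-- The entry `(U_i)_{jk}` is the entry `(U_j U_i)_{0k}`, and `U_i`, `U_j` commute. Together with
the symmetry of each matrix this makes `(U_i)_{jk}` invariant under all permutations of `i`, `j`,
`k`. -/
theorem pathU_swap (i j k : Fin n) : pathU R n i j k = pathU R n j i k := by
  rw [← pathU_mul_zero_row j (pathU R n i) k, (pathU_commute _ _).eq, pathU_mul_zero_row]

theorem pathU_rotate (i j k : Fin n) : pathU R n i j k = pathU R n j k i := by
  rw [pathU_swap, pathU_symm]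

theorem pathU_zero_right (i k : Fin n) : pathU R n i 0 k = if i = k then 1 else 0 := by
  rw [pathU_zero_row i i.2]
  simp only [Fin.ext_iff]

/-- A matrix that commutes with `X` is a combination of the fusion matrices. -/
theorem eq_sum_pathU {P : Matrix (Fin n) (Fin n) R} (hP : Commute P (pathX R n)) (j k : Fin n) :
    P j k = ∑ l : Fin n, P 0 l * pathU R n l j k := by
  rw [← pathU_mul_zero_row j P k, ← (pathU_commute_of_commute hP j).eq, Matrix.mul_apply]
  exact Finset.sum_congr rfl fun l _ => by rw [pathU_swap]

end Fusion

/-! ### Degrees of Laurent polynomials -/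

/-- The degree of `p` is at most `d`. -/
def DegLE (d : ℤ) (p : A) : Prop := ∀ n : ℤ, d < n → p.coeff n = 0

theorem DegLE.mono {d e : ℤ} (h : d ≤ e) {p : A} (hp : DegLE d p) : DegLE e p :=
  fun n hn => hp n (by omega)

theorem DegLE.zero {d : ℤ} : DegLE d 0 := fun _ _ => rfl

theorem DegLE.add {d : ℤ} {p q : A} (hp : DegLE d p) (hq : DegLE d q) : DegLE d (p + q) := by
  intro n hn
  rw [AddMonoidAlgebra.coeff_add, Finsupp.add_apply, hp n hn, hq n hn, add_zero]

theorem DegLE.neg {d : ℤ} {p : A} (hp : DegLE d p) : DegLE d (-p) := by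
  intro n hn
  rw [AddMonoidAlgebra.coeff_neg, Finsupp.neg_apply, hp n hn, neg_zero]

theorem DegLE.sub {d : ℤ} {p q : A} (hp : DegLE d p) (hq : DegLE d q) : DegLE d (p - q) := by
  rw [sub_eq_add_neg]
  exact hp.add hq.neg

theorem DegLE.sum {ι : Type*} {d : ℤ} {s : Finset ι} {p : ι → A} (hp : ∀ i ∈ s, DegLE d (p i)) :
    DegLE d (∑ i ∈ s, p i) := by
  classical
  induction s using Finset.induction_on with
  | empty => exact DegLE.zero
  | insert i s hi ih =>
    rw [Finset.sum_insert hi]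
    exact (hp i (by simp)).add (ih fun j hj => hp j (by simp [hj]))

theorem DegLE.T (d : ℤ) : DegLE d (LaurentPolynomial.T d) := by
  intro n hn
  rw [LaurentPolynomial.T_apply, if_neg (by omega)]

theorem coeff_T_self (d : ℤ) : (LaurentPolynomial.T d : A).coeff d = 1 := by
  rw [LaurentPolynomial.T_apply, if_pos rfl]

theorem isNeg_iff {p : A} : IsNeg p ↔ DegLE (-1) p :=
  ⟨fun h n hn => h n (by omega), fun h n hn => h n (by omega)⟩

theorem coeff_mul_eq_sum (p q : A) (m : ℤ) :
    (p * q).coeff m = p.coeff.sum fun n a => a * q.coeff (m - n) := by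
  induction p using LaurentPolynomial.induction_on' with
  | add p p' hp hp' =>
    rw [add_mul, AddMonoidAlgebra.coeff_add, Finsupp.add_apply, hp, hp', AddMonoidAlgebra.coeff_add,
      Finsupp.sum_add_index']
    · simp
    · intro n a b
      ring
  | C_mul_T n a =>
    rw [← LaurentPolynomial.single_eq_C_mul_T, AddMonoidAlgebra.coeff_single,
      Finsupp.sum_single_index (by simp)]
    have := AddMonoidAlgebra.coeff_single_mul_apply q a n m
    rw [this, neg_add_eq_sub]

theorem DegLE.mul {d e : ℤ} {p q : A} (hp : DegLE d p) (hq : DegLE e q) :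
    DegLE (d + e) (p * q) := by
  intro n hn
  rw [coeff_mul_eq_sum]
  refine Finset.sum_eq_zero fun m _ => ?_
  by_cases hm : d < m
  · simp [hp m hm]
  · simp [hq (n - m) (by omega)]

theorem coeff_mul_of_degLE {d e : ℤ} {p q : A} (hp : DegLE d p) (hq : DegLE e q) :
    (p * q).coeff (d + e) = p.coeff d * q.coeff e := by
  rw [coeff_mul_eq_sum, Finsupp.sum, Finset.sum_eq_single d]
  · rw [add_sub_cancel_left]
  · intro m _ hm
    rcases lt_or_gt_of_ne hm with h | h
    · simp [hq (d + e - m) (by omega)]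
    · simp [hp m h]
  · intro h
    rw [Finsupp.notMem_support_iff.1 h, zero_mul]

theorem intCast_eq_C (a : ℤ) : (a : A) = LaurentPolynomial.C a :=
  (map_intCast (LaurentPolynomial.C : ℤ →+* A) a).symm

theorem coeff_intCast_apply (a n : ℤ) : (a : A).coeff n = if n = 0 then a else 0 := by
  rw [intCast_eq_C, LaurentPolynomial.C_apply]

theorem DegLE.intCast {d : ℤ} (hd : 0 ≤ d) (a : ℤ) : DegLE d (a : A) := by
  intro n hn
  rw [coeff_intCast_apply, if_neg (by omega)]

theorem coeff_mul_intCast (p : A) (a n : ℤ) : (p * (a : A)).coeff n = p.coeff n * a := by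
  rw [mul_comm, intCast_eq_C, ← LaurentPolynomial.smul_eq_C_mul, AddMonoidAlgebra.coeff_smul_apply,
    smul_eq_mul, mul_comm]

theorem DegLE.mul_intCast {d : ℤ} {p : A} (hp : DegLE d p) (a : ℤ) : DegLE d (p * (a : A)) := by
  intro n hn
  rw [coeff_mul_intCast, hp n hn, zero_mul]

theorem DegLE.one {d : ℤ} (hd : 0 ≤ d) : DegLE d 1 := by
  simpa using DegLE.intCast hd 1

end HeckeKL

end

noncomputable section

namespace HeckeKL

variable {W : Type*} [Group W] {S : Set W} {L : W → ℤ}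

/-! ### A cell decomposition with one cell of fusion type -/

/-- A description of the cells and of the structure constants of a Hecke algebra in which one
two-sided cell consists of elements `el ε i δ`, with structure constants given by fusion matrices,
and all other two-sided cells have one element. -/
structure CellDatum (S : Set W) (L : W → ℤ) (n : ℕ) [NeZero n] where
  av : W → ℕ
  b : ℕ
  V : Bool → Fin n → Bool → Prop
  el : Bool → Fin n → Bool → W
  sgn : W → ℤ
  F : W → Bool → Bool → Matrix (Fin n) (Fin n) A
  V_zero : ∀ ε, V ε 0 ε
  V_swap : ∀ ε i δ, V ε i δ → V δ i ε
  V_connected : ∃ i, V false i true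
  el_inv : ∀ ε i δ, V ε i δ → (el ε i δ)⁻¹ = el δ i ε
  el_inj : ∀ ε i δ ε' i' δ', V ε i δ → V ε' i' δ' → el ε i δ = el ε' i' δ' →
    ε = ε' ∧ i = i' ∧ δ = δ'
  av_el : ∀ ε i δ, V ε i δ → av (el ε i δ) = b
  av_inj : ∀ w w', av w = av w' → w = w' ∨
    (∃ ε i δ, V ε i δ ∧ w = el ε i δ) ∧ ∃ ε i δ, V ε i δ ∧ w' = el ε i δ
  sgn_eq : ∀ w, sgn w = 1 ∨ sgn w = -1
  inv_single : ∀ w, (¬ ∃ ε i δ, V ε i δ ∧ w = el ε i δ) → w⁻¹ = w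
  mono : ∀ s ∈ S, ∀ x z, h S L s x z ≠ 0 → av x ≤ av z
  h_el : ∀ w ε i δ ε' k δ', V ε i δ → V ε' k δ' →
    h S L w (el ε i δ) (el ε' k δ') = if δ = δ' then F w ε ε' i k else 0
  F_comm : ∀ w ε ε', Commute (F w ε ε') (pathX A n)
  F_V : ∀ w ε i δ ε' k, V ε i δ → F w ε ε' i k ≠ 0 → V ε' k δ
  F_deg : ∀ w ε ε' i k, DegLE b (F w ε ε' i k)
  F_lead : ∀ ε₁ l ε₂ ε ε' i k, V ε₁ l ε₂ → (F (el ε₁ l ε₂) ε ε' i k).coeff b =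
    if ε₁ = ε' ∧ ε₂ = ε then pathU ℤ n l i k else 0
  F_lead_single : ∀ w ε ε' i k, (¬ ∃ ε i δ, V ε i δ ∧ w = el ε i δ) →
    (F w ε ε' i k).coeff b = 0
  h_single_el : ∀ x y ε k δ, (¬ ∃ ε i δ, V ε i δ ∧ x = el ε i δ) →
    (¬ ∃ ε i δ, V ε i δ ∧ y = el ε i δ) → V ε k δ → h S L x y (el ε k δ) = 0
  h_single_deg : ∀ x y z, (¬ ∃ ε i δ, V ε i δ ∧ z = el ε i δ) → DegLE (av z) (h S L x y z)
  h_single_lead : ∀ z, (¬ ∃ ε i δ, V ε i δ ∧ z = el ε i δ) → (h S L z z z).coeff (av z) = sgn z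
  h_single_lead_ne : ∀ x y z, (¬ ∃ ε i δ, V ε i δ ∧ z = el ε i δ) → ¬ (x = z ∧ y = z) →
    (h S L x y z).coeff (av z) = 0
  le_Del : ∀ z, (av z : ℤ) ≤ Del S L z
  eq_Del : ∀ z, (av z : ℤ) = Del S L z ↔
    (¬ ∃ ε i δ, V ε i δ ∧ z = el ε i δ) ∨ ∃ ε, z = el ε 0 ε
  lead_single : ∀ z, (¬ ∃ ε i δ, V ε i δ ∧ z = el ε i δ) → lead S L z = sgn z
  lead_el : ∀ ε, lead S L (el ε 0 ε) = 1

theorem aFun_eq_of_degLE {z : W} {m : ℕ} (h1 : ∀ x y, DegLE m (h S L x y z)) {x y : W}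
    (h2 : (h S L x y z).coeff (m : ℤ) ≠ 0) : aFun S L z = m := by
  apply le_antisymm
  · refine iSup_le fun x => iSup_le fun y => iSup_le fun k => iSup_le fun hk => ?_
    by_contra hlt
    rw [not_le, Nat.cast_lt] at hlt
    exact hk (h1 x y k (by exact_mod_cast hlt))
  · exact le_iSup_of_le x (le_iSup_of_le y (le_iSup_of_le m (le_iSup_of_le h2 le_rfl)))

/-- Used in P15 to pass from sums over `W` to sums over the vertices of the path: the nonzero terms
come from the elements of the cell with prescribed first and last letters. -/
theorem sum_eq_sum_of_embedding {α ι M : Type*} [AddCommMonoid M] [Fintype α] [Fintype ι]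
    {f : α → M} {g : ι → M} (V : ι → Prop) (e : ι → α)
    (he : ∀ i j, V i → V j → e i = e j → i = j) (hf : ∀ z, f z ≠ 0 → ∃ k, V k ∧ z = e k)
    (hg : ∀ k, g k ≠ 0 → V k) (hfg : ∀ k, V k → f (e k) = g k) : ∑ z, f z = ∑ k, g k := by
  symm
  refine Finset.sum_bij_ne_zero (fun k _ _ => e k) (fun _ _ _ => Finset.mem_univ _) ?_ ?_ ?_
  · intro i _ hi j _ hj hij
    exact he i j (hg i hi) (hg j hj) hij
  · intro z _ hz
    obtain ⟨k, hk, rfl⟩ := hf z hz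
    exact ⟨k, Finset.mem_univ _, by rwa [← hfg k hk], rfl⟩
  · intro k _ hk
    exact (hfg k (hg k hk)).symm

/-- With `P = ∑ p_l U_l` and `Q = ∑ q_m U_m`, where the `U_l` have integer entries, both sides equal
the sum of the `(U_l U_m)_{ij} • p_l ⊗ q_m`, because `U_l` and `U_m` commute. This is P15 on the
fusion cell. -/
theorem sum_tmul_of_commute {n : ℕ} [NeZero n] {P Q : Matrix (Fin n) (Fin n) A}
    (hP : Commute P (pathX A n)) (hQ : Commute Q (pathX A n)) (i j : Fin n) :
    ∑ k, (P i k ⊗ₜ[ℤ] Q k j : A ⊗[ℤ] A) = ∑ k, P k j ⊗ₜ[ℤ] Q i k := by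
  have e : ∀ {P : Matrix (Fin n) (Fin n) A}, Commute P (pathX A n) → ∀ i k,
      P i k = ∑ l : Fin n, pathU ℤ n l i k • P 0 l := by
    intro P hP i k
    rw [eq_sum_pathU hP]
    refine Finset.sum_congr rfl fun l _ => ?_
    rw [← pathU_map (Int.castRingHom A), Matrix.map_apply, zsmul_eq_mul, mul_comm]
    rfl
  have e1 : ∀ a b c d : Fin n, (P a b ⊗ₜ[ℤ] Q c d : A ⊗[ℤ] A) =
      ∑ l : Fin n, ∑ m : Fin n, (pathU ℤ n l a b * pathU ℤ n m c d) •
        (P 0 l ⊗ₜ[ℤ] Q 0 m : A ⊗[ℤ] A) := by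
    intro a b c d
    rw [e hP, e hQ, TensorProduct.sum_tmul]
    refine Finset.sum_congr rfl fun l _ => ?_
    rw [TensorProduct.tmul_sum]
    refine Finset.sum_congr rfl fun m _ => ?_
    rw [TensorProduct.tmul_smul, ← TensorProduct.smul_tmul', smul_smul, mul_comm]
  rw [Finset.sum_congr rfl fun k _ => e1 i k k j, Finset.sum_congr rfl fun k _ => e1 k j i k,
    Finset.sum_comm]
  conv_rhs => rw [Finset.sum_comm]
  refine Finset.sum_congr rfl fun l _ => ?_
  rw [Finset.sum_comm]
  conv_rhs => rw [Finset.sum_comm]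
  refine Finset.sum_congr rfl fun m _ => ?_
  rw [← Finset.sum_smul, ← Finset.sum_smul]
  congr 1
  have := congrFun (congrFun (pathU_commute (R := ℤ) (n := n) l m).eq i) j
  rw [Matrix.mul_apply, Matrix.mul_apply] at this
  rw [this]
  exact Finset.sum_congr rfl fun k _ => mul_comm _ _

namespace CellDatum

variable {n : ℕ} [NeZero n] (D : CellDatum S L n)

/-- The elements of the cell of fusion type. -/
def Big (w : W) : Prop := ∃ ε i δ, D.V ε i δ ∧ w = D.el ε i δ

theorem big_el {ε i δ} (hv : D.V ε i δ) : D.Big (D.el ε i δ) := ⟨ε, i, δ, hv, rfl⟩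

theorem big_inv {w : W} (hw : D.Big w) : D.Big w⁻¹ := by
  obtain ⟨ε, i, δ, hv, rfl⟩ := hw
  rw [D.el_inv _ _ _ hv]
  exact D.big_el (D.V_swap _ _ _ hv)

theorem big_inv_iff {w : W} : D.Big w⁻¹ ↔ D.Big w :=
  ⟨fun h => by simpa using D.big_inv h, D.big_inv⟩

theorem av_inv (w : W) : D.av w⁻¹ = D.av w := by
  by_cases hw : D.Big w
  · obtain ⟨ε, i, δ, hv, rfl⟩ := hw
    rw [D.el_inv _ _ _ hv, D.av_el _ _ _ hv, D.av_el _ _ _ (D.V_swap _ _ _ hv)]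
  · rw [D.inv_single w hw]

theorem av_eq_b_iff {w : W} : D.av w = D.b ↔ D.Big w := by
  constructor
  · intro hw
    rcases D.av_inj w (D.el false 0 false) (by rw [hw, D.av_el _ _ _ (D.V_zero _)]) with h | h
    · rw [h]
      exact D.big_el (D.V_zero _)
    · exact h.1
  · rintro ⟨ε, i, δ, hv, rfl⟩
    exact D.av_el _ _ _ hv

/-! ### The a-function and the numbers γ of a cell datum -/

variable {c : W → H W} [Finite W] (hS : IsHeckeSystem S L) (hc : IsKLFamily S L c)
  (hpos : ∀ s ∈ S, 0 < L s)
include hS hc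

section

include hpos

omit [Finite W] hS hc hpos in
theorem preL_mono {x z : W} (hz : preL S L z x) : D.av x ≤ D.av z := by
  induction hz using Relation.ReflTransGen.head_induction_on with
  | refl => exact le_rfl
  | head hab _ ih =>
    obtain ⟨s, hs, h⟩ := hab
    exact ih.trans (D.mono s hs _ _ h)

theorem h_mono {w x z : W} (hz : h S L w x z ≠ 0) : D.av x ≤ D.av z :=
  D.preL_mono (hc.preL_of_h_ne_zero hS hpos hz)

theorem h_mono_right {w x z : W} (hz : h S L x w z ≠ 0) : D.av x ≤ D.av z := by
  rw [hc.h_flip hS] at hz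
  simpa only [D.av_inv] using D.h_mono hS hc hpos hz

end

theorem h_el_right {w : W} {ε i δ ε' k δ'} (hv : D.V ε i δ) (hv' : D.V ε' k δ') :
    h S L (D.el ε i δ) w (D.el ε' k δ') = if ε = ε' then D.F w⁻¹ δ δ' i k else 0 := by
  rw [hc.h_flip hS, D.el_inv _ _ _ hv, D.el_inv _ _ _ hv',
    D.h_el _ _ _ _ _ _ _ (D.V_swap _ _ _ hv) (D.V_swap _ _ _ hv')]

theorem degLE_h (x y z : W) : DegLE (D.av z) (h S L x y z) := by
  by_cases hz : D.Big z
  · obtain ⟨ε, k, δ, hv, rfl⟩ := hz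
    rw [D.av_el _ _ _ hv]
    by_cases hy : D.Big y
    · obtain ⟨ε', j, δ', hv', rfl⟩ := hy
      rw [D.h_el _ _ _ _ _ _ _ hv' hv]
      split_ifs
      exacts [D.F_deg _ _ _ _ _, DegLE.zero]
    · by_cases hx : D.Big x
      · obtain ⟨ε', j, δ', hv', rfl⟩ := hx
        rw [D.h_el_right hS hc hv' hv]
        split_ifs
        exacts [D.F_deg _ _ _ _ _, DegLE.zero]
      · rw [D.h_single_el _ _ _ _ _ hx hy hv]
        exact DegLE.zero
  · exact D.h_single_deg _ _ _ hz

omit hS hc [Finite W] in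
theorem coeff_h_el {ε i ε' j δ k} (h1 : D.V ε i ε') (h2 : D.V ε' j δ) (h3 : D.V ε k δ) :
    (h S L (D.el ε i ε') (D.el ε' j δ) (D.el ε k δ)).coeff D.b = pathU ℤ n i j k := by
  rw [D.h_el _ _ _ _ _ _ _ h2 h3, if_pos rfl, D.F_lead _ _ _ _ _ _ _ h1, if_pos ⟨rfl, rfl⟩]

/-- The degree `b` is attained on the fusion cell only by products of two elements of the cell whose
adjacent letters agree. A factor outside the cell always acts with smaller degree, from the left by
`F_lead_single` and from the right by inversion. -/
theorem exists_of_coeff_h_el_ne_zero {x y : W} {ε k δ} (hv : D.V ε k δ)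
    (hne : (h S L x y (D.el ε k δ)).coeff D.b ≠ 0) :
    ∃ i j ε', D.V ε i ε' ∧ D.V ε' j δ ∧ x = D.el ε i ε' ∧ y = D.el ε' j δ := by
  by_cases hy : D.Big y
  · obtain ⟨ε', j, δ', hv', rfl⟩ := hy
    rw [D.h_el _ _ _ _ _ _ _ hv' hv] at hne
    split_ifs at hne with hδ
    · subst hδ
      by_cases hx : D.Big x
      · obtain ⟨ε₁, i, ε₂, hv₁, rfl⟩ := hx
        rw [D.F_lead _ _ _ _ _ _ _ hv₁] at hne
        split_ifs at hne with he
        · obtain ⟨rfl, rfl⟩ := he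
          exact ⟨i, j, _, hv₁, hv', rfl, rfl⟩
        · exact absurd rfl hne
      · exact absurd (D.F_lead_single _ _ _ _ _ hx) hne
    · exact absurd rfl hne
  · by_cases hx : D.Big x
    · obtain ⟨ε', j, δ', hv', rfl⟩ := hx
      rw [D.h_el_right hS hc hv' hv] at hne
      split_ifs at hne
      · exact absurd (D.F_lead_single _ _ _ _ _ (fun h' => hy (D.big_inv_iff.1 h'))) hne
      · exact absurd rfl hne
    · rw [D.h_single_el _ _ _ _ _ hx hy hv] at hne
      exact absurd rfl hne

theorem aFun_eq (z : W) : aFun S L z = D.av z := by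
  have key : ∃ x y, (h S L x y z).coeff (D.av z : ℤ) ≠ 0 := by
    by_cases hz : D.Big z
    · obtain ⟨ε, k, δ, hv, rfl⟩ := hz
      -- In top degree the element with vertex `0` is a right unit: `(U_k)_{0k} = 1`.
      refine ⟨D.el ε k δ, D.el δ 0 δ, ?_⟩
      rw [D.av_el _ _ _ hv, D.coeff_h_el hv (D.V_zero _) hv, pathU_zero_right, if_pos rfl]
      exact one_ne_zero
    · refine ⟨z, z, ?_⟩
      rw [D.h_single_lead _ hz]
      rcases D.sgn_eq z with h | h <;> rw [h] <;> decide
  obtain ⟨x, y, hxy⟩ := key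
  exact aFun_eq_of_degLE (fun x y => D.degLE_h hS hc x y z) hxy

theorem hasA (z : W) : HasA S L z (D.av z) := ⟨D.av z, D.aFun_eq hS hc z, rfl⟩

theorem hasA_iff {z : W} {m : ℤ} : HasA S L z m ↔ (D.av z : ℤ) = m := by
  constructor
  · rintro ⟨k, hk, rfl⟩
    rw [D.aFun_eq hS hc, Nat.cast_inj] at hk
    rw [hk]
  · rintro rfl
    exact D.hasA hS hc z

theorem gam_eq (x y z : W) : gam S L x y z = (h S L x y z⁻¹).coeff (D.av z : ℤ) := by
  rw [gam, D.aFun_eq hS hc, ENat.toNat_natCast, D.av_inv]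

theorem gam_single {z : W} (hz : ¬ D.Big z) : gam S L z z z = D.sgn z := by
  rw [D.gam_eq hS hc, D.inv_single z hz, D.h_single_lead z hz]

theorem gam_el {ε i δ j η k} (h1 : D.V ε i δ) (h2 : D.V δ j η) (h3 : D.V η k ε) :
    gam S L (D.el ε i δ) (D.el δ j η) (D.el η k ε) = pathU ℤ n i j k := by
  rw [D.gam_eq hS hc, D.el_inv _ _ _ h3, D.av_el _ _ _ h3,
    D.coeff_h_el h1 h2 (D.V_swap _ _ _ h3)]

/-- This list of the nonvanishing `γ` is what P2, P3, P5, P7, P8 and P13 rest on. -/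
theorem gam_ne_zero {x y z : W} (hne : gam S L x y z ≠ 0) :
    (¬ D.Big z ∧ x = z ∧ y = z) ∨ ∃ ε i δ j η k, D.V ε i δ ∧ D.V δ j η ∧ D.V η k ε ∧
      x = D.el ε i δ ∧ y = D.el δ j η ∧ z = D.el η k ε := by
  rw [D.gam_eq hS hc] at hne
  by_cases hz : D.Big z
  · obtain ⟨η, k, ε, hv, rfl⟩ := hz
    rw [D.el_inv _ _ _ hv, D.av_el _ _ _ hv] at hne
    obtain ⟨i, j, δ, h1, h2, rfl, rfl⟩ :=
      D.exists_of_coeff_h_el_ne_zero hS hc (D.V_swap _ _ _ hv) hne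
    exact Or.inr ⟨ε, i, δ, j, η, k, h1, h2, hv, rfl, rfl, rfl⟩
  · rw [D.inv_single z hz] at hne
    by_contra hcon
    exact hne (D.h_single_lead_ne _ _ _ hz fun hxy => hcon (Or.inl ⟨hz, hxy⟩))

include D in
theorem gam_rotate (x y z : W) : gam S L x y z = gam S L y z x := by
  have key : ∀ x y z : W, gam S L x y z ≠ 0 → gam S L x y z = gam S L y z x := by
    intro x y z hne
    rcases D.gam_ne_zero hS hc hne with ⟨_, rfl, rfl⟩ | ⟨ε, i, δ, j, η, k, h1, h2, h3, rfl, rfl, rfl⟩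
    · rfl
    · rw [D.gam_el hS hc h1 h2 h3, D.gam_el hS hc h2 h3 h1, pathU_rotate]
  -- If only the rotated number is nonzero, rotating it two more times returns to the original one.
  by_cases h1 : gam S L x y z = 0
  · by_cases h2 : gam S L y z x = 0
    · rw [h1, h2]
    · have h3 := key _ _ _ h2
      rw [h3] at h2
      have h4 := key _ _ _ h2
      rw [h3, h4]
  · exact key _ _ _ h1

theorem mem_setD {z : W} : z ∈ setD S L ↔ ¬ D.Big z ∨ ∃ ε, z = D.el ε 0 ε := by
  rw [setD, Set.mem_ofPred_eq, D.hasA_iff hS hc, D.eq_Del]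
  rfl

/-! #### Cells -/

include hpos

theorem preL_of_simple {x y : W} {w : W} (hne : (h S L w y x).coeff (D.av x : ℤ) ≠ 0) :
    preL S L x y :=
  hc.preL_of_h_ne_zero hS hpos (w := w) fun h0 => hne (by rw [h0]; rfl)

/-- Both relations are witnessed by a leading coefficient: `el ε i δ` occurs in its product with `el
δ 0 δ`, and `el δ 0 δ` occurs in the product of `(el ε i δ)⁻¹ = el δ i ε` with `el ε i δ`. -/
theorem simL_el_zero {ε i δ} (hv : D.V ε i δ) : simL S L (D.el ε i δ) (D.el δ 0 δ) := by
  constructor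
  · refine D.preL_of_simple hS hc hpos (w := D.el ε i δ) ?_
    rw [D.av_el _ _ _ hv, D.coeff_h_el hv (D.V_zero _) hv, pathU_zero_right, if_pos rfl]
    exact one_ne_zero
  · refine D.preL_of_simple hS hc hpos (w := D.el δ i ε) ?_
    rw [D.av_el _ _ _ (D.V_zero _), D.coeff_h_el (D.V_swap _ _ _ hv) hv (D.V_zero _), pathU_symm,
      pathU_zero_right, if_pos rfl]
    exact one_ne_zero

omit [Finite W] hS hc hpos in
theorem simL_trans {x y z : W} (h1 : simL S L x y) (h2 : simL S L y z) : simL S L x z :=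
  ⟨h1.1.trans h2.1, h2.2.trans h1.2⟩

theorem simL_el {ε i ε' i' δ} (h1 : D.V ε i δ) (h2 : D.V ε' i' δ) :
    simL S L (D.el ε i δ) (D.el ε' i' δ) :=
  simL_trans (D.simL_el_zero hS hc hpos h1) (D.simL_el_zero hS hc hpos h2).symm

-- `av` is monotone along a chain for `≺_L`, so equal end values force it to be constant. Each step
-- then either is trivial or stays inside the fusion cell, where left multiplication preserves the
-- last letter `δ`.
omit [Finite W] hS hc hpos in
theorem preL_eq_or {x w : W} (hx : preL S L x w) (ha : D.av x = D.av w) :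
    x = w ∨ ∃ ε i δ ε' i', D.V ε i δ ∧ D.V ε' i' δ ∧ x = D.el ε i δ ∧ w = D.el ε' i' δ := by
  induction hx using Relation.ReflTransGen.head_induction_on with
  | refl => exact Or.inl rfl
  | @head a d had hdw ih =>
    obtain ⟨s, hs, hne⟩ := had
    have h1 := D.mono s hs _ _ hne
    have h2 := D.preL_mono hdw
    have h3 : D.av a = D.av d := by omega
    have ih := ih (by omega)
    rcases D.av_inj a d h3 with rfl | ⟨⟨ε, i, δ, hv, rfl⟩, ⟨ε', i', δ', hv', rfl⟩⟩
    · exact ih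
    · rw [D.h_el _ _ _ _ _ _ _ hv' hv] at hne
      split_ifs at hne with hδ
      · subst hδ
        right
        rcases ih with rfl | ⟨ε₁, i₁, δ₁, ε₂, i₂, hv₁, hv₂, he, rfl⟩
        · exact ⟨_, _, _, _, _, hv, hv', rfl, rfl⟩
        · obtain ⟨rfl, rfl, rfl⟩ := D.el_inj _ _ _ _ _ _ hv' hv₁ he
          exact ⟨_, _, _, _, _, hv, hv₂, rfl, rfl⟩
      · exact absurd rfl hne

theorem simL_of_preL {x w : W} (hx : preL S L x w) (ha : D.av x = D.av w) : simL S L x w := by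
  rcases D.preL_eq_or hx ha with rfl | ⟨ε, i, δ, ε', i', hv, hv', rfl, rfl⟩
  · exact ⟨Relation.ReflTransGen.refl, Relation.ReflTransGen.refl⟩
  · exact D.simL_el hS hc hpos hv hv'

omit [Finite W] hS hc hpos in
theorem av_eq_of_simL {x w : W} (hx : simL S L x w) : D.av x = D.av w :=
  le_antisymm (D.preL_mono hx.2) (D.preL_mono hx.1)

omit hpos in
theorem preL_inv {x w : W} (hx : preR S L x w) : preL S L x⁻¹ w⁻¹ := by
  induction hx using Relation.ReflTransGen.head_induction_on with
  | refl => exact Relation.ReflTransGen.refl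
  | head hab _ ih =>
    obtain ⟨s, hs, hne⟩ := hab
    rw [hc.h_flip hS, hS.inv_mem hs] at hne
    exact Relation.ReflTransGen.head ⟨s, hs, hne⟩ ih

omit hpos in
theorem preR_inv {x w : W} (hx : preL S L x w) : preR S L x⁻¹ w⁻¹ := by
  induction hx using Relation.ReflTransGen.head_induction_on with
  | refl => exact Relation.ReflTransGen.refl
  | head hab _ ih =>
    obtain ⟨s, hs, hne⟩ := hab
    rw [hc.h_flip hS, hS.inv_mem hs] at hne
    exact Relation.ReflTransGen.head ⟨s, hs, hne⟩ ih

omit hpos in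
theorem preR_iff {x w : W} : preR S L x w ↔ preL S L x⁻¹ w⁻¹ :=
  ⟨preL_inv hS hc, fun hx => by simpa using preR_inv hS hc hx⟩

omit hpos in
theorem simR_iff {x w : W} : simR S L x w ↔ simL S L x⁻¹ w⁻¹ := by
  rw [simR, simL, preR_iff hS hc,
    preR_iff hS hc]

theorem simR_of_preR {x w : W} (hx : preR S L x w) (ha : D.av x = D.av w) : simR S L x w := by
  rw [simR_iff hS hc]
  refine D.simL_of_preL hS hc hpos (preL_inv hS hc hx) ?_
  rw [D.av_inv, D.av_inv, ha]

theorem preLR_mono {x z : W} (hz : preLR S L z x) : D.av x ≤ D.av z := by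
  induction hz using Relation.ReflTransGen.head_induction_on with
  | refl => exact le_rfl
  | head hab _ ih =>
    obtain ⟨s, hs, h | h⟩ := hab
    · exact ih.trans (D.mono s hs _ _ h)
    · exact ih.trans (D.h_mono_right hS hc hpos h)

omit [Finite W] hS hc hpos in
theorem simLR_of_simL {x w : W} (hx : simL S L x w) : simLR S L x w :=
  ⟨Relation.ReflTransGen.lift id (fun _ _ ⟨s, hs, h⟩ => ⟨s, hs, Or.inl h⟩) _ _ hx.1,
    Relation.ReflTransGen.lift id (fun _ _ ⟨s, hs, h⟩ => ⟨s, hs, Or.inl h⟩) _ _ hx.2⟩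

omit [Finite W] hS hc hpos in
theorem simLR_of_simR {x w : W} (hx : simR S L x w) : simLR S L x w :=
  ⟨Relation.ReflTransGen.lift id (fun _ _ ⟨s, hs, h⟩ => ⟨s, hs, Or.inr h⟩) _ _ hx.1,
    Relation.ReflTransGen.lift id (fun _ _ ⟨s, hs, h⟩ => ⟨s, hs, Or.inr h⟩) _ _ hx.2⟩

omit [Finite W] hS hc hpos in
theorem simLR_trans {x y z : W} (h1 : simLR S L x y) (h2 : simLR S L y z) : simLR S L x z :=
  ⟨h1.1.trans h2.1, h2.2.trans h1.2⟩

/-- An element `el false i true` lies in the right cell of `el false 0 false` and in the left cell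
of `el true 0 true`. Its existence is the assumption `V_connected`. -/
theorem simLR_zero (ε δ : Bool) : simLR S L (D.el ε 0 ε) (D.el δ 0 δ) := by
  have key : simLR S L (D.el false 0 false) (D.el true 0 true) := by
    obtain ⟨i, hi⟩ := D.V_connected
    refine simLR_trans (y := D.el false i true) (simLR_of_simR ?_)
      (simLR_of_simL (D.simL_el_zero hS hc hpos hi))
    rw [simR_iff hS hc, D.el_inv _ _ _ (D.V_zero _), D.el_inv _ _ _ hi]
    exact D.simL_el hS hc hpos (D.V_zero _) (D.V_swap _ _ _ hi)
  have hrefl : ∀ x : W, simLR S L x x :=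
    fun x => ⟨Relation.ReflTransGen.refl, Relation.ReflTransGen.refl⟩
  cases ε <;> cases δ
  exacts [hrefl _, key, key.symm, hrefl _]

/-- The fusion cell is connected through its elements at vertex `0`, and `av` separates all other
elements, so the two-sided cells are the fibres of `av`. -/
theorem simLR_iff {x w : W} : simLR S L x w ↔ D.av x = D.av w := by
  constructor
  · intro hx
    exact le_antisymm (D.preLR_mono hS hc hpos hx.2) (D.preLR_mono hS hc hpos hx.1)
  · intro ha
    rcases D.av_inj x w ha with rfl | ⟨⟨ε, i, δ, hv, rfl⟩, ⟨ε', i', δ', hv', rfl⟩⟩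
    · exact ⟨Relation.ReflTransGen.refl, Relation.ReflTransGen.refl⟩
    · exact simLR_trans (simLR_of_simL (D.simL_el_zero hS hc hpos hv))
        (simLR_trans (D.simLR_zero hS hc hpos _ _)
          (simLR_of_simL (D.simL_el_zero hS hc hpos hv').symm))

end CellDatum

namespace CellDatum

variable {n : ℕ} [NeZero n] (D : CellDatum S L n) {c : W → H W} [Finite W]
  (hS : IsHeckeSystem S L) (hc : IsKLFamily S L c) (hpos : ∀ s ∈ S, 0 < L s)
include D hS hc

/-! #### Lusztig's conjectures -/

theorem mem_WGe {w : W} {N : ℕ} : w ∈ WGe S L N ↔ N ≤ D.av w := by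
  rw [WGe, Set.mem_ofPred_eq, D.aFun_eq hS hc, Nat.cast_le]

theorem mem_WEq {w : W} {N : ℕ} : w ∈ WEq S L N ↔ D.av w = N := by
  have h := D.mem_WGe hS hc (w := w) (N := N + 1)
  rw [WEq, Set.mem_sdiff, D.mem_WGe hS hc, h]
  omega

/-- An element of `𝒟` in the fusion cell sits at vertex `0`. There `(U_i)_{j0}` is `1` or `0`
according to whether `i = j`, and `i = j` says that the two factors are inverse to each other. -/
theorem gam_setD_eq {z x y : W} (hz : z ∈ setD S L) (hne : gam S L x y z ≠ 0) :
    x = y⁻¹ ∧ gam S L x y z = lead S L z ∧ (lead S L z = 1 ∨ lead S L z = -1) := by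
  rcases D.gam_ne_zero hS hc hne with ⟨hb, rfl, rfl⟩ | ⟨ε, i, δ, j, η, k, h1, h2, h3, rfl, rfl, rfl⟩
  · rw [D.gam_single hS hc hb, D.lead_single _ hb, D.inv_single _ hb]
    exact ⟨rfl, rfl, D.sgn_eq _⟩
  · rcases (D.mem_setD hS hc).1 hz with hb | ⟨ε', he⟩
    · exact absurd (D.big_el h3) hb
    · obtain ⟨rfl, rfl, rfl⟩ := D.el_inj _ _ _ _ _ _ h3 (D.V_zero _) he
      rw [D.gam_el hS hc h1 h2 h3, pathU_symm, pathU_zero_right] at hne ⊢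
      split_ifs at hne ⊢ with hij
      · subst hij
        exact ⟨(D.el_inv _ _ _ h2).symm, (D.lead_el _).symm, Or.inl (D.lead_el _)⟩
      · exact absurd rfl hne

theorem mem_setD_single {z : W} (hz : ¬ D.Big z) : z ∈ setD S L :=
  (D.mem_setD hS hc).2 (Or.inl hz)

theorem mem_setD_el (ε : Bool) : D.el ε 0 ε ∈ setD S L :=
  (D.mem_setD hS hc).2 (Or.inr ⟨ε, rfl⟩)

theorem gam_el_zero {ε i δ} (hv : D.V ε i δ) :
    gam S L (D.el ε i δ)⁻¹ (D.el ε i δ) (D.el δ 0 δ) = 1 := by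
  rw [D.el_inv _ _ _ hv, D.gam_el hS hc (D.V_swap _ _ _ hv) hv (D.V_zero _), pathU_symm,
    pathU_zero_right, if_pos rfl]

theorem existsUnique_gam (y : W) : ∃! z, z ∈ setD S L ∧ gam S L y⁻¹ y z ≠ 0 := by
  by_cases hy : D.Big y
  · obtain ⟨ε, i, δ, hv, rfl⟩ := hy
    refine ⟨D.el δ 0 δ, ⟨D.mem_setD_el hS hc δ, ?_⟩, ?_⟩
    · rw [D.gam_el_zero hS hc hv]
      exact one_ne_zero
    · rintro z ⟨hz, hne⟩
      rcases D.gam_ne_zero hS hc hne with ⟨hb, _, rfl⟩ |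
        ⟨ε', i', δ', j, η, k, h1, h2, h3, hx, hy, rfl⟩
      · exact absurd (D.big_el hv) hb
      · rcases (D.mem_setD hS hc).1 hz with hb | ⟨ε'', he⟩
        · exact absurd (D.big_el h3) hb
        · obtain ⟨rfl, rfl, rfl⟩ := D.el_inj _ _ _ _ _ _ h3 (D.V_zero _) he
          obtain ⟨rfl, rfl, rfl⟩ := D.el_inj _ _ _ _ _ _ hv h2 hy
          rfl
  · refine ⟨y, ⟨D.mem_setD_single hS hc hy, ?_⟩, ?_⟩
    · rw [D.inv_single y hy, D.gam_single hS hc hy]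
      rcases D.sgn_eq y with h | h <;> rw [h] <;> decide
    · rintro z ⟨hz, hne⟩
      rcases D.gam_ne_zero hS hc hne with ⟨hb, _, rfl⟩ |
        ⟨ε', i', δ', j, η, k, h1, h2, h3, hx, rfl, rfl⟩
      · rfl
      · exact absurd (D.big_el h2) hy

include hpos

/-- A nonzero term on either side has `av x ≤ av z ≤ av y`, so `z` lies in the two-sided cell of `x`
and `y`. For a singleton cell both sides reduce to the same term. For the fusion cell left factors
act by matrices `F w`, right factors by matrices `F w'⁻¹`, and `sum_tmul_of_commute` applies. -/
theorem sum_tmul_eq (w w' x y : W) (ha : D.av x = D.av y) :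
    ((h S L w x).sum fun z p => p ⊗ₜ[ℤ] h S L z w' y : A ⊗[ℤ] A) =
      (h S L x w').sum fun z p => h S L w z y ⊗ₜ[ℤ] p := by
  have := Fintype.ofFinite W
  rw [Finsupp.sum_fintype (h S L w x) (fun z p => (p ⊗ₜ[ℤ] h S L z w' y : A ⊗[ℤ] A))
      fun z => TensorProduct.zero_tmul _ _,
    Finsupp.sum_fintype (h S L x w') (fun z p => (h S L w z y ⊗ₜ[ℤ] p : A ⊗[ℤ] A))
      fun z => TensorProduct.tmul_zero _ _]
  have hl : ∀ z, (h S L w x z ⊗ₜ[ℤ] h S L z w' y : A ⊗[ℤ] A) ≠ 0 →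
      h S L w x z ≠ 0 ∧ h S L z w' y ≠ 0 ∧ D.av z = D.av x := by
    intro z hz
    have h1 : h S L w x z ≠ 0 := fun h0 => hz (by rw [h0, TensorProduct.zero_tmul])
    have h2 : h S L z w' y ≠ 0 := fun h0 => hz (by rw [h0, TensorProduct.tmul_zero])
    have h3 := D.h_mono hS hc hpos h1
    have h4 := D.h_mono_right hS hc hpos h2
    exact ⟨h1, h2, by omega⟩
  have hr : ∀ z, (h S L w z y ⊗ₜ[ℤ] h S L x w' z : A ⊗[ℤ] A) ≠ 0 →
      h S L w z y ≠ 0 ∧ h S L x w' z ≠ 0 ∧ D.av z = D.av x := by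
    intro z hz
    have h1 : h S L w z y ≠ 0 := fun h0 => hz (by rw [h0, TensorProduct.zero_tmul])
    have h2 : h S L x w' z ≠ 0 := fun h0 => hz (by rw [h0, TensorProduct.tmul_zero])
    have h3 := D.h_mono hS hc hpos h1
    have h4 := D.h_mono_right hS hc hpos h2
    exact ⟨h1, h2, by omega⟩
  by_cases hx : D.Big x
  · have hy : D.Big y := D.av_eq_b_iff.1 (by rw [← ha, D.av_eq_b_iff.2 hx])
    have hzb : ∀ z, D.av z = D.av x → D.Big z := fun z hz =>
      D.av_eq_b_iff.1 (by rw [hz, D.av_eq_b_iff.2 hx])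
    obtain ⟨ε, i, δ, hv, rfl⟩ := hx
    obtain ⟨ε', j, δ', hv', rfl⟩ := hy
    rw [sum_eq_sum_of_embedding (g := fun k => (D.F w ε ε' i k ⊗ₜ[ℤ] D.F w'⁻¹ δ δ' k j : A ⊗[ℤ] A))
      (fun k => D.V ε' k δ) (fun k => D.el ε' k δ)
      (fun i j hi hj hij => (D.el_inj _ _ _ _ _ _ hi hj hij).2.1) ?_ ?_ ?_,
      sum_eq_sum_of_embedding (g := fun k => (D.F w ε ε' k j ⊗ₜ[ℤ] D.F w'⁻¹ δ δ' i k : A ⊗[ℤ] A))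
      (fun k => D.V ε k δ') (fun k => D.el ε k δ')
      (fun i j hi hj hij => (D.el_inj _ _ _ _ _ _ hi hj hij).2.1) ?_ ?_ ?_]
    · exact sum_tmul_of_commute (D.F_comm _ _ _) (D.F_comm _ _ _) i j
    · intro z hz
      obtain ⟨h1, h2, h3⟩ := hr z hz
      obtain ⟨ε₁, k, δ₁, hv₁, rfl⟩ := hzb z h3
      rw [D.h_el _ _ _ _ _ _ _ hv₁ hv'] at h1
      rw [D.h_el_right hS hc hv hv₁] at h2
      split_ifs at h1 h2 with hδ hε
      · subst hδ hε
        exact ⟨k, hv₁, rfl⟩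
      all_goals first | exact absurd rfl h1 | exact absurd rfl h2
    · intro k hk
      refine D.V_swap _ _ _ (D.F_V w'⁻¹ _ _ _ _ _ (D.V_swap _ _ _ hv) (fun h0 => hk ?_))
      rw [h0, TensorProduct.tmul_zero]
    · intro k hk
      rw [D.h_el _ _ _ _ _ _ _ hk hv', if_pos rfl, D.h_el_right hS hc hv hk, if_pos rfl]
    · intro z hz
      obtain ⟨h1, h2, h3⟩ := hl z hz
      obtain ⟨ε₁, k, δ₁, hv₁, rfl⟩ := hzb z h3
      rw [D.h_el _ _ _ _ _ _ _ hv hv₁] at h1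
      rw [D.h_el_right hS hc hv₁ hv'] at h2
      split_ifs at h1 h2 with hδ hε
      · subst hδ hε
        exact ⟨k, hv₁, rfl⟩
      all_goals first | exact absurd rfl h1 | exact absurd rfl h2
    · intro k hk
      refine D.F_V w _ _ _ _ _ hv (fun h0 => hk ?_)
      rw [h0, TensorProduct.zero_tmul]
    · intro k hk
      rw [D.h_el _ _ _ _ _ _ _ hv hk, if_pos rfl, D.h_el_right hS hc hk hv', if_pos rfl]
  · have hz : ∀ z, D.av z = D.av x → z = x := by
      intro z hz
      rcases D.av_inj z x hz with h | h
      · exact h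
      · exact absurd h.2 hx
    have hy : y = x := hz y ha.symm
    subst hy
    rw [Finset.sum_eq_single y, Finset.sum_eq_single y]
    · intro z _ hzy
      by_contra hne
      exact hzy (hz z (hr z hne).2.2)
    · intro h'
      exact absurd (Finset.mem_univ _) h'
    · intro z _ hzy
      by_contra hne
      exact hzy (hz z (hl z hne).2.2)
    · intro h'
      exact absurd (Finset.mem_univ _) h'

theorem simL_iff {x w : W} : simL S L x w ↔
    x = w ∨ ∃ ε i δ ε' i', D.V ε i δ ∧ D.V ε' i' δ ∧ x = D.el ε i δ ∧ w = D.el ε' i' δ := by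
  constructor
  · intro hx
    exact D.preL_eq_or hx.1 (D.av_eq_of_simL hx)
  · rintro (rfl | ⟨ε, i, δ, ε', i', hv, hv', rfl, rfl⟩)
    · exact ⟨Relation.ReflTransGen.refl, Relation.ReflTransGen.refl⟩
    · exact D.simL_el hS hc hpos hv hv'

theorem simL_of_gam_ne_zero {x y z : W} (hne : gam S L x y z ≠ 0) : simL S L x y⁻¹ := by
  rw [D.simL_iff hS hc hpos]
  rcases D.gam_ne_zero hS hc hne with ⟨hb, rfl, rfl⟩ | ⟨ε, i, δ, j, η, k, h1, h2, h3, rfl, rfl, rfl⟩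
  · exact Or.inl (D.inv_single _ hb).symm
  · rw [D.el_inv _ _ _ h2]
    exact Or.inr ⟨_, _, _, _, _, h1, D.V_swap _ _ _ h2, rfl, rfl⟩

theorem leftCell_setD {Γ : Set W} (hΓ : IsLeftCell S L Γ) : (∃! z, z ∈ Γ ∧ z ∈ setD S L) ∧
    ∀ z ∈ Γ, z ∈ setD S L → ∀ y ∈ Γ, gam S L y⁻¹ y z ≠ 0 := by
  obtain ⟨w, rfl⟩ := hΓ
  simp only [Set.mem_ofPred_eq]
  by_cases hw : D.Big w
  · obtain ⟨ε, i, δ, hv, rfl⟩ := hw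
    have huniq : ∀ z, simL S L z (D.el ε i δ) → z ∈ setD S L → z = D.el δ 0 δ := by
      intro z hz hzD
      rcases (D.simL_iff hS hc hpos).1 hz with rfl | ⟨ε₁, i₁, δ₁, ε₂, i₂, hv₁, hv₂, rfl, he⟩
      · rcases (D.mem_setD hS hc).1 hzD with hb | ⟨ε', he⟩
        · exact absurd (D.big_el hv) hb
        · obtain ⟨rfl, rfl, rfl⟩ := D.el_inj _ _ _ _ _ _ hv (D.V_zero _) he
          rfl
      · obtain ⟨rfl, rfl, rfl⟩ := D.el_inj _ _ _ _ _ _ hv hv₂ he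
        rcases (D.mem_setD hS hc).1 hzD with hb | ⟨ε', he⟩
        · exact absurd (D.big_el hv₁) hb
        · obtain ⟨rfl, rfl, rfl⟩ := D.el_inj _ _ _ _ _ _ hv₁ (D.V_zero _) he
          rfl
    refine ⟨⟨D.el δ 0 δ, ⟨(D.simL_el_zero hS hc hpos hv).symm, D.mem_setD_el hS hc δ⟩,
      fun z hz => huniq z hz.1 hz.2⟩, ?_⟩
    intro z hz hzD y hy
    rw [huniq z hz hzD]
    have : ∃ ε' i', D.V ε' i' δ ∧ y = D.el ε' i' δ := by
      rcases (D.simL_iff hS hc hpos).1 hy with rfl | ⟨ε₁, i₁, δ₁, ε₂, i₂, hv₁, hv₂, rfl, he⟩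
      · exact ⟨ε, i, hv, rfl⟩
      · obtain ⟨rfl, rfl, rfl⟩ := D.el_inj _ _ _ _ _ _ hv hv₂ he
        exact ⟨_, _, hv₁, rfl⟩
    obtain ⟨ε', i', hv', rfl⟩ := this
    rw [D.gam_el_zero hS hc hv']
    exact one_ne_zero
  · have huniq : ∀ z, simL S L z w → z = w := by
      intro z hz
      rcases (D.simL_iff hS hc hpos).1 hz with h | ⟨ε₁, i₁, δ₁, ε₂, i₂, hv₁, hv₂, rfl, rfl⟩
      · exact h
      · exact absurd (D.big_el hv₂) hw
    refine ⟨⟨w, ⟨⟨Relation.ReflTransGen.refl, Relation.ReflTransGen.refl⟩,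
      D.mem_setD_single hS hc hw⟩, fun z hz => huniq z hz.1⟩, ?_⟩
    intro z hz _ y hy
    rw [huniq z hz, huniq y hy, D.inv_single w hw, D.gam_single hS hc hw]
    rcases D.sgn_eq w with h | h <;> rw [h] <;> decide

omit hpos in
theorem setD_mul_self {z : W} (hz : z ∈ setD S L) : z * z = 1 := by
  have : z⁻¹ = z := by
    rcases (D.mem_setD hS hc).1 hz with hb | ⟨ε, rfl⟩
    · exact D.inv_single z hb
    · exact D.el_inv _ _ _ (D.V_zero _)
  nth_rw 1 [← this]
  exact inv_mul_cancel z

theorem simLR_inv (w : W) : simLR S L w w⁻¹ :=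
  (D.simLR_iff hS hc hpos).2 (D.av_inv w).symm

/-- P12 compares the a-functions of different groups and is not visible in the structure constants
of `W` alone, so it enters as the hypothesis `h12`. -/
theorem pConj (N : ℕ) (h12 : ∀ I ⊆ S, ∀ y : Subgroup.closure I,
    aFun (W := Subgroup.closure I) {x | (x : W) ∈ I} (fun x => L (x : W)) y = aFun S L (y : W)) :
    PConj S L N where
  P1 w _ := ⟨D.av w, D.aFun_eq hS hc w, D.le_Del w⟩
  P2 z hz x y hne := (D.gam_setD_eq hS hc hz.1 hne).1
  P3 y _ := D.existsUnique_gam hS hc y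
  P4 w _ w' hw := by
    rw [D.aFun_eq hS hc, D.aFun_eq hS hc, Nat.cast_le]
    exact D.preLR_mono hS hc hpos hw
  P5 z hz y hne := (D.gam_setD_eq hS hc hz.1 hne).2
  P6 z hz := D.setD_mul_self hS hc hz.1
  P7 x y z _ := ⟨D.gam_rotate hS hc x y z, D.gam_rotate hS hc y z x⟩
  P8 x y z _ hne := by
    have h1 := hne
    rw [D.gam_rotate hS hc] at h1
    have h2 := h1
    rw [D.gam_rotate hS hc] at h2
    exact ⟨D.simL_of_gam_ne_zero hS hc hpos hne, D.simL_of_gam_ne_zero hS hc hpos h1,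
      D.simL_of_gam_ne_zero hS hc hpos h2⟩
  P9 w _ w' hw ha := by
    rw [D.aFun_eq hS hc, D.aFun_eq hS hc, Nat.cast_inj] at ha
    exact D.simL_of_preL hS hc hpos hw ha
  P10 w _ w' hw ha := by
    rw [D.aFun_eq hS hc, D.aFun_eq hS hc, Nat.cast_inj] at ha
    exact D.simR_of_preR hS hc hpos hw ha
  P11 w _ w' hw ha := by
    rw [D.aFun_eq hS hc, D.aFun_eq hS hc, Nat.cast_inj] at ha
    exact (D.simLR_iff hS hc hpos).2 ha
  P12 I hI y _ := h12 I hI y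
  P13 Γ _ hΓ := D.leftCell_setD hS hc hpos hΓ
  P14 w _ := D.simLR_inv hS hc hpos w
  P15 w w' x _ y _ ha := by
    rw [D.aFun_eq hS hc, D.aFun_eq hS hc, Nat.cast_inj] at ha
    exact D.sum_tmul_eq hS hc hpos w w' x y ha

theorem isTwoSidedCell_iff {Γ : Set W} :
    IsTwoSidedCell S L Γ ↔ ∃ w, Γ = {x | D.av x = D.av w} := by
  unfold IsTwoSidedCell
  simp only [D.simLR_iff hS hc hpos]

end CellDatum

end HeckeKL

end

noncomputable section

namespace HeckeKL

variable {W : Type*} [Group W]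

/-! ### Finite dihedral groups -/

/-- The colour of the letter after `k` letters in the alternating word that starts with `c`. -/
def tog (c : Bool) : ℕ → Bool
  | 0 => c
  | k + 1 => !(tog c k)

theorem tog_not (c : Bool) (k : ℕ) : tog (!c) k = !(tog c k) := by
  induction k with
  | zero => rfl
  | succ k ih => rw [tog, ih, tog]

theorem tog_tog (c : Bool) (k : ℕ) : tog (tog c k) k = c := by
  induction k with
  | zero => rfl
  | succ k ih => rw [tog, tog, tog_not, ih, Bool.not_not]

theorem tog_add_two (c : Bool) (k : ℕ) : tog c (k + 2) = tog c k := by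
  rw [tog, tog, Bool.not_not]

theorem tog_two_mul (c : Bool) (k : ℕ) : tog c (2 * k) = c := by
  induction k with
  | zero => rfl
  | succ k ih => rw [Nat.mul_succ, tog_add_two, ih]

theorem tog_of_mod_two {c : Bool} {j k : ℕ} (h : j % 2 = k % 2) : tog c j = tog c k := by
  rw [← Nat.mod_add_div j 2, ← Nat.mod_add_div k 2, h]
  have : ∀ a m, tog c (a + 2 * m) = tog c a := by
    intro a m
    induction m with
    | zero => rfl
    | succ m ih => rw [Nat.mul_succ, ← add_assoc, tog_add_two, ih]
  rw [this, this]

/-- The alternating product `g c · g !c · g c ⋯` with `k` factors. -/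
def al (g : Bool → W) (c : Bool) (k : ℕ) : W := alt (g c) (g !c) k

theorem al_zero (g : Bool → W) (c : Bool) : al g c 0 = 1 := rfl

theorem al_succ (g : Bool → W) (c : Bool) (k : ℕ) : al g c (k + 1) = g c * al g (!c) k := by
  rw [al, alt, al, Bool.not_not]

theorem al_one (g : Bool → W) (c : Bool) : al g c 1 = g c := by
  rw [al_succ, al_zero, mul_one]

theorem al_add (g : Bool → W) (c : Bool) (j k : ℕ) :
    al g c (j + k) = al g c j * al g (tog c j) k := by
  induction j generalizing c with
  | zero => rw [zero_add, al_zero, one_mul, tog]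
  | succ j ih =>
    rw [show j + 1 + k = (j + k) + 1 by omega, al_succ, ih, al_succ, mul_assoc, tog_not, tog]

theorem al_succ_right (g : Bool → W) (c : Bool) (k : ℕ) :
    al g c (k + 1) = al g c k * g (tog c k) := by
  rw [al_add, al_one]

theorem al_two_mul (g : Bool → W) (c : Bool) (k : ℕ) : al g c (2 * k) = (g c * g !c) ^ k := by
  induction k with
  | zero => rw [mul_zero, al_zero, pow_zero]
  | succ k ih =>
    rw [Nat.mul_succ, al_succ_right, al_succ_right, tog, tog_two_mul, ih, pow_succ, mul_assoc]

/-- The elements `g false`, `g true` generate a dihedral group of order `2 * M`. -/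
structure IsDihedral (g : Bool → W) (M : ℕ) : Prop where
  three_le : 3 ≤ M
  mul_self : ∀ c, g c * g c = 1
  al_top : ∀ c, al g c M = al g (!c) M
  word : ∀ w : W, ∃ l : List W, IsWord (Set.range g) w l
  al_inj : ∀ c c' k k', k ≤ M → k' ≤ M → al g c k = al g c' k' →
    k = k' ∧ (c = c' ∨ k = 0 ∨ k = M)

theorem int_eq_zero_or_of_dvd {M : ℕ} {a : ℤ} (h : (M : ℤ) ∣ a) (h1 : -(M : ℤ) < a) (h2 : a ≤ M) :
    a = 0 ∨ a = M := by
  obtain ⟨k, rfl⟩ := h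
  rcases Nat.eq_zero_or_pos M with h0 | h0
  · left; simp [h0]
  · have h3 : k < 2 := by by_contra h'; nlinarith
    have h4 : -1 < k := by by_contra h'; nlinarith
    interval_cases k
    · left; ring
    · right; ring

/-- The relations alone give the two words of the longest element. That no other alternating words
coincide is seen in `DihedralGroup (M i j)`, to which `W` maps by the universal property: words of
even length become rotations, words of odd length reflections, and a coincidence becomes a
congruence modulo `M i j`. -/
theorem isDihedral_of_coxeterSystem {B : Type*} (M : CoxeterMatrix B) (cs : CoxeterSystem M W)
    (i j : B) (hij : i ≠ j) (hB : ∀ k : B, k = i ∨ k = j) (hm : 3 ≤ M i j) :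
    IsDihedral (fun c : Bool => cs.simple (if c then j else i)) (M i j) := by
  set g : Bool → W := fun c : Bool => cs.simple (if c then j else i) with hg
  have hsq : ∀ c, g c * g c = 1 := fun c => cs.simple_mul_simple_self _
  have hinv : ∀ c, (g c)⁻¹ = g c := fun c => inv_eq_of_mul_eq_one_right (hsq c)
  have hrange : Set.range g = Set.range cs.simple := by
    ext x
    constructor
    · rintro ⟨c, rfl⟩
      exact ⟨_, rfl⟩
    · rintro ⟨k, rfl⟩
      rcases hB k with rfl | rfl
      exacts [⟨false, rfl⟩, ⟨true, rfl⟩]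
  classical
  have hlift : M.IsLiftable (fun k => (DihedralGroup.sr (if k = j then 1 else 0) :
      DihedralGroup (M i j))) := by
    intro k k'
    rcases hB k with rfl | rfl <;> rcases hB k' with rfl | rfl
    · simp
    · simp [hij, DihedralGroup.sr_mul_sr]
    · rw [M.symmetric k' k]
      simp [hij, DihedralGroup.sr_mul_sr, DihedralGroup.r_pow]
    · simp
  let φ : W →* DihedralGroup (M i j) := cs.lift ⟨_, hlift⟩
  have hφ : ∀ c, φ (g c) = DihedralGroup.sr (if c then 1 else 0) := by
    intro c
    rw [hg]
    simp only [φ]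
    rw [CoxeterSystem.lift_apply_simple]
    cases c <;> simp [hij]
  have heven : ∀ (c : Bool) (p : ℕ), φ (al g c (2 * p)) = DihedralGroup.r (if c then -(p : ZMod (M i j)) else p) := by
    intro c p
    rw [al_two_mul, map_pow, map_mul, hφ, hφ, DihedralGroup.sr_mul_sr, DihedralGroup.r_pow]
    cases c <;> simp
  have hodd : ∀ (c : Bool) (p : ℕ), φ (al g c (2 * p + 1)) = DihedralGroup.sr (if c then 1 + (p : ZMod (M i j)) else -(p : ZMod (M i j))) := by
    intro c p
    rw [al_succ_right, map_mul, heven, tog_two_mul, hφ, DihedralGroup.r_mul_sr]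
    cases c <;> simp
  have hpow : ∀ c, (g c * g !c) ^ M i j = 1 := by
    intro c
    cases c
    · exact cs.simple_mul_simple_pow i j
    · exact cs.simple_mul_simple_pow' i j
  have hainv : ∀ k c, (al g c (k + 1))⁻¹ = al g (tog c k) (k + 1) := by
    intro k
    induction k with
    | zero => intro c; rw [al_one, hinv, tog, al_one]
    | succ k ih =>
      intro c
      rw [al_succ, mul_inv_rev, ih, hinv, al_succ_right _ _ (k + 1), tog_not, ← tog, tog_tog]
  refine ⟨hm, hsq, ?_, ?_, ?_⟩
  · intro c
    -- The alternating word of length `2 * M i j` is trivial, so its two halves are inverse to each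
    -- other. Reversing the second half produces the word that starts with `!c`.
    obtain ⟨m, hm'⟩ : ∃ m, M i j = m + 1 := ⟨M i j - 1, by omega⟩
    have h1 := al_two_mul g c (M i j)
    rw [hpow, two_mul, al_add, mul_eq_one_iff_eq_inv] at h1
    rw [h1, hm', hainv, tog, tog_not, tog_tog]
  · intro w
    obtain ⟨ω, hω⟩ := cs.wordProd_surjective w
    refine ⟨ω.map cs.simple, fun x hx => ?_, hω⟩
    rw [hrange]
    obtain ⟨k, -, rfl⟩ := List.mem_map.1 hx
    exact ⟨k, rfl⟩
  · intro c c' k k' hk hk' he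
    have he := congrArg φ he
    have hM : (0 : ℤ) < (M i j : ℤ) := by omega
    have hdvd : ∀ a : ℤ, (a : ZMod (M i j)) = 0 → -(M i j : ℤ) < a → a ≤ M i j →
        a = 0 ∨ a = M i j := fun a ha h1 h2 =>
      int_eq_zero_or_of_dvd ((ZMod.intCast_zmod_eq_zero_iff_dvd a _).1 ha) h1 h2
    rcases Nat.even_or_odd' k with ⟨p, rfl | rfl⟩ <;> rcases Nat.even_or_odd' k' with ⟨p', rfl | rfl⟩
    · rw [heven, heven, DihedralGroup.r.injEq] at he
      rcases c <;> rcases c' <;> simp only [Bool.false_eq_true, if_false, if_true] at he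
      · obtain h0 | h0 := hdvd (p - p') (by push_cast; linear_combination he) (by omega) (by omega)
        · exact ⟨by omega, Or.inl rfl⟩
        · exact ⟨by omega, Or.inr (by omega)⟩
      · obtain h0 | h0 := hdvd (p + p') (by push_cast; linear_combination he) (by omega) (by omega)
        · exact ⟨by omega, Or.inr (by omega)⟩
        · exact ⟨by omega, Or.inr (by omega)⟩
      · obtain h0 | h0 := hdvd (p + p') (by push_cast; linear_combination -he) (by omega) (by omega)
        · exact ⟨by omega, Or.inr (by omega)⟩
        · exact ⟨by omega, Or.inr (by omega)⟩
      · obtain h0 | h0 := hdvd (p' - p) (by push_cast; linear_combination he) (by omega) (by omega)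
        · exact ⟨by omega, Or.inl rfl⟩
        · exact ⟨by omega, Or.inr (by omega)⟩
    · rw [heven, hodd] at he
      exact absurd he (by simp)
    · rw [heven, hodd] at he
      exact absurd he (by simp)
    · rw [hodd, hodd, DihedralGroup.sr.injEq] at he
      rcases c <;> rcases c' <;> simp only [Bool.false_eq_true, if_false, if_true] at he
      · obtain h0 | h0 := hdvd (p' - p) (by push_cast; linear_combination he) (by omega) (by omega)
        · exact ⟨by omega, Or.inl rfl⟩
        · exact ⟨by omega, Or.inr (by omega)⟩
      · obtain h0 | h0 := hdvd (1 + p + p') (by push_cast; linear_combination -he) (by omega) (by omega)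
        · exact ⟨by omega, Or.inr (by omega)⟩
        · exact ⟨by omega, Or.inr (by omega)⟩
      · obtain h0 | h0 := hdvd (1 + p + p') (by push_cast; linear_combination he) (by omega) (by omega)
        · exact ⟨by omega, Or.inr (by omega)⟩
        · exact ⟨by omega, Or.inr (by omega)⟩
      · obtain h0 | h0 := hdvd (p - p') (by push_cast; linear_combination he) (by omega) (by omega)
        · exact ⟨by omega, Or.inl rfl⟩
        · exact ⟨by omega, Or.inr (by omega)⟩

namespace IsDihedral

variable {g : Bool → W} {M : ℕ} (hg : IsDihedral g M)
include hg

theorem inv_gen (c : Bool) : (g c)⁻¹ = g c := inv_eq_of_mul_eq_one_right (hg.mul_self c)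

theorem inv_al (c : Bool) (k : ℕ) : (al g c (k + 1))⁻¹ = al g (tog c k) (k + 1) := by
  induction k generalizing c with
  | zero => rw [al_one, hg.inv_gen, tog, al_one]
  | succ k ih =>
    rw [al_succ, mul_inv_rev, ih, hg.inv_gen, al_succ_right _ _ (k + 1), tog_not, ← tog, tog_tog]

theorem gen_mul_al_succ (c : Bool) (k : ℕ) : g c * al g c (k + 1) = al g (!c) k := by
  rw [al_succ, ← mul_assoc, hg.mul_self, one_mul]

/-- Letters are absorbed one at a time from the left. The bound by the length of the list is what
identifies `k` as the length of `al g c k` in `len_al`. -/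
theorem exists_al_of_word {l : List W} (hl : ∀ x ∈ l, x ∈ Set.range g) :
    ∃ c k, k ≤ M ∧ k ≤ l.length ∧ l.prod = al g c k := by
  induction l with
  | nil => exact ⟨false, 0, Nat.zero_le _, le_rfl, rfl⟩
  | cons s l ih =>
    obtain ⟨c, k, hk, hkl, he⟩ := ih fun x hx => hl x (List.mem_cons_of_mem _ hx)
    obtain ⟨d, rfl⟩ := hl s (by simp)
    rw [List.prod_cons, he, List.length_cons]
    have hM := hg.three_le
    rcases k with _ | k
    · exact ⟨d, 1, by omega, by omega, by rw [al_zero, al_one, mul_one]⟩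
    · by_cases hd : d = c
      · subst hd
        exact ⟨!d, k, by omega, by omega, hg.gen_mul_al_succ d k⟩
      · have hc : c = !d := by revert hd; cases c <;> cases d <;> decide
        subst hc
        by_cases hkM : k + 1 < M
        · exact ⟨d, k + 2, by omega, by omega, (al_succ g d (k + 1)).symm⟩
        -- The longest element also has a word that begins with `d`, so the new letter cancels
        -- against that one.
        · have hkM : k + 1 = M := by omega
          refine ⟨!d, k, by omega, by omega, ?_⟩
          rw [hkM, ← hg.al_top, ← hkM, hg.gen_mul_al_succ]

theorem exists_al (w : W) : ∃ c k, k ≤ M ∧ w = al g c k := by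
  obtain ⟨l, hl, rfl⟩ := hg.word w
  obtain ⟨c, k, hk, -, he⟩ := hg.exists_al_of_word hl
  exact ⟨c, k, hk, he⟩

theorem finite : Finite W := by
  refine Finite.of_surjective (fun x : Bool × Fin (M + 1) => al g x.1 x.2) fun w => ?_
  obtain ⟨c, k, hk, rfl⟩ := hg.exists_al w
  exact ⟨(c, ⟨k, by omega⟩), rfl⟩

omit hg in
theorem isWord_al (c : Bool) (k : ℕ) :
    ∃ l, IsWord (Set.range g) (al g c k) l ∧ l.length = k := by
  induction k generalizing c with
  | zero => exact ⟨[], ⟨by simp, rfl⟩, rfl⟩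
  | succ k ih =>
    obtain ⟨l, ⟨h1, h2⟩, h3⟩ := ih (!c)
    exact ⟨g c :: l, ⟨List.forall_mem_cons.2 ⟨⟨c, rfl⟩, h1⟩, by rw [List.prod_cons, h2, al_succ]⟩,
      by rw [List.length_cons, h3]⟩

theorem len_al {c : Bool} {k : ℕ} (hk : k ≤ M) : len (Set.range g) (al g c k) = k := by
  obtain ⟨l, hl, hlen⟩ := isWord_al (g := g) c k
  apply le_antisymm
  · rw [← hlen]
    exact Nat.sInf_le ⟨l, by rwa [hlen], rfl⟩
  · refine le_csInf ⟨l.length, l, hl, rfl⟩ ?_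
    rintro m ⟨l', ⟨h1, h2⟩, rfl⟩
    obtain ⟨c', k', hk', hkl, he⟩ := hg.exists_al_of_word h1
    rw [h2] at he
    rw [(hg.al_inj _ _ _ _ hk hk' he).1]
    exact hkl

theorem exists_of_len_lt {w : W} {d : Bool}
    (h : len (Set.range g) w < len (Set.range g) (g d * w)) : ∃ k, k < M ∧ w = al g (!d) k := by
  obtain ⟨c, k, hk, rfl⟩ := hg.exists_al w
  rcases k with _ | k
  · exact ⟨0, by have := hg.three_le; omega, rfl⟩
  · by_cases hd : d = c
    · subst hd
      rw [hg.gen_mul_al_succ, hg.len_al hk, hg.len_al (by omega)] at h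
      omega
    · have hc : c = !d := by revert hd; cases c <;> cases d <;> decide
      subst hc
      refine ⟨k + 1, lt_of_le_of_ne hk ?_, rfl⟩
      intro hkM
      rw [hkM, ← hg.al_top, ← hkM, hg.gen_mul_al_succ, hg.len_al hk, hg.len_al (by omega)] at h
      omega

theorem isHeckeSystem {L : W → ℤ} (hL : IsWeight (Set.range g) L) :
    IsHeckeSystem (Set.range g) L where
  mul_self := by
    rintro _ ⟨c, rfl⟩
    exact hg.mul_self c
  exists_word := hg.word
  len_mul_ne := by
    rintro _ ⟨d, rfl⟩ w
    obtain ⟨c, k, hk, rfl⟩ := hg.exists_al w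
    have hM := hg.three_le
    rcases k with _ | k
    · rw [al_zero, mul_one, ← al_zero g d, ← al_one g d, hg.len_al (by omega),
        hg.len_al (by omega)]
      decide
    · by_cases hd : d = c
      · subst hd
        rw [hg.gen_mul_al_succ, hg.len_al hk, hg.len_al (by omega)]
        omega
      · have hc : c = !d := by revert hd; cases c <;> cases d <;> decide
        subst hc
        by_cases hkM : k + 1 = M
        · rw [hkM, ← hg.al_top, ← hkM, hg.gen_mul_al_succ, hg.len_al hk, hg.len_al (by omega)]
          omega
        · rw [← al_succ, hg.len_al hk, hg.len_al (by omega)]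
          omega
  exchange := by
    rintro _ ⟨d, rfl⟩ _ ⟨e, rfl⟩ w h1 h2 h3
    obtain ⟨k, hk, rfl⟩ := hg.exists_of_len_lt h1
    rw [← al_succ] at h3 ⊢
    have hM := hg.three_le
    -- Since `e` lengthens `w` on the right, it continues the alternating word, unless `w` is empty
    -- and any letter is allowed.
    have key : e = tog d (k + 1) ∨ k = 0 ∧ e = d := by
      by_cases he : e = tog d (k + 1)
      · exact Or.inl he
      · right
        rcases k with _ | k
        · refine ⟨rfl, ?_⟩
          revert he
          simp only [tog]
          cases e <;> cases d <;> decide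
        · exfalso
          have he' : e = tog (!d) k := by
            rw [tog_not]
            rw [tog, tog] at he
            revert he
            cases e <;> cases tog d k <;> decide
          rw [al_succ_right, he', mul_assoc, hg.mul_self, mul_one, ← al_succ_right,
            hg.len_al (by omega), hg.len_al (by omega)] at h2
          omega
    rcases key with rfl | ⟨rfl, rfl⟩
    · by_cases hkM : k + 1 = M
      · rw [tog, ← tog_not, ← al_succ_right, hkM, hg.al_top]
      · rw [← al_succ_right, hg.len_al (by omega), hg.len_al (by omega)] at h3
        omega
    · rw [zero_add, al_one, al_zero, one_mul]
  isWeight := hL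

end IsDihedral

/-! ### Bruhat interval sums in dihedral groups -/

/-- The weight of an alternating word with `k` letters, the first of which is `c`. -/
def lw (a : Bool → ℤ) (c : Bool) : ℕ → ℤ
  | 0 => 0
  | k + 1 => a c + lw a (!c) k

theorem lw_two_mul (a : Bool → ℤ) (c : Bool) (k : ℕ) : lw a c (2 * k) = k * (a c + a !c) := by
  induction k with
  | zero => simp [lw]
  | succ k ih =>
    rw [Nat.mul_succ, lw, lw, Bool.not_not, ih]
    push_cast
    ring

theorem lw_two_mul_add_one (a : Bool → ℤ) (c : Bool) (k : ℕ) :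
    lw a c (2 * k + 1) = (k + 1) * a c + k * a !c := by
  rw [lw, lw_two_mul, Bool.not_not]
  ring

theorem lw_strictMono {a : Bool → ℤ} (ha : ∀ c, 0 < a c) {c : Bool} {j k : ℕ} (h : j < k) :
    lw a c j < lw a c k := by
  induction k generalizing c j with
  | zero => omega
  | succ k ih =>
    rcases j with _ | j
    · rcases k with _ | k
      · simpa [lw] using ha c
      · have := ih (c := !c) (Nat.succ_pos k)
        have h1 := ha c
        rw [lw] at this ⊢
        rw [lw]
        omega
    · have := ih (c := !c) (j := j) (by omega)
      rw [lw, lw]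
      omega

/-- Without its first letter the longer word starts with the other colour, so a shorter word with
either first letter can be compared with an initial segment of the longer word or of its tail. -/
theorem lw_lt_lw {a : Bool → ℤ} (ha : ∀ c, 0 < a c) {c c' : Bool} {j k : ℕ} (h : j < k) :
    lw a c' j < lw a c k := by
  by_cases hc : c' = c
  · subst hc
    exact lw_strictMono ha h
  · obtain rfl : c' = !c := by revert hc; cases c <;> cases c' <;> decide
    obtain ⟨k, rfl⟩ : ∃ k', k = k' + 1 := ⟨k - 1, by omega⟩
    have h1 := ha c
    rw [lw]
    rcases Nat.lt_succ_iff_lt_or_eq.1 h with h' | rfl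
    · have := lw_strictMono ha (c := !c) h'
      omega
    · omega

/-- Elements of `⨁ q⁻¹ ℤ[q⁻¹] T_y`, where the sum is over the `y` with `ℓ(y) < N`. -/
def NegLower (S : Set W) (N : ℕ) (u : H W) : Prop := u ∈ lower S N ∧ ∀ y, IsNeg (u y)

theorem NegLower.zero {S : Set W} {N : ℕ} : NegLower S N 0 :=
  ⟨Submodule.zero_mem _, fun _ _ _ => rfl⟩

theorem NegLower.add {S : Set W} {N : ℕ} {u v : H W} (hu : NegLower S N u)
    (hv : NegLower S N v) : NegLower S N (u + v) := by
  refine ⟨Submodule.add_mem _ hu.1 hv.1, fun y => ?_⟩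
  rw [Finsupp.add_apply, isNeg_iff]
  exact (isNeg_iff.1 (hu.2 y)).add (isNeg_iff.1 (hv.2 y))

theorem NegLower.mono {S : Set W} {N N' : ℕ} (h : N ≤ N') {u : H W} (hu : NegLower S N u) :
    NegLower S N' u := ⟨lower_mono h hu.1, hu.2⟩

theorem NegLower.smul {S : Set W} {N : ℕ} {u : H W} {p : A} (hp : DegLE 0 p)
    (hu : NegLower S N u) : NegLower S N (p • u) := by
  refine ⟨Submodule.smul_mem _ _ hu.1, fun y => ?_⟩
  rw [Finsupp.smul_apply, smul_eq_mul, isNeg_iff]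
  simpa using hp.mul (isNeg_iff.1 (hu.2 y))

theorem NegLower.single {S : Set W} {N : ℕ} {w : W} {p : A} (hp : IsNeg p) (hw : len S w < N) :
    NegLower S N (p • stdT w) := by
  refine ⟨Submodule.smul_mem _ _ (stdT_mem_lower hw), fun y => ?_⟩
  by_cases hy : y = w
  · subst hy
    rw [Finsupp.smul_apply, stdT_apply_self, smul_eq_mul, mul_one]
    exact hp
  · rw [Finsupp.smul_apply, stdT_apply_of_ne hy, smul_zero]
    exact fun _ _ => rfl

theorem isNeg_T {m : ℤ} (hm : m < 0) : IsNeg (LaurentPolynomial.T m) :=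
  isNeg_iff.2 ((DegLE.T m).mono (by omega))

section

variable (g : Bool → W) (L : W → ℤ)

/-- `q ^ L(w) T_w` for an alternating word `w`. -/
def tau (c : Bool) (k : ℕ) : H W :=
  (LaurentPolynomial.T (lw (fun c => L (g c)) c k) : A) • stdT (al g c k)

/-- The sum of `q ^ L(y) T_y` over the `y ≤ al g c k`, for `k ≠ 0`; and `0` for `k = 0`. -/
def preGam (c : Bool) (k : ℕ) : H W :=
  ∑ j ∈ Finset.range k, (tau g L (!c) j + tau g L c (j + 1))

/-- The sum of `q ^ (L(y) - L(w)) T_y` over the `y ≤ w = al g c k`, for `k ≠ 0`. -/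
def Gam (c : Bool) (k : ℕ) : H W :=
  (LaurentPolynomial.T (-lw (fun c => L (g c)) c k) : A) • preGam g L c k

theorem Gam_zero (c : Bool) : Gam g L c 0 = 0 := by
  rw [Gam, preGam, Finset.sum_range_zero, smul_zero]

theorem preGam_zero (c : Bool) : preGam g L c 0 = 0 := Finset.sum_range_zero _

theorem tau_zero (c : Bool) : tau g L c 0 = stdT 1 := by
  rw [tau, lw, LaurentPolynomial.T_zero, one_smul, al_zero]

theorem preGam_succ (c : Bool) (k : ℕ) :
    preGam g L c (k + 1) = preGam g L c k + (tau g L (!c) k + tau g L c (k + 1)) :=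
  Finset.sum_range_succ _ _

theorem preGam_not_succ (c : Bool) (k : ℕ) :
    preGam g L (!c) (k + 1) = preGam g L c k + (tau g L (!c) k + tau g L (!c) (k + 1)) := by
  induction k with
  | zero => rw [preGam_succ, Bool.not_not, preGam_zero, preGam_zero, tau_zero, tau_zero]
  | succ k ih =>
    rw [preGam_succ, ih, preGam_succ, Bool.not_not]
    abel

end

theorem T_mul_T (m n : ℤ) :
    (LaurentPolynomial.T m * LaurentPolynomial.T n : A) = LaurentPolynomial.T (m + n) :=
  (LaurentPolynomial.T_add m n).symm

/-- `q ^ n + q ^ (-n)` -/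
def eta (n : ℤ) : A := LaurentPolynomial.T n + LaurentPolynomial.T (-n)

theorem invert_eta (n : ℤ) : LaurentPolynomial.invert (eta n) = eta n := by
  simp [eta, add_comm]

/-! ### The action of the generators on interval sums -/

namespace IsDihedral

variable {g : Bool → W} {M : ℕ} (hg : IsDihedral g M) {L : W → ℤ}
  (hL : IsWeight (Set.range g) L)
include hg

theorem genOp_al {c : Bool} {k : ℕ} (hk : k < M) :
    genOp (Set.range g) L (g c) (stdT (al g (!c) k)) = stdT (al g c (k + 1)) := by
  rw [genOp_stdT_of_lt, ← al_succ]
  rw [← al_succ, hg.len_al hk, hg.len_al hk.le]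
  exact Nat.lt_succ_self k

theorem genOp_al_succ {c : Bool} {k : ℕ} (hk : k < M) :
    genOp (Set.range g) L (g c) (stdT (al g c (k + 1))) =
      stdT (al g (!c) k) + xi L (g c) • stdT (al g c (k + 1)) := by
  rw [genOp_stdT_of_not_lt, hg.gen_mul_al_succ]
  rw [hg.gen_mul_al_succ, hg.len_al hk, hg.len_al hk.le]
  omega

theorem klOp_tau_not {c : Bool} {k : ℕ} (hk : k < M) :
    klOp (Set.range g) L (g c) (tau g L (!c) k) =
      (LaurentPolynomial.T (-(L (g c))) : A) • (tau g L (!c) k + tau g L c (k + 1)) := by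
  rw [klOp_apply, tau, map_smul, hg.genOp_al hk, tau, smul_add, smul_smul, smul_smul,
    T_mul_T, T_mul_T, lw, neg_add_cancel_left, add_comm]

theorem klOp_tau_succ {c : Bool} {k : ℕ} (hk : k < M) :
    klOp (Set.range g) L (g c) (tau g L c (k + 1)) =
      (LaurentPolynomial.T (L (g c)) : A) • (tau g L (!c) k + tau g L c (k + 1)) := by
  rw [klOp_apply, tau, map_smul, hg.genOp_al_succ hk, tau, lw, xi, LaurentPolynomial.T_add]
  module

/-- The sum is made of pairs `{y, g c * y}`, and on each pair `q^L(y) T_y + q^L(g c * y) T_{g c *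
y}` is an eigenvector of `C_{g c}`. -/
theorem klOp_preGam {c : Bool} {k : ℕ} (hk : k ≤ M) :
    klOp (Set.range g) L (g c) (preGam g L c k) = eta (L (g c)) • preGam g L c k := by
  rw [preGam, map_sum, Finset.smul_sum]
  refine Finset.sum_congr rfl fun j hj => ?_
  have hj : j < M := lt_of_lt_of_le (Finset.mem_range.1 hj) hk
  rw [map_add, hg.klOp_tau_not hj, hg.klOp_tau_succ hj, ← add_smul, eta, add_comm]

theorem klOp_Gam_self {c : Bool} {k : ℕ} (hk : k ≤ M) :
    klOp (Set.range g) L (g c) (Gam g L c k) = eta (L (g c)) • Gam g L c k := by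
  rw [Gam, map_smul, hg.klOp_preGam hk, smul_comm]

theorem klOp_preGam_not {c : Bool} {k : ℕ} (hk : k + 1 < M) :
    klOp (Set.range g) L (g c) (preGam g L (!c) (k + 1)) =
      (LaurentPolynomial.T (-(L (g c))) : A) • preGam g L c (k + 2) +
        (LaurentPolynomial.T (L (g c)) : A) • preGam g L c k := by
  rw [preGam_not_succ, map_add, map_add, hg.klOp_preGam (by omega), hg.klOp_tau_not (by omega),
    hg.klOp_tau_not hk, preGam_succ, preGam_succ, eta]
  module

/-- Without its two outer terms, `preGam g L (!c) (k + 1)` is the eigenvector `preGam g L c k` for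
`η = q^(-L) + q^L`. The copy with `q^(-L)` and the images of the outer terms make up the interval of
length `k + 2`; the copy with `q^L` is left over. This recursion produces all Kazhdan–Lusztig
elements and structure constants below. -/
theorem klOp_Gam_not {c : Bool} {k : ℕ} (hk : k + 1 < M) :
    klOp (Set.range g) L (g c) (Gam g L (!c) (k + 1)) =
      Gam g L c (k + 2) + (LaurentPolynomial.T (L (g c) - L (g !c)) : A) • Gam g L c k := by
  rw [Gam, map_smul, hg.klOp_preGam_not hk, Gam, Gam, smul_add, smul_smul, smul_smul, smul_smul,
    T_mul_T, T_mul_T, T_mul_T]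
  simp only [lw, Bool.not_not]
  congr 3 <;> ring

theorem klOp_one (c : Bool) : klOp (Set.range g) L (g c) (stdT 1) = Gam g L c 1 := by
  have h := hg.klOp_tau_not (L := L) (c := c) (k := 0) (by have := hg.three_le; omega)
  rw [tau_zero] at h
  rw [h, Gam, preGam, Finset.sum_range_one, lw, lw, add_zero, tau_zero]

theorem L_al (hL : IsWeight (Set.range g) L) {c : Bool} {k : ℕ} (hk : k ≤ M) :
    L (al g c k) = lw (fun c => L (g c)) c k := by
  have hS := hg.isHeckeSystem hL
  induction k generalizing c with
  | zero => rw [al_zero, hS.weight_one, lw]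
  | succ k ih =>
    rw [al_succ, hS.weight_gen_mul ⟨c, rfl⟩, ih (by omega), lw]
    rw [← al_succ, hg.len_al hk, hg.len_al (by omega)]
    exact Nat.lt_succ_self k

section

include hL

theorem lw_top (c : Bool) : lw (fun c => L (g c)) (!c) M = lw (fun c => L (g c)) c M := by
  rw [← hg.L_al hL le_rfl, ← hg.L_al hL le_rfl, ← hg.al_top]

/-- Both words represent the longest element, and both sums run over the whole group. -/
theorem Gam_top (c : Bool) : Gam g L (!c) M = Gam g L c M := by
  obtain ⟨k, hk⟩ : ∃ k, M = k + 1 := ⟨M - 1, by have := hg.three_le; omega⟩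
  have h : tau g L (!c) M = tau g L c M := by
    rw [tau, tau, hg.lw_top hL, ← hg.al_top]
  rw [Gam, Gam, hg.lw_top hL]
  congr 1
  nth_rw 1 [hk]
  rw [preGam_not_succ, ← hk, h, hk, preGam_succ]

end


theorem negLower_tau {c : Bool} {j N : ℕ} {m : ℤ} (hj : j < N) (hjM : j ≤ M)
    (hm : lw (fun c => L (g c)) c j < m) :
    NegLower (Set.range g) N ((LaurentPolynomial.T (-m) : A) • tau g L c j) := by
  rw [tau, smul_smul, T_mul_T]
  refine NegLower.single (isNeg_T (by omega)) ?_
  rwa [hg.len_al hjM]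

theorem negLower_preGam {c : Bool} {k N : ℕ} {m : ℤ} (hk : k < N) (hkM : k ≤ M)
    (hm : ∀ c j, j ≤ k → lw (fun c => L (g c)) c j < m) :
    NegLower (Set.range g) N ((LaurentPolynomial.T (-m) : A) • preGam g L c k) := by
  induction k with
  | zero =>
    rw [preGam, Finset.sum_range_zero, smul_zero]
    exact NegLower.zero
  | succ k ih =>
    rw [preGam_succ, smul_add, smul_add]
    refine (ih (by omega) (by omega) fun c j hj => hm c j (by omega)).add
      (NegLower.add ?_ ?_)
    · exact hg.negLower_tau (by omega) (by omega) (hm _ _ (by omega))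
    · exact hg.negLower_tau (by omega) (by omega) (hm _ _ (by omega))

/-- A shorter alternating word has strictly smaller weight whatever its first letter, so all
exponents `L(y) - L(w)` with `y ≠ w` are negative. -/
theorem negLower_Gam_sub (hpos : ∀ c, 0 < L (g c)) {c : Bool} {k : ℕ} (hk : k + 1 ≤ M) :
    NegLower (Set.range g) (k + 1) (Gam g L c (k + 1) - stdT (al g c (k + 1))) := by
  have e : Gam g L c (k + 1) - stdT (al g c (k + 1)) =
      (LaurentPolynomial.T (-lw (fun c => L (g c)) c (k + 1)) : A) • preGam g L c k +
      (LaurentPolynomial.T (-lw (fun c => L (g c)) c (k + 1)) : A) • tau g L (!c) k := by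
    rw [Gam, preGam_succ, tau, tau, smul_add, smul_add, smul_smul _ _ (stdT (al g c (k + 1))),
      T_mul_T, neg_add_cancel, LaurentPolynomial.T_zero, one_smul]
    abel
  rw [e]
  refine (hg.negLower_preGam (by omega) (by omega) fun c' j hj => ?_).add
    (hg.negLower_tau (by omega) (by omega) ?_)
  · exact lw_lt_lw hpos (by omega)
  · exact lw_lt_lw hpos (by omega)

theorem tau_apply_one {c : Bool} {k : ℕ} (hk : k < M) : tau g L c (k + 1) 1 = 0 := by
  rw [tau, Finsupp.smul_apply, stdT_apply_of_ne, smul_zero]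
  intro h
  rw [← al_zero g c] at h
  have := (hg.al_inj _ _ _ _ (by omega) (by omega) h).1
  omega

theorem preGam_apply_one {c : Bool} {k : ℕ} (hk : k + 1 ≤ M) : preGam g L c (k + 1) 1 = 1 := by
  induction k with
  | zero =>
    rw [preGam, Finset.sum_range_one, Finsupp.add_apply, hg.tau_apply_one (by omega), add_zero,
      tau, lw, LaurentPolynomial.T_zero, one_smul, al_zero, stdT_apply_self]
  | succ k ih =>
    rw [preGam_succ, Finsupp.add_apply, Finsupp.add_apply, ih (by omega),
      hg.tau_apply_one (by omega), hg.tau_apply_one (by omega), add_zero, add_zero]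

theorem Gam_apply_one {c : Bool} {k : ℕ} (hk : k + 1 ≤ M) :
    Gam g L c (k + 1) 1 = LaurentPolynomial.T (-lw (fun c => L (g c)) c (k + 1)) := by
  rw [Gam, Finsupp.smul_apply, hg.preGam_apply_one hk, smul_eq_mul, mul_one]

end IsDihedral

end HeckeKL

end

noncomputable section

namespace HeckeKL

variable {W : Type*} [Group W] {S : Set W} {L : W → ℤ}

/-! ### Operators modulo a left ideal -/

section Rep

variable {n : ℕ}

/-- The combinations of the vectors `f ε i` whose coefficients are the rows of a block matrix. -/
def act {V : Type*} [AddCommGroup V] [Module A V]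
    (F : Matrix Bool Bool (Matrix (Fin n) (Fin n) A)) (f : Bool → Fin n → V) (ε : Bool)
    (i : Fin n) : V := ∑ ε', ∑ k, F ε ε' i k • f ε' k

section

variable {V : Type*} [AddCommGroup V] [Module A V]
  (F G : Matrix Bool Bool (Matrix (Fin n) (Fin n) A)) (f f' : Bool → Fin n → V)

theorem sum_mul_smul (G F : Matrix (Fin n) (Fin n) A) (f : Fin n → V) (i : Fin n) :
    ∑ l, (G * F) i l • f l = ∑ k, G i k • ∑ l, F k l • f l := by
  simp only [Matrix.mul_apply, Finset.sum_smul, Finset.smul_sum, smul_smul]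
  exact Finset.sum_comm

theorem act_mul : act (G * F) f = act G (act F f) := by
  funext ε i
  simp only [act, Matrix.mul_apply (M := G) (N := F), Fintype.sum_bool, Matrix.add_apply, add_smul,
    Finset.sum_add_distrib, sum_mul_smul, smul_add]
  abel

theorem act_sub (ε : Bool) (i : Fin n) :
    act F (fun ε i => f ε i - f' ε i) ε i = act F f ε i - act F f' ε i := by
  simp only [act, smul_sub, Finset.sum_sub_distrib]

theorem map_act (P : Module.End A V) (ε : Bool) (i : Fin n) :
    P (act F f ε i) = act F (fun ε i => P (f ε i)) ε i := by
  simp only [act, map_sum, map_smul]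

end

/-- The operator `P` acts on the vectors `e ε i` by the block matrix `F`, modulo `N`. -/
def Rep (N : Submodule A (H W)) (e : Bool → Fin n → H W) (P : Module.End A (H W))
    (F : Matrix Bool Bool (Matrix (Fin n) (Fin n) A)) : Prop :=
  ∀ ε i, P (e ε i) - act F e ε i ∈ N

variable {N : Submodule A (H W)} {e : Bool → Fin n → H W} {P Q : Module.End A (H W)}
  {F G : Matrix Bool Bool (Matrix (Fin n) (Fin n) A)}

-- Coefficients are stored in rows, so matrices multiply in the order opposite to that of the
-- operators. The outer operator has to preserve `N`.
omit [Group W] in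
theorem Rep.mul (hN : ∀ u ∈ N, P u ∈ N) (hP : Rep N e P F) (hQ : Rep N e Q G) :
    Rep N e (P * Q) (G * F) := by
  intro ε i
  have h1 := hN _ (hQ ε i)
  rw [map_sub, map_act] at h1
  have h2 : act G (fun ε i => P (e ε i) - act F e ε i) ε i ∈ N :=
    N.sum_mem fun _ _ => N.sum_mem fun _ _ => N.smul_mem _ (hP _ _)
  rw [act_sub] at h2
  rw [act_mul, Module.End.mul_apply, ← sub_add_sub_cancel]
  exact N.add_mem h1 h2

omit [Group W] in
theorem Rep.sub (hP : Rep N e P F) (hQ : Rep N e Q G) : Rep N e (P - Q) (F - G) := by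
  intro ε i
  have := N.sub_mem (hP ε i) (hQ ε i)
  convert this using 1
  simp only [act, LinearMap.sub_apply, Matrix.sub_apply, sub_smul, Finset.sum_sub_distrib]
  abel

omit [Group W] in
theorem Rep.smul (a : A) (hP : Rep N e P F) : Rep N e (a • P) (a • F) := by
  intro ε i
  have := N.smul_mem a (hP ε i)
  convert this using 1
  simp only [act, LinearMap.smul_apply, Matrix.smul_apply, smul_sub, Finset.smul_sum, smul_smul,
    smul_eq_mul]

end Rep

/-! ### Degrees of coefficients in the standard basis -/

omit [Group W] in
theorem degLE_apply_of_stdT {P : Module.End A (H W)} {d e : ℤ}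
    (hP : ∀ w y, DegLE e (P (stdT w) y)) {u : H W} (hu : ∀ y, DegLE d (u y)) (y : W) :
    DegLE (d + e) (P u y) := by
  have h : u = u.sum fun w p => p • stdT w := by
    conv_lhs => rw [← Finsupp.sum_single u]
    simp [stdT]
  rw [h, Finsupp.sum, map_sum, Finsupp.finsetSum_apply]
  refine DegLE.sum fun w _ => ?_
  rw [map_smul, Finsupp.smul_apply, smul_eq_mul]
  exact (hu w).mul (hP w y)

omit [Group W] in
theorem degLE_stdT {d : ℤ} (hd : 0 ≤ d) (w y : W) : DegLE d (stdT w y) := by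
  by_cases h : y = w
  · rw [h, stdT_apply_self]
    exact DegLE.one hd
  · rw [stdT_apply_of_ne h]
    exact DegLE.zero

omit [Group W] in
theorem degLE_xi {s : W} (hs : 0 ≤ L s) : DegLE (L s) (xi L s) :=
  (DegLE.T _).sub ((DegLE.T _).mono (by omega))

theorem degLE_genOp {s : W} (hs : 0 ≤ L s) {d : ℤ} {u : H W} (hu : ∀ y, DegLE d (u y)) (y : W) :
    DegLE (d + L s) (genOp S L s u y) := by
  refine degLE_apply_of_stdT (fun w y => ?_) hu y
  by_cases hw : len S w < len S (s * w)
  · rw [genOp_stdT_of_lt hw]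
    exact degLE_stdT hs _ _
  · rw [genOp_stdT_of_not_lt hw, Finsupp.add_apply, Finsupp.smul_apply, smul_eq_mul]
    refine (degLE_stdT hs _ _).add ?_
    simpa using (degLE_xi hs).mul (degLE_stdT le_rfl w y)

theorem degLE_of_isKL {w : W} {c : H W} (hc : IsKL S L w c) (y : W) : DegLE 0 (c y) := by
  have := ((isNeg_iff.1 (hc.2 y)).mono (by omega)).add (degLE_stdT le_rfl w y)
  rwa [Finsupp.sub_apply, sub_add_cancel] at this

theorem degree_eq_of_degLE {p : A} {d : ℤ} (hp : DegLE d p) (hd : p.coeff d ≠ 0) :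
    LaurentPolynomial.degree p = d := by
  apply le_antisymm
  · refine Finset.max_le fun n hn => ?_
    rw [WithBot.coe_le_coe]
    by_contra h
    exact Finsupp.mem_support_iff.1 hn (hp n (by omega))
  · exact Finset.le_max (Finsupp.mem_support_iff.2 hd)

namespace IsHeckeSystem

variable (hS : IsHeckeSystem S L)
include hS

theorem degLE_stdOp (hpos : ∀ s ∈ S, 0 < L s) (w : W) {d : ℤ} {u : H W}
    (hu : ∀ y, DegLE d (u y)) : ∀ y, DegLE (d + L w) (stdOp S L w u y) := by
  induction w using hS.induction_left with
  | one =>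
    intro y
    rw [hS.stdOp_one, hS.weight_one, add_zero]
    exact hu y
  | step s hs w hw ih =>
    intro y
    rw [hS.stdOp_gen_mul hs hw, Module.End.mul_apply, hS.weight_gen_mul hs hw,
      add_comm (L s), ← add_assoc]
    exact degLE_genOp (hpos s hs).le ih y

theorem stdOp_of_genOp {v : H W} (hv : ∀ s ∈ S, genOp S L s v = (LaurentPolynomial.T (L s) : A) • v)
    (w : W) : stdOp S L w v = (LaurentPolynomial.T (L w) : A) • v := by
  induction w using hS.induction_left with
  | one => rw [hS.stdOp_one, hS.weight_one, LaurentPolynomial.T_zero, one_smul]; rfl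
  | step s hs w hw ih =>
    rw [hS.stdOp_gen_mul hs hw, Module.End.mul_apply, ih, map_smul, hv s hs, smul_smul, T_mul_T,
      hS.weight_gen_mul hs hw, add_comm]

end IsHeckeSystem

theorem op_eq_finsetSum (u v : H W) : op S L u v = ∑ w ∈ u.support, u w • stdOp S L w v := by
  have h : u = u.sum fun w p => p • stdT w := by
    conv_lhs => rw [← Finsupp.sum_single u]
    simp [stdT]
  conv_lhs => rw [h, Finsupp.sum, map_sum, LinearMap.sum_apply]
  refine Finset.sum_congr rfl fun w _ => ?_
  rw [map_smul, LinearMap.smul_apply, op_stdT]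

/-! ### Degrees at the identity and at the longest element -/

namespace IsKLFamily

variable {c : W → H W} (hS : IsHeckeSystem S L) (hc : IsKLFamily S L c)
include hc

theorem Del_eq (hS : IsHeckeSystem S L) {w : W} {d : ℤ} (h : DegLE (-d) (c w 1))
    (hd : (c w 1).coeff (-d) ≠ 0) : Del S L w = d := by
  rw [Del, klP, hc.klC_eq hS, degree_eq_of_degLE h hd]
  exact neg_neg d

theorem lead_eq (hS : IsHeckeSystem S L) {w : W} {d : ℤ} (h : DegLE (-d) (c w 1))
    (hd : (c w 1).coeff (-d) ≠ 0) : lead S L w = (c w 1).coeff (-d) := by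
  rw [lead, hc.Del_eq hS h hd, klP, hc.klC_eq hS]

theorem apply_self (w : W) : c w w = 1 := by
  have := mem_lower.1 (hc.sub_mem_lower w) w le_rfl
  rwa [Finsupp.sub_apply, stdT_apply_self, sub_eq_zero] at this

theorem apply_eq_zero {w y : W} (hne : y ≠ w) (hl : len S w ≤ len S y) : c w y = 0 := by
  have := mem_lower.1 (hc.sub_mem_lower w) y hl
  rwa [Finsupp.sub_apply, stdT_apply_of_ne hne, sub_zero] at this

theorem degLE_neg_one {w y : W} (hne : y ≠ w) : DegLE (-1) (c w y) := by
  have := isNeg_iff.1 ((hc.isKL w).2 y)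
  rwa [Finsupp.sub_apply, stdT_apply_of_ne hne, sub_zero] at this

variable [Finite W]
include hS

theorem repr_eq_zero {Z : Set W} {u : H W} (hu : u ∈ Submodule.span A (c '' Z)) {z : W}
    (hz : z ∉ Z) : (hc.basis hS).repr u z = 0 := by
  have e : c '' Z = hc.basis hS '' Z := Set.image_congr fun w _ => (hc.basis_apply hS w).symm
  rw [e, Module.Basis.mem_span_image] at hu
  by_contra h
  exact hz (hu (Finsupp.mem_support_iff.2 h))

theorem mem_span_of_repr {Z : Set W} {u : H W} (hu : ∀ z, (hc.basis hS).repr u z ≠ 0 → z ∈ Z) :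
    u ∈ Submodule.span A (c '' Z) := by
  have e : c '' Z = hc.basis hS '' Z := Set.image_congr fun w _ => (hc.basis_apply hS w).symm
  rw [e, Module.Basis.mem_span_image]
  exact fun z hz => hu z (Finsupp.mem_support_iff.1 hz)

theorem repr_apply (w z : W) [Decidable (w = z)] :
    (hc.basis hS).repr (c w) z = if w = z then 1 else 0 := by
  rw [hc.repr_self hS]
  split_ifs with h
  · rw [h, Finsupp.single_eq_same]
  · rw [Finsupp.single_eq_of_ne (Ne.symm h)]

theorem av_le_of_h_ne_zero (hpos : ∀ s ∈ S, 0 < L s) {av : W → ℕ}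
    (hav : ∀ s ∈ S, ∀ x z, h S L s x z ≠ 0 → av x ≤ av z) {w x z : W} (hz : h S L w x z ≠ 0) :
    av x ≤ av z := by
  have key := hc.preL_of_h_ne_zero hS hpos hz
  clear hz
  induction key using Relation.ReflTransGen.head_induction_on with
  | refl => exact le_rfl
  | head hab _ ih =>
    obtain ⟨s, hs, h'⟩ := hab
    exact ih.trans (hav s hs _ _ h')

/-- The coefficient of an element of maximal length. -/
theorem repr_eq_apply {w₀ : W} (hlen : ∀ x, len S x ≤ len S w₀) (u : H W) :
    (hc.basis hS).repr u w₀ = u w₀ := by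
  classical
  have : Finsupp.lapply w₀ ∘ₗ (hc.basis hS).repr.toLinearMap =
      (Finsupp.lapply w₀ : H W →ₗ[A] A) := by
    refine (hc.basis hS).ext fun w => ?_
    simp only [LinearMap.comp_apply, LinearEquiv.coe_coe, hc.basis_apply hS, Finsupp.lapply_apply,
      hc.repr_apply hS]
    split_ifs with h
    · rw [h, hc.apply_self]
    · rw [hc.apply_eq_zero (Ne.symm h) (hlen w)]
  exact LinearMap.congr_fun this u

variable (hpos : ∀ s ∈ S, 0 < L s) {w₀ : W} (hlen : ∀ x, len S x ≤ len S w₀)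
  (hL : ∀ x, x ≠ w₀ → L x < L w₀)
include hpos hlen hL

/-- Expand `C_x` in the `T_w`: multiplication by `T_w` raises degrees by at most `L(w)`. A term with
`w ≠ x` has a coefficient of negative degree, and for `w = x` one has `L(x) < L(w₀)`. Each term
misses the degree `L(w₀)`. -/
theorem degLE_h_top {x y : W} (hx : x ≠ w₀) : DegLE (L w₀ - 1) (h S L x y w₀) := by
  rw [hc.h_eq hS, hc.repr_eq_apply hS hlen, op_eq_finsetSum, Finsupp.finsetSum_apply]
  refine DegLE.sum fun w _ => ?_
  rw [Finsupp.smul_apply, smul_eq_mul]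
  have h1 := hS.degLE_stdOp hpos w (degLE_of_isKL (hc.isKL y)) w₀
  by_cases hw : w = x
  · subst hw
    exact ((degLE_of_isKL (hc.isKL w) w).mul h1).mono (by have := hL w hx; omega)
  · have h2 : L w ≤ L w₀ := by
      by_cases h : w = w₀
      · rw [h]
      · exact (hL w h).le
    exact ((hc.degLE_neg_one hw).mul h1).mono (by omega)

-- Here `T_w C_{w₀} = q^L(w) C_{w₀}`, so the coefficient is the sum of the `p_{w,w₀} q^L(w)`, in
-- which only `w = w₀` reaches degree `L(w₀)`.
omit hpos in
theorem degLE_h_top_self (hT : ∀ s ∈ S, genOp S L s (c w₀) = (LaurentPolynomial.T (L s) : A) • c w₀) :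
    DegLE (L w₀) (h S L w₀ w₀ w₀) ∧ (h S L w₀ w₀ w₀).coeff (L w₀) = 1 := by
  have := Fintype.ofFinite W
  classical
  have e : h S L w₀ w₀ w₀ = ∑ w ∈ (c w₀).support.erase w₀, c w₀ w * LaurentPolynomial.T (L w) +
      LaurentPolynomial.T (L w₀) := by
    rw [hc.h_eq hS, hc.repr_eq_apply hS hlen, op_eq_finsetSum, Finsupp.finsetSum_apply,
      ← Finset.sum_erase_add (a := w₀)]
    · congr 1
      · refine Finset.sum_congr rfl fun w _ => ?_
        rw [hS.stdOp_of_genOp hT, Finsupp.smul_apply, Finsupp.smul_apply, hc.apply_self,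
          smul_eq_mul, smul_eq_mul, mul_one]
      · rw [hS.stdOp_of_genOp hT, Finsupp.smul_apply, Finsupp.smul_apply, hc.apply_self,
          smul_eq_mul, smul_eq_mul, mul_one, one_mul]
    · rw [Finsupp.mem_support_iff, hc.apply_self]
      exact one_ne_zero
  have h1 : DegLE (L w₀ - 1) (∑ w ∈ (c w₀).support.erase w₀, c w₀ w * LaurentPolynomial.T (L w)) := by
    refine DegLE.sum fun w hw => ?_
    have hne := (Finset.mem_erase.1 hw).1
    exact ((hc.degLE_neg_one hne).mul (DegLE.T _)).mono (by have := hL w hne; omega)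
  rw [e]
  refine ⟨(h1.mono (by omega)).add (DegLE.T _), ?_⟩
  rw [AddMonoidAlgebra.coeff_add, Finsupp.add_apply, h1 _ (by omega), coeff_T_self, zero_add]

/-- The coefficients of `C_{w₀}` for the longest element `w₀`. -/
theorem h_top (hinv : w₀⁻¹ = w₀)
    (hT : ∀ s ∈ S, genOp S L s (c w₀) = (LaurentPolynomial.T (L s) : A) • c w₀) (x y : W) :
    DegLE (L w₀) (h S L x y w₀) ∧
      (h S L x y w₀).coeff (L w₀) = (open Classical in if x = w₀ ∧ y = w₀ then 1 else 0) := by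
  by_cases hx : x = w₀
  · by_cases hy : y = w₀
    · subst hx
      subst hy
      rw [if_pos ⟨rfl, rfl⟩]
      exact hc.degLE_h_top_self hS hlen hL hT
    · rw [if_neg fun h => hy h.2, hc.h_flip hS, hinv]
      have := hc.degLE_h_top hS hpos hlen hL (x := y⁻¹) (y := x⁻¹)
        fun h => hy (by rw [← hinv, ← h, inv_inv])
      exact ⟨this.mono (by omega), this _ (by omega)⟩
  · rw [if_neg fun h => hx h.1]
    have := hc.degLE_h_top hS hpos hlen hL (y := y) hx
    exact ⟨this.mono (by omega), this _ (by omega)⟩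

end IsKLFamily

end HeckeKL

end

noncomputable section

namespace HeckeKL

variable {W : Type*} [Group W]

/-! ### Block matrices of fusion type -/

section Block

variable {n : ℕ}

/-- The matrix `U_l (p + r X)`. -/
def fusionMatrix (n : ℕ) (p r : A) (l : ℕ) : Matrix (Fin n) (Fin n) A :=
  pathU A n l * (p • 1 + r • pathX A n)

theorem fusionMatrix_apply (p r : A) (l : ℕ) (i k : Fin n) : fusionMatrix n p r l i k =
    p * (pathU ℤ n l i k : ℤ) + r * ((pathU ℤ n l * pathX ℤ n) i k : ℤ) := by
  have h1 : pathU A n l = (pathU ℤ n l).map (Int.castRingHom A) := (pathU_map _ _).symm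
  have h2 : pathU A n l * pathX A n = (pathU ℤ n l * pathX ℤ n).map (Int.castRingHom A) := by
    rw [Matrix.map_mul, pathU_map, pathX_map]
  rw [fusionMatrix, mul_add, mul_smul_comm, mul_smul_comm, mul_one, h2, h1, Matrix.add_apply,
    Matrix.smul_apply, Matrix.smul_apply, Matrix.map_apply, Matrix.map_apply, smul_eq_mul,
    smul_eq_mul]
  rfl

theorem fusionMatrix_commute (p r : A) (l : ℕ) : Commute (fusionMatrix n p r l) (pathX A n) :=
  (pathU_commute_pathX l).mul_left
    (((Commute.one_left _).smul_left p).add_left ((Commute.refl _).smul_left r))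

theorem degLE_fusionMatrix {b : ℤ} {p r : A} (hp : DegLE b p) (hr : DegLE b r) (l : ℕ)
    (i k : Fin n) : DegLE b (fusionMatrix n p r l i k) := by
  rw [fusionMatrix_apply]
  exact (hp.mul_intCast _).add (hr.mul_intCast _)

theorem coeff_fusionMatrix {b : ℤ} {p r : A} (hr : DegLE (b - 1) r) (l : ℕ)
    (i k : Fin n) : (fusionMatrix n p r l i k).coeff b = p.coeff b * pathU ℤ n l i k := by
  rw [fusionMatrix_apply, AddMonoidAlgebra.coeff_add, Finsupp.add_apply, coeff_mul_intCast,
    hr.mul_intCast _ b (by omega), add_zero]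

theorem fusionMatrix_add_two (p r : A) (l : ℕ) : fusionMatrix n p r (l + 2) =
    fusionMatrix n p r (l + 1) * pathX A n - fusionMatrix n p r l := by
  rw [(fusionMatrix_commute p r (l + 1)).eq, fusionMatrix, pathU, sub_mul, mul_assoc]
  rfl

theorem fusionMatrix_one (p r : A) :
    fusionMatrix n p r 1 = fusionMatrix n p r 0 * pathX A n := by
  rw [(fusionMatrix_commute p r 0).eq, fusionMatrix, fusionMatrix, pathU, pathU, one_mul]

theorem fusionMatrix_zero (p r : A) : fusionMatrix n p r 0 = p • 1 + r • pathX A n := by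
  rw [fusionMatrix, pathU, one_mul]

/-- The block matrix with blocks `U_l (p d ε + r d ε X)` in its column `c`, and zero elsewhere. -/
def fusionBlock (n : ℕ) (p r : Bool → Bool → A) (c : Bool) (l : ℕ) (d : Bool) :
    Matrix Bool Bool (Matrix (Fin n) (Fin n) A) :=
  Matrix.of fun ε ε' => if ε' = c then fusionMatrix n (p d ε) (r d ε) l else 0

theorem fusionBlock_apply (p r : Bool → Bool → A) (c : Bool) (l : ℕ) (d ε ε' : Bool) :
    fusionBlock n p r c l d ε ε' = if ε' = c then fusionMatrix n (p d ε) (r d ε) l else 0 := rfl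

/-- The block matrix with blocks `f ε ε'`. -/
def scalarBlock (n : ℕ) (f : Bool → Bool → A) : Matrix Bool Bool (Matrix (Fin n) (Fin n) A) :=
  Matrix.of fun ε ε' => f ε ε' • 1

theorem scalarBlock_apply (f : Bool → Bool → A) (ε ε' : Bool) :
    scalarBlock n f ε ε' = f ε ε' • 1 := rfl

open Classical in
/-- Block matrices attached to the elements of `W`: those given by `F` on the elements `el ε i δ`,
and block scalar ones on all other elements. -/
def cellF (V : Bool → Fin n → Bool → Prop) (el : Bool → Fin n → Bool → W)
    (F : Bool → Fin n → Bool → Matrix Bool Bool (Matrix (Fin n) (Fin n) A))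
    (f : W → Bool → Bool → A) (w : W) : Matrix Bool Bool (Matrix (Fin n) (Fin n) A) :=
  if h : ∃ x : Bool × Fin n × Bool, V x.1 x.2.1 x.2.2 ∧ w = el x.1 x.2.1 x.2.2 then
    F h.choose.1 h.choose.2.1 h.choose.2.2 else scalarBlock n (f w)

variable {V : Bool → Fin n → Bool → Prop} {el : Bool → Fin n → Bool → W}
    {F : Bool → Fin n → Bool → Matrix Bool Bool (Matrix (Fin n) (Fin n) A)}
    {f : W → Bool → Bool → A}

omit [Group W] in
theorem cellF_el (inj : ∀ ε i δ ε' i' δ', V ε i δ → V ε' i' δ' → el ε i δ = el ε' i' δ' →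
    ε = ε' ∧ i = i' ∧ δ = δ') {ε i δ} (hv : V ε i δ) : cellF V el F f (el ε i δ) = F ε i δ := by
  have h : ∃ x : Bool × Fin n × Bool, V x.1 x.2.1 x.2.2 ∧ el ε i δ = el x.1 x.2.1 x.2.2 :=
    ⟨(ε, i, δ), hv, rfl⟩
  rw [cellF, dif_pos h]
  obtain ⟨h1, h2, h3⟩ := inj _ _ _ _ _ _ hv h.choose_spec.1 h.choose_spec.2
  rw [← h1, ← h2, ← h3]

omit [Group W] in
theorem cellF_single {w : W} (hw : ¬ ∃ ε i δ, V ε i δ ∧ w = el ε i δ) :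
    cellF V el F f w = scalarBlock n (f w) := by
  rw [cellF, dif_neg]
  rintro ⟨⟨ε, i, δ⟩, h⟩
  exact hw ⟨ε, i, δ, h⟩

open Classical in
/-- The vectors `C_w` for `w = el ε i δ`. -/
def cellVec (V : Bool → Fin n → Bool → Prop) (el : Bool → Fin n → Bool → W) (c : W → H W)
    (δ ε : Bool) (i : Fin n) : H W := if V ε i δ then c (el ε i δ) else 0

/-- The submodule is spanned by basis elements outside the cell, so working modulo it does not
affect the coefficients at the elements `el ε' k δ'`. Last letters are kept apart by using one set
of vectors for each `δ`. -/
theorem IsKLFamily.h_of_rep {S : Set W} {L : W → ℤ} [Finite W] {c : W → H W}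
    (hS : IsHeckeSystem S L)
    (hc : IsKLFamily S L c) (inj : ∀ ε i δ ε' i' δ', V ε i δ → V ε' i' δ' →
      el ε i δ = el ε' i' δ' → ε = ε' ∧ i = i' ∧ δ = δ') {Z : Set W}
    (hZ : ∀ ε i δ, V ε i δ → el ε i δ ∉ Z) {w : W}
    {F : Matrix Bool Bool (Matrix (Fin n) (Fin n) A)} {δ : Bool}
    (hF : Rep (Submodule.span A (c '' Z)) (cellVec V el c δ) (op S L (c w)) F)
    {ε ε' δ' : Bool} {i k : Fin n} (hv : V ε i δ) (hv' : V ε' k δ') :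
    h S L w (el ε i δ) (el ε' k δ') = if δ = δ' then F ε ε' i k else 0 := by
  classical
  have h1 := hc.repr_eq_zero hS (hF ε i) (hZ ε' k δ' hv')
  rw [cellVec, if_pos hv, map_sub, Finsupp.sub_apply, sub_eq_zero] at h1
  have h2 : ∀ ε'' k', (hc.basis hS).repr (cellVec V el c δ ε'' k') (el ε' k δ') =
      if δ = δ' then if ε'' = ε' then if k' = k then 1 else 0 else 0 else 0 := by
    intro ε'' k'
    rw [cellVec]
    by_cases hv'' : V ε'' k' δ
    · rw [if_pos hv'', hc.repr_apply hS]
      by_cases he : el ε'' k' δ = el ε' k δ'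
      · obtain ⟨h3, h4, h5⟩ := inj _ _ _ _ _ _ hv'' hv' he
        rw [if_pos he, if_pos h5, if_pos h3, if_pos h4]
      · rw [if_neg he]
        split_ifs with h3 h4 h5
        · subst h3 h4 h5
          exact absurd rfl he
        all_goals rfl
    · rw [if_neg hv'', map_zero, Finsupp.zero_apply]
      split_ifs with h3 h4 h5
      · subst h3 h4 h5
        exact absurd hv' hv''
      all_goals rfl
  rw [hc.h_eq hS, h1]
  simp only [act, map_sum, map_smul, Finsupp.finsetSum_apply, Finsupp.smul_apply, h2, smul_eq_mul]
  by_cases hδ : δ = δ'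
  · simp [hδ]
  · simp [hδ]

end Block

/-! ### Kazhdan-Lusztig families of dihedral groups -/

section Family

variable {g : Bool → W} {M : ℕ}

open Classical in
/-- The family with value `G c k` at the alternating word `al g c k`. -/
def wordFamily (g : Bool → W) (M : ℕ) (G : Bool → ℕ → H W) (w : W) : H W :=
  if h : ∃ x : Bool × ℕ, x.2 ≤ M ∧ w = al g x.1 x.2 then G h.choose.1 h.choose.2 else 0

variable (hg : IsDihedral g M) {G : Bool → ℕ → H W}
include hg

theorem wordFamily_al (h0 : ∀ c, G (!c) 0 = G c 0) (hM : ∀ c, G (!c) M = G c M) {c : Bool}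
    {k : ℕ} (hk : k ≤ M) : wordFamily g M G (al g c k) = G c k := by
  have h : ∃ x : Bool × ℕ, x.2 ≤ M ∧ al g c k = al g x.1 x.2 := ⟨(c, k), hk, rfl⟩
  rw [wordFamily, dif_pos h]
  obtain ⟨h1, h2⟩ := hg.al_inj _ _ _ _ hk h.choose_spec.1 h.choose_spec.2
  rw [← h1]
  have key : ∀ d : Bool, (∀ c, G (!c) k = G c k) → G d k = G c k := by
    intro d hd
    cases c <;> cases d
    · rfl
    · exact hd false
    · exact hd true
    · rfl
  rcases h2 with h2 | rfl | rfl
  · rw [← h2]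
  · exact key _ h0
  · exact key _ hM

theorem isKLFamily_wordFamily {L : W → ℤ} (h0 : ∀ c, G (!c) 0 = G c 0)
    (hM : ∀ c, G (!c) M = G c M)
    (hbar : ∀ c k, k ≤ M → bar (Set.range g) L (G c k) = G c k)
    (hneg : ∀ c k, k ≤ M → NegLower (Set.range g) k (G c k - stdT (al g c k))) :
    IsKLFamily (Set.range g) L (wordFamily g M G) where
  isKL w := by
    obtain ⟨c, k, hk, rfl⟩ := hg.exists_al w
    rw [wordFamily_al hg h0 hM hk]
    exact ⟨hbar c k hk, (hneg c k hk).2⟩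
  sub_mem_lower w := by
    obtain ⟨c, k, hk, rfl⟩ := hg.exists_al w
    rw [wordFamily_al hg h0 hM hk, hg.len_al hk]
    exact (hneg c k hk).1

end Family

namespace IsDihedral

variable {g : Bool → W} {M : ℕ} (hg : IsDihedral g M)
include hg

theorem top_inv : (al g false M)⁻¹ = al g false M := by
  obtain ⟨k, rfl⟩ : ∃ k, M = k + 1 := ⟨M - 1, by have := hg.three_le; omega⟩
  rw [hg.inv_al]
  cases tog false k
  · rfl
  · exact (hg.al_top false).symm

theorem al_top_eq (c : Bool) : al g c M = al g false M := by
  cases c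
  · rfl
  · exact (hg.al_top false).symm

theorem len_le_top (x : W) : len (Set.range g) x ≤ len (Set.range g) (al g false M) := by
  obtain ⟨c, k, hk, rfl⟩ := hg.exists_al x
  rw [hg.len_al hk, hg.len_al le_rfl]
  exact hk

theorem len_lt_top {x : W} (hx : x ≠ al g false M) :
    len (Set.range g) x < len (Set.range g) (al g false M) := by
  obtain ⟨c, k, hk, rfl⟩ := hg.exists_al x
  rw [hg.len_al hk, hg.len_al le_rfl]
  refine lt_of_le_of_ne hk ?_
  rintro rfl
  exact hx (hg.al_top_eq c)

variable {L : W → ℤ} (hL : IsWeight (Set.range g) L)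
include hL

theorem weight_lt_top (hpos : ∀ c, 0 < L (g c)) {x : W} (hx : x ≠ al g false M) :
    L x < L (al g false M) := by
  have h := hg.len_lt_top hx
  obtain ⟨c, k, hk, rfl⟩ := hg.exists_al x
  rw [hg.len_al hk, hg.len_al le_rfl] at h
  rw [hg.L_al hL hk, hg.L_al hL le_rfl]
  exact lw_lt_lw hpos h

theorem genOp_Gam_top (d : Bool) : genOp (Set.range g) L (g d) (Gam g L false M) =
    (LaurentPolynomial.T (L (g d)) : A) • Gam g L false M := by
  have e : Gam g L false M = Gam g L d M := by
    cases d
    · rfl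
    · exact (hg.Gam_top hL false).symm
  have := hg.klOp_Gam_self (L := L) (c := d) le_rfl
  rw [e]
  rw [klOp_apply, eta, add_smul] at this
  exact add_right_cancel this

end IsDihedral

theorem degLE_eta {m : ℤ} (hm : 0 ≤ m) : DegLE m (eta m) :=
  (DegLE.T _).add ((DegLE.T _).mono (by omega))

theorem coeff_eta {m : ℤ} (hm : 0 < m) : (eta m).coeff m = 1 := by
  rw [eta, AddMonoidAlgebra.coeff_add, Finsupp.add_apply, coeff_T_self,
    (DegLE.T (-m)) m (by omega), add_zero]

theorem sum_pathX_smul {V : Type*} [AddCommGroup V] [Module A V] {n : ℕ} (f : ℕ → V) (i : Fin n) :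
    ∑ k : Fin n, pathX A n i k • f k =
      (if (i : ℕ) + 1 < n then f (i + 1) else 0) + if 1 ≤ (i : ℕ) then f (i - 1) else 0 := by
  have e : ∀ k : Fin n, pathX A n i k • f k =
      (if (i : ℕ) + 1 = k then f k else 0) + if (k : ℕ) + 1 = i then f k else 0 := by
    intro k
    unfold pathX
    by_cases h1 : (i : ℕ) + 1 = k
    · rw [if_pos (Or.inl h1), if_pos h1, if_neg (by omega), one_smul, add_zero]
    · by_cases h2 : (k : ℕ) + 1 = i
      · rw [if_pos (Or.inr h2), if_neg h1, if_pos h2, one_smul, zero_add]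
      · rw [if_neg (by omega), if_neg h1, if_neg h2, zero_smul, zero_add]
  rw [Finset.sum_congr rfl fun k _ => e k, Finset.sum_add_distrib]
  congr 1
  · split_ifs with h
    · rw [Finset.sum_eq_single ⟨i + 1, h⟩]
      · rw [if_pos rfl]
      · intro k _ hk
        rw [if_neg]
        intro h'
        exact hk (Fin.ext h'.symm)
      · exact fun h' => absurd (Finset.mem_univ _) h'
    · refine Finset.sum_eq_zero fun k _ => if_neg ?_
      omega
  · split_ifs with h
    · rw [Finset.sum_eq_single ⟨i - 1, by omega⟩]
      · exact if_pos (Nat.sub_add_cancel h)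
      · intro k _ hk
        rw [if_neg]
        intro h'
        exact hk (Fin.ext (by simp only; omega))
      · exact fun h' => absurd (Finset.mem_univ _) h'
    · refine Finset.sum_eq_zero fun k _ => if_neg ?_
      omega

theorem IsKLFamily.av_le_of_h_ne_zero_right {S : Set W} {L : W → ℤ} {c : W → H W}
    (hS : IsHeckeSystem S L) (hc : IsKLFamily S L c) [Finite W]
    (hpos : ∀ s ∈ S, 0 < L s) {av : W → ℕ}
    (hav : ∀ s ∈ S, ∀ x z, h S L s x z ≠ 0 → av x ≤ av z) (hinv : ∀ w, av w⁻¹ = av w) {w x z : W}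
    (hz : h S L x w z ≠ 0) : av x ≤ av z := by
  rw [hc.h_flip hS] at hz
  simpa only [hinv] using hc.av_le_of_h_ne_zero hS hpos hav hz

theorem IsKLFamily.h_one_right {S : Set W} {L : W → ℤ} {c : W → H W}
    (hS : IsHeckeSystem S L) (hc : IsKLFamily S L c) [Finite W] (x : W) :
    h S L x 1 = Finsupp.single x 1 := by
  rw [hc.h_eq hS, hc.klC_one hS, ← mul_eq_op, hS.mul_one', hc.repr_self hS]

theorem IsKLFamily.h_apply_one {S : Set W} {L : W → ℤ} {c : W → H W}
    (hS : IsHeckeSystem S L) (hc : IsKLFamily S L c) [Finite W]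
    (hpos : ∀ s ∈ S, 0 < L s) {av : W → ℕ}
    (hav : ∀ s ∈ S, ∀ x z, h S L s x z ≠ 0 → av x ≤ av z) (h1 : ∀ w, av w = 0 ↔ w = 1) (x y : W) :
    h S L x y 1 = open Classical in if x = 1 ∧ y = 1 then 1 else 0 := by
  by_cases hy : y = 1
  · subst hy
    rw [hc.h_one_right hS]
    by_cases hx : x = 1
    · rw [hx, Finsupp.single_eq_same, if_pos ⟨rfl, rfl⟩]
    · rw [Finsupp.single_eq_of_ne (Ne.symm hx), if_neg fun h => hx h.1]
  · rw [if_neg fun h => hy h.2]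
    by_contra hne
    have := hc.av_le_of_h_ne_zero hS hpos hav hne
    rw [(h1 1).2 rfl, Nat.le_zero, h1] at this
    exact hy this

/-! ### Dihedral groups with equal parameters -/

/-- The Kazhdan-Lusztig elements in the case of equal parameters. -/
def eqG (g : Bool → W) (L : W → ℤ) (c : Bool) : ℕ → H W
  | 0 => stdT 1
  | k + 1 => Gam g L c (k + 1)

/-- The a-function in the case of equal parameters. -/
def eqAv (g : Bool → W) (M : ℕ) (L : W → ℤ) (w : W) : ℕ :=
  open Classical in
  if w = 1 then 0 else if w = al g false M then (L (al g false M)).toNat else (L (g false)).toNat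

namespace IsDihedral

variable {g : Bool → W} {M : ℕ} (hg : IsDihedral g M) {L : W → ℤ}
  (hL : IsWeight (Set.range g) L) (heq : ∀ c, L (g c) = L (g !c))
include hg heq

theorem klOp_Gam_not_eq {c : Bool} {k : ℕ} (hk : k + 1 < M) :
    klOp (Set.range g) L (g c) (Gam g L (!c) (k + 1)) = Gam g L c (k + 2) + Gam g L c k := by
  rw [hg.klOp_Gam_not hk, heq c, sub_self, LaurentPolynomial.T_zero, one_smul]

include hL

/-- For equal parameters the recursion has coefficient `1` and expresses `Γ` at length `k + 2`
through bar invariant elements and the bar invariant operator `C_c`. Two consecutive lengths are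
carried through the induction. -/
theorem bar_Gam {k : ℕ} (c : Bool) (hk : k ≤ M) :
    bar (Set.range g) L (Gam g L c k) = Gam g L c k := by
  have hS := hg.isHeckeSystem hL
  have key : ∀ k, (∀ c, k ≤ M → bar (Set.range g) L (Gam g L c k) = Gam g L c k) ∧
      ∀ c, k + 1 ≤ M → bar (Set.range g) L (Gam g L c (k + 1)) = Gam g L c (k + 1) := by
    intro k
    induction k with
    | zero =>
      refine ⟨fun c _ => by rw [Gam_zero, bar_zero], fun c _ => ?_⟩
      rw [zero_add, ← hg.klOp_one, hS.bar_klOp ⟨c, rfl⟩, hS.bar_stdT_one]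
    | succ k ih =>
      refine ⟨ih.2, fun c hk => ?_⟩
      rw [← add_sub_cancel_right (Gam g L c (k + 1 + 1)) (Gam g L c k),
        ← hg.klOp_Gam_not_eq heq (by omega), bar_sub, hS.bar_klOp ⟨c, rfl⟩, ih.2 _ (by omega),
        ih.1 _ (by omega)]
  exact (key k).1 c hk

theorem isKLFamily_eq (hpos : ∀ c, 0 < L (g c)) :
    IsKLFamily (Set.range g) L (wordFamily g M (eqG g L)) := by
  have hM := hg.three_le
  obtain ⟨m, rfl⟩ : ∃ m, M = m + 1 := ⟨M - 1, by omega⟩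
  refine isKLFamily_wordFamily hg (fun _ => rfl) (fun c => hg.Gam_top hL c) ?_ ?_
  · rintro c (_ | k) hk
    · exact (hg.isHeckeSystem hL).bar_stdT_one
    · exact hg.bar_Gam hL heq c hk
  · rintro c (_ | k) hk
    · rw [eqG, al_zero, sub_self]
      exact NegLower.zero
    · exact hg.negLower_Gam_sub hpos hk

omit heq in
theorem eqC_one : wordFamily g M (eqG g L) 1 = stdT 1 := by
  have hM := hg.three_le
  obtain ⟨m, rfl⟩ : ∃ m, M = m + 1 := ⟨M - 1, by omega⟩
  exact wordFamily_al hg (G := eqG g L) (c := false) (fun _ => rfl) (fun c => hg.Gam_top hL c) (Nat.zero_le _)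

omit heq in
theorem eqC_al {c : Bool} {k : ℕ} (hk : k + 1 ≤ M) :
    wordFamily g M (eqG g L) (al g c (k + 1)) = Gam g L c (k + 1) := by
  have hM := hg.three_le
  obtain ⟨m, rfl⟩ : ∃ m, M = m + 1 := ⟨M - 1, by omega⟩
  exact wordFamily_al hg (G := eqG g L) (fun _ => rfl) (fun c => hg.Gam_top hL c) hk

omit heq in
theorem eqC_top : wordFamily g M (eqG g L) (al g false M) = Gam g L false M := by
  have hM := hg.three_le
  obtain ⟨m, rfl⟩ : ∃ m, M = m + 1 := ⟨M - 1, by omega⟩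
  exact hg.eqC_al hL le_rfl

omit heq in
theorem op_Gam_one (c : Bool) :
    op (Set.range g) L (Gam g L c 1) = klOp (Set.range g) L (g c) := by
  have hS := hg.isHeckeSystem hL
  rw [← hg.klOp_one, IsKLFamily.op_klOp hS ⟨c, rfl⟩, hS.op_one, mul_one]

theorem op_Gam_two (c : Bool) : op (Set.range g) L (Gam g L c 2) =
    klOp (Set.range g) L (g c) * op (Set.range g) L (Gam g L (!c) 1) := by
  have hS := hg.isHeckeSystem hL
  have h := hg.klOp_Gam_not_eq heq (c := c) (k := 0) (by have := hg.three_le; omega)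
  rw [Gam_zero, add_zero, zero_add] at h
  rw [← h, IsKLFamily.op_klOp hS ⟨c, rfl⟩]

theorem op_Gam_add_two {c : Bool} {k : ℕ} (hk : k + 1 < M) :
    op (Set.range g) L (Gam g L c (k + 2)) = klOp (Set.range g) L (g c) *
      op (Set.range g) L (Gam g L (!c) (k + 1)) - op (Set.range g) L (Gam g L c k) := by
  have hS := hg.isHeckeSystem hL
  rw [← add_sub_cancel_right (Gam g L c (k + 2)) (Gam g L c k), ← hg.klOp_Gam_not_eq heq hk,
    map_sub, IsKLFamily.op_klOp hS ⟨c, rfl⟩]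

end IsDihedral

/-! ### The fusion cell for equal parameters -/

/-- The coefficients of the block matrices of the fusion cell, for equal parameters `a`. -/
def eqP (a : ℤ) (d ε : Bool) : A := if d = ε then eta a else 0

/-- The coefficients of the block matrices of the fusion cell, for equal parameters. -/
def eqR (d ε : Bool) : A := if d = ε then 0 else 1

/-- The position `(ε, i, δ)` is that of an alternating word in the case of equal parameters. -/
def eqV {n : ℕ} (ε : Bool) (i : Fin n) (δ : Bool) : Prop := δ = tog ε i

/-- The alternating words of lengths `1, …, n`. -/
def eqEl {n : ℕ} (g : Bool → W) (ε : Bool) (i : Fin n) (_ : Bool) : W := al g ε (i + 1)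

/-- Block scalars for the elements outside of the fusion cell. -/
def eqF (w : W) (ε ε' : Bool) : A := open Classical in if w = 1 ∧ ε = ε' then 1 else 0

theorem eqP_self (a : ℤ) (c : Bool) : eqP a c c = eta a := if_pos rfl

theorem eqP_not (a : ℤ) (c : Bool) : eqP a c (!c) = 0 := if_neg (by cases c <;> decide)

theorem eqR_self (c : Bool) : eqR c c = 0 := if_pos rfl

theorem eqR_not (c : Bool) : eqR c (!c) = 1 := if_neg (by cases c <;> decide)

namespace IsDihedral

section

variable {g : Bool → W} {M : ℕ} (hg : IsDihedral g M) {L : W → ℤ}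
  (hL : IsWeight (Set.range g) L) (heq : ∀ c, L (g c) = L (g !c)) (hpos : ∀ c, 0 < L (g c))
include hg

theorem al_ne_one {c : Bool} {k : ℕ} (hk : k + 1 ≤ M) : al g c (k + 1) ≠ 1 := by
  intro h
  rw [← al_zero g c] at h
  have := (hg.al_inj _ _ _ _ hk (Nat.zero_le _) h).1
  omega

theorem al_ne_top {c : Bool} {k : ℕ} (hk : k < M) : al g c k ≠ al g false M := by
  intro h
  have := (hg.al_inj _ _ _ _ hk.le le_rfl h).1
  omega

theorem top_ne_one : al g false M ≠ 1 := fun h =>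
  hg.al_ne_top (c := false) (by have := hg.three_le; omega : 0 < M) h.symm

omit hg in
theorem eqAv_one : eqAv g M L 1 = 0 := by
  rw [eqAv, if_pos rfl]

theorem eqAv_top : eqAv g M L (al g false M) = (L (al g false M)).toNat := by
  rw [eqAv, if_neg hg.top_ne_one, if_pos rfl]

theorem eqAv_al {c : Bool} {k : ℕ} (hk : k + 1 < M) :
    eqAv g M L (al g c (k + 1)) = (L (g false)).toNat := by
  rw [eqAv, if_neg (hg.al_ne_one hk.le), if_neg (hg.al_ne_top hk)]

include hL hpos

theorem weight_gen_lt_top : L (g false) < L (al g false M) := by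
  rw [← al_one g false]
  exact hg.weight_lt_top hL hpos (hg.al_ne_top (by have := hg.three_le; omega))

theorem le_eqAv {c : Bool} {k : ℕ} (hk : k + 1 ≤ M) :
    (L (g false)).toNat ≤ eqAv g M L (al g c (k + 1)) := by
  rcases hk.lt_or_eq with h | h
  · rw [hg.eqAv_al h]
  · rw [h, hg.al_top_eq, hg.eqAv_top]
    exact Int.toNat_le_toNat (hg.weight_gen_lt_top hL hpos).le

theorem eqAv_eq_zero_iff (w : W) : eqAv g M L w = 0 ↔ w = 1 := by
  constructor
  · intro h
    obtain ⟨c, k, hk, rfl⟩ := hg.exists_al w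
    rcases k with _ | k
    · rfl
    · have h1 := hg.le_eqAv hL hpos (c := c) hk
      have h2 := hpos false
      omega
  · rintro rfl
    exact eqAv_one

theorem mem_span_Gam {k N : ℕ} (c : Bool) (hk : k ≤ M) (hN : N ≤ (L (g false)).toNat) :
    Gam g L c k ∈ Submodule.span A (wordFamily g M (eqG g L) '' {z | N ≤ eqAv g M L z}) := by
  rcases k with _ | k
  · rw [Gam_zero]
    exact Submodule.zero_mem _
  · rw [← hg.eqC_al hL hk]
    exact Submodule.subset_span ⟨_, hN.trans (hg.le_eqAv hL hpos hk), rfl⟩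

include heq

theorem klOp_mem_span (d : Bool) (x : W) :
    klOp (Set.range g) L (g d) (wordFamily g M (eqG g L) x) ∈
      Submodule.span A (wordFamily g M (eqG g L) '' {z | eqAv g M L x ≤ eqAv g M L z}) := by
  obtain ⟨c, k, hk, rfl⟩ := hg.exists_al x
  rcases k with _ | k
  · rw [al_zero, hg.eqC_one hL, hg.klOp_one, eqAv_one]
    exact hg.mem_span_Gam hL hpos d (by have := hg.three_le; omega) (Nat.zero_le _)
  -- The vectors are compared and not the letters, so that the longest element is treated as an
  -- eigenvector for both generators.
  · by_cases hcd : Gam g L c (k + 1) = Gam g L d (k + 1)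
    · rw [hg.eqC_al hL hk, hcd, hg.klOp_Gam_self hk, ← hcd, ← hg.eqC_al hL hk]
      exact Submodule.smul_mem _ _ (Submodule.subset_span ⟨_, le_refl (eqAv g M L _), rfl⟩)
    · obtain rfl : c = !d := by
        cases c <;> cases d <;> first | rfl | exact absurd rfl hcd
      have hkM : k + 1 < M := by
        refine lt_of_le_of_ne hk ?_
        intro h
        rw [h] at hcd
        exact hcd (hg.Gam_top hL d)
      rw [hg.eqC_al hL hk, hg.klOp_Gam_not_eq heq hkM, hg.eqAv_al hkM]
      exact Submodule.add_mem _ (hg.mem_span_Gam hL hpos _ (by omega) le_rfl)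
        (hg.mem_span_Gam hL hpos _ (by omega) le_rfl)

theorem eqAv_le (s : W) (hs : s ∈ Set.range g) (x z : W) (hz : h (Set.range g) L s x z ≠ 0) :
    eqAv g M L x ≤ eqAv g M L z := by
  have := hg.finite
  obtain ⟨d, rfl⟩ := hs
  have hS := hg.isHeckeSystem hL
  have hc := hg.isKLFamily_eq hL heq hpos
  rw [hc.h_gen hS ⟨d, rfl⟩ (hpos d)] at hz
  by_contra hne
  exact hz (hc.repr_eq_zero hS (hg.klOp_mem_span hL heq hpos d x) hne)

end

section

variable {g : Bool → W} {n : ℕ} [NeZero n] (hg : IsDihedral g (n + 1)) {L : W → ℤ}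
  (hL : IsWeight (Set.range g) L) (heq : ∀ c, L (g c) = L (g !c)) (hpos : ∀ c, 0 < L (g c))
include hg

omit [NeZero n] in
theorem eqEl_inj (ε : Bool) (i : Fin n) (δ ε' : Bool) (i' : Fin n) (δ' : Bool) (hv : eqV ε i δ)
    (hv' : eqV ε' i' δ') (he : eqEl g ε i δ = eqEl g ε' i' δ') : ε = ε' ∧ i = i' ∧ δ = δ' := by
  have hi := i.2
  have hi' := i'.2
  obtain ⟨h1, h2⟩ := hg.al_inj _ _ _ _ (by omega) (by omega) he
  obtain rfl : ε = ε' := by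
    rcases h2 with h2 | h2 | h2
    · exact h2
    · omega
    · omega
  obtain rfl : i = i' := Fin.ext (by omega)
  rw [eqV] at hv hv'
  exact ⟨rfl, rfl, by rw [hv, hv']⟩

theorem eqEl_big_iff (w : W) :
    (∃ ε i δ, eqV (n := n) ε i δ ∧ w = eqEl g ε i δ) ↔ w ≠ 1 ∧ w ≠ al g false (n + 1) := by
  constructor
  · rintro ⟨ε, i, δ, -, rfl⟩
    have := i.2
    exact ⟨hg.al_ne_one (by omega), hg.al_ne_top (by omega)⟩
  · rintro ⟨h1, h2⟩
    obtain ⟨c, k, hk, rfl⟩ := hg.exists_al w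
    rcases k with _ | k
    · exact absurd (al_zero g c) h1
    · have hk' : k < n := by
        by_contra h
        obtain rfl : k = n := by omega
        exact h2 (hg.al_top_eq c)
      exact ⟨c, ⟨k, hk'⟩, _, rfl, rfl⟩

omit [NeZero n] in
theorem eqEl_not_mem (ε : Bool) (i : Fin n) (δ : Bool) (_ : eqV ε i δ) :
    eqEl g ε i δ ∉ ({al g false (n + 1)} : Set W) :=
  hg.al_ne_top (by have := i.2; omega)

include hL

omit [NeZero n] in
theorem cellVec_eq (δ ε : Bool) (i : Fin n) :
    cellVec (eqV (n := n)) (eqEl g) (wordFamily g (n + 1) (eqG g L)) δ ε i =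
      if δ = tog ε i then Gam g L ε (i + 1) else 0 := by
  have := i.2
  rw [cellVec, eqEl, hg.eqC_al hL (by omega)]
  by_cases h : δ = tog ε i
  · rw [if_pos h, if_pos (show eqV ε i δ from h)]
  · rw [if_neg h, if_neg (show ¬ eqV ε i δ from h)]

include heq

-- `C_c` multiplies words beginning with `c` by `η`, and takes a word beginning with `!c` to its two
-- neighbours on the path of words beginning with `c`.
omit [NeZero n] in
theorem rep_klOp (δ c : Bool) :
    Rep (Submodule.span A (wordFamily g (n + 1) (eqG g L) '' {al g false (n + 1)}))
      (cellVec (eqV (n := n)) (eqEl g) (wordFamily g (n + 1) (eqG g L)) δ)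
      (klOp (Set.range g) L (g c)) (fusionBlock n (eqP (L (g false))) eqR c 0 c) := by
  intro ε i
  have hi := i.2
  have ha : ∀ c, L (g c) = L (g false) := by
    intro c
    cases c
    · rfl
    · exact heq true
  have e : act (fusionBlock n (eqP (L (g false))) eqR c 0 c)
      (cellVec (eqV (n := n)) (eqEl g) (wordFamily g (n + 1) (eqG g L)) δ) ε i =
      ∑ k : Fin n, fusionMatrix n (eqP (L (g false)) c ε) (eqR c ε) 0 i k •
        (if δ = tog c k then Gam g L c (k + 1) else 0) := by
    rw [act, Finset.sum_eq_single c]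
    · simp only [fusionBlock_apply, if_pos, hg.cellVec_eq hL]
    · intro d _ hd
      refine Finset.sum_eq_zero fun k _ => ?_
      rw [fusionBlock_apply, if_neg hd]
      exact zero_smul _ _
    · exact fun h => absurd (Finset.mem_univ _) h
  rw [e, fusionMatrix_zero, hg.cellVec_eq hL]
  by_cases hε : ε = c
  · subst hε
    rw [eqP_self, eqR_self, zero_smul, add_zero, Finset.sum_eq_single i]
    · rw [Matrix.smul_apply, Matrix.one_apply_eq, smul_eq_mul, mul_one]
      split_ifs with hδ
      · rw [hg.klOp_Gam_self (by omega), ha, sub_self]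
        exact Submodule.zero_mem _
      · rw [map_zero, smul_zero, sub_zero]
        exact Submodule.zero_mem _
    · intro k _ hk
      rw [Matrix.smul_apply, Matrix.one_apply_ne hk.symm, smul_zero, zero_smul]
    · exact fun h => absurd (Finset.mem_univ _) h
  · obtain rfl : ε = !c := by
      cases ε <;> cases c <;> first | rfl | exact absurd rfl hε
    rw [eqP_not, eqR_not, zero_smul, zero_add, one_smul,
      sum_pathX_smul fun k => if δ = tog c k then Gam g L c (k + 1) else 0]
    have ht : tog c (i + 1) = tog (!c) i := by rw [tog_not, tog]
    by_cases hδ : δ = tog (!c) i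
    · rw [if_pos hδ, hg.klOp_Gam_not_eq heq (by omega), ht, if_pos hδ]
      -- The lower neighbour has the required last letter by parity. At `i = 0` there is none, in
      -- accordance with the convention that `Gam g L c 0` is zero.
      have h1 : (if 1 ≤ (i : ℕ) then if δ = tog c (i - 1) then Gam g L c (i - 1 + 1) else 0 else 0) =
          Gam g L c i := by
        split_ifs with h1 h2
        · rw [Nat.sub_add_cancel h1]
        · rw [hδ, ← ht] at h2
          exact absurd (tog_of_mod_two (by omega)) h2
        · rw [show (i : ℕ) = 0 by omega, Gam_zero]
      rw [h1]
      split_ifs with h2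
      · rw [sub_self]
        exact Submodule.zero_mem _
      -- The path ends here: the upper neighbour of the last vertex is the longest element, which
      -- lies in the submodule.
      · rw [zero_add, add_sub_cancel_right, show (i : ℕ) + 2 = n + 1 by omega]
        refine Submodule.subset_span ⟨_, rfl, ?_⟩
        rw [hg.eqC_top hL]
        cases c
        · rfl
        · exact (hg.Gam_top hL false).symm
    · have h1 : (if 1 ≤ (i : ℕ) then if δ = tog c (i - 1) then Gam g L c (i - 1 + 1) else 0 else 0) =
          0 := by
        split_ifs with h1 h2
        · rw [← ht] at hδ
          exact absurd (h2.trans (tog_of_mod_two (by omega))) hδ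
        · rfl
        · rfl
      simp only [h1, ht, if_neg hδ, ite_self, map_zero, add_zero, sub_zero]
      exact Submodule.zero_mem _

omit [NeZero n] heq in
theorem klOp_mem_span_top (c : Bool) (u : H W)
    (hu : u ∈ Submodule.span A (wordFamily g (n + 1) (eqG g L) '' {al g false (n + 1)})) :
    klOp (Set.range g) L (g c) u ∈
      Submodule.span A (wordFamily g (n + 1) (eqG g L) '' {al g false (n + 1)}) := by
  rw [Set.image_singleton, Submodule.mem_span_singleton] at hu ⊢
  obtain ⟨p, rfl⟩ := hu
  have e : Gam g L false (n + 1) = Gam g L c (n + 1) := by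
    cases c
    · rfl
    · exact (hg.Gam_top hL false).symm
  refine ⟨p * eta (L (g c)), ?_⟩
  rw [hg.eqC_top hL, map_smul, e, hg.klOp_Gam_self le_rfl, smul_smul]

-- The elements satisfy `C_{c,l+2} = C_c C_{!c,l+1} - C_{c,l}`. Multiplication by the block of `C_c`
-- contributes a factor `X`, and this becomes the Chebyshev recursion for the `U_l`.
omit [NeZero n] in
theorem rep_op_Gam (δ c : Bool) {l : ℕ} (hl : l < n) :
    Rep (Submodule.span A (wordFamily g (n + 1) (eqG g L) '' {al g false (n + 1)}))
      (cellVec (eqV (n := n)) (eqEl g) (wordFamily g (n + 1) (eqG g L)) δ)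
      (op (Set.range g) L (Gam g L c (l + 1)))
      (fusionBlock n (eqP (L (g false))) eqR c l (tog c l)) := by
  induction l using Nat.strong_induction_on generalizing c with
  | _ l ih =>
    rcases l with _ | l
    · rw [zero_add, hg.op_Gam_one hL]
      exact hg.rep_klOp hL heq δ c
    · have h1 := (hg.rep_klOp hL heq δ c).mul (hg.klOp_mem_span_top hL c)
        (ih l (by omega) (!c) (by omega))
      have h2 : fusionBlock n (eqP (L (g false))) eqR (!c) l (tog (!c) l) *
          fusionBlock n (eqP (L (g false))) eqR c 0 c = Matrix.of fun ε ε' =>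
            if ε' = c then fusionMatrix n (eqP (L (g false)) (tog (!c) l) ε)
              (eqR (tog (!c) l) ε) l * pathX A n else 0 := by
        ext1 ε ε'
        rw [Matrix.mul_apply, Finset.sum_eq_single (!c)]
        · rw [fusionBlock_apply, fusionBlock_apply, if_pos rfl, Matrix.of_apply]
          split_ifs
          · rw [fusionMatrix_zero, eqP_not, eqR_not, zero_smul, one_smul, zero_add]
          · rw [mul_zero]
        · intro d _ hd
          rw [fusionBlock_apply, if_neg hd, zero_mul]
        · exact fun h => absurd (Finset.mem_univ _) h
      rw [h2] at h1
      rcases l with _ | l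
      · rw [zero_add] at h1
        rw [zero_add, hg.op_Gam_two hL heq]
        convert h1 using 1
        ext1 ε ε'
        rw [fusionBlock_apply, Matrix.of_apply, fusionMatrix_one]
        rfl
      · have h3 := h1.sub (ih l (by omega) c (by omega))
        rw [hg.op_Gam_add_two hL heq (by omega)]
        convert h3 using 1
        ext1 ε ε'
        rw [fusionBlock_apply, Matrix.sub_apply, Matrix.of_apply, fusionBlock_apply]
        have e1 : tog (!c) (l + 1) = tog c (l + 1 + 1) := by rw [tog_not, ← tog]
        rw [e1, tog_add_two]
        split_ifs
        · rw [fusionMatrix_add_two]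
        · rw [sub_zero]

end

end IsDihedral

theorem tog_add (c : Bool) (j k : ℕ) : tog c (j + k) = tog (tog c j) k := by
  induction k with
  | zero => rfl
  | succ k ih => rw [← add_assoc, tog, ih, tog]

/-- The action of the unit element in block matrices. -/
theorem IsKLFamily.h_one_el {n : ℕ} {S : Set W} {L : W → ℤ} {c : W → H W} (hS : IsHeckeSystem S L)
    (hc : IsKLFamily S L c) [Finite W] {V : Bool → Fin n → Bool → Prop}
    {el : Bool → Fin n → Bool → W} (inj : ∀ ε i δ ε' i' δ', V ε i δ → V ε' i' δ' →
      el ε i δ = el ε' i' δ' → ε = ε' ∧ i = i' ∧ δ = δ') {f : Bool → Bool → A}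
    (hf : ∀ ε ε', f ε ε' = if ε = ε' then 1 else 0)
    {ε i δ ε' k δ'} (hv : V ε i δ) (hv' : V ε' k δ') :
    h S L 1 (el ε i δ) (el ε' k δ') = if δ = δ' then scalarBlock n f ε ε' i k else 0 := by
  classical
  rw [hc.h_one_left hS, scalarBlock_apply, Matrix.smul_apply, hf, Matrix.one_apply]
  by_cases he : el ε i δ = el ε' k δ'
  · obtain ⟨rfl, rfl, rfl⟩ := inj _ _ _ _ _ _ hv hv' he
    simp
  · rw [Finsupp.single_eq_of_ne (Ne.symm he)]
    split_ifs with h1 h2 h3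
    · subst h1 h2 h3
      exact absurd rfl he
    all_goals simp

theorem pathU_mul_pathX_parity {n : ℕ} {l : ℕ} {i k : Fin n}
    (h : (pathU ℤ n l * pathX ℤ n) i k ≠ 0) : (l + i + k) % 2 = 1 := by
  by_contra hne
  refine h ?_
  rw [Matrix.mul_apply]
  refine Finset.sum_eq_zero fun j _ => ?_
  by_contra h'
  have h1 := pathU_parity l i j (left_ne_zero_of_mul h')
  have h2 := pathU_parity 1 j k (right_ne_zero_of_mul h')
  omega

/-! ### The cell datum for equal parameters -/

namespace IsDihedral

variable {g : Bool → W} {n : ℕ} [NeZero n] (hg : IsDihedral g (n + 1)) {L : W → ℤ}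
  (hL : IsWeight (Set.range g) L) (heq : ∀ c, L (g c) = L (g !c)) (hpos : ∀ c, 0 < L (g c))
include hg

theorem eq_one_or_eq_top_of_not_big {w : W}
    (hw : ¬ ∃ ε i δ, eqV (n := n) ε i δ ∧ w = eqEl g ε i δ) : w = 1 ∨ w = al g false (n + 1) := by
  by_contra h
  rw [hg.eqEl_big_iff] at hw
  tauto

omit [NeZero n] in
theorem eqAv_inv (w : W) : eqAv g (n + 1) L w⁻¹ = eqAv g (n + 1) L w := by
  obtain ⟨c, k, hk, rfl⟩ := hg.exists_al w
  rcases k with _ | k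
  · rw [al_zero, inv_one]
  · rw [hg.inv_al]
    rcases hk.lt_or_eq with h | h
    · rw [hg.eqAv_al h, hg.eqAv_al h]
    · rw [h, hg.al_top_eq, hg.al_top_eq c]

/-- The block matrices of the fusion cell, for equal parameters. -/
def eqCellF (g : Bool → W) (L : W → ℤ) (n : ℕ) : W → Matrix Bool Bool (Matrix (Fin n) (Fin n) A) :=
  cellF eqV (eqEl g) (fun ε i δ => fusionBlock n (eqP (L (g false))) eqR ε i δ) eqF

omit [NeZero n] in
theorem eqCellF_el {ε : Bool} {i : Fin n} {δ : Bool} (hv : eqV ε i δ) :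
    eqCellF g L n (eqEl g ε i δ) = fusionBlock n (eqP (L (g false))) eqR ε i δ :=
  cellF_el hg.eqEl_inj hv

omit [NeZero n] hg in
theorem eqCellF_single {w : W} (hw : ¬ ∃ ε i δ, eqV (n := n) ε i δ ∧ w = eqEl g ε i δ) :
    eqCellF g L n w = scalarBlock n (eqF w) := cellF_single hw

omit [NeZero n] hg in
theorem degLE_eqF {m : ℤ} (hm : 0 ≤ m) (w : W) (ε ε' : Bool) : DegLE m (eqF w ε ε') := by
  rw [eqF]
  split_ifs
  · exact DegLE.one hm
  · exact DegLE.zero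

omit [NeZero n] hg in
theorem degLE_eqR {m : ℤ} (hm : 0 ≤ m) (d ε : Bool) : DegLE m (eqR d ε) := by
  rw [eqR]
  split_ifs
  · exact DegLE.zero
  · exact DegLE.one hm

omit [NeZero n] hg in
theorem degLE_eqP {a : ℤ} (ha : 0 ≤ a) (d ε : Bool) : DegLE a (eqP a d ε) := by
  rw [eqP]
  split_ifs
  · exact degLE_eta ha
  · exact DegLE.zero

-- For equal parameters the last letter is determined by the first letter and the length. The parity
-- of `U_l`, or of `U_l X` when the adjacent letters differ, ensures that a nonzero entry respects
-- this.
omit [NeZero n] in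
theorem eqCellF_V (w : W) (ε : Bool) (i : Fin n) (δ ε' : Bool) (k : Fin n) (hv : eqV ε i δ)
    (hne : eqCellF g L n w ε ε' i k ≠ 0) : eqV ε' k δ := by
  by_cases hw : ∃ ε i δ, eqV (n := n) ε i δ ∧ w = eqEl g ε i δ
  · obtain ⟨c, l, d, hd, rfl⟩ := hw
    rw [hg.eqCellF_el hd, fusionBlock_apply] at hne
    split_ifs at hne with hε
    · subst hε
      rw [eqV] at hd hv ⊢
      rw [fusionMatrix_apply] at hne
      by_cases hde : d = ε
      · subst hde
        rw [eqR_self, zero_mul, add_zero] at hne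
        have := pathU_parity _ _ _ fun h' => hne (by rw [h', Int.cast_zero, mul_zero])
        rw [hv, hd, ← tog_add]
        exact tog_of_mod_two (by omega)
      · obtain rfl : ε = !d := by cases ε <;> cases d <;> first | rfl | exact absurd rfl hde
        rw [eqP_not, zero_mul, zero_add] at hne
        have := pathU_mul_pathX_parity fun h' => hne (by rw [h', Int.cast_zero, mul_zero])
        rw [hv, hd, tog_not, ← tog_add, ← tog]
        exact tog_of_mod_two (by omega)
    · exact absurd rfl hne
  · rw [eqCellF_single hw, scalarBlock_apply, Matrix.smul_apply, Matrix.one_apply, eqF] at hne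
    split_ifs at hne with h1 h2
    · obtain ⟨-, rfl⟩ := h1
      subst h2
      exact hv
    all_goals exact absurd (by simp) hne

include hL heq hpos

theorem eq_h_el (w : W) (ε : Bool) (i : Fin n) (δ ε' : Bool) (k : Fin n) (δ' : Bool)
    (hv : eqV ε i δ) (hv' : eqV ε' k δ') :
    h (Set.range g) L w (eqEl g ε i δ) (eqEl g ε' k δ') =
      if δ = δ' then eqCellF g L n w ε ε' i k else 0 := by
  have := hg.finite
  have hS := hg.isHeckeSystem hL
  have hc := hg.isKLFamily_eq hL heq hpos
  have hposS : ∀ s ∈ Set.range g, 0 < L s := by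
    rintro _ ⟨c, rfl⟩
    exact hpos c
  by_cases hw : ∃ ε i δ, eqV (n := n) ε i δ ∧ w = eqEl g ε i δ
  · obtain ⟨c, l, d, hd, rfl⟩ := hw
    rw [hg.eqCellF_el hd]
    refine hc.h_of_rep hS hg.eqEl_inj hg.eqEl_not_mem ?_ hv hv'
    have := hg.rep_op_Gam hL heq δ c l.2
    rw [← hd, ← hg.eqC_al hL (by have := l.2; omega)] at this
    exact this
  · rw [eqCellF_single hw]
    rcases hg.eq_one_or_eq_top_of_not_big hw with rfl | rfl
    · refine hc.h_one_el hS hg.eqEl_inj (fun ε ε' => ?_) hv hv'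
      simp [eqF]
    · have e : scalarBlock n (eqF (al g false (n + 1))) ε ε' i k = 0 := by
        rw [scalarBlock_apply, Matrix.smul_apply, eqF, if_neg fun h => hg.top_ne_one h.1]
        exact zero_smul _ _
      rw [e, ite_self]
      -- A product with the longest element as a factor only involves elements whose a-value is at
      -- least that of the longest element.
      by_contra hne
      have h1 := hc.av_le_of_h_ne_zero_right hS hposS (hg.eqAv_le hL heq hpos) hg.eqAv_inv hne
      have hk := k.2
      rw [hg.eqAv_top, eqEl, hg.eqAv_al (by omega)] at h1
      have h2 := hg.weight_gen_lt_top hL hpos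
      have h3 := hpos false
      omega

theorem eq_h_single_el (x y : W) (ε : Bool) (k : Fin n) (δ : Bool)
    (hx : ¬ ∃ ε i δ, eqV (n := n) ε i δ ∧ x = eqEl g ε i δ)
    (hy : ¬ ∃ ε i δ, eqV (n := n) ε i δ ∧ y = eqEl g ε i δ) (hv : eqV ε k δ) :
    h (Set.range g) L x y (eqEl g ε k δ) = 0 := by
  have := hg.finite
  have hS := hg.isHeckeSystem hL
  have hc := hg.isKLFamily_eq hL heq hpos
  have hposS : ∀ s ∈ Set.range g, 0 < L s := by
    rintro _ ⟨c, rfl⟩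
    exact hpos c
  have hz : ¬ (eqEl g ε k δ = 1 ∨ eqEl g ε k δ = al g false (n + 1)) := by
    have := (hg.eqEl_big_iff _).1 ⟨ε, k, δ, hv, rfl⟩
    tauto
  rcases hg.eq_one_or_eq_top_of_not_big hx with rfl | rfl
  · rw [hc.h_one_left hS, Finsupp.single_eq_of_ne]
    rintro h'
    rw [h'] at hz
    exact hz (hg.eq_one_or_eq_top_of_not_big hy)
  · by_contra hne
    have h1 := hc.av_le_of_h_ne_zero_right hS hposS (hg.eqAv_le hL heq hpos) hg.eqAv_inv hne
    have hk := k.2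
    rw [hg.eqAv_top, eqEl, hg.eqAv_al (by omega)] at h1
    have h2 := hg.weight_gen_lt_top hL hpos
    have h3 := hpos false
    omega

theorem eq_h_single (x y z : W)
    (hz : ¬ ∃ ε i δ, eqV (n := n) ε i δ ∧ z = eqEl g ε i δ) :
    DegLE (eqAv g (n + 1) L z) (h (Set.range g) L x y z) ∧
      (h (Set.range g) L x y z).coeff (eqAv g (n + 1) L z) =
        (open Classical in if x = z ∧ y = z then 1 else 0) := by
  have := hg.finite
  have hS := hg.isHeckeSystem hL
  have hc := hg.isKLFamily_eq hL heq hpos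
  have hposS : ∀ s ∈ Set.range g, 0 < L s := by
    rintro _ ⟨c, rfl⟩
    exact hpos c
  rcases hg.eq_one_or_eq_top_of_not_big hz with rfl | rfl
  · rw [hc.h_apply_one hS hposS (hg.eqAv_le hL heq hpos) (hg.eqAv_eq_zero_iff hL hpos), eqAv_one]
    split_ifs
    · refine ⟨DegLE.one le_rfl, ?_⟩
      rw [← Int.cast_one, coeff_intCast_apply]
      rfl
    · exact ⟨DegLE.zero, rfl⟩
  · rw [hg.eqAv_top, Int.toNat_of_nonneg ((hpos false).trans (hg.weight_gen_lt_top hL hpos)).le]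
    refine hc.h_top hS hposS hg.len_le_top (fun x hx => hg.weight_lt_top hL hpos hx) hg.top_inv
      ?_ x y
    rintro _ ⟨c, rfl⟩
    rw [hg.eqC_top hL]
    exact hg.genOp_Gam_top hL c

omit [Group W] [NeZero n] hg hL hpos in
theorem lw_of_eq (c : Bool) (k : ℕ) : lw (fun c => L (g c)) c k = k * L (g false) := by
  induction k generalizing c with
  | zero => simp [lw]
  | succ k ih =>
    have ha : L (g c) = L (g false) := by
      cases c
      · rfl
      · exact heq true
    rw [lw, ih, ha]
    push_cast
    ring

-- The coefficient of `T_1` in `Γ_w` is exactly `q^(-L(w))`, where `L(w)` is the length times the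
-- common weight. So within the fusion cell `Δ` meets the a-value only at the two generators.
omit [NeZero n] in
theorem eq_Del_lead {c : Bool} {k : ℕ} (hk : k + 1 ≤ n + 1) :
    Del (Set.range g) L (al g c (k + 1)) = (k + 1) * L (g false) ∧
      lead (Set.range g) L (al g c (k + 1)) = 1 := by
  have hS := hg.isHeckeSystem hL
  have hc := hg.isKLFamily_eq hL heq hpos
  have e : wordFamily g (n + 1) (eqG g L) (al g c (k + 1)) 1 =
      LaurentPolynomial.T (-((k + 1) * L (g false))) := by
    rw [hg.eqC_al hL hk, hg.Gam_apply_one hk, lw_of_eq heq]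
    push_cast
    rfl
  have h1 : DegLE (-((k + 1) * L (g false))) (wordFamily g (n + 1) (eqG g L) (al g c (k + 1)) 1) := by
    rw [e]
    exact DegLE.T _
  have h2 : (wordFamily g (n + 1) (eqG g L) (al g c (k + 1)) 1).coeff (-((k + 1) * L (g false)))
      = 1 := by
    rw [e, coeff_T_self]
  have h3 : (wordFamily g (n + 1) (eqG g L) (al g c (k + 1)) 1).coeff (-((k + 1) * L (g false)))
      ≠ 0 := by
    rw [h2]
    exact one_ne_zero
  exact ⟨hc.Del_eq hS h1 h3, by rw [hc.lead_eq hS h1 h3, h2]⟩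

omit [NeZero n] hpos in
theorem eq_weight_top : L (al g false (n + 1)) = (n + 1) * L (g false) := by
  rw [hg.L_al hL le_rfl, lw_of_eq heq]
  push_cast
  rfl

omit [NeZero n] in
theorem eq_Del_lead_one :
    Del (Set.range g) L 1 = 0 ∧ lead (Set.range g) L 1 = 1 := by
  have hS := hg.isHeckeSystem hL
  have hc := hg.isKLFamily_eq hL heq hpos
  have e : wordFamily g (n + 1) (eqG g L) 1 1 = 1 := by
    rw [hg.eqC_one hL, stdT_apply_self]
  have h1 : DegLE (-0) (wordFamily g (n + 1) (eqG g L) 1 1) := by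
    rw [e]
    exact DegLE.one (by omega)
  have h2 : (wordFamily g (n + 1) (eqG g L) 1 1).coeff (-0) = 1 := by
    rw [e, neg_zero, ← LaurentPolynomial.T_zero, coeff_T_self]
  have h3 : (wordFamily g (n + 1) (eqG g L) 1 1).coeff (-0) ≠ 0 := by
    rw [h2]
    exact one_ne_zero
  exact ⟨hc.Del_eq hS h1 h3, by rw [hc.lead_eq hS h1 h3, h2]⟩

/-- The cells of a finite dihedral group with equal parameters. -/
def eqDatum : CellDatum (Set.range g) L n where
  av := eqAv g (n + 1) L
  b := (L (g false)).toNat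
  V := eqV
  el := eqEl g
  sgn _ := 1
  F := eqCellF g L n
  V_zero _ := rfl
  V_swap ε i δ hv := by
    rw [eqV] at hv ⊢
    rw [hv, tog_tog]
  -- Vertex `1` carries the word of two letters, whose first and last letters differ.
  V_connected := ⟨⟨1, by have := hg.three_le; omega⟩, rfl⟩
  el_inv ε i δ hv := by
    rw [eqV] at hv
    rw [eqEl, eqEl, hg.inv_al, hv]
  el_inj := hg.eqEl_inj
  av_el ε i δ _ := hg.eqAv_al (by have := i.2; omega)
  av_inj w w' hw := by
    have h2 := hg.weight_gen_lt_top hL hpos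
    have h3 := hpos false
    by_cases h : ∃ ε i δ, eqV (n := n) ε i δ ∧ w = eqEl g ε i δ
    · by_cases h' : ∃ ε i δ, eqV (n := n) ε i δ ∧ w' = eqEl g ε i δ
      · exact Or.inr ⟨h, h'⟩
      · obtain ⟨ε, i, δ, -, rfl⟩ := h
        have hi := i.2
        rw [eqEl, hg.eqAv_al (by omega)] at hw
        rcases hg.eq_one_or_eq_top_of_not_big h' with rfl | rfl
        · rw [eqAv_one] at hw
          omega
        · rw [hg.eqAv_top] at hw
          omega
    · by_cases h' : ∃ ε i δ, eqV (n := n) ε i δ ∧ w' = eqEl g ε i δ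
      · obtain ⟨ε, i, δ, -, rfl⟩ := h'
        have hi := i.2
        rw [eqEl, hg.eqAv_al (by omega)] at hw
        rcases hg.eq_one_or_eq_top_of_not_big h with rfl | rfl
        · rw [eqAv_one] at hw
          omega
        · rw [hg.eqAv_top] at hw
          omega
      · rcases hg.eq_one_or_eq_top_of_not_big h with rfl | rfl <;>
          rcases hg.eq_one_or_eq_top_of_not_big h' with rfl | rfl
        · exact Or.inl rfl
        · rw [eqAv_one, hg.eqAv_top] at hw
          omega
        · rw [eqAv_one, hg.eqAv_top] at hw
          omega
        · exact Or.inl rfl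
  sgn_eq _ := Or.inl rfl
  inv_single w hw := by
    rcases hg.eq_one_or_eq_top_of_not_big hw with rfl | rfl
    · exact inv_one
    · exact hg.top_inv
  mono s hs x z hz := hg.eqAv_le hL heq hpos s hs x z hz
  h_el := hg.eq_h_el hL heq hpos
  F_comm w ε ε' := by
    by_cases hw : ∃ ε i δ, eqV (n := n) ε i δ ∧ w = eqEl g ε i δ
    · obtain ⟨c, l, d, hd, rfl⟩ := hw
      rw [hg.eqCellF_el hd, fusionBlock_apply]
      split_ifs
      · exact fusionMatrix_commute _ _ _
      · exact Commute.zero_left _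
    · rw [eqCellF_single hw, scalarBlock_apply]
      exact (Commute.one_left _).smul_left _
  F_V := hg.eqCellF_V
  F_deg w ε ε' i k := by
    have h3 := hpos false
    by_cases hw : ∃ ε i δ, eqV (n := n) ε i δ ∧ w = eqEl g ε i δ
    · obtain ⟨c, l, d, hd, rfl⟩ := hw
      rw [hg.eqCellF_el hd, fusionBlock_apply]
      split_ifs
      · refine degLE_fusionMatrix ?_ (degLE_eqR (Int.natCast_nonneg _) _ _) _ _ _
        exact (degLE_eqP h3.le _ _).mono (Int.self_le_toNat _)
      · exact DegLE.zero
    · rw [eqCellF_single hw, scalarBlock_apply, Matrix.smul_apply, Matrix.one_apply, smul_ite,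
        smul_zero, smul_eq_mul, mul_one]
      split_ifs
      · exact degLE_eqF (Int.natCast_nonneg _) _ _ _
      · exact DegLE.zero
  F_lead c l d ε ε' i k hd := by
    have h3 := hpos false
    rw [hg.eqCellF_el hd, fusionBlock_apply, Int.toNat_of_nonneg h3.le]
    by_cases hε : ε' = c
    · rw [if_pos hε, coeff_fusionMatrix (degLE_eqR (by omega) _ _), eqP]
      split_ifs with h1 h2 h2
      · rw [coeff_eta h3, one_mul]
      · exact absurd ⟨hε.symm, h1⟩ h2
      · exact absurd h2.2 h1
      · exact zero_mul _
    · rw [if_neg hε, if_neg fun h => hε h.1.symm]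
      rfl
  F_lead_single w ε ε' i k hw := by
    have h3 := hpos false
    rw [eqCellF_single hw, scalarBlock_apply, Matrix.smul_apply, Matrix.one_apply, smul_ite,
      smul_zero, smul_eq_mul, mul_one, Int.toNat_of_nonneg h3.le]
    split_ifs
    · exact degLE_eqF le_rfl _ _ _ _ h3
    · rfl
  h_single_el := hg.eq_h_single_el hL heq hpos
  h_single_deg x y z hz := (hg.eq_h_single hL heq hpos x y z hz).1
  h_single_lead z hz := by
    rw [(hg.eq_h_single hL heq hpos z z z hz).2, if_pos ⟨rfl, rfl⟩]
  h_single_lead_ne x y z hz hne := by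
    rw [(hg.eq_h_single hL heq hpos x y z hz).2, if_neg hne]
  le_Del z := by
    have h3 := hpos false
    by_cases hz : ∃ ε i δ, eqV (n := n) ε i δ ∧ z = eqEl g ε i δ
    · obtain ⟨c, l, d, hd, rfl⟩ := hz
      have hl := l.2
      rw [eqEl, hg.eqAv_al (by omega), (hg.eq_Del_lead hL heq hpos (by omega)).1,
        Int.toNat_of_nonneg h3.le]
      nlinarith
    · rcases hg.eq_one_or_eq_top_of_not_big hz with rfl | rfl
      · rw [eqAv_one, (hg.eq_Del_lead_one hL heq hpos).1]
        rfl
      · rw [hg.eqAv_top, hg.eq_weight_top hL heq, (hg.eq_Del_lead hL heq hpos le_rfl).1,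
          Int.toNat_of_nonneg (by positivity)]
  eq_Del z := by
    have h3 := hpos false
    by_cases hz : ∃ ε i δ, eqV (n := n) ε i δ ∧ z = eqEl g ε i δ
    · rw [iff_of_eq (congrArg (· ∨ _) (eq_false (not_not_intro hz))), false_or]
      obtain ⟨c, l, d, hd, rfl⟩ := hz
      have hl := l.2
      have h1 : (eqAv g (n + 1) L (eqEl g c l d) : ℤ) = Del (Set.range g) L (eqEl g c l d) ↔
          l = 0 := by
        rw [eqEl, hg.eqAv_al (by omega), (hg.eq_Del_lead hL heq hpos (by omega)).1,
          Int.toNat_of_nonneg h3.le]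
        constructor
        · intro h
          have : (l : ℤ) * L (g false) = 0 := by linarith
          rcases mul_eq_zero.1 this with h4 | h4
          · exact Fin.ext (by rw [Fin.val_zero]; omega)
          · omega
        · rintro rfl
          rw [Fin.val_zero]
          simp
      rw [h1]
      constructor
      · rintro rfl
        exact ⟨c, rfl⟩
      · rintro ⟨ε, hε⟩
        exact (hg.eqEl_inj _ _ _ _ _ _ hd (show eqV ε (0 : Fin n) ε from rfl) hε).2.1
    · refine iff_of_true ?_ (Or.inl hz)
      rcases hg.eq_one_or_eq_top_of_not_big hz with rfl | rfl
      · rw [eqAv_one, (hg.eq_Del_lead_one hL heq hpos).1]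
        rfl
      · rw [hg.eqAv_top, hg.eq_weight_top hL heq, (hg.eq_Del_lead hL heq hpos le_rfl).1,
          Int.toNat_of_nonneg (by positivity)]
  lead_single z hz := by
    rcases hg.eq_one_or_eq_top_of_not_big hz with rfl | rfl
    · exact (hg.eq_Del_lead_one hL heq hpos).2
    · exact (hg.eq_Del_lead hL heq hpos le_rfl).2
  lead_el ε := (hg.eq_Del_lead hL heq hpos (by have := (0 : Fin n).2; omega)).2

end IsDihedral

/-! ### Dihedral groups with unequal parameters -/

section

variable (g : Bool → W) (L : W → ℤ)

/-- The Kazhdan-Lusztig elements of the words `t s t ⋯ t`, where `L s < L t`. -/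
def nePal : ℕ → H W
  | 0 => Gam g L true 1
  | i + 1 => Gam g L true (2 * i + 3) -
      (LaurentPolynomial.T (L (g false) - L (g true)) : A) • nePal i

/-- The Kazhdan-Lusztig elements of the words with first letter `ε`, last letter `δ`, and `i`
further letters `t` (apart from a single central one), where `L s < L t`. -/
def neE : Bool → ℕ → Bool → H W
  | true, i, true => nePal g L i
  | true, i, false => Gam g L true (2 * i + 2)
  | false, i, true => Gam g L false (2 * i + 2)
  | false, i, false => Gam g L false (2 * i + 3) +
      (LaurentPolynomial.T (L (g false) - L (g true)) : A) • Gam g L false (2 * i + 1)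

/-- The length of the words that correspond to the elements `neE g L ε i δ`. -/
def neLen (ε : Bool) (i : ℕ) (δ : Bool) : ℕ := 2 * i + 1 + (!ε).toNat + (!δ).toNat

/-- The Kazhdan-Lusztig elements in the case of unequal parameters. -/
def neG : Bool → ℕ → H W
  | _, 0 => stdT 1
  | true, k + 1 => neE g L true (k / 2) (decide (k % 2 = 0))
  | false, 1 => Gam g L false 1
  | false, k + 2 => neE g L false (k / 2) (decide (k % 2 = 0))

theorem neG_neLen (ε : Bool) (i : ℕ) (δ : Bool) : neG g L ε (neLen ε i δ) = neE g L ε i δ := by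
  have h1 : (2 * i) / 2 = i := by omega
  have h2 : (2 * i + 1) / 2 = i := by omega
  have h3 : (2 * i) % 2 = 0 := by omega
  have h4 : (2 * i + 1) % 2 = 1 := by omega
  cases ε <;> cases δ
  · rw [show neLen false i false = (2 * i + 1) + 2 from rfl, neG, h2, h4]
    rfl
  · rw [show neLen false i true = (2 * i) + 2 from rfl, neG, h1, h3]
    rfl
  · rw [show neLen true i false = (2 * i + 1) + 1 from rfl, neG, h2, h4]
    rfl
  · rw [show neLen true i true = (2 * i) + 1 from rfl, neG, h1, h3]
    rfl

end

/-- The parameter `ζ = q ^ (L t - L s) + q ^ (L s - L t)`. -/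
def neZeta (g : Bool → W) (L : W → ℤ) : A := eta (L (g true) - L (g false))

theorem exists_neLen (c : Bool) {k : ℕ} (hk : k ≠ 0) (h : c = true ∨ k ≠ 1) :
    ∃ i δ, k = neLen c i δ := by
  cases c
  · rcases Nat.even_or_odd' k with ⟨i, rfl | rfl⟩
    · exact ⟨i - 1, true, by simp [neLen]; omega⟩
    · refine ⟨i - 1, false, ?_⟩
      have : i ≠ 0 := by
        rintro rfl
        simp at h
      simp [neLen]
      omega
  · rcases Nat.even_or_odd' k with ⟨i, rfl | rfl⟩
    · exact ⟨i - 1, false, by simp [neLen]; omega⟩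
    · exact ⟨i, true, by simp [neLen]⟩

namespace IsDihedral

variable {g : Bool → W} {n : ℕ} (hg : IsDihedral g (2 * n + 2)) {L : W → ℤ}
include hg

theorem klOp_true_Gam {k : ℕ} (hk : k < 2 * n + 1) :
    klOp (Set.range g) L (g true) (Gam g L false (k + 1)) = Gam g L true (k + 2) +
      (LaurentPolynomial.T (L (g true) - L (g false)) : A) • Gam g L true k :=
  hg.klOp_Gam_not (c := true) (by omega)

theorem klOp_false_Gam {k : ℕ} (hk : k < 2 * n + 1) :
    klOp (Set.range g) L (g false) (Gam g L true (k + 1)) = Gam g L false (k + 2) +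
      (LaurentPolynomial.T (L (g false) - L (g true)) : A) • Gam g L false k :=
  hg.klOp_Gam_not (c := false) (by omega)

/-- The correction in `nePal` is chosen to cancel the second term of the recursion for `Γ`. At the
largest index the result says `C_s C_{d_I} = C_{w_I}`. -/
theorem klOp_false_nePal {i : ℕ} (hi : i ≤ n) :
    klOp (Set.range g) L (g false) (nePal g L i) = Gam g L false (2 * i + 2) := by
  induction i with
  | zero => rw [nePal, hg.klOp_false_Gam (by omega), Gam_zero, smul_zero, add_zero]
  | succ i ih =>
    rw [nePal, map_sub, map_smul, ih (by omega), hg.klOp_false_Gam (by omega), add_sub_cancel_right]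
    rfl

theorem klOp_true_nePal {i : ℕ} (hi : i ≤ n) :
    klOp (Set.range g) L (g true) (nePal g L i) = eta (L (g true)) • nePal g L i := by
  induction i with
  | zero => exact hg.klOp_Gam_self (by omega)
  | succ i ih =>
    rw [nePal, map_sub, map_smul, ih (by omega), hg.klOp_Gam_self (by omega), smul_sub,
      smul_comm (eta _) (LaurentPolynomial.T _)]

/-- Left multiplication by `C_s`. -/
theorem klOp_false_neE {i : ℕ} (hi : i < n) (δ : Bool) :
    klOp (Set.range g) L (g false) (neE g L true i δ) = neE g L false i δ := by
  cases δ
  · exact hg.klOp_false_Gam (by omega)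
  · exact hg.klOp_false_nePal hi.le

theorem klOp_false_neE_false {i : ℕ} (hi : i < n) (δ : Bool) :
    klOp (Set.range g) L (g false) (neE g L false i δ) =
      eta (L (g false)) • neE g L false i δ := by
  cases δ
  · rw [neE, map_add, map_smul, hg.klOp_Gam_self (by omega), hg.klOp_Gam_self (by omega), smul_add,
      smul_comm (eta _) (LaurentPolynomial.T _)]
  · exact hg.klOp_Gam_self (by omega)

theorem klOp_true_neE {i : ℕ} (hi : i ≤ n) (δ : Bool) :
    klOp (Set.range g) L (g true) (neE g L true i δ) = eta (L (g true)) • neE g L true i δ := by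
  cases δ
  · exact hg.klOp_Gam_self (by omega)
  · exact hg.klOp_true_nePal hi

/-- Left multiplication by `C_t`. -/
theorem klOp_true_neE_false {i : ℕ} (hi : i < n) (δ : Bool) :
    klOp (Set.range g) L (g true) (neE g L false i δ) = neE g L true (i + 1) δ +
      neZeta g L • neE g L true i δ + if 1 ≤ i then neE g L true (i - 1) δ else 0 := by
  have hT : (LaurentPolynomial.T (L (g false) - L (g true)) *
      LaurentPolynomial.T (L (g true) - L (g false)) : A) = 1 := by
    rw [T_mul_T, sub_add_sub_cancel, sub_self, LaurentPolynomial.T_zero]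
  have hz : neZeta g L = LaurentPolynomial.T (L (g true) - L (g false)) +
      LaurentPolynomial.T (L (g false) - L (g true)) := by
    rw [neZeta, eta, neg_sub]
  cases δ
  -- For `i = 0` the absent lower neighbour agrees with the convention that `Gam` vanishes at length
  -- `0`.
  · have h0 : (if 1 ≤ i then neE g L true (i - 1) false else 0) = Gam g L true (2 * i) := by
      split_ifs with h
      · rw [neE, show 2 * (i - 1) + 2 = 2 * i by omega]
      · rw [show i = 0 by omega, Gam_zero]
    rw [h0, neE, neE, neE, map_add, map_smul, hg.klOp_true_Gam (by omega),
      hg.klOp_true_Gam (by omega), smul_add, smul_smul, hT, one_smul, hz, add_smul]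
    rw [show 2 * (i + 1) + 2 = 2 * i + 2 + 2 by ring]
    abel
  · rw [neE, neE, neE, neE, hg.klOp_true_Gam (by omega), nePal, hz]
    rcases i with _ | i
    · rw [if_neg (by omega), nePal, add_smul]
      abel
    · rw [if_pos (by omega), Nat.add_sub_cancel, add_smul]
      -- Solving the definition of `nePal` for `Γ` makes its second contribution `q^(b-a) q^(a-b)
      -- E_i = E_i`, which is the lower neighbour.
      have h1 : Gam g L true (2 * (i + 1) + 1) = nePal g L (i + 1) +
          (LaurentPolynomial.T (L (g false) - L (g true)) : A) • nePal g L i := by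
        rw [nePal]
        exact (sub_add_cancel _ _).symm
      rw [h1, smul_add, smul_smul, mul_comm (LaurentPolynomial.T _) (LaurentPolynomial.T _), hT,
        one_smul, show 2 * (i + 1) + 1 + 2 = 2 * (i + 1) + 3 from rfl]
      abel

section Family

variable (hL : IsWeight (Set.range g) L)
include hL

/-- The relation `E_{i+1} = C_t C_s E_i - ζ E_i - E_{i-1}` involves only bar invariant operators and
the bar invariant scalar `ζ`. -/
theorem bar_neE_true {i : ℕ} (hi : i ≤ n) (δ : Bool) :
    bar (Set.range g) L (neE g L true i δ) = neE g L true i δ := by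
  have hS := hg.isHeckeSystem hL
  induction i using Nat.strong_induction_on with
  | _ i ih =>
    rcases i with _ | i
    · have h1 : ∀ c, bar (Set.range g) L (Gam g L c 1) = Gam g L c 1 := by
        intro c
        rw [← hg.klOp_one, hS.bar_klOp ⟨c, rfl⟩, hS.bar_stdT_one]
      cases δ
      · have h2 := hg.klOp_true_Gam (L := L) (k := 0) (by omega)
        rw [Gam_zero, smul_zero, add_zero, zero_add] at h2
        rw [neE, mul_zero, zero_add, ← h2, hS.bar_klOp ⟨true, rfl⟩, h1]
      · exact h1 true
    · have e := hg.klOp_true_neE_false (L := L) (i := i) (by omega) δ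
      rw [add_assoc] at e
      rw [← add_sub_cancel_right (neE g L true (i + 1) δ) _, ← e, bar_sub,
        hS.bar_klOp ⟨true, rfl⟩, ← hg.klOp_false_neE (by omega), hS.bar_klOp ⟨false, rfl⟩,
        ih i (by omega) (by omega), bar_add, bar_smul, ih i (by omega) (by omega), neZeta, invert_eta]
      split_ifs
      · rw [ih _ (by omega) (by omega)]
      · rw [bar_zero]

theorem bar_neE_false {i : ℕ} (hi : i < n) (δ : Bool) :
    bar (Set.range g) L (neE g L false i δ) = neE g L false i δ := by
  rw [← hg.klOp_false_neE hi, (hg.isHeckeSystem hL).bar_klOp ⟨false, rfl⟩,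
    hg.bar_neE_true hL hi.le]

theorem bar_neG {c : Bool} {k : ℕ} (hk : k ≤ 2 * n + 2) :
    bar (Set.range g) L (neG g L c k) = neG g L c k := by
  have hS := hg.isHeckeSystem hL
  by_cases h0 : k = 0
  · subst h0
    exact hS.bar_stdT_one
  by_cases h1 : c = true ∨ k ≠ 1
  · obtain ⟨i, δ, rfl⟩ := exists_neLen c h0 h1
    rw [neG_neLen]
    cases c
    · by_cases hi : i < n
      · exact hg.bar_neE_false hL hi δ
      -- The only admissible word starting with `s` beyond the fusion cell is the longest element.
      · obtain ⟨rfl, rfl⟩ : i = n ∧ δ = true := by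
          revert hk
          cases δ <;> (simp [neLen]; omega)
        rw [neE, ← hg.klOp_false_nePal le_rfl, hS.bar_klOp ⟨false, rfl⟩]
        exact congrArg _ (hg.bar_neE_true hL le_rfl true)
    · refine hg.bar_neE_true hL ?_ δ
      rw [neLen] at hk
      omega
  · push Not at h1
    obtain ⟨h1, rfl⟩ := h1
    obtain rfl : c = false := by simpa using h1
    rw [neG, ← hg.klOp_one, hS.bar_klOp ⟨false, rfl⟩, hS.bar_stdT_one]

omit hL

variable (hpos : ∀ c, 0 < L (g c)) (hlt : L (g false) < L (g true))
include hpos hlt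

/-- All corrections carry the factor `q^(a-b)`, which lies in `q⁻¹ℤ[q⁻¹]` because `a < b`, and
involve only shorter words. -/
theorem negLower_nePal_sub {i : ℕ} (hi : i ≤ n) :
    NegLower (Set.range g) (2 * i + 1) (nePal g L i - stdT (al g true (2 * i + 1))) := by
  induction i with
  | zero => exact hg.negLower_Gam_sub hpos (by omega)
  | succ i ih =>
    have e : nePal g L (i + 1) - stdT (al g true (2 * (i + 1) + 1)) =
        (Gam g L true (2 * i + 2 + 1) - stdT (al g true (2 * i + 2 + 1))) +
        ((-LaurentPolynomial.T (L (g false) - L (g true)) : A) •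
          (nePal g L i - stdT (al g true (2 * i + 1))) +
        (-LaurentPolynomial.T (L (g false) - L (g true)) : A) • stdT (al g true (2 * i + 1))) := by
      rw [nePal, smul_sub, sub_add_cancel, neg_smul, show 2 * (i + 1) + 1 = 2 * i + 2 + 1 by ring]
      abel
    rw [e]
    have h1 : DegLE (-1) (-LaurentPolynomial.T (L (g false) - L (g true)) : A) :=
      ((DegLE.T _).mono (by omega)).neg
    refine (hg.negLower_Gam_sub hpos (by omega)).add (NegLower.add ?_ ?_)
    · exact ((ih (by omega)).smul (h1.mono (by omega))).mono (by omega)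
    · refine NegLower.single (isNeg_iff.2 h1) ?_
      rw [hg.len_al (by omega)]
      omega

theorem negLower_neG_sub {c : Bool} {k : ℕ} (hk : k ≤ 2 * n + 2) :
    NegLower (Set.range g) k (neG g L c k - stdT (al g c k)) := by
  by_cases h0 : k = 0
  · subst h0
    rw [neG, al_zero, sub_self]
    exact NegLower.zero
  by_cases h1 : c = true ∨ k ≠ 1
  · obtain ⟨i, δ, rfl⟩ := exists_neLen c h0 h1
    rw [neG_neLen]
    cases c <;> cases δ
    · have hk' : 2 * i + 3 ≤ 2 * n + 2 := hk
      have e : neE g L false i false - stdT (al g false (neLen false i false)) =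
          (Gam g L false (2 * i + 2 + 1) - stdT (al g false (2 * i + 2 + 1))) +
          ((LaurentPolynomial.T (L (g false) - L (g true)) : A) •
            (Gam g L false (2 * i + 1) - stdT (al g false (2 * i + 1))) +
          (LaurentPolynomial.T (L (g false) - L (g true)) : A) • stdT (al g false (2 * i + 1))) := by
        rw [neE, smul_sub, sub_add_cancel, show neLen false i false = 2 * i + 2 + 1 from rfl]
        abel
      rw [e]
      have h1 : DegLE (-1) (LaurentPolynomial.T (L (g false) - L (g true)) : A) :=
        (DegLE.T _).mono (by omega)
      refine NegLower.add (hg.negLower_Gam_sub hpos (k := 2 * i + 2) hk') (NegLower.add ?_ ?_)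
      · exact ((hg.negLower_Gam_sub hpos (k := 2 * i) (by omega)).smul (h1.mono (by omega))).mono
          (show 2 * i + 1 ≤ 2 * i + 3 by omega)
      · refine NegLower.single (isNeg_iff.2 h1) ?_
        rw [hg.len_al (by omega)]
        show 2 * i + 1 < 2 * i + 3
        omega
    · exact hg.negLower_Gam_sub hpos hk
    · exact hg.negLower_Gam_sub hpos hk
    · have hk' : 2 * i + 1 ≤ 2 * n + 2 := hk
      exact hg.negLower_nePal_sub hpos hlt (by omega)
  · push Not at h1
    obtain ⟨h1, rfl⟩ := h1
    obtain rfl : c = false := by simpa using h1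
    exact hg.negLower_Gam_sub hpos (by omega)

end Family

section Words

variable (hL : IsWeight (Set.range g) L)
include hL

theorem neG_top (c : Bool) : neG g L (!c) (2 * n + 2) = neG g L c (2 * n + 2) := by
  have h : ∀ c, neG g L c (2 * n + 2) = Gam g L c (2 * n + 2) := by
    rintro (_ | _)
    · exact neG_neLen g L false n true
    · exact neG_neLen g L true n false
  rw [h, h]
  exact hg.Gam_top hL c

theorem isKLFamily_ne (hpos : ∀ c, 0 < L (g c)) (hlt : L (g false) < L (g true)) :
    IsKLFamily (Set.range g) L (wordFamily g (2 * n + 2) (neG g L)) :=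
  isKLFamily_wordFamily hg (fun c => by cases c <;> rfl) (hg.neG_top hL)
    (fun _ _ hk => hg.bar_neG hL hk) fun _ _ hk => hg.negLower_neG_sub hpos hlt hk

theorem neC_al {c : Bool} {k : ℕ} (hk : k ≤ 2 * n + 2) :
    wordFamily g (2 * n + 2) (neG g L) (al g c k) = neG g L c k :=
  wordFamily_al hg (fun c => by cases c <;> rfl) (hg.neG_top hL) hk

theorem neC_neLen {ε : Bool} {i : ℕ} {δ : Bool} (hk : neLen ε i δ ≤ 2 * n + 2) :
    wordFamily g (2 * n + 2) (neG g L) (al g ε (neLen ε i δ)) = neE g L ε i δ := by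
  rw [hg.neC_al hL hk, neG_neLen]

theorem neC_one : wordFamily g (2 * n + 2) (neG g L) 1 = stdT 1 :=
  hg.neC_al hL (c := false) (Nat.zero_le _)

theorem neC_false : wordFamily g (2 * n + 2) (neG g L) (g false) = Gam g L false 1 := by
  rw [← al_one g false, hg.neC_al hL (by omega)]
  rfl

theorem neC_pal : wordFamily g (2 * n + 2) (neG g L) (al g true (2 * n + 1)) =
    neE g L true n true :=
  hg.neC_neLen hL (ε := true) (i := n) (δ := true) (show 2 * n + 1 ≤ 2 * n + 2 by omega)

theorem neC_top : wordFamily g (2 * n + 2) (neG g L) (al g false (2 * n + 2)) =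
    Gam g L false (2 * n + 2) :=
  hg.neC_neLen hL (ε := false) (i := n) (δ := true) le_rfl

end Words

end IsDihedral

/-! ### Elements and a-values for unequal parameters -/

/-- The elements of the fusion cell in the case of unequal parameters. -/
def neEl {n : ℕ} (g : Bool → W) (ε : Bool) (i : Fin n) (δ : Bool) : W := al g ε (neLen ε i δ)

/-- The value of the a-function at `t s t ⋯ t`, with `2 * n + 1` factors. -/
def neWt (g : Bool → W) (L : W → ℤ) (n : ℕ) : ℤ := (n + 1) * L (g true) - n * L (g false)

/-- The a-function in the case of unequal parameters. -/
def neAv (g : Bool → W) (n : ℕ) (L : W → ℤ) (w : W) : ℕ :=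
  open Classical in
  if w = 1 then 0 else if w = g false then (L (g false)).toNat
  else if w = al g true (2 * n + 1) then (neWt g L n).toNat
  else if w = al g false (2 * n + 2) then (L (al g false (2 * n + 2))).toNat
  else (L (g true)).toNat

theorem neLen_comm (ε : Bool) (i : ℕ) (δ : Bool) : neLen ε i δ = neLen δ i ε := by
  rw [neLen, neLen, add_right_comm]

theorem neLen_pos (ε : Bool) (i : ℕ) (δ : Bool) : 1 ≤ neLen ε i δ := by
  rw [neLen]
  omega

theorem neLen_lt {n : ℕ} (ε : Bool) {i : ℕ} (hi : i < n) (δ : Bool) : neLen ε i δ < 2 * n + 2 := by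
  cases ε <;> cases δ <;> (simp [neLen]; omega)

theorem neLen_true_le {n : ℕ} {i : ℕ} (hi : i ≤ n) (δ : Bool) : neLen true i δ ≤ 2 * n + 2 := by
  cases δ <;> (simp [neLen]; omega)

theorem tog_neLen_sub_one (ε : Bool) (i : ℕ) (δ : Bool) : tog ε (neLen ε i δ - 1) = δ := by
  have h : neLen ε i δ - 1 = 2 * i + ((!ε).toNat + (!δ).toNat) := by
    rw [neLen]
    omega
  rw [h, tog_add, tog_two_mul]
  cases ε <;> cases δ <;> rfl

namespace IsDihedral

variable {g : Bool → W} {n : ℕ} (hg : IsDihedral g (2 * n + 2)) {L : W → ℤ}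
include hg

theorem inv_al_neLen (ε : Bool) (i : ℕ) (δ : Bool) :
    (al g ε (neLen ε i δ))⁻¹ = al g δ (neLen δ i ε) := by
  have h := hg.inv_al ε (neLen ε i δ - 1)
  rw [tog_neLen_sub_one, Nat.sub_add_cancel (neLen_pos _ _ _)] at h
  rw [h, neLen_comm]

theorem neEl_inj (ε : Bool) (i : Fin n) (δ ε' : Bool) (i' : Fin n) (δ' : Bool) (_ : True)
    (_ : True) (he : neEl g ε i δ = neEl g ε' i' δ') : ε = ε' ∧ i = i' ∧ δ = δ' := by
  have h1 := neLen_lt ε i.2 δ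
  have h3 := neLen_pos ε i δ
  obtain ⟨h4, h5⟩ := hg.al_inj _ _ _ _ h1.le (neLen_lt ε' i'.2 δ').le he
  have h6 : ε = ε' := by
    rcases h5 with h5 | h5 | h5
    · exact h5
    · omega
    · omega
  subst h6
  refine ⟨rfl, ?_⟩
  have h7 : (i : ℕ) = i' ∧ δ = δ' := by
    revert h4
    cases ε <;> cases δ <;> cases δ' <;> simp [neLen] <;> omega
  exact ⟨Fin.ext h7.1, h7.2⟩

theorem ne_cases (w : W) : w = 1 ∨ w = g false ∨ w = al g true (2 * n + 1) ∨
    w = al g false (2 * n + 2) ∨ ∃ (ε : Bool) (i : Fin n) (δ : Bool), w = neEl g ε i δ := by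
  obtain ⟨c, k, hk, rfl⟩ := hg.exists_al w
  by_cases h0 : k = 0
  · subst h0
    exact Or.inl (al_zero g c)
  by_cases h1 : c = true ∨ k ≠ 1
  · by_cases hM : k = 2 * n + 2
    · subst hM
      exact Or.inr (Or.inr (Or.inr (Or.inl (hg.al_top_eq c))))
    · obtain ⟨i, δ, rfl⟩ := exists_neLen c h0 h1
      by_cases hi : i < n
      · exact Or.inr (Or.inr (Or.inr (Or.inr ⟨c, ⟨i, hi⟩, δ, rfl⟩)))
      · have : c = true ∧ δ = true ∧ i = n := by
          revert hk hM
          cases c <;> cases δ <;> simp [neLen] <;> omega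
        obtain ⟨rfl, rfl, rfl⟩ := this
        exact Or.inr (Or.inr (Or.inl rfl))
  · push Not at h1
    obtain ⟨h1, rfl⟩ := h1
    obtain rfl : c = false := by simpa using h1
    exact Or.inr (Or.inl (al_one g false))

theorem neEl_ne_one (ε : Bool) (i : Fin n) (δ : Bool) : neEl g ε i δ ≠ 1 := by
  intro h
  rw [← al_zero g false] at h
  have h1 := neLen_pos ε i δ
  have := (hg.al_inj _ _ _ _ (neLen_lt ε i.2 δ).le (Nat.zero_le _) h).1
  omega

theorem neEl_ne_false (ε : Bool) (i : Fin n) (δ : Bool) : neEl g ε i δ ≠ g false := by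
  intro h
  rw [← al_one g false] at h
  have h1 := neLen_lt ε i.2 δ
  obtain ⟨h2, h3⟩ := hg.al_inj _ _ _ _ h1.le (by omega) h
  have h4 : ε = false := by
    rcases h3 with h3 | h3 | h3
    · exact h3
    · omega
    · omega
  subst h4
  rw [neLen] at h2
  simp at h2
  omega

theorem neEl_ne_pal (ε : Bool) (i : Fin n) (δ : Bool) : neEl g ε i δ ≠ al g true (2 * n + 1) := by
  intro h
  have h1 := neLen_lt ε i.2 δ
  obtain ⟨h2, h3⟩ := hg.al_inj _ _ _ _ h1.le (by omega) h
  have h4 : ε = true := by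
    rcases h3 with h3 | h3 | h3
    · exact h3
    · omega
    · omega
  subst h4
  have hi := i.2
  rw [neLen] at h2
  have : (!δ).toNat ≤ 1 := Bool.toNat_le _
  simp at h2
  omega

theorem neEl_ne_top (ε : Bool) (i : Fin n) (δ : Bool) : neEl g ε i δ ≠ al g false (2 * n + 2) :=
  hg.al_ne_top (neLen_lt ε i.2 δ)

theorem gen_ne_one (c : Bool) : g c ≠ 1 := by
  rw [← al_one g c]
  exact hg.al_ne_one (by omega)

theorem pal_ne_one : al g true (2 * n + 1) ≠ 1 := hg.al_ne_one (by omega)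

theorem pal_ne_false : al g true (2 * n + 1) ≠ g false := by
  intro h
  rw [← al_one g false] at h
  have := hg.three_le
  have := (hg.al_inj _ _ _ _ (by omega) (by omega) h).1
  omega

theorem pal_ne_top : al g true (2 * n + 1) ≠ al g false (2 * n + 2) := hg.al_ne_top (by omega)

theorem false_ne_top : g false ≠ al g false (2 * n + 2) := by
  rw [← al_one g false]
  exact hg.al_ne_top (by omega)

theorem ne_not_big {w : W} (hw : ¬ ∃ (ε : Bool) (i : Fin n) (δ : Bool), True ∧ w = neEl g ε i δ) :
    w = 1 ∨ w = g false ∨ w = al g true (2 * n + 1) ∨ w = al g false (2 * n + 2) := by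
  rcases hg.ne_cases w with h | h | h | h | ⟨ε, i, δ, h⟩
  · exact Or.inl h
  · exact Or.inr (Or.inl h)
  · exact Or.inr (Or.inr (Or.inl h))
  · exact Or.inr (Or.inr (Or.inr h))
  · exact absurd ⟨ε, i, δ, trivial, h⟩ hw

omit hg in
theorem neAv_one : neAv g n L 1 = 0 := if_pos rfl

theorem neAv_false : neAv g n L (g false) = (L (g false)).toNat := by
  rw [neAv, if_neg (hg.gen_ne_one false), if_pos rfl]

theorem neAv_pal : neAv g n L (al g true (2 * n + 1)) = (neWt g L n).toNat := by
  rw [neAv, if_neg hg.pal_ne_one, if_neg hg.pal_ne_false, if_pos rfl]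

theorem neAv_top : neAv g n L (al g false (2 * n + 2)) = (L (al g false (2 * n + 2))).toNat := by
  rw [neAv, if_neg hg.top_ne_one, if_neg hg.false_ne_top.symm, if_neg hg.pal_ne_top.symm,
    if_pos rfl]

theorem neAv_el (ε : Bool) (i : Fin n) (δ : Bool) :
    neAv g n L (neEl g ε i δ) = (L (g true)).toNat := by
  rw [neAv, if_neg (hg.neEl_ne_one ε i δ), if_neg (hg.neEl_ne_false ε i δ),
    if_neg (hg.neEl_ne_pal ε i δ), if_neg (hg.neEl_ne_top ε i δ)]

theorem pal_inv : (al g true (2 * n + 1))⁻¹ = al g true (2 * n + 1) :=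
  hg.inv_al_neLen true n true

theorem neAv_inv (w : W) : neAv g n L w⁻¹ = neAv g n L w := by
  rcases hg.ne_cases w with rfl | rfl | rfl | rfl | ⟨ε, i, δ, rfl⟩
  · rw [inv_one]
  · rw [hg.inv_gen]
  · rw [hg.pal_inv]
  · rw [hg.top_inv]
  · rw [hg.neAv_el, neEl, hg.inv_al_neLen]
    exact hg.neAv_el δ i ε

variable (hL : IsWeight (Set.range g) L) (hpos : ∀ c, 0 < L (g c)) (hlt : L (g false) < L (g true))

include hL in
theorem ne_weight_top : L (al g false (2 * n + 2)) = (n + 1) * (L (g false) + L (g true)) := by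
  rw [hg.L_al hL le_rfl, show 2 * n + 2 = 2 * (n + 1) by ring, lw_two_mul]
  push_cast
  rfl

include hL hpos hlt

/-- This strict chain of values makes the a-function separate the cells. The inequality between `b`
and `L'(d_I)` uses `n ≥ 1`, that is, `m_st ≥ 3`. -/
theorem ne_order : 0 < L (g false) ∧ L (g false) < L (g true) ∧ L (g true) < neWt g L n ∧
    neWt g L n < L (al g false (2 * n + 2)) := by
  have h1 := hpos false
  have hn : (1 : ℤ) ≤ n := by
    have := hg.three_le
    omega
  rw [hg.ne_weight_top hL, neWt]
  refine ⟨h1, hlt, ?_, ?_⟩ <;> nlinarith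

theorem neAv_eq_zero_iff (w : W) : neAv g n L w = 0 ↔ w = 1 := by
  obtain ⟨h1, h2, h3, h4⟩ := hg.ne_order hL hpos hlt
  constructor
  · intro h
    rcases hg.ne_cases w with rfl | rfl | rfl | rfl | ⟨ε, i, δ, rfl⟩
    · rfl
    · rw [hg.neAv_false] at h; omega
    · rw [hg.neAv_pal] at h; omega
    · rw [hg.neAv_top] at h; omega
    · rw [hg.neAv_el] at h; omega
  · rintro rfl
    exact neAv_one

theorem neAv_le_false_iff (w : W) :
    neAv g n L w ≤ (L (g false)).toNat ↔ w = 1 ∨ w = g false := by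
  obtain ⟨h1, h2, h3, h4⟩ := hg.ne_order hL hpos hlt
  constructor
  · intro h
    rcases hg.ne_cases w with rfl | rfl | rfl | rfl | ⟨ε, i, δ, rfl⟩
    · exact Or.inl rfl
    · exact Or.inr rfl
    · rw [hg.neAv_pal] at h; omega
    · rw [hg.neAv_top] at h; omega
    · rw [hg.neAv_el] at h; omega
  · rintro (rfl | rfl)
    · rw [neAv_one]
      exact Nat.zero_le _
    · rw [hg.neAv_false]

theorem neE_true_mem {i : ℕ} (hi : i ≤ n) (δ : Bool) :
    neE g L true i δ ∈ Submodule.span A (wordFamily g (2 * n + 2) (neG g L) ''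
      {z | (L (g true)).toNat ≤ neAv g n L z}) := by
  obtain ⟨h1, h2, h3, h4⟩ := hg.ne_order hL hpos hlt
  rw [← hg.neC_neLen hL (neLen_true_le hi δ)]
  refine Submodule.subset_span ⟨_, ?_, rfl⟩
  show (L (g true)).toNat ≤ neAv g n L (al g true (neLen true i δ))
  rcases hi.lt_or_eq with hi' | rfl
  · exact (hg.neAv_el true ⟨i, hi'⟩ δ).ge
  · cases δ
    · have e : al g true (neLen true i false) = al g false (2 * i + 2) := hg.al_top_eq true
      rw [e, hg.neAv_top]
      omega
    · have e : al g true (neLen true i true) = al g true (2 * i + 1) := rfl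
      rw [e, hg.neAv_pal]
      omega

omit hpos hlt in
theorem neE_false_mem {i : ℕ} (hi : i < n) (δ : Bool) :
    neE g L false i δ ∈ Submodule.span A (wordFamily g (2 * n + 2) (neG g L) ''
      {z | (L (g true)).toNat ≤ neAv g n L z}) := by
  rw [← hg.neC_neLen hL (neLen_lt false hi δ).le]
  exact Submodule.subset_span ⟨_, (hg.neAv_el false ⟨i, hi⟩ δ).ge, rfl⟩

omit hpos hlt in
theorem klOp_neC_top (c : Bool) : klOp (Set.range g) L (g c)
    (wordFamily g (2 * n + 2) (neG g L) (al g false (2 * n + 2))) =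
      eta (L (g c)) • wordFamily g (2 * n + 2) (neG g L) (al g false (2 * n + 2)) := by
  have e : Gam g L false (2 * n + 2) = Gam g L c (2 * n + 2) := by
    cases c
    · rfl
    · exact (hg.Gam_top hL false).symm
  rw [hg.neC_top hL, e, hg.klOp_Gam_self le_rfl]

omit hpos hlt in
theorem klOp_true_neC_pal : klOp (Set.range g) L (g true)
    (wordFamily g (2 * n + 2) (neG g L) (al g true (2 * n + 1))) =
      eta (L (g true)) • wordFamily g (2 * n + 2) (neG g L) (al g true (2 * n + 1)) := by
  rw [hg.neC_pal hL, hg.klOp_true_neE le_rfl]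

omit hpos hlt in
theorem klOp_false_neC_pal : klOp (Set.range g) L (g false)
    (wordFamily g (2 * n + 2) (neG g L) (al g true (2 * n + 1))) =
      wordFamily g (2 * n + 2) (neG g L) (al g false (2 * n + 2)) := by
  rw [hg.neC_pal hL, hg.neC_top hL]
  exact hg.klOp_false_nePal le_rfl

omit hpos hlt in
theorem klOp_neC_false (c : Bool) : klOp (Set.range g) L (g c)
    (wordFamily g (2 * n + 2) (neG g L) (g false)) =
      if c then neE g L true 0 false
      else eta (L (g false)) • wordFamily g (2 * n + 2) (neG g L) (g false) := by
  rw [hg.neC_false hL]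
  cases c
  · exact hg.klOp_Gam_self (by omega)
  · have := hg.klOp_true_Gam (L := L) (k := 0) (by omega)
    rw [Gam_zero, smul_zero, add_zero] at this
    exact this

omit hpos hlt in
theorem neC_el (ε : Bool) (i : Fin n) (δ : Bool) :
    wordFamily g (2 * n + 2) (neG g L) (neEl g ε i δ) = neE g L ε i δ :=
  hg.neC_neLen hL (neLen_lt ε i.2 δ).le

theorem klOp_neC_mem_span (d : Bool) (x : W) :
    klOp (Set.range g) L (g d) (wordFamily g (2 * n + 2) (neG g L) x) ∈
      Submodule.span A (wordFamily g (2 * n + 2) (neG g L) ''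
        {z | neAv g n L x ≤ neAv g n L z}) := by
  have := hg.finite
  have hS := hg.isHeckeSystem hL
  have hc := hg.isKLFamily_ne hL hpos hlt
  obtain ⟨h1, h2, h3, h4⟩ := hg.ne_order hL hpos hlt
  have self : ∀ x, wordFamily g (2 * n + 2) (neG g L) x ∈ Submodule.span A
      (wordFamily g (2 * n + 2) (neG g L) '' {z | neAv g n L x ≤ neAv g n L z}) :=
    fun x => Submodule.subset_span ⟨x, le_refl (neAv g n L x), rfl⟩
  have mono : ∀ k k' : ℕ, k ≤ k' → Submodule.span A
      (wordFamily g (2 * n + 2) (neG g L) '' {z | k' ≤ neAv g n L z}) ≤ Submodule.span A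
      (wordFamily g (2 * n + 2) (neG g L) '' {z | k ≤ neAv g n L z}) := fun k k' hk =>
    Submodule.span_mono (Set.image_mono fun z (hz : k' ≤ neAv g n L z) => hk.trans hz)
  rcases hg.ne_cases x with rfl | rfl | rfl | rfl | ⟨ε, i, δ, rfl⟩
  · refine hc.mem_span_of_repr hS fun z _ => ?_
    show neAv g n L 1 ≤ neAv g n L z
    rw [neAv_one]
    exact Nat.zero_le _
  · rw [hg.klOp_neC_false hL]
    cases d
    · exact Submodule.smul_mem _ _ (self _)
    · rw [if_pos rfl]
      refine mono _ (L (g true)).toNat ?_ (hg.neE_true_mem hL hpos hlt (Nat.zero_le _) _)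
      rw [hg.neAv_false]
      omega
  · cases d
    · rw [hg.klOp_false_neC_pal hL]
      refine mono _ _ ?_ (self _)
      rw [hg.neAv_pal, hg.neAv_top]
      omega
    · rw [hg.klOp_true_neC_pal hL]
      exact Submodule.smul_mem _ _ (self _)
  · rw [hg.klOp_neC_top hL]
    exact Submodule.smul_mem _ _ (self _)
  · rw [hg.neC_el hL, hg.neAv_el]
    have hi := i.2
    cases ε <;> cases d
    · rw [hg.klOp_false_neE_false hi]
      exact Submodule.smul_mem _ _ (hg.neE_false_mem hL hi _)
    · rw [hg.klOp_true_neE_false hi]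
      refine Submodule.add_mem _ (Submodule.add_mem _ (hg.neE_true_mem hL hpos hlt hi _)
        (Submodule.smul_mem _ _ (hg.neE_true_mem hL hpos hlt hi.le _))) ?_
      split_ifs
      · exact hg.neE_true_mem hL hpos hlt (by omega) _
      · exact Submodule.zero_mem _
    · rw [hg.klOp_false_neE hi]
      exact hg.neE_false_mem hL hi _
    · rw [hg.klOp_true_neE hi.le]
      exact Submodule.smul_mem _ _ (hg.neE_true_mem hL hpos hlt hi.le _)

theorem neAv_le (s : W) (hs : s ∈ Set.range g) (x z : W) (hz : h (Set.range g) L s x z ≠ 0) :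
    neAv g n L x ≤ neAv g n L z := by
  have := hg.finite
  obtain ⟨d, rfl⟩ := hs
  have hS := hg.isHeckeSystem hL
  have hc := hg.isKLFamily_ne hL hpos hlt
  rw [hc.h_gen hS ⟨d, rfl⟩ (hpos d)] at hz
  by_contra hne
  exact hz (hc.repr_eq_zero hS (hg.klOp_neC_mem_span hL hpos hlt d x) hne)

end IsDihedral

/-! ### The fusion cell for unequal parameters -/

/-- The coefficients of the block matrices of the fusion cell, for unequal parameters. -/
def neP (g : Bool → W) (L : W → ℤ) : Bool → Bool → A
  | true, true => eta (L (g true))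
  | false, false => eta (L (g false)) * neZeta g L
  | _, _ => neZeta g L

/-- The coefficients of the block matrices of the fusion cell, for unequal parameters. -/
def neR (g : Bool → W) (L : W → ℤ) : Bool → Bool → A
  | true, true => 0
  | false, false => eta (L (g false))
  | _, _ => 1

omit [Group W] in
theorem neP_true_false (g : Bool → W) (L : W → ℤ) : neP g L true false = neZeta g L := by
  rw [neP] <;> simp

omit [Group W] in
theorem neP_false_true (g : Bool → W) (L : W → ℤ) : neP g L false true = neZeta g L := by
  rw [neP] <;> simp

omit [Group W] in
theorem neR_true_false (g : Bool → W) (L : W → ℤ) : neR g L true false = 1 := by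
  rw [neR] <;> simp

omit [Group W] in
theorem neR_false_true (g : Bool → W) (L : W → ℤ) : neR g L false true = 1 := by
  rw [neR] <;> simp

/-- The block scalars of left multiplication by `C_s`. -/
def neGen (g : Bool → W) (L : W → ℤ) : Bool → Bool → A
  | _, true => 0
  | true, false => 1
  | false, false => eta (L (g false))

/-- Block scalars for the elements outside of the fusion cell. -/
def neF (g : Bool → W) (L : W → ℤ) (w : W) (ε ε' : Bool) : A :=
  open Classical in
  if w = 1 then (if ε = ε' then 1 else 0) else if w = g false then neGen g L ε ε' else 0

theorem act_scalarBlock {V : Type*} [AddCommGroup V] [Module A V] {n : ℕ} (f : Bool → Bool → A)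
    (e : Bool → Fin n → V) (ε : Bool) (i : Fin n) :
    act (scalarBlock n f) e ε i = ∑ ε', f ε ε' • e ε' i := by
  refine Finset.sum_congr rfl fun ε' _ => ?_
  rw [Finset.sum_eq_single i]
  · rw [scalarBlock_apply, Matrix.smul_apply, Matrix.one_apply_eq, smul_eq_mul, mul_one]
  · intro k _ hk
    rw [scalarBlock_apply, Matrix.smul_apply, Matrix.one_apply_ne hk.symm, smul_zero, zero_smul]
  · exact fun h => absurd (Finset.mem_univ _) h

theorem act_fusionBlock_zero {V : Type*} [AddCommGroup V] [Module A V] {n : ℕ}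
    (p r : Bool → Bool → A) (c d : Bool) (e : Bool → Fin n → V) (f : ℕ → V) (hf : ∀ k : Fin n, e c k = f k)
    (ε : Bool) (i : Fin n) : act (fusionBlock n p r c 0 d) e ε i =
      p d ε • f i + r d ε • ((if (i : ℕ) + 1 < n then f (i + 1) else 0) +
        if 1 ≤ (i : ℕ) then f (i - 1) else 0) := by
  rw [act, Finset.sum_eq_single c]
  · rw [← sum_pathX_smul, ← hf i, Finset.smul_sum, fusionBlock_apply, if_pos rfl, fusionMatrix_zero]
    simp only [Matrix.add_apply, add_smul, Finset.sum_add_distrib, Matrix.smul_apply, smul_assoc, hf]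
    congr 1
    rw [Finset.sum_eq_single i]
    · rw [Matrix.one_apply_eq, one_smul]
    · intro k _ hk
      rw [Matrix.one_apply_ne hk.symm, zero_smul, smul_zero]
    · exact fun h => absurd (Finset.mem_univ _) h
  · intro ε' _ hε'
    refine Finset.sum_eq_zero fun k _ => ?_
    rw [fusionBlock_apply, if_neg hε']
    exact zero_smul _ _
  · exact fun h => absurd (Finset.mem_univ _) h

theorem block_sub_apply {n : ℕ} (F G : Matrix Bool Bool (Matrix (Fin n) (Fin n) A)) (ε ε' : Bool) :
    (F - G) ε ε' = F ε ε' - G ε ε' := rfl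

theorem block_smul_apply {n : ℕ} (a : A) (F : Matrix Bool Bool (Matrix (Fin n) (Fin n) A))
    (ε ε' : Bool) : (a • F) ε ε' = a • F ε ε' := rfl

theorem fusionBlock_mul_apply {n : ℕ} (p r : Bool → Bool → A) (c : Bool) (l : ℕ) (d : Bool)
    (G : Matrix Bool Bool (Matrix (Fin n) (Fin n) A)) (ε ε' : Bool) :
    (fusionBlock n p r c l d * G) ε ε' = fusionMatrix n (p d ε) (r d ε) l * G c ε' := by
  rw [Matrix.mul_apply (M := fusionBlock n p r c l d) (N := G), Finset.sum_eq_single c]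
  · rw [fusionBlock_apply, if_pos rfl]
  · intro x _ hx
    rw [fusionBlock_apply, if_neg hx, zero_mul]
  · exact fun h => absurd (Finset.mem_univ _) h

namespace IsDihedral

variable {g : Bool → W} {n : ℕ} (hg : IsDihedral g (2 * n + 2)) {L : W → ℤ}
include hg

/-- The submodule spanned by the two top cells. -/
def neTop (g : Bool → W) (L : W → ℤ) (n : ℕ) : Submodule A (H W) :=
  Submodule.span A (wordFamily g (2 * n + 2) (neG g L) ''
    {al g true (2 * n + 1), al g false (2 * n + 2)})

theorem op_neE_one (hL : IsWeight (Set.range g) L) :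
    op (Set.range g) L (neE g L true 0 true) = klOp (Set.range g) L (g true) :=
  hg.op_Gam_one hL true

theorem op_neE_two (hL : IsWeight (Set.range g) L) : op (Set.range g) L (neE g L true 0 false) =
    klOp (Set.range g) L (g true) * klOp (Set.range g) L (g false) := by
  have h := hg.klOp_true_Gam (L := L) (k := 0) (by omega)
  rw [Gam_zero, smul_zero, add_zero] at h
  rw [neE, mul_zero, ← h, IsKLFamily.op_klOp (hg.isHeckeSystem hL) ⟨true, rfl⟩, zero_add,
    hg.op_Gam_one hL]

theorem op_neE_false (hL : IsWeight (Set.range g) L) {i : ℕ} (hi : i < n) (δ : Bool) :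
    op (Set.range g) L (neE g L false i δ) =
      klOp (Set.range g) L (g false) * op (Set.range g) L (neE g L true i δ) := by
  rw [← hg.klOp_false_neE hi, IsKLFamily.op_klOp (hg.isHeckeSystem hL) ⟨false, rfl⟩]

theorem neE_add_one {i : ℕ} (hi : i < n) (δ : Bool) : neE g L true (i + 1) δ =
    klOp (Set.range g) L (g true) (klOp (Set.range g) L (g false) (neE g L true i δ)) -
      neZeta g L • neE g L true i δ - if 1 ≤ i then neE g L true (i - 1) δ else 0 := by
  rw [hg.klOp_false_neE hi, hg.klOp_true_neE_false hi]
  abel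

theorem op_neE_succ (hL : IsWeight (Set.range g) L) {i : ℕ} (hi : i < n) (δ : Bool) (u : H W) :
    op (Set.range g) L (neE g L true (i + 1) δ) u =
      klOp (Set.range g) L (g true) (klOp (Set.range g) L (g false)
        (op (Set.range g) L (neE g L true i δ) u)) -
      neZeta g L • op (Set.range g) L (neE g L true i δ) u -
      if 1 ≤ i then op (Set.range g) L (neE g L true (i - 1) δ) u else 0 := by
  have hS := hg.isHeckeSystem hL
  rw [hg.neE_add_one hi, map_sub, map_sub, map_smul, IsKLFamily.op_klOp hS ⟨true, rfl⟩,
    IsKLFamily.op_klOp hS ⟨false, rfl⟩, LinearMap.sub_apply, LinearMap.sub_apply,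
    Module.End.mul_apply, Module.End.mul_apply, LinearMap.smul_apply]
  split_ifs
  · rfl
  · rw [map_zero, LinearMap.zero_apply]

variable (hL : IsWeight (Set.range g) L)
include hL

theorem neTop_neE (δ : Bool) : neE g L true n δ ∈ neTop g L n := by
  rw [← hg.neC_neLen hL (neLen_true_le le_rfl δ)]
  refine Submodule.subset_span ⟨_, ?_, rfl⟩
  cases δ
  · exact Or.inr (hg.al_top_eq true)
  · exact Or.inl rfl

theorem klOp_mem_neTop (d : Bool) (u : H W) (hu : u ∈ neTop g L n) :
    klOp (Set.range g) L (g d) u ∈ neTop g L n := by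
  have h1 : wordFamily g (2 * n + 2) (neG g L) (al g true (2 * n + 1)) ∈ neTop g L n :=
    Submodule.subset_span ⟨_, Or.inl rfl, rfl⟩
  have h2 : wordFamily g (2 * n + 2) (neG g L) (al g false (2 * n + 2)) ∈ neTop g L n :=
    Submodule.subset_span ⟨_, Or.inr rfl, rfl⟩
  have key : neTop g L n ≤ (neTop g L n).comap (klOp (Set.range g) L (g d)) := by
    refine Submodule.span_le.2 ?_
    rintro _ ⟨z, rfl | rfl, rfl⟩
    · show klOp (Set.range g) L (g d) _ ∈ neTop g L n
      cases d
      · rw [hg.klOp_false_neC_pal hL]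
        exact h2
      · rw [hg.klOp_true_neC_pal hL]
        exact Submodule.smul_mem _ _ h1
    · show klOp (Set.range g) L (g d) _ ∈ neTop g L n
      rw [hg.klOp_neC_top hL]
      exact Submodule.smul_mem _ _ h2
  exact key hu

theorem ne_cellVec (δ ε : Bool) (i : Fin n) :
    cellVec (fun _ _ _ => True) (neEl g) (wordFamily g (2 * n + 2) (neG g L)) δ ε i =
      neE g L ε i δ := by
  rw [cellVec, if_pos trivial, hg.neC_el hL]

theorem rep_klOp_false (δ : Bool) : Rep (neTop g L n)
    (cellVec (fun _ _ _ => True) (neEl g) (wordFamily g (2 * n + 2) (neG g L)) δ)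
    (klOp (Set.range g) L (g false)) (scalarBlock n (neGen g L)) := by
  intro ε i
  rw [act_scalarBlock, Fintype.sum_bool, hg.ne_cellVec hL, hg.ne_cellVec hL, hg.ne_cellVec hL]
  cases ε
  · rw [hg.klOp_false_neE_false i.2]
    simp [neGen]
  · rw [hg.klOp_false_neE i.2]
    simp [neGen]

/-- On words beginning with `s`, `C_t` acts by `ζ + X`. At the last vertex the upper neighbour is
`d_I` or `w_I`, according to the last letter, and so vanishes modulo `neTop`. -/
theorem rep_klOp_true (δ : Bool) : Rep (neTop g L n)
    (cellVec (fun _ _ _ => True) (neEl g) (wordFamily g (2 * n + 2) (neG g L)) δ)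
    (klOp (Set.range g) L (g true)) (fusionBlock n (neP g L) (neR g L) true 0 true) := by
  intro ε i
  have hi := i.2
  rw [act_fusionBlock_zero _ _ _ _ _ (fun k => neE g L true k δ) (fun k => hg.ne_cellVec hL _ _ k),
    hg.ne_cellVec hL]
  cases ε
  · rw [hg.klOp_true_neE_false hi, neP_true_false, neR_true_false, one_smul]
    by_cases h1 : (i : ℕ) + 1 < n
    · have : ∀ a b c : H W, a + b + c - (b + (a + c)) = 0 := fun a b c => by abel
      rw [if_pos h1, this]
      exact Submodule.zero_mem _
    · have : ∀ a b c : H W, a + b + c - (b + (0 + c)) = a := fun a b c => by abel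
      rw [if_neg h1, this, show (i : ℕ) + 1 = n by omega]
      exact hg.neTop_neE hL δ
  · rw [hg.klOp_true_neE hi.le, neP, neR, zero_smul, add_zero, sub_self]
    exact Submodule.zero_mem _

/-- Passing from `E_l` to `E_{l+1}` multiplies by `C_t C_s - ζ` and subtracts `E_{l-1}`. On matrices
`C_t C_s` contributes the factor `ζ + X`, and what remains is the Chebyshev recursion. -/
theorem rep_op_neE_true (δ : Bool) {l : ℕ} (hl : l < n) (d : Bool) : Rep (neTop g L n)
    (cellVec (fun _ _ _ => True) (neEl g) (wordFamily g (2 * n + 2) (neG g L)) δ)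
    (op (Set.range g) L (neE g L true l d)) (fusionBlock n (neP g L) (neR g L) true l d) := by
  -- The matrix of `C_t C_s = C_{ts}`, with the factors in reversed order because coefficients are
  -- rows. It accounts for the coefficients `η(a) ζ` and `η(a)` in `neP` and `neR`.
  have hK : scalarBlock n (neGen g L) * fusionBlock n (neP g L) (neR g L) true 0 true =
      fusionBlock n (neP g L) (neR g L) true 0 false := by
    ext1 ε ε'
    rw [Matrix.mul_apply, Fintype.sum_bool, scalarBlock_apply, scalarBlock_apply,
      fusionBlock_apply, fusionBlock_apply, fusionBlock_apply, neGen, zero_smul, zero_mul, zero_add]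
    split_ifs
    · rw [fusionMatrix_zero, fusionMatrix_zero, smul_mul_assoc, one_mul, neP_true_false, neR_true_false, one_smul]
      cases ε
      · rw [neGen, neP, neR, smul_add, smul_smul]
      · rw [neGen, neP_false_true, neR_false_true, one_smul, one_smul]
    · rw [mul_zero]
  induction l using Nat.strong_induction_on with
  | _ l ih =>
    rcases l with _ | l
    · cases d
      · rw [hg.op_neE_two hL, ← hK]
        exact (hg.rep_klOp_true hL δ).mul (hg.klOp_mem_neTop hL true) (hg.rep_klOp_false hL δ)
      · rw [hg.op_neE_one hL]
        exact hg.rep_klOp_true hL δ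
    · have hX : Rep (neTop g L n)
          (cellVec (fun _ _ _ => True) (neEl g) (wordFamily g (2 * n + 2) (neG g L)) δ)
          (klOp (Set.range g) L (g true) * (klOp (Set.range g) L (g false) *
            op (Set.range g) L (neE g L true l d)))
          (fusionBlock n (neP g L) (neR g L) true l d *
            fusionBlock n (neP g L) (neR g L) true 0 false) := by
        rw [← hK, ← Matrix.mul_assoc]
        exact (hg.rep_klOp_true hL δ).mul (hg.klOp_mem_neTop hL true)
          ((hg.rep_klOp_false hL δ).mul (hg.klOp_mem_neTop hL false) (ih l (by omega) (by omega)))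
      have h1 := hX.sub ((ih l (by omega) (by omega)).smul (neZeta g L))
      -- Subtracting `ζ` turns the factor `ζ + X` into the adjacency matrix.
      have h2 : ∀ ε ε' : Bool, (fusionBlock n (neP g L) (neR g L) true l d *
            fusionBlock n (neP g L) (neR g L) true 0 false) ε ε' -
          neZeta g L • fusionBlock n (neP g L) (neR g L) true l d ε ε' =
          if ε' = true then fusionMatrix n (neP g L d ε) (neR g L d ε) l * pathX A n else 0 := by
        intro ε ε'
        rw [fusionBlock_mul_apply, fusionBlock_apply, fusionBlock_apply]
        split_ifs
        · have e : ∀ P : Matrix (Fin n) (Fin n) A, P * (neZeta g L • 1 + pathX A n) -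
              neZeta g L • P = P * pathX A n := by
            intro P
            rw [mul_add, Matrix.mul_smul, mul_one, add_sub_cancel_left]
          rw [fusionMatrix_zero, neP_false_true, neR_false_true, one_smul, e]
        · rw [mul_zero, smul_zero, sub_zero]
      rcases l with _ | l
      · intro ε i
        have h3 := h1 ε i
        rw [hg.op_neE_succ hL (by omega), if_neg (by omega), sub_zero]
        have e : fusionBlock n (neP g L) (neR g L) true (0 + 1) d =
            fusionBlock n (neP g L) (neR g L) true 0 d *
              fusionBlock n (neP g L) (neR g L) true 0 false -
            neZeta g L • fusionBlock n (neP g L) (neR g L) true 0 d := by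
          ext1 ε ε'
          rw [block_sub_apply, block_smul_apply, h2, fusionBlock_apply, fusionMatrix_one]
        rw [e]
        exact h3
      · intro ε i
        have h3 := (h1.sub (ih l (by omega) (by omega))) ε i
        rw [hg.op_neE_succ hL (by omega), if_pos (by omega), Nat.add_sub_cancel]
        have e : fusionBlock n (neP g L) (neR g L) true (l + 1 + 1) d =
            fusionBlock n (neP g L) (neR g L) true (l + 1) d *
              fusionBlock n (neP g L) (neR g L) true 0 false -
            neZeta g L • fusionBlock n (neP g L) (neR g L) true (l + 1) d -
            fusionBlock n (neP g L) (neR g L) true l d := by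
          ext1 ε ε'
          rw [block_sub_apply, block_sub_apply, block_smul_apply, h2, fusionBlock_apply,
            fusionBlock_apply]
          split_ifs
          · rw [fusionMatrix_add_two]
          · rw [sub_zero]
        rw [e]
        exact h3

/-- For a word beginning with `s`, `C_w` is `C_s` times the element without that letter. The matrix
of `C_s` moves the nonzero column from `t` to `s` without changing its blocks. -/
theorem rep_op_neE (δ ε : Bool) {l : ℕ} (hl : l < n) (d : Bool) : Rep (neTop g L n)
    (cellVec (fun _ _ _ => True) (neEl g) (wordFamily g (2 * n + 2) (neG g L)) δ)
    (op (Set.range g) L (neE g L ε l d)) (fusionBlock n (neP g L) (neR g L) ε l d) := by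
  cases ε
  · rw [hg.op_neE_false hL hl]
    convert (hg.rep_klOp_false hL δ).mul (hg.klOp_mem_neTop hL false)
      (hg.rep_op_neE_true hL δ hl d) using 1
    ext1 ε ε'
    rw [fusionBlock_mul_apply, fusionBlock_apply, scalarBlock_apply]
    cases ε'
    · rw [if_pos rfl, neGen, one_smul, mul_one]
    · rw [if_neg (by decide), neGen, zero_smul, mul_zero]
  · exact hg.rep_op_neE_true hL δ hl d

end IsDihedral

/-! ### Degrees in dihedral groups with unequal parameters -/

/-- The element `u` is supported on words with first letter `t`, and its coefficients on these,
except for the longest word, are of degree at most `d`. -/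
def NeDeg (B : Module.Basis W A (H W)) (g : Bool → W) (n : ℕ) (d : ℤ) (u : H W) : Prop :=
  (∀ z, B.repr u z ≠ 0 → ∃ i δ, i ≤ n ∧ z = al g true (neLen true i δ)) ∧
    ∀ z, z ≠ al g false (2 * n + 2) → DegLE d (B.repr u z)

namespace NeDeg

variable {B : Module.Basis W A (H W)} {g : Bool → W} {n : ℕ} {d e : ℤ} {u v : H W}

theorem mono (h : d ≤ e) (hu : NeDeg B g n d u) : NeDeg B g n e u :=
  ⟨hu.1, fun z hz => (hu.2 z hz).mono h⟩

theorem zero : NeDeg B g n d 0 := by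
  refine ⟨fun z hz => absurd ?_ hz, fun z _ => ?_⟩
  · rw [map_zero, Finsupp.zero_apply]
  · rw [map_zero, Finsupp.zero_apply]
    exact DegLE.zero

theorem add (hu : NeDeg B g n d u) (hv : NeDeg B g n d v) : NeDeg B g n d (u + v) := by
  refine ⟨fun z hz => ?_, fun z hz => ?_⟩
  · rw [map_add, Finsupp.add_apply] at hz
    by_cases h : B.repr u z = 0
    · rw [h, zero_add] at hz
      exact hv.1 z hz
    · exact hu.1 z h
  · rw [map_add, Finsupp.add_apply]
    exact (hu.2 z hz).add (hv.2 z hz)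

theorem smul {p : A} (hp : DegLE e p) (hu : NeDeg B g n d u) : NeDeg B g n (e + d) (p • u) := by
  refine ⟨fun z hz => ?_, fun z hz => ?_⟩
  · rw [map_smul, Finsupp.smul_apply, smul_eq_mul] at hz
    exact hu.1 z (right_ne_zero_of_mul hz)
  · rw [map_smul, Finsupp.smul_apply, smul_eq_mul]
    exact hp.mul (hu.2 z hz)

theorem sub (hu : NeDeg B g n d u) (hv : NeDeg B g n d v) : NeDeg B g n d (u - v) := by
  have h : DegLE 0 (-1 : A) := (DegLE.one le_rfl).neg
  have := hu.add ((hv.smul h).mono (by omega : 0 + d ≤ d))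
  rwa [neg_one_smul, ← sub_eq_add_neg] at this

theorem sum {ι : Type*} {s : Finset ι} {f : ι → H W} (h : ∀ i ∈ s, NeDeg B g n d (f i)) :
    NeDeg B g n d (∑ i ∈ s, f i) := by
  classical
  induction s using Finset.induction_on with
  | empty => exact zero
  | insert i s hi ih =>
    rw [Finset.sum_insert hi]
    exact (h i (by simp)).add (ih fun j hj => h j (by simp [hj]))

/-- No bound is available for the coefficient at the longest element, so every multiple of its image
has to be admissible. -/
theorem map {P : Module.End A (H W)} (hu : NeDeg B g n d u)
    (hP : ∀ i δ, i ≤ n → NeDeg B g n e (P (B (al g true (neLen true i δ)))))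
    (htop : ∀ p : A, NeDeg B g n (d + e) (p • P (B (al g false (2 * n + 2))))) :
    NeDeg B g n (d + e) (P u) := by
  rw [← B.linearCombination_repr u, Finsupp.linearCombination_apply, Finsupp.sum, map_sum]
  refine sum fun z hz => ?_
  rw [map_smul]
  by_cases h : z = al g false (2 * n + 2)
  · rw [h]
    exact htop _
  · obtain ⟨i, δ, hi, hz'⟩ := hu.1 z (Finsupp.mem_support_iff.1 hz)
    have h1 := hu.2 z h
    rw [hz'] at h1 ⊢
    exact (hP i δ hi).smul h1

end NeDeg

/-- The eigenvalues of the `C_w`, `w = t s t ⋯ t`, on the cell module of the largest such `w`. -/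
def neChain (g : Bool → W) (L : W → ℤ) : ℕ → A
  | 0 => eta (L (g true))
  | 1 => -(neZeta g L * eta (L (g true)))
  | i + 2 => -(neZeta g L * neChain g L (i + 1)) - neChain g L i

-- Each step multiplies the leading term by `-q^(b-a)`, and the term two steps back has smaller
-- degree and does not interfere.
omit [Group W] in
theorem neChain_deg {g : Bool → W} {L : W → ℤ} (hpos : 0 < L (g true))
    (hlt : L (g false) < L (g true)) (i : ℕ) :
    DegLE (L (g true) + i * (L (g true) - L (g false))) (neChain g L i) ∧
    (neChain g L i).coeff (L (g true) + i * (L (g true) - L (g false))) = (-1) ^ i := by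
  have hz : DegLE (L (g true) - L (g false)) (neZeta g L) := degLE_eta (by omega)
  have hz1 : (neZeta g L).coeff (L (g true) - L (g false)) = 1 := coeff_eta (by omega)
  have step : ∀ (e : ℤ) (p : A) (j : ℕ), DegLE e p ∧ p.coeff e = (-1) ^ j →
      DegLE (L (g true) - L (g false) + e) (-(neZeta g L * p)) ∧
      (-(neZeta g L * p)).coeff (L (g true) - L (g false) + e) = (-1) ^ (j + 1) := by
    rintro e p j ⟨h1, h2⟩
    refine ⟨(hz.mul h1).neg, ?_⟩
    rw [AddMonoidAlgebra.coeff_neg, Finsupp.neg_apply, coeff_mul_of_degLE hz h1, hz1, h2, pow_succ]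
    ring
  induction i using Nat.strong_induction_on with
  | _ i ih =>
    rcases i with _ | _ | i
    · rw [neChain, Nat.cast_zero, zero_mul, add_zero, pow_zero]
      exact ⟨degLE_eta hpos.le, coeff_eta hpos⟩
    · have := step _ _ 0 ⟨degLE_eta hpos.le, by rw [coeff_eta hpos, pow_zero]⟩
      rw [neChain]
      rw [show L (g true) + ((0 + 1 : ℕ) : ℤ) * (L (g true) - L (g false)) =
        L (g true) - L (g false) + L (g true) by push_cast; ring]
      exact this
    · have h1 := step _ _ (i + 1) (ih (i + 1) (by omega))
      have h2 := (ih i (by omega)).1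
      have e : L (g true) + ((i + 1 + 1 : ℕ) : ℤ) * (L (g true) - L (g false)) =
        L (g true) - L (g false) + (L (g true) + ((i + 1 : ℕ) : ℤ) * (L (g true) - L (g false))) := by
        push_cast
        ring
      have hlt' : L (g true) + (i : ℤ) * (L (g true) - L (g false)) <
        L (g true) - L (g false) + (L (g true) + ((i + 1 : ℕ) : ℤ) * (L (g true) - L (g false))) := by
        push_cast
        linarith
      rw [neChain, e]
      refine ⟨h1.1.sub (h2.mono hlt'.le), ?_⟩
      rw [AddMonoidAlgebra.coeff_sub, Finsupp.sub_apply, h1.2, h2 _ hlt', sub_zero]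

namespace IsDihedral

variable {g : Bool → W} {n : ℕ} (hg : IsDihedral g (2 * n + 2)) {L : W → ℤ}
  (hL : IsWeight (Set.range g) L)
include hg hL

/-- Modulo `C_{w_I}` the element `C_{d_I}` is killed by `C_s` and is an eigenvector of `C_t`. In the
recursion for the `E_i` the term `C_t C_s E_i` therefore disappears, and the eigenvalues are those
of `neChain`. -/
theorem op_neE_pal {i : ℕ} (hi : i ≤ n) :
    op (Set.range g) L (neE g L true i true) (neE g L true n true) -
      neChain g L i • neE g L true n true ∈
      Submodule.span A {Gam g L false (2 * n + 2)} := by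
  set N := Submodule.span A {Gam g L false (2 * n + 2)} with hN
  have hstab : ∀ c, ∀ u ∈ N, klOp (Set.range g) L (g c) u ∈ N := by
    intro c u hu
    rw [hN, Submodule.mem_span_singleton] at hu ⊢
    obtain ⟨p, rfl⟩ := hu
    have := hg.klOp_neC_top hL c
    rw [hg.neC_top hL] at this
    exact ⟨p * eta (L (g c)), by rw [map_smul, this, smul_smul]⟩
  have hts : ∀ (p : A) (v : H W), v - p • neE g L true n true ∈ N →
      klOp (Set.range g) L (g true) (klOp (Set.range g) L (g false) v) ∈ N := by
    intro p v hv
    have h1 := hstab true _ (hstab false _ hv)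
    have h2 : klOp (Set.range g) L (g true)
        (klOp (Set.range g) L (g false) (p • neE g L true n true)) ∈ N := by
      refine hstab true _ ?_
      rw [map_smul]
      refine N.smul_mem _ ?_
      have := hg.klOp_false_nePal (L := L) (le_refl n)
      rw [neE, this]
      exact Submodule.mem_span_singleton_self _
    have h3 := N.add_mem h1 h2
    rwa [← map_add, ← map_add, sub_add_cancel] at h3
  induction i using Nat.strong_induction_on with
  | _ i ih =>
    rcases i with _ | _ | i
    · rw [hg.op_neE_one hL, hg.klOp_true_neE le_rfl, neChain, sub_self]
      exact N.zero_mem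
    · have h0 := ih 0 (by omega) (by omega)
      rw [hg.op_neE_succ hL (by omega), if_neg (by omega), sub_zero, neChain]
      have := N.sub_mem (hts _ _ h0) (N.smul_mem (neZeta g L) h0)
      convert this using 1
      rw [neChain, neg_smul, mul_smul]
      module
    · have h1 := ih (i + 1) (by omega) (by omega)
      have h0 := ih i (by omega) (by omega)
      rw [hg.op_neE_succ hL (by omega), if_pos (by omega), Nat.add_sub_cancel, neChain]
      have := N.sub_mem (N.sub_mem (hts _ _ h1) (N.smul_mem (neZeta g L) h1)) h0
      convert this using 1
      rw [sub_smul, neg_smul, mul_smul, smul_sub]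
      abel

variable (hpos : ∀ c, 0 < L (g c)) (hlt : L (g false) < L (g true))
include hpos hlt

/-- The image of `C_s` is spanned by the `C_z` for which `z` has a reduced word beginning with `s`,
and `d_I = ts⋯t` has none. -/
theorem repr_klOp_false_pal [Finite W] (u : H W) :
    ((hg.isKLFamily_ne hL hpos hlt).basis (hg.isHeckeSystem hL)).repr
      (klOp (Set.range g) L (g false) u) (al g true (2 * n + 1)) = 0 := by
  classical
  have hS := hg.isHeckeSystem hL
  have hc := hg.isKLFamily_ne hL hpos hlt
  have hC : ∀ w, w ≠ al g true (2 * n + 1) →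
      (hc.basis hS).repr (wordFamily g (2 * n + 2) (neG g L) w) (al g true (2 * n + 1)) = 0 := by
    intro w hw
    rw [hc.repr_apply hS, if_neg hw]
  have : (Finsupp.lapply (al g true (2 * n + 1)) ∘ₗ (hc.basis hS).repr.toLinearMap) ∘ₗ
      klOp (Set.range g) L (g false) = 0 := by
    refine (hc.basis hS).ext fun z => ?_
    simp only [LinearMap.comp_apply, LinearEquiv.coe_coe, hc.basis_apply hS, Finsupp.lapply_apply,
      LinearMap.zero_apply]
    rcases hg.ne_cases z with rfl | rfl | rfl | rfl | ⟨ε, i, δ, rfl⟩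
    · rw [hg.neC_one hL, hg.klOp_one, ← hg.neC_false hL]
      exact hC _ hg.pal_ne_false.symm
    · rw [hg.klOp_neC_false hL, if_neg (by decide), map_smul, Finsupp.smul_apply,
        hC _ hg.pal_ne_false.symm, smul_zero]
    · rw [hg.klOp_false_neC_pal hL]
      exact hC _ hg.pal_ne_top.symm
    · rw [hg.klOp_neC_top hL, map_smul, Finsupp.smul_apply, hC _ hg.pal_ne_top.symm, smul_zero]
    · rw [hg.neC_el hL]
      cases ε
      · rw [hg.klOp_false_neE_false i.2, ← hg.neC_el hL, map_smul, Finsupp.smul_apply,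
          hC _ (hg.neEl_ne_pal _ _ _), smul_zero]
      · rw [hg.klOp_false_neE i.2, ← hg.neC_el hL]
        exact hC _ (hg.neEl_ne_pal _ _ _)
  exact LinearMap.congr_fun this u

section Deg

variable [Finite W] {B : Module.Basis W A (H W)}
  (hB : B = (hg.isKLFamily_ne hL hpos hlt).basis (hg.isHeckeSystem hL))
include hB

theorem neDeg_neE {i : ℕ} (hi : i ≤ n) (δ : Bool) : NeDeg B g n 0 (neE g L true i δ) := by
  classical
  have hS := hg.isHeckeSystem hL
  have hc := hg.isKLFamily_ne hL hpos hlt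
  rw [hB, ← hg.neC_neLen hL (neLen_true_le hi δ)]
  refine ⟨fun z hz => ?_, fun z _ => ?_⟩
  · rw [hc.repr_apply hS] at hz
    split_ifs at hz with h
    · exact ⟨i, δ, hi, h.symm⟩
    · exact absurd rfl hz
  · rw [hc.repr_apply hS]
    split_ifs
    · exact DegLE.one le_rfl
    · exact DegLE.zero

theorem neDeg_top (d : ℤ) (p : A) : NeDeg B g n d (p • Gam g L false (2 * n + 2)) := by
  classical
  have hS := hg.isHeckeSystem hL
  have hc := hg.isKLFamily_ne hL hpos hlt
  rw [hB, ← hg.neC_top hL]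
  refine ⟨fun z hz => ?_, fun z hz => ?_⟩
  · rw [map_smul, Finsupp.smul_apply, hc.repr_apply hS] at hz
    split_ifs at hz with h
    · exact ⟨n, false, le_rfl, h ▸ (hg.al_top_eq true).symm⟩
    · exact absurd (smul_zero _) hz
  · rw [map_smul, Finsupp.smul_apply, hc.repr_apply hS, if_neg (Ne.symm hz), smul_zero]
    exact DegLE.zero

theorem neDeg_klOp_neE_false {i : ℕ} (hi : i < n) (δ : Bool) :
    NeDeg B g n (L (g true) - L (g false)) (klOp (Set.range g) L (g true) (neE g L false i δ)) := by
  have hz : DegLE (L (g true) - L (g false)) (neZeta g L) := degLE_eta (by omega)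
  rw [hg.klOp_true_neE_false hi]
  refine NeDeg.add (NeDeg.add ?_ ?_) ?_
  · exact (hg.neDeg_neE hL hpos hlt hB hi δ).mono (by omega)
  · exact ((hg.neDeg_neE hL hpos hlt hB hi.le δ).smul hz).mono (by omega)
  · split_ifs
    · exact (hg.neDeg_neE hL hpos hlt hB (by omega) δ).mono (by omega)
    · exact NeDeg.zero

theorem neDeg_start {y : W} (hy1 : y ≠ 1) (hy2 : y ≠ g false) (δ : Bool) :
    NeDeg B g n (L (g true)) (op (Set.range g) L (neE g L true 0 δ)
      (wordFamily g (2 * n + 2) (neG g L) y)) := by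
  have h1 := hpos false
  have h2 := hpos true
  have ht : ∀ c, klOp (Set.range g) L (g c) (Gam g L false (2 * n + 2)) =
      eta (L (g c)) • Gam g L false (2 * n + 2) := by
    intro c
    rw [← hg.neC_top hL, hg.klOp_neC_top hL]
  cases δ
  · rw [hg.op_neE_two hL, Module.End.mul_apply]
    rcases hg.ne_cases y with rfl | rfl | rfl | rfl | ⟨ε, i, δ, rfl⟩
    · exact absurd rfl hy1
    · exact absurd rfl hy2
    · rw [hg.klOp_false_neC_pal hL, hg.neC_top hL, ht]
      exact hg.neDeg_top hL hpos hlt hB _ _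
    · rw [hg.neC_top hL, ht, map_smul, ht, smul_smul]
      exact hg.neDeg_top hL hpos hlt hB _ _
    · rw [hg.neC_el hL]
      cases ε
      · rw [hg.klOp_false_neE_false i.2, map_smul]
        exact ((hg.neDeg_klOp_neE_false hL hpos hlt hB i.2 δ).smul (degLE_eta h1.le)).mono
          (by omega)
      · rw [hg.klOp_false_neE i.2]
        exact (hg.neDeg_klOp_neE_false hL hpos hlt hB i.2 δ).mono (by omega)
  · rw [hg.op_neE_one hL]
    rcases hg.ne_cases y with rfl | rfl | rfl | rfl | ⟨ε, i, δ, rfl⟩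
    · exact absurd rfl hy1
    · exact absurd rfl hy2
    · rw [hg.klOp_true_neC_pal hL, hg.neC_pal hL]
      exact ((hg.neDeg_neE hL hpos hlt hB le_rfl true).smul (degLE_eta h2.le)).mono (by omega)
    · rw [hg.neC_top hL, ht]
      exact hg.neDeg_top hL hpos hlt hB _ _
    · rw [hg.neC_el hL]
      cases ε
      · exact (hg.neDeg_klOp_neE_false hL hpos hlt hB i.2 δ).mono (by omega)
      · rw [hg.klOp_true_neE i.2.le]
        exact ((hg.neDeg_neE hL hpos hlt hB i.2.le δ).smul (degLE_eta h2.le)).mono (by omega)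

/-- The first step costs degree `b`. Each further step applies `C_t C_s - ζ`, which costs at most `b
- a`. This keeps the products with `i < n` strictly below `L'(d_I) = b + n (b - a)` at `d_I`. -/
theorem neDeg_op {y : W} (hy1 : y ≠ 1) (hy2 : y ≠ g false) {i : ℕ} (hi : i ≤ n) (δ : Bool) :
    NeDeg B g n (L (g true) + i * (L (g true) - L (g false)))
      (op (Set.range g) L (neE g L true i δ) (wordFamily g (2 * n + 2) (neG g L) y)) := by
  have hS := hg.isHeckeSystem hL
  have hc := hg.isKLFamily_ne hL hpos hlt
  have hz : DegLE (L (g true) - L (g false)) (neZeta g L) := degLE_eta (by omega)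
  have ht : ∀ c, klOp (Set.range g) L (g c) (Gam g L false (2 * n + 2)) =
      eta (L (g c)) • Gam g L false (2 * n + 2) := by
    intro c
    rw [← hg.neC_top hL, hg.klOp_neC_top hL]
  have key : ∀ u d, NeDeg B g n d u → NeDeg B g n (d + (L (g true) - L (g false)))
      (klOp (Set.range g) L (g true) (klOp (Set.range g) L (g false) u) - neZeta g L • u) := by
    intro u d hu
    have e : klOp (Set.range g) L (g true) (klOp (Set.range g) L (g false) u) - neZeta g L • u =
        (klOp (Set.range g) L (g true) * klOp (Set.range g) L (g false) + (-neZeta g L) • 1) u := by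
      rw [LinearMap.add_apply, Module.End.mul_apply, LinearMap.smul_apply, Module.End.one_apply,
        neg_smul, sub_eq_add_neg]
    rw [e]
    refine hu.map (fun i δ hi => ?_) fun p => ?_
    · rw [hB, hc.basis_apply hS, ← hB, hg.neC_neLen hL (neLen_true_le hi δ), LinearMap.add_apply,
        Module.End.mul_apply, LinearMap.smul_apply, Module.End.one_apply, neg_smul, ← sub_eq_add_neg]
      rcases hi.lt_or_eq with hi' | rfl
      · rw [hg.klOp_false_neE hi', hg.klOp_true_neE_false hi', add_right_comm, add_sub_cancel_right]
        refine NeDeg.add ((hg.neDeg_neE hL hpos hlt hB hi' δ).mono (by omega)) ?_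
        split_ifs
        · exact (hg.neDeg_neE hL hpos hlt hB (by omega) δ).mono (by omega)
        · exact NeDeg.zero
      -- Below `n` the term `ζ E_i` cancels and no degree is lost. At `i = n` it survives, since
      -- `C_t C_s E_n` is a multiple of `C_{w_I}`; this is where `b - a` is spent.
      · refine NeDeg.sub ?_ (((hg.neDeg_neE hL hpos hlt hB le_rfl δ).smul hz).mono (by omega))
        cases δ
        · have e2 : neE g L true i false = Gam g L false (2 * i + 2) := (hg.Gam_top hL true).symm
          rw [e2, ht, map_smul, ht, smul_smul]
          exact hg.neDeg_top hL hpos hlt hB _ _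
        · rw [neE, hg.klOp_false_nePal le_rfl, ht]
          exact hg.neDeg_top hL hpos hlt hB _ _
    · rw [hB, hc.basis_apply hS, ← hB, hg.neC_top hL, LinearMap.add_apply,
        Module.End.mul_apply, LinearMap.smul_apply, Module.End.one_apply, ht, map_smul, ht,
        smul_smul, ← add_smul, smul_smul]
      exact hg.neDeg_top hL hpos hlt hB _ _
  induction i using Nat.strong_induction_on with
  | _ i ih =>
    rcases i with _ | i
    · rw [Nat.cast_zero, zero_mul, add_zero]
      exact hg.neDeg_start hL hpos hlt hB hy1 hy2 δ
    · rw [hg.op_neE_succ hL (by omega)]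
      refine NeDeg.sub ((key _ _ (ih i (by omega) (by omega))).mono (by push_cast; linarith)) ?_
      split_ifs with h
      · obtain ⟨i, rfl⟩ : ∃ j, i = j + 1 := ⟨i - 1, by omega⟩
        refine (ih i (by omega) (by omega)).mono ?_
        push_cast
        nlinarith
      · exact NeDeg.zero

end Deg

end IsDihedral

/-! ### Structure constants at the one-element cells for unequal parameters -/

namespace IsDihedral

variable {g : Bool → W} {n : ℕ} (hg : IsDihedral g (2 * n + 2)) {L : W → ℤ}
  (hL : IsWeight (Set.range g) L) (hpos : ∀ c, 0 < L (g c)) (hlt : L (g false) < L (g true))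

omit [Group W] in
theorem weight_pos_of_gen {g : Bool → W} {L : W → ℤ} (hpos : ∀ c, 0 < L (g c)) :
    ∀ s ∈ Set.range g, 0 < L s := by
  rintro _ ⟨c, rfl⟩
  exact hpos c

include hg hL hpos hlt

theorem h_false_pal (x : W) : h (Set.range g) L (g false) x (al g true (2 * n + 1)) = 0 := by
  have := hg.finite
  rw [(hg.isKLFamily_ne hL hpos hlt).h_gen (hg.isHeckeSystem hL) ⟨false, rfl⟩ (hpos false)]
  exact hg.repr_klOp_false_pal hL hpos hlt _

/-- For a word `x` beginning with `s` the product lies in the image of `C_s`, where `d_I` does not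
occur. For `x` in the fusion cell beginning with `t`, `neDeg_op` applies with `i < n`. The longest
element is excluded by monotonicity of the a-function. -/
theorem degLE_h_pal_of_ne {x : W} (y : W) (hx : x ≠ al g true (2 * n + 1)) :
    DegLE (neWt g L n - 1) (h (Set.range g) L x y (al g true (2 * n + 1))) := by
  classical
  have := hg.finite
  have hS := hg.isHeckeSystem hL
  have hc := hg.isKLFamily_ne hL hpos hlt
  have hposS := weight_pos_of_gen hpos
  obtain ⟨h1, h2, h3, h4⟩ := hg.ne_order hL hpos hlt
  by_cases hy1 : y = 1
  · rw [hy1, hc.h_one_right hS, Finsupp.single_eq_of_ne hx.symm]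
    exact DegLE.zero
  by_cases hy2 : y = g false
  · rw [hy2, hc.h_flip hS, hg.inv_gen, hg.pal_inv, hg.h_false_pal hL hpos hlt]
    exact DegLE.zero
  rcases hg.ne_cases x with rfl | rfl | rfl | rfl | ⟨ε, i, δ, rfl⟩
  · rw [hc.h_one_left hS, Finsupp.single_apply]
    split_ifs
    · exact DegLE.one (by omega)
    · exact DegLE.zero
  · rw [hg.h_false_pal hL hpos hlt]
    exact DegLE.zero
  · exact absurd rfl hx
  · have h0 : h (Set.range g) L (al g false (2 * n + 2)) y (al g true (2 * n + 1)) = 0 := by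
      by_contra hne
      have := hc.av_le_of_h_ne_zero_right hS hposS (hg.neAv_le hL hpos hlt) hg.neAv_inv hne
      rw [hg.neAv_top, hg.neAv_pal] at this
      omega
    rw [h0]
    exact DegLE.zero
  · rw [hc.h_eq hS, hg.neC_el hL]
    cases ε
    · rw [hg.op_neE_false hL i.2, Module.End.mul_apply, hg.repr_klOp_false_pal hL hpos hlt]
      exact DegLE.zero
    · refine ((hg.neDeg_op hL hpos hlt rfl hy1 hy2 i.2.le δ).2 _ hg.pal_ne_top).mono ?_
      have hi : (i : ℤ) + 1 ≤ n := by exact_mod_cast i.2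
      rw [neWt]
      nlinarith

/-- For `x = y = d_I` the coefficient is the eigenvalue `neChain g L n`. If only `x = d_I`,
inversion exchanges the factors and the strict bound for `y` applies, `d_I` being an involution. -/
theorem h_pal (x y : W) :
    DegLE (neWt g L n) (h (Set.range g) L x y (al g true (2 * n + 1))) ∧
      (h (Set.range g) L x y (al g true (2 * n + 1))).coeff (neWt g L n) =
        (open Classical in if x = al g true (2 * n + 1) ∧ y = al g true (2 * n + 1) then
          (-1) ^ n else 0) := by
  classical
  have := hg.finite
  have hS := hg.isHeckeSystem hL
  have hc := hg.isKLFamily_ne hL hpos hlt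
  have key : DegLE (neWt g L n - 1) (h (Set.range g) L x y (al g true (2 * n + 1))) →
      ¬ (x = al g true (2 * n + 1) ∧ y = al g true (2 * n + 1)) →
      DegLE (neWt g L n) (h (Set.range g) L x y (al g true (2 * n + 1))) ∧
      (h (Set.range g) L x y (al g true (2 * n + 1))).coeff (neWt g L n) =
        if x = al g true (2 * n + 1) ∧ y = al g true (2 * n + 1) then (-1) ^ n else 0 := by
    intro h1 h2
    rw [if_neg h2]
    exact ⟨h1.mono (by omega), h1 _ (by omega)⟩
  by_cases hx : x = al g true (2 * n + 1)
  · by_cases hy : y = al g true (2 * n + 1)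
    · subst hx
      subst hy
      have e : h (Set.range g) L (al g true (2 * n + 1)) (al g true (2 * n + 1))
          (al g true (2 * n + 1)) = neChain g L n := by
        have h1 := hg.op_neE_pal hL (le_refl n)
        rw [← hg.neC_top hL, ← Set.image_singleton (f := wordFamily g (2 * n + 2) (neG g L))] at h1
        have h2 := hc.repr_eq_zero hS h1 (z := al g true (2 * n + 1)) hg.pal_ne_top
        rw [map_sub, Finsupp.sub_apply, sub_eq_zero, map_smul, Finsupp.smul_apply, ← hg.neC_pal hL,
          hc.repr_self hS, Finsupp.single_eq_same, smul_eq_mul, mul_one] at h2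
        rw [hc.h_eq hS, h2]
      have e2 : neWt g L n = L (g true) + n * (L (g true) - L (g false)) := by
        rw [neWt]
        ring
      rw [e, if_pos ⟨rfl, rfl⟩, e2]
      exact neChain_deg (hpos true) hlt n
    · refine key ?_ fun h => hy h.2
      rw [hc.h_flip hS, hg.pal_inv]
      refine hg.degLE_h_pal_of_ne hL hpos hlt _ fun h => hy ?_
      rw [← hg.pal_inv, ← h, inv_inv]
  · exact key (hg.degLE_h_pal_of_ne hL hpos hlt _ hx) fun h => hx h.1

/-- By monotonicity of the a-function from both sides, only factors in `{1, s}` can produce `C_s`,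
so the computation takes place in the parabolic subgroup generated by `s`. -/
theorem h_false (x y : W) :
    h (Set.range g) L x y (g false) = open Classical in
      if x = g false ∧ y = g false then eta (L (g false))
      else if (x = 1 ∧ y = g false) ∨ (x = g false ∧ y = 1) then 1 else 0 := by
  classical
  have := hg.finite
  have hS := hg.isHeckeSystem hL
  have hc := hg.isKLFamily_ne hL hpos hlt
  have hposS := weight_pos_of_gen hpos
  have hne := hg.gen_ne_one false
  by_cases hx : x = 1 ∨ x = g false
  · by_cases hy : y = 1 ∨ y = g false
    · rcases hx with rfl | rfl
      · rw [hc.h_one_left hS, Finsupp.single_apply]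
        rcases hy with rfl | rfl <;> simp [hne, hne.symm]
      · rcases hy with rfl | rfl
        · rw [hc.h_one_right hS, Finsupp.single_eq_same]
          simp [hne.symm]
        · rw [hc.h_gen hS ⟨false, rfl⟩ (hpos false), hg.klOp_neC_false hL, if_neg (by decide),
            map_smul, Finsupp.smul_apply, hc.repr_self hS, Finsupp.single_eq_same, if_pos ⟨rfl, rfl⟩,
            smul_eq_mul, mul_one]
    · rw [if_neg (by tauto), if_neg (by tauto)]
      by_contra h0
      have := hc.av_le_of_h_ne_zero hS hposS (hg.neAv_le hL hpos hlt) h0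
      rw [hg.neAv_false, hg.neAv_le_false_iff hL hpos hlt] at this
      exact hy this
  · rw [if_neg (by tauto), if_neg (by tauto)]
    by_contra h0
    have := hc.av_le_of_h_ne_zero_right hS hposS (hg.neAv_le hL hpos hlt) hg.neAv_inv h0
    rw [hg.neAv_false, hg.neAv_le_false_iff hL hpos hlt] at this
    exact hx this

/-- The signs of the leading coefficients. -/
def neSgn (g : Bool → W) (n : ℕ) (w : W) : ℤ :=
  open Classical in if w = al g true (2 * n + 1) then (-1) ^ n else 1

theorem ne_h_single (x y z : W)
    (hz : ¬ ∃ (ε : Bool) (i : Fin n) (δ : Bool), True ∧ z = neEl g ε i δ) :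
    DegLE (neAv g n L z) (h (Set.range g) L x y z) ∧
      (h (Set.range g) L x y z).coeff (neAv g n L z) =
        (open Classical in if x = z ∧ y = z then neSgn g n z else 0) := by
  classical
  have := hg.finite
  have hS := hg.isHeckeSystem hL
  have hc := hg.isKLFamily_ne hL hpos hlt
  have hposS := weight_pos_of_gen hpos
  obtain ⟨h1, h2, h3, h4⟩ := hg.ne_order hL hpos hlt
  rcases hg.ne_not_big hz with rfl | rfl | rfl | rfl
  · rw [hc.h_apply_one hS hposS (hg.neAv_le hL hpos hlt) (hg.neAv_eq_zero_iff hL hpos hlt), neAv_one,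
      neSgn, if_neg hg.pal_ne_one.symm]
    split_ifs
    · refine ⟨DegLE.one le_rfl, ?_⟩
      rw [← Int.cast_one, coeff_intCast_apply]
      rfl
    · exact ⟨DegLE.zero, rfl⟩
  · rw [hg.h_false hL hpos hlt, hg.neAv_false, Int.toNat_of_nonneg h1.le, neSgn,
      if_neg hg.pal_ne_false.symm]
    split_ifs
    · exact ⟨degLE_eta h1.le, coeff_eta h1⟩
    · exact ⟨DegLE.one h1.le, DegLE.one le_rfl _ h1⟩
    · exact ⟨DegLE.zero, rfl⟩
  · rw [hg.neAv_pal, Int.toNat_of_nonneg (by omega), neSgn, if_pos rfl]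
    exact hg.h_pal hL hpos hlt x y
  · rw [hg.neAv_top, Int.toNat_of_nonneg (by omega), neSgn, if_neg hg.pal_ne_top.symm]
    refine hc.h_top hS hposS hg.len_le_top (fun x hx => hg.weight_lt_top hL hpos hx) hg.top_inv
      ?_ x y
    rintro _ ⟨c, rfl⟩
    rw [hg.neC_top hL]
    exact hg.genOp_Gam_top hL c

end IsDihedral

/-! ### Leading terms of the coefficients at the identity for unequal parameters -/

/-- The number `Δ(w)` for the elements of the fusion cell, for unequal parameters. -/
def neDel (g : Bool → W) (L : W → ℤ) : Bool → ℕ → Bool → ℤ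
  | true, i, true => L (g true) + i * (L (g true) - L (g false))
  | false, i, false => (i + 1) * L (g true) + i * L (g false)
  | true, i, false => (i + 1) * (L (g false) + L (g true))
  | false, i, true => (i + 1) * (L (g false) + L (g true))

/-- The number `n_w` for the elements of the fusion cell, for unequal parameters. -/
def neLead : Bool → ℕ → Bool → ℤ
  | true, i, true => (-1) ^ i
  | true, _, false => 1
  | false, _, _ => 1

theorem degLE_T_add {d e : ℤ} (h : e < d) {p : A} (hp : DegLE e p) :
    DegLE d (LaurentPolynomial.T d + p) ∧ (LaurentPolynomial.T d + p).coeff d = 1 := by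
  refine ⟨(DegLE.T d).add (hp.mono h.le), ?_⟩
  rw [AddMonoidAlgebra.coeff_add, Finsupp.add_apply, coeff_T_self, hp d h, add_zero]

theorem IsKLFamily.Del_lead_eq {S : Set W} {L : W → ℤ} {c : W → H W} (hS : IsHeckeSystem S L)
    (hc : IsKLFamily S L c) {w : W} {d l : ℤ} (hl : l ≠ 0)
    (h : DegLE (-d) (c w 1) ∧ (c w 1).coeff (-d) = l) : Del S L w = d ∧ lead S L w = l := by
  have hd : (c w 1).coeff (-d) ≠ 0 := by rwa [h.2]
  exact ⟨hc.Del_eq hS h.1 hd, by rw [hc.lead_eq hS h.1 hd, h.2]⟩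

omit [Group W] in
theorem neLead_ne_zero (ε : Bool) (i : ℕ) (δ : Bool) : neLead ε i δ ≠ 0 := by
  cases ε <;> cases δ <;> simp [neLead]

namespace IsDihedral

variable {g : Bool → W} {n : ℕ} (hg : IsDihedral g (2 * n + 2)) {L : W → ℤ}
  (hL : IsWeight (Set.range g) L) (hpos : ∀ c, 0 < L (g c)) (hlt : L (g false) < L (g true))
include hg

section Apply

include hpos

/-- The contribution `q^(-L(w))` of `Γ_w` is of lower degree than that of the correction. The
leading term is therefore multiplied by `-q^(a-b)` at each step, which explains the sign and why `Δ`
grows only by `b - a`. -/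
theorem nePal_apply_one {i : ℕ} (hi : i ≤ n) :
    DegLE (-neDel g L true i true) (nePal g L i 1) ∧
      (nePal g L i 1).coeff (-neDel g L true i true) = (-1) ^ i := by
  have h1 := hpos false
  have h2 := hpos true
  induction i with
  | zero =>
    rw [nePal, hg.Gam_apply_one (by omega)]
    have e : lw (fun c => L (g c)) true (0 + 1) = neDel g L true 0 true := by
      rw [neDel, lw, lw]
      push_cast
      ring
    rw [e, coeff_T_self]
    exact ⟨DegLE.T _, rfl⟩
  | succ i ih =>
    obtain ⟨h3, h4⟩ := ih (by omega)
    have e1 : Gam g L true (2 * i + 3) 1 =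
        LaurentPolynomial.T (-lw (fun c => L (g c)) true (2 * (i + 1) + 1)) :=
      hg.Gam_apply_one (by omega)
    have e2 : -neDel g L true (i + 1) true =
        (L (g false) - L (g true)) + -neDel g L true i true := by
      rw [neDel, neDel]
      push_cast
      ring
    have e3 : -lw (fun c => L (g c)) true (2 * (i + 1) + 1) < -neDel g L true (i + 1) true := by
      rw [lw_two_mul_add_one, neDel]
      push_cast
      show -(((i : ℤ) + 1 + 1) * L (g true) + (i + 1) * L (g false)) < _
      nlinarith
    rw [nePal, Finsupp.sub_apply, Finsupp.smul_apply, smul_eq_mul, e1]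
    constructor
    · refine ((DegLE.T _).mono e3.le).sub ?_
      rw [e2]
      exact (DegLE.T _).mul h3
    · rw [AddMonoidAlgebra.coeff_sub, Finsupp.sub_apply, (DegLE.T _) _ e3, e2,
        coeff_mul_of_degLE (DegLE.T _) h3, coeff_T_self, h4, pow_succ]
      ring

theorem neE_apply_one {ε : Bool} {i : ℕ} {δ : Bool} (hi : neLen ε i δ ≤ 2 * n + 2) :
    DegLE (-neDel g L ε i δ) (neE g L ε i δ 1) ∧
      (neE g L ε i δ 1).coeff (-neDel g L ε i δ) = neLead ε i δ := by
  have h1 := hpos false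
  have h2 := hpos true
  have even : ∀ c, 2 * i + 2 ≤ 2 * n + 2 → Gam g L c (2 * i + 2) 1 =
      LaurentPolynomial.T (-((i + 1) * (L (g false) + L (g true)))) := by
    intro c hi
    have e : lw (fun c => L (g c)) c (2 * i + 1 + 1) = (i + 1) * (L (g false) + L (g true)) := by
      rw [show 2 * i + 1 + 1 = 2 * (i + 1) by ring, lw_two_mul]
      push_cast
      cases c
      · rfl
      · show _ * (L (g true) + L (g false)) = _
        ring
    rw [hg.Gam_apply_one (k := 2 * i + 1) hi, e]
  cases ε <;> cases δ
  · have hi' : 2 * i + 3 ≤ 2 * n + 2 := hi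
    rw [neE, neDel, neLead, Finsupp.add_apply, Finsupp.smul_apply, smul_eq_mul,
      hg.Gam_apply_one (k := 2 * i + 2) (by omega), hg.Gam_apply_one (k := 2 * i) (by omega),
      T_mul_T, lw_two_mul_add_one, show 2 * i + 2 + 1 = 2 * (i + 1) + 1 by ring, lw_two_mul_add_one]
    -- The second summand of `neE g L false i false`, attached to the shorter word, gives the
    -- leading term.
    have e : L (g false) - L (g true) + -((i + 1) * L (g false) + i * L (g !false)) =
        -((i + 1) * L (g true) + i * L (g false)) := by
      rw [Bool.not_false]
      ring
    rw [e, add_comm (LaurentPolynomial.T _)]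
    refine degLE_T_add ?_ (DegLE.T _)
    rw [Bool.not_false]
    push_cast
    nlinarith
  · rw [neE, neDel, neLead, even _ hi, coeff_T_self]
    exact ⟨DegLE.T _, rfl⟩
  · rw [neE, neDel, neLead, even _ hi, coeff_T_self]
    exact ⟨DegLE.T _, rfl⟩
  · have hi' : 2 * i + 1 ≤ 2 * n + 2 := hi
    exact hg.nePal_apply_one hpos (by omega)

end Apply

section DelLead

include hL hpos hlt

theorem ne_Del_lead {ε : Bool} {i : ℕ} {δ : Bool} (hi : neLen ε i δ ≤ 2 * n + 2) :
    Del (Set.range g) L (al g ε (neLen ε i δ)) = neDel g L ε i δ ∧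
      lead (Set.range g) L (al g ε (neLen ε i δ)) = neLead ε i δ := by
  refine (hg.isKLFamily_ne hL hpos hlt).Del_lead_eq (hg.isHeckeSystem hL) (neLead_ne_zero ε i δ) ?_
  rw [hg.neC_neLen hL hi]
  exact hg.neE_apply_one hpos hi

theorem ne_Del_lead_single {z : W}
    (hz : ¬ ∃ (ε : Bool) (i : Fin n) (δ : Bool), True ∧ z = neEl g ε i δ) :
    Del (Set.range g) L z = neAv g n L z ∧ lead (Set.range g) L z = neSgn g n z := by
  have hS := hg.isHeckeSystem hL
  have hc := hg.isKLFamily_ne hL hpos hlt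
  obtain ⟨h1, h2, h3, h4⟩ := hg.ne_order hL hpos hlt
  rcases hg.ne_not_big hz with rfl | rfl | rfl | rfl
  · rw [neAv_one, neSgn, if_neg hg.pal_ne_one.symm]
    refine hc.Del_lead_eq hS one_ne_zero ?_
    rw [hg.neC_one hL, stdT_apply_self, Nat.cast_zero, neg_zero]
    refine ⟨DegLE.one le_rfl, ?_⟩
    rw [← LaurentPolynomial.T_zero, coeff_T_self]
  · rw [hg.neAv_false, neSgn, if_neg hg.pal_ne_false.symm, Int.toNat_of_nonneg h1.le]
    refine hc.Del_lead_eq hS one_ne_zero ?_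
    have e : lw (fun c => L (g c)) false (0 + 1) = L (g false) := by
      rw [lw, lw, add_zero]
    rw [hg.neC_false hL, hg.Gam_apply_one (k := 0) (by omega), e, coeff_T_self]
    exact ⟨DegLE.T _, rfl⟩
  · rw [hg.neAv_pal, neSgn, if_pos rfl, Int.toNat_of_nonneg (by omega)]
    have h5 := hg.ne_Del_lead hL hpos hlt (ε := true) (i := n) (δ := true)
      (neLen_true_le le_rfl true)
    have e : neWt g L n = neDel g L true n true := by
      rw [neWt, neDel]
      ring
    rw [e]
    exact h5
  · rw [hg.neAv_top, neSgn, if_neg hg.pal_ne_top.symm, Int.toNat_of_nonneg (by omega),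
      hg.ne_weight_top hL]
    exact hg.ne_Del_lead hL hpos hlt (ε := false) (i := n) (δ := true) le_rfl

/-- The equality cases are `t` and `sts`. These are the members of `𝒟` in the fusion cell, one for
each last letter. -/
theorem ne_Del_el (ε : Bool) (i : Fin n) (δ : Bool) :
    L (g true) ≤ Del (Set.range g) L (neEl g ε i δ) ∧
      (L (g true) = Del (Set.range g) L (neEl g ε i δ) ↔ (i : ℕ) = 0 ∧ ε = δ) := by
  have h1 := hpos false
  have h2 := hpos true
  have hi : (0 : ℤ) ≤ (i : ℕ) := Int.natCast_nonneg _
  rw [neEl, (hg.ne_Del_lead hL hpos hlt (neLen_lt ε i.2 δ).le).1]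
  have hi0 : (i : ℕ) = 0 ∨ (1 : ℤ) ≤ (i : ℕ) := by omega
  cases ε <;> cases δ <;> rw [neDel]
  · refine ⟨by nlinarith, fun h => ⟨?_, rfl⟩, fun h => by rw [h.1]; push_cast; ring⟩
    rcases hi0 with h0 | h0
    · exact h0
    · nlinarith
  · refine ⟨by nlinarith, fun h => ?_, fun h => absurd h.2 (by decide)⟩
    nlinarith
  · refine ⟨by nlinarith, fun h => ?_, fun h => absurd h.2 (by decide)⟩
    nlinarith
  · refine ⟨by nlinarith, fun h => ⟨?_, rfl⟩, fun h => by rw [h.1]; push_cast; ring⟩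
    rcases hi0 with h0 | h0
    · exact h0
    · nlinarith

end DelLead

end IsDihedral

/-! ### The cell datum for unequal parameters -/

namespace IsDihedral

variable {g : Bool → W} {n : ℕ} (hg : IsDihedral g (2 * n + 2)) {L : W → ℤ}
  (hL : IsWeight (Set.range g) L) (hpos : ∀ c, 0 < L (g c)) (hlt : L (g false) < L (g true))
include hg

/-- The block matrices of the fusion cell, for unequal parameters. -/
def neCellF (g : Bool → W) (L : W → ℤ) (n : ℕ) : W → Matrix Bool Bool (Matrix (Fin n) (Fin n) A) :=
  cellF (fun _ _ _ => True) (neEl g) (fun ε i δ => fusionBlock n (neP g L) (neR g L) ε i δ) (neF g L)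

theorem neCellF_el (ε : Bool) (i : Fin n) (δ : Bool) :
    neCellF g L n (neEl g ε i δ) = fusionBlock n (neP g L) (neR g L) ε i δ :=
  cellF_el hg.neEl_inj trivial

omit hg in
theorem neCellF_single {w : W} (hw : ¬ ∃ (ε : Bool) (i : Fin n) (δ : Bool), True ∧ w = neEl g ε i δ) :
    neCellF g L n w = scalarBlock n (neF g L w) := cellF_single hw

-- `η(a) ζ` has degree `a + (b - a) = b` with leading coefficient `1`, just like `η(b)`. In leading
-- order the letters `s` and `t` thus play the same role inside the cell.
omit [Group W] hg in
theorem degLE_neP (hpos : ∀ c, 0 < L (g c)) (hlt : L (g false) < L (g true)) (d ε : Bool) :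
    DegLE (L (g true)) (neP g L d ε) ∧
      (neP g L d ε).coeff (L (g true)) = if d = ε then 1 else 0 := by
  have h1 := hpos false
  have h2 := hpos true
  have hz : DegLE (L (g true) - L (g false)) (neZeta g L) := degLE_eta (by omega)
  cases d <;> cases ε
  · rw [neP, if_pos rfl]
    have e : L (g true) = L (g false) + (L (g true) - L (g false)) := by ring
    have h3 := degLE_eta h1.le
    refine ⟨(h3.mul hz).mono e.ge, ?_⟩
    have h4 := coeff_mul_of_degLE h3 hz
    rw [← e, neZeta, coeff_eta h1, coeff_eta (by omega), one_mul] at h4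
    exact h4
  · rw [neP_false_true, if_neg (by decide)]
    exact ⟨hz.mono (by omega), hz _ (by omega)⟩
  · rw [neP_true_false, if_neg (by decide)]
    exact ⟨hz.mono (by omega), hz _ (by omega)⟩
  · rw [neP, if_pos rfl]
    exact ⟨degLE_eta h2.le, coeff_eta h2⟩

omit [Group W] hg in
theorem degLE_neR (hpos : ∀ c, 0 < L (g c)) (hlt : L (g false) < L (g true)) (d ε : Bool) :
    DegLE (L (g true) - 1) (neR g L d ε) := by
  have h1 := hpos false
  cases d <;> cases ε
  · rw [neR]
    exact (degLE_eta h1.le).mono (by omega)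
  · rw [neR_false_true]
    exact DegLE.one (by omega)
  · rw [neR_true_false]
    exact DegLE.one (by omega)
  · rw [neR]
    exact DegLE.zero

omit hg in
theorem degLE_neF (hpos : ∀ c, 0 < L (g c)) (hlt : L (g false) < L (g true)) (w : W)
    (ε ε' : Bool) : DegLE (L (g true) - 1) (neF g L w ε ε') := by
  have h1 := hpos false
  rw [neF]
  split_ifs
  · exact DegLE.one (by omega)
  · exact DegLE.zero
  · cases ε <;> cases ε' <;> rw [neGen]
    · exact (degLE_eta h1.le).mono (by omega)
    · exact DegLE.zero
    · exact DegLE.one (by omega)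
    · exact DegLE.zero
  · exact DegLE.zero

omit hg in
theorem degLE_neCellF_single (hpos : ∀ c, 0 < L (g c)) (hlt : L (g false) < L (g true)) {w : W}
    (hw : ¬ ∃ (ε : Bool) (i : Fin n) (δ : Bool), True ∧ w = neEl g ε i δ)
    (ε ε' : Bool) (i k : Fin n) : DegLE (L (g true) - 1) (neCellF g L n w ε ε' i k) := by
  rw [neCellF_single hw, scalarBlock_apply, Matrix.smul_apply, Matrix.one_apply, smul_ite,
    smul_zero, smul_eq_mul, mul_one]
  split_ifs
  · exact degLE_neF hpos hlt _ _ _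
  · exact DegLE.zero

include hL hpos hlt

theorem h_neEl_eq_zero_of_lt_av_left {x : W} (hx : L (g true) < neAv g n L x) (y : W) (ε : Bool)
    (i : Fin n) (δ : Bool) : h (Set.range g) L x y (neEl g ε i δ) = 0 := by
  have := hg.finite
  by_contra hne
  have h1 := (hg.isKLFamily_ne hL hpos hlt).av_le_of_h_ne_zero_right (hg.isHeckeSystem hL)
    (weight_pos_of_gen hpos) (hg.neAv_le hL hpos hlt) hg.neAv_inv hne
  rw [hg.neAv_el] at h1
  have h2 := hpos true
  omega

theorem ne_h_el (w : W) (ε : Bool) (i : Fin n) (δ ε' : Bool) (k : Fin n) (δ' : Bool) :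
    h (Set.range g) L w (neEl g ε i δ) (neEl g ε' k δ') =
      if δ = δ' then neCellF g L n w ε ε' i k else 0 := by
  have := hg.finite
  have hS := hg.isHeckeSystem hL
  have hc := hg.isKLFamily_ne hL hpos hlt
  obtain ⟨h1, h2, h3, h4⟩ := hg.ne_order hL hpos hlt
  have hZ : ∀ (ε : Bool) (i : Fin n) (δ : Bool), True →
      neEl g ε i δ ∉ ({al g true (2 * n + 1), al g false (2 * n + 2)} : Set W) := by
    rintro ε i δ - (h | h)
    · exact hg.neEl_ne_pal _ _ _ h
    · exact hg.neEl_ne_top _ _ _ h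
  by_cases hw : ∃ (ε : Bool) (i : Fin n) (δ : Bool), True ∧ w = neEl g ε i δ
  · obtain ⟨c, l, d, -, rfl⟩ := hw
    rw [hg.neCellF_el]
    refine hc.h_of_rep hS hg.neEl_inj hZ ?_ trivial trivial
    rw [hg.neC_el hL]
    exact hg.rep_op_neE hL δ c l.2 d
  · rw [neCellF_single hw]
    have zero : w ≠ 1 → w ≠ g false → scalarBlock n (neF g L w) ε ε' i k = 0 := by
      intro h1 h2
      rw [scalarBlock_apply, Matrix.smul_apply, neF, if_neg h1, if_neg h2, zero_smul]
    rcases hg.ne_not_big hw with rfl | rfl | rfl | rfl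
    · refine hc.h_one_el hS hg.neEl_inj (fun ε ε' => ?_) trivial trivial
      rw [neF, if_pos rfl]
    · have e : neF g L (g false) = neGen g L := by
        funext ε ε'
        rw [neF, if_neg (hg.gen_ne_one false), if_pos rfl]
      rw [e]
      refine hc.h_of_rep hS hg.neEl_inj hZ ?_ trivial trivial
      rw [hc.op_klC_gen hS ⟨false, rfl⟩ (hpos false)]
      exact hg.rep_klOp_false hL δ
    · rw [zero hg.pal_ne_one hg.pal_ne_false, ite_self]
      refine hg.h_neEl_eq_zero_of_lt_av_left hL hpos hlt ?_ _ _ _ _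
      rw [hg.neAv_pal]
      omega
    · rw [zero hg.top_ne_one hg.false_ne_top.symm, ite_self]
      refine hg.h_neEl_eq_zero_of_lt_av_left hL hpos hlt ?_ _ _ _ _
      rw [hg.neAv_top]
      omega

theorem ne_h_single_el (x y : W) (ε : Bool) (k : Fin n) (δ : Bool)
    (hx : ¬ ∃ (ε : Bool) (i : Fin n) (δ : Bool), True ∧ x = neEl g ε i δ)
    (hy : ¬ ∃ (ε : Bool) (i : Fin n) (δ : Bool), True ∧ y = neEl g ε i δ) :
    h (Set.range g) L x y (neEl g ε k δ) = 0 := by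
  have := hg.finite
  have hS := hg.isHeckeSystem hL
  have hc := hg.isKLFamily_ne hL hpos hlt
  obtain ⟨h1, h2, h3, h4⟩ := hg.ne_order hL hpos hlt
  have big : ∀ w, (¬ ∃ (ε : Bool) (i : Fin n) (δ : Bool), True ∧ w = neEl g ε i δ) →
      w = 1 ∨ w = g false ∨ L (g true) < neAv g n L w := by
    intro w hw
    rcases hg.ne_not_big hw with rfl | rfl | rfl | rfl
    · exact Or.inl rfl
    · exact Or.inr (Or.inl rfl)
    · rw [hg.neAv_pal]
      omega
    · rw [hg.neAv_top]
      omega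
  rcases big x hx with rfl | rfl | hx'
  · rw [hc.h_one_left hS, Finsupp.single_eq_of_ne]
    rintro rfl
    exact hy ⟨_, _, _, trivial, rfl⟩
  · rcases big y hy with rfl | rfl | hy'
    · rw [hc.h_one_right hS, Finsupp.single_eq_of_ne (hg.neEl_ne_false _ _ _)]
    · rw [hc.h_gen hS ⟨false, rfl⟩ (hpos false), hg.klOp_neC_false hL, if_neg (by decide),
        map_smul, Finsupp.smul_apply, hc.repr_self hS,
        Finsupp.single_eq_of_ne (hg.neEl_ne_false _ _ _), smul_zero]
    · rw [hc.h_flip hS, neEl, hg.inv_al_neLen]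
      refine hg.h_neEl_eq_zero_of_lt_av_left hL hpos hlt ?_ _ δ k ε
      rwa [hg.neAv_inv]
  · exact hg.h_neEl_eq_zero_of_lt_av_left hL hpos hlt hx' _ _ _ _

/-- The cells of a finite dihedral group with unequal parameters. -/
def neDatum [NeZero n] : CellDatum (Set.range g) L n where
  av := neAv g n L
  b := (L (g true)).toNat
  V _ _ _ := True
  el := neEl g
  sgn := neSgn g n
  F := neCellF g L n
  V_zero _ := trivial
  V_swap _ _ _ _ := trivial
  V_connected := ⟨0, trivial⟩
  el_inv ε i δ _ := hg.inv_al_neLen ε i δ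
  el_inj := hg.neEl_inj
  av_el ε i δ _ := hg.neAv_el ε i δ
  av_inj w w' hw := by
    obtain ⟨h1, h2, h3, h4⟩ := hg.ne_order hL hpos hlt
    have val : ∀ w, (¬ ∃ (ε : Bool) (i : Fin n) (δ : Bool), True ∧ w = neEl g ε i δ) →
        w = 1 ∧ neAv g n L w = 0 ∨ w = g false ∧ neAv g n L w = (L (g false)).toNat ∨
        w = al g true (2 * n + 1) ∧ neAv g n L w = (neWt g L n).toNat ∨
        w = al g false (2 * n + 2) ∧ neAv g n L w = (L (al g false (2 * n + 2))).toNat := by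
      intro w hw
      rcases hg.ne_not_big hw with rfl | rfl | rfl | rfl
      · exact Or.inl ⟨rfl, neAv_one⟩
      · exact Or.inr (Or.inl ⟨rfl, hg.neAv_false⟩)
      · exact Or.inr (Or.inr (Or.inl ⟨rfl, hg.neAv_pal⟩))
      · exact Or.inr (Or.inr (Or.inr ⟨rfl, hg.neAv_top⟩))
    have el : ∀ w, (∃ (ε : Bool) (i : Fin n) (δ : Bool), True ∧ w = neEl g ε i δ) →
        neAv g n L w = (L (g true)).toNat := by
      rintro _ ⟨ε, i, δ, -, rfl⟩
      exact hg.neAv_el ε i δ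
    by_cases h : ∃ (ε : Bool) (i : Fin n) (δ : Bool), True ∧ w = neEl g ε i δ <;>
      by_cases h' : ∃ (ε : Bool) (i : Fin n) (δ : Bool), True ∧ w' = neEl g ε i δ
    · exact Or.inr ⟨h, h'⟩
    · have e := el w h
      rcases val w' h' with ⟨-, h5⟩ | ⟨-, h5⟩ | ⟨-, h5⟩ | ⟨-, h5⟩ <;> omega
    · have e := el w' h'
      rcases val w h with ⟨-, h5⟩ | ⟨-, h5⟩ | ⟨-, h5⟩ | ⟨-, h5⟩ <;> omega
    · left
      rcases val w h with ⟨h6, h5⟩ | ⟨h6, h5⟩ | ⟨h6, h5⟩ | ⟨h6, h5⟩ <;>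
        rcases val w' h' with ⟨h7, h8⟩ | ⟨h7, h8⟩ | ⟨h7, h8⟩ | ⟨h7, h8⟩ <;>
        first | exact h6.trans h7.symm | omega
  sgn_eq w := by
    rw [neSgn]
    split_ifs
    · exact neg_one_pow_eq_or ℤ n
    · exact Or.inl rfl
  inv_single w hw := by
    rcases hg.ne_not_big hw with rfl | rfl | rfl | rfl
    · exact inv_one
    · exact hg.inv_gen false
    · exact hg.pal_inv
    · exact hg.top_inv
  mono s hs x z hz := hg.neAv_le hL hpos hlt s hs x z hz
  h_el w ε i δ ε' k δ' _ _ := hg.ne_h_el hL hpos hlt w ε i δ ε' k δ'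
  F_comm w ε ε' := by
    by_cases hw : ∃ (ε : Bool) (i : Fin n) (δ : Bool), True ∧ w = neEl g ε i δ
    · obtain ⟨c, l, d, -, rfl⟩ := hw
      rw [hg.neCellF_el, fusionBlock_apply]
      split_ifs
      · exact fusionMatrix_commute _ _ _
      · exact Commute.zero_left _
    · rw [neCellF_single hw, scalarBlock_apply]
      exact (Commute.one_left _).smul_left _
  F_V _ _ _ _ _ _ _ _ := trivial
  F_deg w ε ε' i k := by
    rw [Int.toNat_of_nonneg (hpos true).le]
    by_cases hw : ∃ (ε : Bool) (i : Fin n) (δ : Bool), True ∧ w = neEl g ε i δ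
    · obtain ⟨c, l, d, -, rfl⟩ := hw
      rw [hg.neCellF_el, fusionBlock_apply]
      split_ifs
      · exact degLE_fusionMatrix (degLE_neP hpos hlt _ _).1
          ((degLE_neR hpos hlt _ _).mono (by omega)) _ _ _
      · exact DegLE.zero
    · exact (degLE_neCellF_single hpos hlt hw ε ε' i k).mono (by omega)
  F_lead c l d ε ε' i k _ := by
    rw [hg.neCellF_el, fusionBlock_apply, Int.toNat_of_nonneg (hpos true).le]
    by_cases hε : ε' = c
    · rw [if_pos hε, coeff_fusionMatrix (degLE_neR hpos hlt _ _), (degLE_neP hpos hlt _ _).2]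
      split_ifs with h1 h2 h2
      · rw [one_mul]
      · exact absurd ⟨hε.symm, h1⟩ h2
      · exact absurd h2.2 h1
      · exact zero_mul _
    · rw [if_neg hε, if_neg fun h => hε h.1.symm]
      rfl
  F_lead_single w ε ε' i k hw := by
    rw [Int.toNat_of_nonneg (hpos true).le]
    exact degLE_neCellF_single hpos hlt hw ε ε' i k _ (by omega)
  h_single_el x y ε k δ hx hy _ := hg.ne_h_single_el hL hpos hlt x y ε k δ hx hy
  h_single_deg x y z hz := (hg.ne_h_single hL hpos hlt x y z hz).1
  h_single_lead z hz := by
    rw [(hg.ne_h_single hL hpos hlt z z z hz).2, if_pos ⟨rfl, rfl⟩]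
  h_single_lead_ne x y z hz hne := by
    rw [(hg.ne_h_single hL hpos hlt x y z hz).2, if_neg hne]
  le_Del z := by
    by_cases hz : ∃ (ε : Bool) (i : Fin n) (δ : Bool), True ∧ z = neEl g ε i δ
    · obtain ⟨c, l, d, -, rfl⟩ := hz
      rw [hg.neAv_el, Int.toNat_of_nonneg (hpos true).le]
      exact (hg.ne_Del_el hL hpos hlt c l d).1
    · exact (hg.ne_Del_lead_single hL hpos hlt hz).1.ge
  eq_Del z := by
    by_cases hz : ∃ (ε : Bool) (i : Fin n) (δ : Bool), True ∧ z = neEl g ε i δ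
    · rw [iff_of_eq (congrArg (· ∨ _) (eq_false (not_not_intro hz))), false_or]
      obtain ⟨c, l, d, -, rfl⟩ := hz
      rw [hg.neAv_el, Int.toNat_of_nonneg (hpos true).le, (hg.ne_Del_el hL hpos hlt c l d).2]
      constructor
      · rintro ⟨h1, rfl⟩
        obtain rfl : l = 0 := Fin.ext h1
        exact ⟨c, rfl⟩
      · rintro ⟨ε, hε⟩
        obtain ⟨rfl, rfl, rfl⟩ := hg.neEl_inj _ _ _ _ _ _ trivial trivial hε
        exact ⟨rfl, rfl⟩
    · exact iff_of_true (hg.ne_Del_lead_single hL hpos hlt hz).1.symm (Or.inl hz)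
  lead_single z hz := (hg.ne_Del_lead_single hL hpos hlt hz).2
  lead_el ε := by
    rw [neEl, (hg.ne_Del_lead hL hpos hlt (neLen_lt ε (0 : Fin n).2 ε).le).2]
    cases ε <;> rfl

end IsDihedral

/-! ### Groups of rank at most one -/

section RankOne

variable {S : Set W} {L : W → ℤ}

theorem IsHeckeSystem.klOp_klOp (hS : IsHeckeSystem S L) {s : W} (hs : s ∈ S) (u : H W) :
    klOp S L s (klOp S L s u) = eta (L s) • klOp S L s u := by
  have h : genOp S L s (genOp S L s u) = u + xi L s • genOp S L s u :=
    LinearMap.congr_fun (hS.genOp_mul_self hs) u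
  have hT : (LaurentPolynomial.T (-L s) * LaurentPolynomial.T (L s) : A) = 1 := by
    rw [T_mul_T, neg_add_cancel, LaurentPolynomial.T_zero]
  simp only [klOp_apply, map_add, map_smul, h, xi, eta]
  match_scalars
  · linear_combination -hT
  · ring

variable (hinv : ∀ s ∈ S, s * s = 1 ∧ s ≠ 1) (hsub : S.Subsingleton) (hW : ∀ w : W, w = 1 ∨ w ∈ S)
include hinv hsub hW

theorem isHeckeSystem_of_subsingleton (h1 : L 1 = 0) : IsHeckeSystem S L := by
  have word : ∀ w : W, ∃ l : List W, IsWord S w l := by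
    intro w
    rcases hW w with rfl | hw
    · exact ⟨[], by simp, rfl⟩
    · exact ⟨[w], by simpa using hw, by simp⟩
  have len_pos : ∀ s ∈ S, len S s ≠ 0 := by
    intro s hs h0
    have hmem : len S s ∈ {n | ∃ l : List W, IsWord S s l ∧ l.length = n} := by
      obtain ⟨l, hl⟩ := word s
      exact Nat.sInf_mem ⟨l.length, l, hl, rfl⟩
    rw [h0] at hmem
    obtain ⟨l, ⟨-, h2⟩, h3⟩ := hmem
    rw [List.length_eq_zero_iff.1 h3] at h2
    exact (hinv s hs).2 h2.symm
  have len_one : len S (1 : W) = 0 := IsHeckeSystem.len_one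
  refine ⟨fun s hs => (hinv s hs).1, word, ?_, ?_, ?_⟩
  · intro s hs w
    rcases hW w with rfl | hw
    · rw [mul_one, len_one]
      exact len_pos s hs
    · rw [hsub hw hs, (hinv s hs).1, len_one]
      exact (len_pos s hs).symm
  · intro s hs r hr w _ _ _
    rw [hsub hr hs]
    rcases hW w with rfl | hw
    · rw [mul_one, one_mul]
    · rw [hsub hw hs]
  · intro x y hxy
    rcases hW x with rfl | hx
    · rw [one_mul, h1, zero_add]
    · rcases hW y with rfl | hy
      · rw [mul_one, h1, add_zero]
      · rw [hsub hy hx, (hinv x hx).1, len_one] at hxy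
        have := len_pos x hx
        omega

omit hinv hsub in
open Classical in
theorem isKLFamily_of_subsingleton (hS : IsHeckeSystem S L) (hpos : ∀ s ∈ S, 0 < L s) :
    IsKLFamily S L fun w => if w = 1 then stdT 1 else klOp S L w (stdT 1) where
  isKL w := by
    split_ifs with h
    · rw [h]
      exact IsKLFamily.isKL_stdT_one hS
    · have hw := (hW w).resolve_left h
      exact IsKLFamily.isKL_klOp_one hS hw (hpos w hw)
  sub_mem_lower w := by
    split_ifs with h
    · rw [h, sub_self]
      exact Submodule.zero_mem _
    · have hw := (hW w).resolve_left h
      rw [klOp_apply, ← hS.stdOp_gen hw, hS.stdOp_stdT_one, add_sub_cancel_left]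
      refine Submodule.smul_mem _ _ ?_
      rw [mem_lower]
      intro y hy
      refine stdT_apply_of_ne ?_
      rintro rfl
      rw [IsHeckeSystem.len_one, Nat.le_zero] at hy
      exact h (hS.len_eq_zero hy)

/-- For the trivial group and for groups of order two every product is covered by the unit and `C_s
C_s = η C_s`. This is the part of P12 that concerns proper parabolic subgroups. -/
theorem aFun_of_subsingleton (h1 : L 1 = 0) (hpos : ∀ s ∈ S, 0 < L s) (w : W) :
    aFun S L w = (L w).toNat := by
  classical
  have hS := isHeckeSystem_of_subsingleton (L := L) hinv hsub hW h1
  have hc := isKLFamily_of_subsingleton hW hS hpos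
  have hfin : Finite W := by
    refine Set.finite_univ_iff.1 (((Set.finite_singleton 1).union hsub.finite).subset fun w _ => ?_)
    exact hW w
  have hgen : ∀ s ∈ S, h S L s s = Finsupp.single s (eta (L s)) := by
    intro s hs
    rw [hc.h_gen hS hs (hpos s hs)]
    have h2 := hc.repr_self hS s
    simp only [if_neg (hinv s hs).2] at h2 ⊢
    rw [hS.klOp_klOp hs, map_smul, h2, Finsupp.smul_single, smul_eq_mul, mul_one]
  rcases hW w with rfl | hw
  · rw [h1]
    refine aFun_eq_of_degLE (x := 1) (y := 1) (fun x y => ?_) ?_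
    · rcases hW x with rfl | hx
      · rw [hc.h_one_left hS, Finsupp.single_apply]
        split_ifs
        · exact DegLE.one le_rfl
        · exact DegLE.zero
      · rcases hW y with rfl | hy
        · rw [hc.h_one_right hS, Finsupp.single_eq_of_ne (hinv x hx).2.symm]
          exact DegLE.zero
        · rw [hsub hy hx, hgen x hx, Finsupp.single_eq_of_ne (hinv x hx).2.symm]
          exact DegLE.zero
    · rw [hc.h_one_left hS, Finsupp.single_eq_same, ← Int.cast_one, coeff_intCast_apply]
      exact one_ne_zero
  · have h2 := hpos w hw
    refine aFun_eq_of_degLE (x := w) (y := w) (fun x y => ?_) ?_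
    · rw [Int.toNat_of_nonneg h2.le]
      rcases hW x with rfl | hx
      · rw [hc.h_one_left hS, Finsupp.single_apply]
        split_ifs
        · exact DegLE.one h2.le
        · exact DegLE.zero
      · rw [hsub hx hw]
        rcases hW y with rfl | hy
        · rw [hc.h_one_right hS, Finsupp.single_eq_same]
          exact DegLE.one h2.le
        · rw [hsub hy hw, hgen w hw, Finsupp.single_eq_same]
          exact degLE_eta h2.le
    · rw [hgen w hw, Finsupp.single_eq_same, Int.toNat_of_nonneg h2.le, coeff_eta h2]
      exact one_ne_zero

end RankOne

theorem eq_one_or_mem_of_mem_closure {S : Set W} (hinv : ∀ s ∈ S, s * s = 1) (hsub : S.Subsingleton)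
    {w : W} (hw : w ∈ Subgroup.closure S) : w = 1 ∨ w ∈ S := by
  induction hw using Subgroup.closure_induction with
  | mem x hx => exact Or.inr hx
  | one => exact Or.inl rfl
  | mul x y _ _ hx hy =>
    rcases hx with rfl | hx
    · rwa [one_mul]
    · rcases hy with rfl | hy
      · rw [mul_one]
        exact Or.inr hx
      · rw [hsub hy hx]
        exact Or.inl (hinv x hx)
  | inv x _ hx =>
    rcases hx with rfl | hx
    · exact Or.inl inv_one
    · rw [inv_eq_of_mul_eq_one_right (hinv x hx)]
      exact Or.inr hx

theorem aFun_closure_of_subsingleton {S : Set W} {L : W → ℤ} (hinv : ∀ s ∈ S, s * s = 1 ∧ s ≠ 1)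
    (hsub : S.Subsingleton) (h1 : L 1 = 0) (hpos : ∀ s ∈ S, 0 < L s) (y : Subgroup.closure S) :
    aFun (W := Subgroup.closure S) {x | (x : W) ∈ S} (fun x => L (x : W)) y = (L y).toNat := by
  refine aFun_of_subsingleton (L := fun x : Subgroup.closure S => L x) ?_ ?_ ?_ h1 (fun s hs => hpos s hs) y
  · rintro ⟨s, hs'⟩ hs
    obtain ⟨h2, h3⟩ := hinv s hs
    exact ⟨Subtype.ext h2, fun h => h3 (congrArg Subtype.val h)⟩
  · intro x hx y hy
    exact Subtype.ext (hsub hx hy)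
  · rintro ⟨w, hw⟩
    rcases eq_one_or_mem_of_mem_closure (fun s hs => (hinv s hs).1) hsub hw with rfl | h
    · exact Or.inl rfl
    · exact Or.inr h

namespace IsDihedral

variable {g : Bool → W} {M : ℕ} (hg : IsDihedral g M)

theorem eq_range_or_subsingleton {α : Type*} {g : Bool → α} {I : Set α} (hI : I ⊆ Set.range g) :
    I = Set.range g ∨ I.Subsingleton := by
  by_cases h : ∀ c, g c ∈ I
  · refine Or.inl (hI.antisymm ?_)
    rintro _ ⟨c, rfl⟩
    exact h c
  · obtain ⟨d, hd⟩ := not_forall.1 h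
    have key : ∀ x ∈ I, x = g !d := by
      intro x hx
      obtain ⟨c, rfl⟩ := hI hx
      by_cases hc : c = d
      · rw [hc] at hx
        exact absurd hx hd
      · rw [show c = !d by cases c <;> cases d <;> first | rfl | exact absurd rfl hc]
    exact Or.inr fun x hx y hy => (key x hx).trans (key y hy).symm

/-- The generators, as elements of the subgroup they generate. -/
def closureGen (g : Bool → W) (c : Bool) : Subgroup.closure (Set.range g) :=
  ⟨g c, Subgroup.subset_closure ⟨c, rfl⟩⟩

theorem coe_al_closureGen (c : Bool) (k : ℕ) : ((al (closureGen g) c k : Subgroup.closure (Set.range g)) : W) = al g c k := by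
  induction k generalizing c with
  | zero => rfl
  | succ k ih =>
    rw [al_succ, al_succ, Subgroup.coe_mul, ih]
    rfl

theorem range_closureGen : Set.range (closureGen g) =
    {x : Subgroup.closure (Set.range g) | (x : W) ∈ Set.range g} := by
  ext ⟨x, hx⟩
  constructor
  · rintro ⟨c, hc⟩
    exact ⟨c, congrArg Subtype.val hc⟩
  · rintro ⟨c, hc⟩
    exact ⟨c, Subtype.ext hc⟩

include hg

theorem isDihedral_closureGen : IsDihedral (closureGen g) M where
  three_le := hg.three_le
  mul_self c := Subtype.ext (hg.mul_self c)
  al_top c := Subtype.ext (by rw [coe_al_closureGen, coe_al_closureGen, hg.al_top])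
  word := by
    rintro ⟨w, hw⟩
    obtain ⟨c, k, -, rfl⟩ := hg.exists_al w
    obtain ⟨l, hl, -⟩ := isWord_al (g := closureGen g) c k
    exact ⟨l, by rwa [show (⟨al g c k, hw⟩ : Subgroup.closure (Set.range g)) =
      al (closureGen g) c k from Subtype.ext (coe_al_closureGen c k).symm]⟩
  al_inj c c' k k' hk hk' h := by
    refine hg.al_inj c c' k k' hk hk' ?_
    rw [← coe_al_closureGen, h, coe_al_closureGen]

theorem len_closureGen (x : Subgroup.closure (Set.range g)) :
    len (Set.range (closureGen g)) x = len (Set.range g) (x : W) := by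
  obtain ⟨c, k, hk, rfl⟩ := hg.isDihedral_closureGen.exists_al x
  rw [hg.isDihedral_closureGen.len_al hk, coe_al_closureGen, hg.len_al hk]

theorem isWeight_closureGen {L : W → ℤ} (hL : IsWeight (Set.range g) L) :
    IsWeight (Set.range (closureGen g)) fun x => L (x : W) := by
  intro x y hxy
  rw [hg.len_closureGen, hg.len_closureGen, hg.len_closureGen] at hxy
  exact hL x y hxy

end IsDihedral

/-! ### Distinguished elements -/

theorem IsLongestIn.unique {S J : Set W} {d d' : W} (h : IsLongestIn S J d)
    (h' : IsLongestIn S J d') : d = d' := by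
  by_contra hne
  have h1 := h.2 d' h'.1 (Ne.symm hne)
  have h2 := h'.2 d h.1 hne
  omega

theorem isLongestIn_empty (S : Set W) : IsLongestIn S ∅ 1 := by
  refine ⟨Subgroup.one_mem _, fun x hx hne => ?_⟩
  rw [Subgroup.closure_empty, Subgroup.mem_bot] at hx
  exact absurd hx hne

theorem IsDist.mem_OmGe {S : Set W} {L : W → ℤ} {d : W} {m : ℤ} (hd : IsDist S L d m) {N : ℕ}
    (hN : (N : ℤ) ≤ m) : d ∈ OmGe S L N :=
  ⟨d, m, hd, hN, 1, 1, by rw [one_mul, mul_one], by rw [IsHeckeSystem.len_one, zero_add, add_zero]⟩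

theorem IsHeckeSystem.eq_or_len_lt {S : Set W} {L : W → ℤ} (hS : IsHeckeSystem S L) {w x d y : W}
    (hw : w = x * d * y) (hl : len S w = len S x + len S d + len S y) :
    w = d ∨ len S d < len S w := by
  by_cases h : len S x + len S y = 0
  · have hx := hS.len_eq_zero (w := x) (by omega)
    have hy := hS.len_eq_zero (w := y) (by omega)
    left
    rw [hw, hx, hy, one_mul, mul_one]
  · right
    omega

theorem klP_one_ne_zero_of_lead {S : Set W} {L : W → ℤ} {w : W} (h : lead S L w ≠ 0) :
    klP S L 1 w ≠ 0 := by
  intro h0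
  rw [lead, h0] at h
  exact h rfl

namespace IsDihedral

variable {g : Bool → W} {M : ℕ} (hg : IsDihedral g M) {L : W → ℤ} (hL : IsWeight (Set.range g) L)
include hg

theorem isLongestIn_gen (c : Bool) : IsLongestIn (Set.range g) {g c} (g c) := by
  refine ⟨Subgroup.subset_closure rfl, fun x hx hne => ?_⟩
  rcases eq_one_or_mem_of_mem_closure (by rintro _ rfl; exact hg.mul_self c)
    Set.subsingleton_singleton hx with rfl | h
  · have h1 := hg.len_al (c := c) (k := 1) (by have := hg.three_le; omega)
    rw [al_one] at h1
    rw [IsHeckeSystem.len_one, h1]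
    exact one_pos
  · exact absurd h hne

theorem isLongestIn_top : IsLongestIn (Set.range g) (Set.range g) (al g false M) := by
  refine ⟨?_, fun x _ hne => hg.len_lt_top hne⟩
  rw [← coe_al_closureGen]
  exact Subtype.prop _

/-- `IsDist` reads `m_st` as an order. If a smaller power `m` were trivial, the alternating word of
length `2 * m` would be trivial. Either it is itself a nonempty word of length at most `M`, or
removing an initial segment of length `M` leaves a word shorter than `M` that equals the longest
element. -/
theorem orderOf_gen_mul (c : Bool) : orderOf (g c * g !c) = M := by
  have hM := hg.three_le
  have htop : al g false M * al g false M = 1 := by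
    rw [← mul_inv_cancel (al g false M), hg.top_inv]
  rw [orderOf_eq_iff (by omega)]
  constructor
  · rw [← al_two_mul, two_mul, al_add, hg.al_top_eq c, hg.al_top_eq (tog c M), htop]
  · intro m hm h0 h1
    rw [← al_two_mul] at h1
    by_cases hle : 2 * m ≤ M
    · obtain ⟨k, hk⟩ : ∃ k, 2 * m = k + 1 := ⟨2 * m - 1, by omega⟩
      rw [hk] at h1 hle
      exact hg.al_ne_one hle h1
    · obtain ⟨k, hk⟩ : ∃ k, 2 * m = M + k := ⟨2 * m - M, by omega⟩
      rw [hk, al_add, hg.al_top_eq] at h1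
      refine hg.al_ne_top (c := tog c M) (k := k) (by omega) ?_
      rw [← hg.top_inv]
      exact (inv_eq_of_mul_eq_one_right h1).symm

include hL

theorem isDist_cases {d : W} {m : ℤ} (hd : IsDist (Set.range g) L d m) :
    (d = 1 ∧ m = 0) ∨ (∃ c, d = g c ∧ m = L (g c)) ∨ (d = al g false M ∧ m = L (al g false M)) ∨
      ∃ c, L (g !c) < L (g c) ∧ ∃ k : ℕ, 0 < k ∧ M = 2 * k ∧ d = al g c (2 * k - 1) ∧
        m = k * L (g c) - (k - 1) * L (g !c) := by
  rcases hd with ⟨J, hJ, hd, rfl⟩ | ⟨_, ⟨c', rfl⟩, _, ⟨c, rfl⟩, hlt, k, hk, ho, rfl, rfl⟩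
  · rcases eq_range_or_subsingleton hJ with rfl | hsub
    · obtain rfl := hd.unique hg.isLongestIn_top
      exact Or.inr (Or.inr (Or.inl ⟨rfl, rfl⟩))
    · rcases hsub.eq_empty_or_singleton with rfl | ⟨r, rfl⟩
      · obtain rfl := hd.unique (isLongestIn_empty _)
        exact Or.inl ⟨rfl, (hg.isHeckeSystem hL).weight_one⟩
      · obtain ⟨c, rfl⟩ := hJ rfl
        obtain rfl := hd.unique (hg.isLongestIn_gen c)
        exact Or.inr (Or.inl ⟨c, rfl, rfl⟩)
  · obtain rfl : c' = !c := by
      cases c <;> cases c' <;> first | rfl | exact absurd hlt (lt_irrefl _)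
    refine Or.inr (Or.inr (Or.inr ⟨c, hlt, k, hk, ?_, rfl, rfl⟩))
    rw [← ho, ← hg.orderOf_gen_mul (!c), Bool.not_not]

omit hL in
theorem isDist_top : IsDist (Set.range g) L (al g false M) (L (al g false M)) :=
  Or.inl ⟨_, subset_rfl, hg.isLongestIn_top, rfl⟩

omit hL in
theorem isDist_gen (c : Bool) : IsDist (Set.range g) L (g c) (L (g c)) :=
  Or.inl ⟨{g c}, by rintro _ rfl; exact ⟨c, rfl⟩, hg.isLongestIn_gen c, rfl⟩

theorem isDist_one : IsDist (Set.range g) L 1 0 :=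
  Or.inl ⟨∅, Set.empty_subset _, isLongestIn_empty _, (hg.isHeckeSystem hL).weight_one.symm⟩

omit hL in
theorem len_gen (c : Bool) : len (Set.range g) (g c) = 1 := by
  have h1 := hg.len_al (c := c) (k := 1) (by have := hg.three_le; omega)
  rwa [al_one] at h1

/-- The compatibility of the a-function with parabolic subgroups only needs to be checked on the
group itself and on its generators. -/
theorem aFun_closure (hpos : ∀ c, 0 < L (g c)) (h1 : aFun (Set.range g) L 1 = 0)
    (hgen : ∀ c, aFun (Set.range g) L (g c) = (L (g c)).toNat)
    (htop : ∀ y : Subgroup.closure (Set.range g),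
      aFun (W := Subgroup.closure (Set.range g)) (Set.range (closureGen g)) (fun x => L (x : W)) y =
        aFun (Set.range g) L y)
    (I : Set W) (hI : I ⊆ Set.range g) (y : Subgroup.closure I) :
    aFun (W := Subgroup.closure I) {x | (x : W) ∈ I} (fun x => L (x : W)) y =
      aFun (Set.range g) L (y : W) := by
  rcases eq_range_or_subsingleton hI with rfl | hsub
  · rw [← range_closureGen]
    exact htop y
  · have hS := hg.isHeckeSystem hL
    have hinv : ∀ s ∈ I, s * s = 1 ∧ s ≠ 1 := by
      intro s hs
      obtain ⟨c, rfl⟩ := hI hs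
      refine ⟨hg.mul_self c, ?_⟩
      rw [← al_one g c]
      exact hg.al_ne_one (by have := hg.three_le; omega)
    rw [aFun_closure_of_subsingleton hinv hsub hS.weight_one
      fun s hs => weight_pos_of_gen hpos s (hI hs)]
    rcases eq_one_or_mem_of_mem_closure (fun s hs => (hinv s hs).1) hsub y.2 with h | h
    · rw [h, h1, hS.weight_one]
      rfl
    · obtain ⟨c, hc⟩ := hI h
      rw [← hc, hgen]

end IsDihedral

/-! ### Lusztig's conjectures for finite dihedral groups -/

namespace IsDihedral

section Equal

variable {g : Bool → W} {n : ℕ} [NeZero n] (hg : IsDihedral g (n + 1)) {L : W → ℤ}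
  (hL : IsWeight (Set.range g) L) (heq : ∀ c, L (g c) = L (g !c)) (hpos : ∀ c, 0 < L (g c))
include hg hL heq hpos

omit [NeZero n] in
theorem eq_wellDefined : WellDefined (Set.range g) L := by
  have := hg.finite
  refine (hg.isKLFamily_eq hL heq hpos).wellDefined (hg.isHeckeSystem hL) fun w => ?_
  refine klP_one_ne_zero_of_lead ?_
  obtain ⟨c, k, hk, rfl⟩ := hg.exists_al w
  rcases k with _ | k
  · rw [al_zero, (hg.eq_Del_lead_one hL heq hpos).2]
    exact one_ne_zero
  · rw [(hg.eq_Del_lead hL heq hpos hk).2]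
    exact one_ne_zero

theorem eq_aFun (w : W) : aFun (Set.range g) L w = eqAv g (n + 1) L w :=
  have := hg.finite
  (hg.eqDatum hL heq hpos).aFun_eq (hg.isHeckeSystem hL) (hg.isKLFamily_eq hL heq hpos) w

theorem eq_pConj (N : ℕ) : PConj (Set.range g) L N := by
  classical
  have := hg.finite
  refine (hg.eqDatum hL heq hpos).pConj (hg.isHeckeSystem hL) (hg.isKLFamily_eq hL heq hpos)
    (weight_pos_of_gen hpos) N (hg.aFun_closure hL hpos ?_ (fun c => ?_) fun y => ?_)
  · rw [hg.eq_aFun hL heq hpos, eqAv_one, Nat.cast_zero]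
  · rw [hg.eq_aFun hL heq hpos, ← al_one g c,
      hg.eqAv_al (k := 0) (by have := hg.three_le; omega), al_one]
    cases c
    · rfl
    · rw [heq true]
      rfl
  -- For `I = S` the subgroup is dihedral on the same words and with the same weights, so the
  -- explicit formula for the a-function applies on both sides.
  · rw [hg.isDihedral_closureGen.eq_aFun (hg.isWeight_closureGen hL) heq hpos,
      hg.eq_aFun hL heq hpos]
    have e1 : y = 1 ↔ (y : W) = 1 := (OneMemClass.coe_eq_one).symm
    have e2 : y = al (closureGen g) false (n + 1) ↔ (y : W) = al g false (n + 1) := by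
      rw [Subtype.ext_iff, coe_al_closureGen]
    simp only [eqAv, e1, e2, coe_al_closureGen]
    rfl

omit [NeZero n] in
-- A length-additive multiple of `d` is `d` itself or strictly longer. With the explicit a-function,
-- and since every nontrivial word contains a generator, the condition reduces to comparing weights;
-- the second kind of distinguished element does not exist here.
theorem eq_mem_OmGe {w : W} {N : ℕ} : w ∈ OmGe (Set.range g) L N ↔ N ≤ eqAv g (n + 1) L w := by
  have hS := hg.isHeckeSystem hL
  have h3 := hg.weight_gen_lt_top hL hpos
  have h4 := hpos false
  constructor
  · rintro ⟨d, m, hd, hN, x, y, hw, hl⟩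
    have hwd := hS.eq_or_len_lt hw hl
    rcases hg.isDist_cases hL hd with ⟨-, rfl⟩ | ⟨c, rfl, rfl⟩ | ⟨rfl, rfl⟩ | ⟨c, hlt, -⟩
    · omega
    · have hlc : L (g c) = L (g false) := by
        cases c
        · rfl
        · exact heq true
      rw [hg.len_gen] at hwd
      obtain ⟨c', k, hk, rfl⟩ := hg.exists_al w
      rcases k with _ | k
      · rw [al_zero, IsHeckeSystem.len_one] at hwd
        rcases hwd with h | h
        · rw [← al_one g c] at h
          exact absurd h.symm (hg.al_ne_one (by have := hg.three_le; omega))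
        · omega
      · have := hg.le_eqAv hL hpos (c := c') hk
        omega
    · rcases hwd with rfl | h
      · rw [hg.eqAv_top]
        omega
      · exact absurd (hg.len_le_top w) (by omega)
    · rw [heq c] at hlt
      exact absurd hlt (lt_irrefl _)
  · intro hN
    obtain ⟨c, k, hk, rfl⟩ := hg.exists_al w
    rcases k with _ | k
    · rw [al_zero, eqAv_one] at hN
      exact (hg.isDist_one hL).mem_OmGe (by omega)
    · rcases hk.lt_or_eq with hk' | hk'
      · rw [hg.eqAv_al hk'] at hN
        refine ⟨g c, L (g c), hg.isDist_gen c, ?_, 1, al g (!c) k, ?_, ?_⟩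
        · cases c
          · omega
          · have := heq true
            rw [Bool.not_true] at this
            omega
        · rw [one_mul, al_succ]
        · rw [hg.len_al hk, IsHeckeSystem.len_one, hg.len_gen, hg.len_al (by omega)]
          omega
      · rw [hk', hg.al_top_eq, hg.eqAv_top] at hN
        rw [hk', hg.al_top_eq]
        exact hg.isDist_top.mem_OmGe (by omega)

theorem eq_WEq_eq_OmEq (N : ℕ) : WEq (Set.range g) L N = OmEq (Set.range g) L N := by
  ext w
  simp only [WEq, OmEq, Set.mem_sdiff, hg.eq_mem_OmGe hL heq hpos, WGe, Set.mem_ofPred_eq,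
    hg.eq_aFun hL heq hpos, Nat.cast_le]

end Equal

section Unequal

variable {g : Bool → W} {n : ℕ} (hg : IsDihedral g (2 * n + 2)) {L : W → ℤ}
  (hL : IsWeight (Set.range g) L) (hpos : ∀ c, 0 < L (g c)) (hlt : L (g false) < L (g true))
include hg hL hpos hlt

theorem ne_wellDefined : WellDefined (Set.range g) L := by
  have := hg.finite
  refine (hg.isKLFamily_ne hL hpos hlt).wellDefined (hg.isHeckeSystem hL) fun w => ?_
  refine klP_one_ne_zero_of_lead ?_
  by_cases hw : ∃ (ε : Bool) (i : Fin n) (δ : Bool), True ∧ w = neEl g ε i δ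
  · obtain ⟨ε, i, δ, -, rfl⟩ := hw
    rw [neEl, (hg.ne_Del_lead hL hpos hlt (neLen_lt ε i.2 δ).le).2]
    exact neLead_ne_zero ε i δ
  · rw [(hg.ne_Del_lead_single hL hpos hlt hw).2, neSgn]
    split_ifs
    · exact pow_ne_zero _ (by decide)
    · exact one_ne_zero

omit hL hpos hlt in
theorem neZero : NeZero n := ⟨by have := hg.three_le; omega⟩

theorem ne_aFun (w : W) : aFun (Set.range g) L w = neAv g n L w :=
  have := hg.finite
  have := hg.neZero
  (hg.neDatum hL hpos hlt).aFun_eq (hg.isHeckeSystem hL) (hg.isKLFamily_ne hL hpos hlt) w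

omit hL hpos hlt in
theorem neAv_true : neAv g n L (g true) = (L (g true)).toNat := by
  have h : neAv g n L (al g true 1) = (L (g true)).toNat :=
    hg.neAv_el true ⟨0, Nat.pos_of_ne_zero hg.neZero.out⟩ true
  rwa [al_one] at h

theorem ne_pConj (N : ℕ) : PConj (Set.range g) L N := by
  classical
  have := hg.finite
  have := hg.neZero
  refine (hg.neDatum hL hpos hlt).pConj (hg.isHeckeSystem hL) (hg.isKLFamily_ne hL hpos hlt)
    (weight_pos_of_gen hpos) N (hg.aFun_closure hL hpos ?_ (fun c => ?_) fun y => ?_)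
  · rw [hg.ne_aFun hL hpos hlt, neAv_one, Nat.cast_zero]
  · rw [hg.ne_aFun hL hpos hlt]
    cases c
    · rw [hg.neAv_false]
    · rw [hg.neAv_true]
  · rw [hg.isDihedral_closureGen.ne_aFun (hg.isWeight_closureGen hL) hpos hlt,
      hg.ne_aFun hL hpos hlt]
    have e1 : y = 1 ↔ (y : W) = 1 := (OneMemClass.coe_eq_one).symm
    have e2 : ∀ c k, y = al (closureGen g) c k ↔ (y : W) = al g c k := by
      intro c k
      rw [Subtype.ext_iff, coe_al_closureGen]
    have e3 : y = closureGen g false ↔ (y : W) = g false := Subtype.ext_iff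
    simp only [neAv, e1, e2, e3, coe_al_closureGen]
    rfl

/-- An element strictly longer than a generator is neither `1` nor `s` and has a-value at least `b`;
one strictly longer than `d_I` is `w_I`. Conversely, the words of the fusion cell all contain the
letter `t`, and the other elements are themselves distinguished. -/
theorem ne_mem_OmGe {w : W} {N : ℕ} : w ∈ OmGe (Set.range g) L N ↔ N ≤ neAv g n L w := by
  have hS := hg.isHeckeSystem hL
  obtain ⟨h1, h2, h3, h4⟩ := hg.ne_order hL hpos hlt
  have hpal : IsDist (Set.range g) L (al g true (2 * n + 1)) (neWt g L n) := by
    refine Or.inr ⟨_, ⟨false, rfl⟩, _, ⟨true, rfl⟩, hlt, n + 1, by omega, ?_, rfl, ?_⟩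
    · exact hg.orderOf_gen_mul false
    · rw [neWt]
      push_cast
      ring
  constructor
  · rintro ⟨d, m, hd, hN, x, y, hw, hl⟩
    have hwd := hS.eq_or_len_lt hw hl
    rcases hg.isDist_cases hL hd with ⟨-, rfl⟩ | ⟨c, rfl, rfl⟩ | ⟨rfl, rfl⟩ |
      ⟨c, hlt', k, hk, hM, rfl, rfl⟩
    · omega
    · rcases hwd with rfl | h
      · cases c
        · rw [hg.neAv_false]
          omega
        · rw [hg.neAv_true]
          omega
      · rw [hg.len_gen] at h
        have h5 : L (g c) ≤ L (g true) := by
          cases c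
          · exact hlt.le
          · exact le_rfl
        rcases hg.ne_cases w with rfl | rfl | rfl | rfl | ⟨ε, i, δ, rfl⟩
        · rw [IsHeckeSystem.len_one] at h
          omega
        · rw [hg.len_gen] at h
          omega
        · rw [hg.neAv_pal]
          omega
        · rw [hg.neAv_top]
          omega
        · rw [hg.neAv_el]
          omega
    · rcases hwd with rfl | h
      · rw [hg.neAv_top]
        omega
      · exact absurd (hg.len_le_top w) (by omega)
    · obtain rfl : k = n + 1 := by omega
      obtain rfl : c = true := by
        cases c
        · exact absurd (hlt'.trans hlt) (lt_irrefl _)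
        · rfl
      have e : ((n + 1 : ℕ) : ℤ) * L (g true) - ((n + 1 : ℕ) - 1) * L (g !true) = neWt g L n := by
        rw [neWt, Bool.not_true]
        push_cast
        ring
      rw [e] at hN
      rw [show 2 * (n + 1) - 1 = 2 * n + 1 by omega, hg.len_al (by omega)] at hwd
      rcases hwd with rfl | h
      · rw [hg.neAv_pal]
        omega
      · obtain ⟨c, k, hk, rfl⟩ := hg.exists_al w
        rw [hg.len_al hk] at h
        obtain rfl : k = 2 * n + 2 := by omega
        rw [hg.al_top_eq, hg.neAv_top]
        omega
  · intro hN
    rcases hg.ne_cases w with rfl | rfl | rfl | rfl | ⟨ε, i, δ, rfl⟩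
    · rw [neAv_one] at hN
      exact (hg.isDist_one hL).mem_OmGe (by omega)
    · rw [hg.neAv_false] at hN
      exact (hg.isDist_gen false).mem_OmGe (by omega)
    · rw [hg.neAv_pal] at hN
      exact hpal.mem_OmGe (by omega)
    · rw [hg.neAv_top] at hN
      exact hg.isDist_top.mem_OmGe (by omega)
    · rw [hg.neAv_el] at hN
      have hlen := neLen_lt ε i.2 δ
      refine ⟨g true, L (g true), hg.isDist_gen true, by omega, ?_⟩
      -- If the word starts with `s`, its second letter is `t`. Otherwise the first letter is
      -- already `t`.
      cases ε
      · obtain ⟨k, hk⟩ : ∃ k, neLen false i δ = k + 1 + 1 := ⟨neLen false i δ - 2, by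
          simp [neLen]
          omega⟩
        refine ⟨g false, al g false k, ?_, ?_⟩
        · rw [neEl, hk, al_succ, al_succ, mul_assoc]
          rfl
        · rw [neEl, hk, hg.len_al (by omega), hg.len_gen, hg.len_gen, hg.len_al (by omega)]
          omega
      · obtain ⟨k, hk⟩ : ∃ k, neLen true i δ = k + 1 := ⟨neLen true i δ - 1, by
          simp [neLen]
          omega⟩
        refine ⟨1, al g false k, ?_, ?_⟩
        · rw [neEl, hk, al_succ, one_mul]
          rfl
        · rw [neEl, hk, hg.len_al (by omega), hg.len_gen, IsHeckeSystem.len_one,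
            hg.len_al (by omega)]
          omega

theorem ne_WEq_eq_OmEq (N : ℕ) : WEq (Set.range g) L N = OmEq (Set.range g) L N := by
  ext w
  simp only [WEq, OmEq, Set.mem_sdiff, hg.ne_mem_OmGe hL hpos hlt, WGe, Set.mem_ofPred_eq,
    hg.ne_aFun hL hpos hlt, Nat.cast_le]

end Unequal

end IsDihedral

namespace IsDihedral

/-! ### Cells and values of the a-function -/

section Equal

variable {g : Bool → W} {n : ℕ} [NeZero n] (hg : IsDihedral g (n + 1)) {L : W → ℤ}
  (hL : IsWeight (Set.range g) L) (heq : ∀ c, L (g c) = L (g !c)) (hpos : ∀ c, 0 < L (g c))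
include hg

omit [NeZero n] in
theorem eqAv_cases (w : W) : w = 1 ∧ eqAv g (n + 1) L w = 0 ∨
    w = al g false (n + 1) ∧ eqAv g (n + 1) L w = (L (al g false (n + 1))).toNat ∨
    w ≠ 1 ∧ w ≠ al g false (n + 1) ∧ eqAv g (n + 1) L w = (L (g false)).toNat := by
  by_cases h1 : w = 1
  · rw [h1]
    exact Or.inl ⟨rfl, eqAv_one⟩
  · by_cases h2 : w = al g false (n + 1)
    · rw [h2]
      exact Or.inr (Or.inl ⟨rfl, hg.eqAv_top⟩)
    · refine Or.inr (Or.inr ⟨h1, h2, ?_⟩)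
      rw [eqAv, if_neg h1, if_neg h2]

include hL heq hpos

theorem eq_mem_WEq {w : W} {N : ℕ} : w ∈ WEq (Set.range g) L N ↔ eqAv g (n + 1) L w = N :=
  have := hg.finite
  (hg.eqDatum hL heq hpos).mem_WEq (hg.isHeckeSystem hL) (hg.isKLFamily_eq hL heq hpos)

theorem eq_hasA_iff {w : W} {m : ℤ} : HasA (Set.range g) L w m ↔ (eqAv g (n + 1) L w : ℤ) = m :=
  have := hg.finite
  (hg.eqDatum hL heq hpos).hasA_iff (hg.isHeckeSystem hL) (hg.isKLFamily_eq hL heq hpos)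

theorem eq_cells : {Γ : Set W | IsTwoSidedCell (Set.range g) L Γ} =
    {{1}, {1, al g false (n + 1)}ᶜ, {al g false (n + 1)}} := by
  have := hg.finite
  have hS := hg.isHeckeSystem hL
  have hc := hg.isKLFamily_eq hL heq hpos
  have h1 := hpos false
  have h2 := hg.weight_gen_lt_top hL hpos
  have f : ∀ w, {x | eqAv g (n + 1) L x = eqAv g (n + 1) L w} =
      open Classical in if w = 1 then {1} else if w = al g false (n + 1) then
        {al g false (n + 1)} else {1, al g false (n + 1)}ᶜ := by
    intro w
    ext x
    rw [Set.mem_ofPred_eq]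
    have hx := hg.eqAv_cases (L := L) x
    have hw := hg.eqAv_cases (L := L) w
    split_ifs with h3 h4 <;> simp only [Set.mem_singleton_iff, Set.mem_compl_iff, Set.mem_insert_iff]
    · grind
    · grind
    · grind
  ext Γ
  rw [Set.mem_ofPred_eq, (hg.eqDatum hL heq hpos).isTwoSidedCell_iff hS hc
    (weight_pos_of_gen hpos)]
  simp only [Set.mem_insert_iff, Set.mem_singleton_iff]
  constructor
  · rintro ⟨w, rfl⟩
    have := f w
    split_ifs at this
    · exact Or.inl this
    · exact Or.inr (Or.inr this)
    · exact Or.inr (Or.inl this)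
  · rintro (rfl | rfl | rfl)
    · refine ⟨1, ((f 1).trans ?_).symm⟩
      rw [if_pos rfl]
    · refine ⟨g false, ((f (g false)).trans ?_).symm⟩
      rw [← al_one g false, if_neg (hg.al_ne_one (by omega)),
        if_neg (hg.al_ne_top (by have := hg.three_le; omega))]
    · refine ⟨al g false (n + 1), ((f _).trans ?_).symm⟩
      rw [if_neg hg.top_ne_one, if_pos rfl]

theorem eq_summary :
    (∀ N : ℕ, L (g false) < N → (N : ℤ) < L (al g false (n + 1)) → WEq (Set.range g) L N = ∅) ∧
    (∀ N : ℕ, (N : ℤ) = L (g false) → WEq (Set.range g) L N = {1, al g false (n + 1)}ᶜ) ∧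
    HasA (Set.range g) L 1 0 ∧
    (∀ w : W, w ≠ 1 → w ≠ al g false (n + 1) → HasA (Set.range g) L w (L (g false))) ∧
    HasA (Set.range g) L (al g false (n + 1)) (L (al g false (n + 1))) ∧
    {Γ : Set W | IsTwoSidedCell (Set.range g) L Γ} =
      {{1}, {1, al g false (n + 1)}ᶜ, {al g false (n + 1)}} := by
  have h1 := hpos false
  have h2 := hg.weight_gen_lt_top hL hpos
  simp only [hg.eq_hasA_iff hL heq hpos]
  refine ⟨fun N h3 h4 => ?_, fun N h3 => ?_, ?_, fun w h3 h4 => ?_, ?_, hg.eq_cells hL heq hpos⟩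
  · refine Set.eq_empty_iff_forall_notMem.2 fun x hx => ?_
    rw [hg.eq_mem_WEq hL heq hpos] at hx
    rcases hg.eqAv_cases (L := L) x with h | h | h <;> omega
  · ext x
    rw [hg.eq_mem_WEq hL heq hpos]
    have hx := hg.eqAv_cases (L := L) x
    simp only [Set.mem_compl_iff, Set.mem_insert_iff, Set.mem_singleton_iff]
    grind
  · rw [eqAv_one, Nat.cast_zero]
  · rw [eqAv, if_neg h3, if_neg h4]
    omega
  · rw [hg.eqAv_top]
    omega

end Equal

section Unequal

variable {g : Bool → W} {n : ℕ} (hg : IsDihedral g (2 * n + 2)) {L : W → ℤ}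
  (hL : IsWeight (Set.range g) L) (hpos : ∀ c, 0 < L (g c)) (hlt : L (g false) < L (g true))
include hg

theorem neAv_cases (w : W) : w = 1 ∧ neAv g n L w = 0 ∨
    w = g false ∧ neAv g n L w = (L (g false)).toNat ∨
    w = al g true (2 * n + 1) ∧ neAv g n L w = (neWt g L n).toNat ∨
    w = al g false (2 * n + 2) ∧ neAv g n L w = (L (al g false (2 * n + 2))).toNat ∨
    (w ≠ 1 ∧ w ≠ g false ∧ w ≠ al g true (2 * n + 1) ∧ w ≠ al g false (2 * n + 2)) ∧
      neAv g n L w = (L (g true)).toNat := by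
  rcases hg.ne_cases w with rfl | rfl | rfl | rfl | ⟨ε, i, δ, rfl⟩
  · exact Or.inl ⟨rfl, neAv_one⟩
  · exact Or.inr (Or.inl ⟨rfl, hg.neAv_false⟩)
  · exact Or.inr (Or.inr (Or.inl ⟨rfl, hg.neAv_pal⟩))
  · exact Or.inr (Or.inr (Or.inr (Or.inl ⟨rfl, hg.neAv_top⟩)))
  · exact Or.inr (Or.inr (Or.inr (Or.inr ⟨⟨hg.neEl_ne_one _ _ _, hg.neEl_ne_false _ _ _,
      hg.neEl_ne_pal _ _ _, hg.neEl_ne_top _ _ _⟩, hg.neAv_el _ _ _⟩)))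

include hL hpos hlt

theorem ne_mem_WEq {w : W} {N : ℕ} : w ∈ WEq (Set.range g) L N ↔ neAv g n L w = N :=
  have := hg.finite
  have := hg.neZero
  (hg.neDatum hL hpos hlt).mem_WEq (hg.isHeckeSystem hL) (hg.isKLFamily_ne hL hpos hlt)

theorem ne_hasA_iff {w : W} {m : ℤ} : HasA (Set.range g) L w m ↔ (neAv g n L w : ℤ) = m :=
  have := hg.finite
  have := hg.neZero
  (hg.neDatum hL hpos hlt).hasA_iff (hg.isHeckeSystem hL) (hg.isKLFamily_ne hL hpos hlt)

theorem ne_fibers :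
    (∀ x, neAv g n L x = 0 ↔ x = 1) ∧
    (∀ x, neAv g n L x = (L (g false)).toNat ↔ x = g false) ∧
    (∀ x, neAv g n L x = (neWt g L n).toNat ↔ x = al g true (2 * n + 1)) ∧
    (∀ x, neAv g n L x = (L (al g false (2 * n + 2))).toNat ↔ x = al g false (2 * n + 2)) ∧
    (∀ x, neAv g n L x = (L (g true)).toNat ↔
      ¬ (x = 1 ∨ x = g false ∨ x = al g true (2 * n + 1) ∨ x = al g false (2 * n + 2))) := by
  obtain ⟨h1, h2, h3, h4⟩ := hg.ne_order hL hpos hlt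
  refine ⟨fun x => ?_, fun x => ?_, fun x => ?_, fun x => ?_, fun x => ?_⟩ <;>
    have hx := hg.neAv_cases (L := L) x
  · exact hg.neAv_eq_zero_iff hL hpos hlt x
  · refine ⟨fun h => ?_, fun h => by rw [h, hg.neAv_false]⟩
    rcases hx with h' | h' | h' | h' | h'
    · omega
    · exact h'.1
    all_goals omega
  · refine ⟨fun h => ?_, fun h => by rw [h, hg.neAv_pal]⟩
    rcases hx with h' | h' | h' | h' | h'
    · omega
    · omega
    · exact h'.1
    all_goals omega
  · refine ⟨fun h => ?_, fun h => by rw [h, hg.neAv_top]⟩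
    rcases hx with h' | h' | h' | h' | h'
    · omega
    · omega
    · omega
    · exact h'.1
    · omega
  · constructor
    · intro h
      rcases hx with h' | h' | h' | h' | h'
      · omega
      · omega
      · omega
      · omega
      · tauto
    · intro h
      rcases hx with h' | h' | h' | h' | h'
      · exact absurd (Or.inl h'.1) h
      · exact absurd (Or.inr (Or.inl h'.1)) h
      · exact absurd (Or.inr (Or.inr (Or.inl h'.1))) h
      · exact absurd (Or.inr (Or.inr (Or.inr h'.1))) h
      · exact h'.2

theorem ne_cells : {Γ : Set W | IsTwoSidedCell (Set.range g) L Γ} =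
    {{1}, {g false}, {1, g false, al g true (2 * n + 1), al g false (2 * n + 2)}ᶜ,
      {al g true (2 * n + 1)}, {al g false (2 * n + 2)}} := by
  have := hg.finite
  have := hg.neZero
  have hS := hg.isHeckeSystem hL
  have hc := hg.isKLFamily_ne hL hpos hlt
  obtain ⟨f1, f2, f3, f4, f5⟩ := hg.ne_fibers hL hpos hlt
  have e1 : {x | neAv g n L x = neAv g n L 1} = {1} := by
    rw [neAv_one]
    exact Set.ext f1
  have e2 : {x | neAv g n L x = neAv g n L (g false)} = {g false} := by
    rw [hg.neAv_false]
    exact Set.ext f2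
  have e3 : {x | neAv g n L x = neAv g n L (al g true (2 * n + 1))} = {al g true (2 * n + 1)} := by
    rw [hg.neAv_pal]
    exact Set.ext f3
  have e4 : {x | neAv g n L x = neAv g n L (al g false (2 * n + 2))} =
      {al g false (2 * n + 2)} := by
    rw [hg.neAv_top]
    exact Set.ext f4
  have e5 : ∀ (ε : Bool) (i : Fin n) (δ : Bool), {x | neAv g n L x = neAv g n L (neEl g ε i δ)} =
      {1, g false, al g true (2 * n + 1), al g false (2 * n + 2)}ᶜ := by
    intro ε i δ
    rw [hg.neAv_el]
    exact Set.ext f5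
  ext Γ
  rw [Set.mem_ofPred_eq, (hg.neDatum hL hpos hlt).isTwoSidedCell_iff hS hc
    (weight_pos_of_gen hpos)]
  simp only [Set.mem_insert_iff, Set.mem_singleton_iff]
  constructor
  · rintro ⟨w, rfl⟩
    rcases hg.ne_cases w with rfl | rfl | rfl | rfl | ⟨ε, i, δ, rfl⟩
    · exact Or.inl e1
    · exact Or.inr (Or.inl e2)
    · exact Or.inr (Or.inr (Or.inr (Or.inl e3)))
    · exact Or.inr (Or.inr (Or.inr (Or.inr e4)))
    · exact Or.inr (Or.inr (Or.inl (e5 _ _ _)))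
  · rintro (rfl | rfl | rfl | rfl | rfl)
    · exact ⟨1, e1.symm⟩
    · exact ⟨_, e2.symm⟩
    · exact ⟨_, (e5 true 0 true).symm⟩
    · exact ⟨_, e3.symm⟩
    · exact ⟨_, e4.symm⟩

theorem ne_summary :
    (∀ N : ℕ, neWt g L n < N → (N : ℤ) < L (al g false (2 * n + 2)) →
      WEq (Set.range g) L N = ∅) ∧
    (∀ N : ℕ, (N : ℤ) = neWt g L n → WEq (Set.range g) L N = {al g true (2 * n + 1)}) ∧
    (∀ N : ℕ, L (g true) < N → (N : ℤ) < neWt g L n → WEq (Set.range g) L N = ∅) ∧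
    (∀ N : ℕ, (N : ℤ) = L (g true) → WEq (Set.range g) L N =
      {1, g false, al g true (2 * n + 1), al g false (2 * n + 2)}ᶜ) ∧
    (∀ N : ℕ, L (g false) < N → (N : ℤ) < L (g true) → WEq (Set.range g) L N = ∅) ∧
    (∀ N : ℕ, (N : ℤ) = L (g false) → WEq (Set.range g) L N = {g false}) ∧
    HasA (Set.range g) L 1 0 ∧
    HasA (Set.range g) L (g false) (L (g false)) ∧
    (∀ w : W, w ≠ 1 → w ≠ g false → w ≠ al g true (2 * n + 1) → w ≠ al g false (2 * n + 2) →
      HasA (Set.range g) L w (L (g true))) ∧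
    HasA (Set.range g) L (al g true (2 * n + 1)) (neWt g L n) ∧
    HasA (Set.range g) L (al g false (2 * n + 2)) (L (al g false (2 * n + 2))) ∧
    {Γ : Set W | IsTwoSidedCell (Set.range g) L Γ} =
      {{1}, {g false}, {1, g false, al g true (2 * n + 1), al g false (2 * n + 2)}ᶜ,
        {al g true (2 * n + 1)}, {al g false (2 * n + 2)}} := by
  obtain ⟨h1, h2, h3, h4⟩ := hg.ne_order hL hpos hlt
  obtain ⟨f1, f2, f3, f4, f5⟩ := hg.ne_fibers hL hpos hlt
  have empty : ∀ N : ℕ, N ≠ 0 → N ≠ (L (g false)).toNat → N ≠ (neWt g L n).toNat →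
      N ≠ (L (al g false (2 * n + 2))).toNat → N ≠ (L (g true)).toNat →
      WEq (Set.range g) L N = ∅ := by
    intro N _ _ _ _ _
    refine Set.eq_empty_iff_forall_notMem.2 fun x hx => ?_
    rw [hg.ne_mem_WEq hL hpos hlt] at hx
    rcases hg.neAv_cases (L := L) x with h | h | h | h | h <;> omega
  have mem : ∀ (N : ℕ) (T : Set W), (∀ x, neAv g n L x = N ↔ x ∈ T) → WEq (Set.range g) L N = T := by
    intro N T h
    ext x
    rw [hg.ne_mem_WEq hL hpos hlt, h]
  have nat : ∀ (N : ℕ) (m : ℤ), (N : ℤ) = m → N = m.toNat := fun N m h => by omega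
  simp only [hg.ne_hasA_iff hL hpos hlt]
  refine ⟨fun N _ _ => empty N ?_ ?_ ?_ ?_ ?_, fun N hN => ?_, fun N _ _ => empty N ?_ ?_ ?_ ?_ ?_,
    fun N hN => ?_, fun N _ _ => empty N ?_ ?_ ?_ ?_ ?_, fun N hN => ?_, ?_, ?_,
    fun w h5 h6 h7 h8 => ?_, ?_, ?_, hg.ne_cells hL hpos hlt⟩
  any_goals omega
  · rw [nat N _ hN]
    exact mem _ _ f3
  · rw [nat N _ hN]
    exact mem _ _ f5
  · rw [nat N _ hN]
    exact mem _ _ f2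
  · rw [neAv_one, Nat.cast_zero]
  · rw [hg.neAv_false]
    omega
  · rw [(f5 w).2 (by tauto)]
    omega
  · rw [hg.neAv_pal]
    omega
  · rw [hg.neAv_top]
    omega

end Unequal

/-! ### Exchange of the generators and parity of the order -/

section General

variable {g : Bool → W} {M : ℕ} (hg : IsDihedral g M) {L : W → ℤ}
  (hL : IsWeight (Set.range g) L)
include hg

theorem swap : IsDihedral (fun c => g !c) M where
  three_le := hg.three_le
  mul_self c := hg.mul_self !c
  al_top c := hg.al_top !c
  word w := by
    obtain ⟨l, ⟨h1, h2⟩⟩ := hg.word w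
    refine ⟨l, fun x hx => ?_, h2⟩
    obtain ⟨c, rfl⟩ := h1 x hx
    exact ⟨!c, by simp only [Bool.not_not]⟩
  al_inj c c' k k' hk hk' h := by
    have := hg.al_inj (!c) (!c') k k' hk hk' h
    rwa [Bool.not_inj_iff] at this

include hL in
-- The longest element has two alternating words. If `M` is odd, one of them contains `s` once more
-- than `t` and the other `t` once more than `s`, and equality of their weights forces `L(s) =
-- L(t)`.
theorem even_of_weight_ne (hne : L (g false) ≠ L (g true)) : ∃ n, M = 2 * n + 2 := by
  have hM := hg.three_le
  rcases Nat.even_or_odd' M with ⟨k, rfl | rfl⟩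
  · exact ⟨k - 1, by omega⟩
  · have h := hg.lw_top hL false
    rw [lw_two_mul_add_one, lw_two_mul_add_one, Bool.not_false, Bool.not_true] at h
    exact absurd (by linarith) hne

end General

end IsDihedral

end HeckeKL

end

/-! ### The main theorem -/

theorem mainTheorem10 {B W : Type*} [Group W] (M : CoxeterMatrix B) (cs : CoxeterSystem M W)
    (i j : B) (hij : i ≠ j) (hB : ∀ k : B, k = i ∨ k = j) (hm : 3 ≤ M i j)
    (S : Set W) (hS : S = Set.range cs.simple)
    (s t : W) (hs : s = cs.simple i) (ht : t = cs.simple j)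
    (L : W → ℤ) (hL : HeckeKL.IsWeight S L) (hpos : ∀ r ∈ S, 0 < L r)
    (wI : W) (hwI : wI = HeckeKL.alt s t (M i j)) :
    HeckeKL.WellDefined S L ∧ HeckeKL.IsLongestIn S S wI ∧
    -- P1-P15, in all their graded versions
    (∀ N : ℕ, HeckeKL.PConj S L N) ∧
    (∀ N : ℕ, HeckeKL.WEq S L N = HeckeKL.OmEq S L N) ∧
    -- equal parameters
    (L s = L t →
      (∀ N : ℕ, L s < N → (N : ℤ) < L wI → HeckeKL.WEq S L N = ∅) ∧
      (∀ N : ℕ, (N : ℤ) = L s → HeckeKL.WEq S L N = {1, wI}ᶜ) ∧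
      HeckeKL.HasA S L 1 0 ∧
      (∀ w : W, w ≠ 1 → w ≠ wI → HeckeKL.HasA S L w (L s)) ∧
      HeckeKL.HasA S L wI (L wI) ∧
      {Γ : Set W | HeckeKL.IsTwoSidedCell S L Γ} = {{1}, {1, wI}ᶜ, {wI}}) ∧
    -- unequal parameters
    (L s < L t →
      ∃ m : ℕ, M i j = 2 * m ∧
      ∀ (dI : W) (LdI : ℤ), dI = HeckeKL.alt t s (2 * m - 1) → LdI = m * L t - (m - 1) * L s →
        (∀ N : ℕ, LdI < N → (N : ℤ) < L wI → HeckeKL.WEq S L N = ∅) ∧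
        (∀ N : ℕ, (N : ℤ) = LdI → HeckeKL.WEq S L N = {dI}) ∧
        (∀ N : ℕ, L t < N → (N : ℤ) < LdI → HeckeKL.WEq S L N = ∅) ∧
        (∀ N : ℕ, (N : ℤ) = L t → HeckeKL.WEq S L N = {1, s, dI, wI}ᶜ) ∧
        (∀ N : ℕ, L s < N → (N : ℤ) < L t → HeckeKL.WEq S L N = ∅) ∧
        (∀ N : ℕ, (N : ℤ) = L s → HeckeKL.WEq S L N = {s}) ∧
        HeckeKL.HasA S L 1 0 ∧
        HeckeKL.HasA S L s (L s) ∧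
        (∀ w : W, w ≠ 1 → w ≠ s → w ≠ dI → w ≠ wI → HeckeKL.HasA S L w (L t)) ∧
        HeckeKL.HasA S L dI LdI ∧
        HeckeKL.HasA S L wI (L wI) ∧
        {Γ : Set W | HeckeKL.IsTwoSidedCell S L Γ} =
          {{1}, {s}, {1, s, dI, wI}ᶜ, {dI}, {wI}}) := by
  subst hS hs ht hwI
  have hg := HeckeKL.isDihedral_of_coxeterSystem M cs i j hij hB hm
  set g : Bool → W := fun c : Bool => cs.simple (if c then j else i) with hg_def
  have hrange : Set.range cs.simple = Set.range g := by
    refine Set.Subset.antisymm ?_ ?_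
    · rintro _ ⟨k, rfl⟩
      rcases hB k with rfl | rfl
      exacts [⟨false, rfl⟩, ⟨true, rfl⟩]
    · rintro _ ⟨c, rfl⟩
      exact ⟨_, rfl⟩
  rw [hrange] at hL hpos ⊢
  have hpos' : ∀ c, 0 < L (g c) := fun c => hpos _ ⟨c, rfl⟩
  have htop : HeckeKL.IsLongestIn (Set.range g) (Set.range g)
      (HeckeKL.alt (cs.simple i) (cs.simple j) (M i j)) := hg.isLongestIn_top
  rcases lt_trichotomy (L (g false)) (L (g true)) with hlt | heq | hlt
  · obtain ⟨n, hn⟩ := hg.even_of_weight_ne hL hlt.ne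
    rw [hn] at hg htop ⊢
    -- The path has `n` vertices with `m_st = 2 * n + 2`, so the `m` of the statement is `n + 1`.
    refine ⟨hg.ne_wellDefined hL hpos' hlt, htop, hg.ne_pConj hL hpos' hlt,
      hg.ne_WEq_eq_OmEq hL hpos' hlt, fun h => absurd h hlt.ne, fun _ => ⟨n + 1, by ring, ?_⟩⟩
    rintro dI LdI rfl rfl
    have e : ((n + 1 : ℕ) : ℤ) * L (cs.simple j) - ((n + 1 : ℕ) - 1) * L (cs.simple i) =
        HeckeKL.neWt g L n := by
      rw [HeckeKL.neWt]
      push_cast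
      rw [add_sub_cancel_right]
      rfl
    rw [e]
    exact hg.ne_summary hL hpos' hlt
  · obtain ⟨n, hn⟩ : ∃ n, M i j = n + 1 := ⟨M i j - 1, by omega⟩
    rw [hn] at hg htop ⊢
    have : NeZero n := ⟨by omega⟩
    have heq' : ∀ c, L (g c) = L (g !c) := by
      rintro (_ | _)
      exacts [heq, heq.symm]
    exact ⟨hg.eq_wellDefined hL heq' hpos', htop, hg.eq_pConj hL heq' hpos',
      hg.eq_WEq_eq_OmEq hL heq' hpos', fun _ => hg.eq_summary hL heq' hpos',
      fun h => absurd heq h.ne⟩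
  -- If `L(t) < L(s)`, only assertions symmetric in the two generators remain to be proved. They
  -- follow from the previous case after exchanging the colours, which leaves the set of generators
  -- unchanged.
  · have hrange' : Set.range g = Set.range fun c => g !c :=
      (Equiv.boolNot.surjective.range_comp g).symm
    obtain ⟨n, hn⟩ := hg.even_of_weight_ne hL hlt.ne'
    rw [hn] at hg
    have hg' := hg.swap
    refine ⟨?_, htop, ?_, ?_, fun h => absurd h hlt.ne', fun h => absurd hlt h.not_gt⟩
    all_goals rw [hrange'] at hL ⊢
    · exact hg'.ne_wellDefined hL (fun c => hpos' !c) hlt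
    · exact hg'.ne_pConj hL (fun c => hpos' !c) hlt
    · exact hg'.ne_WEq_eq_OmEq hL (fun c => hpos' !c) hlt
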